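/- **Setting.** A *perimeter* consists of a region $R\subset\mathbb R^2$ (a set homeomorphic to the closed unit disc) whose boundary curve $\partial R$ has finite length, and a set $P\subset\partial R$ to be guarded that is a disjoint union of $q\ge 1$ non-degenerate closed boundary arcs (*segments*) $S_1,\dots,S_q$ in cyclic order, separated by gaps $G_1,\dots,G_q$ (if $q=1$, $S_1$ may be all of $\partial R$ and $G_1=\emptyset$). Put $S_{i\sim i'}=S_i\cup G_i\cup S_{i+1}\cup\dots\cup G_{i'-1}\cup S_{i'}$, indices cyclic. There are $t\ge1$ types of robots, with $n_\tau\ge 0$ robots of type $\tau$, each of capability $a_\tau\in\mathbb Z_{>0}$. For $m\ge 1$ perimeters with pairwise disjoint regions ($P_k$ having $q_k$ segments), a *cover* assigns to each of the $\sum_\tau n_\tau$ robots $j$ a closed (possibly one-point) arc $C_j$ of some $\partial R_k$, distinct arcs sharing at most endpoints, such that $\bigcup_k P_k\subset\bigcup_j C_j$. OPG$_{LR}$ asks for a cover that minimizes $\max_j len(C_j)/a_{\tau_j}$; the minimum is denoted $\ell^*$. For $\ell\ge0$, D-OPG$_{LR}$ at $\ell$ asks whether there is a cover with $len(C_j)\le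 a_{\tau_j}\ell$ for all $j$. Algorithms are programs for a real RAM (unit-cost exact $+,-,\times,/$ and comparisons on reals; unit-cost $+,-$, halving and comparison on natural numbers, which serve as array indices). They receive $m$, $t$, the $q_k$, $n_\tau$, $a_\tau$ and the lengths of all segments and gaps. Each program below is the same for all inputs and all $t$. For one perimeter, a starting segment $i$ and $\ell\ge 0$, OPG-lr-Feasible$(i,\ell)$ is the following test. For $0\le x\le n$ put $M[x]=\max\bigl(0,\max_{\tau:\,x_\tau>0}\mathrm{Inc}(M[x-e_\tau],a_\tau\ell)\bigr)$, where $M[0]=0$ and $\mathrm{Inc}(L,y)$ is the boundary distance $L+y$ from the start of $S_i$, moved forward to the end of the gap if it lies in a gap (endpoints included). The answer is "yes" iff $M[n_1,\dots,n_t]\ge len(S_{i\sim i-1})$. **Theorem.** 1. (Feasibility test.) For one perimeter and every $\ell\ge 0$, D-OPG$_{LR}$ at $\ell$ has answer "yes" iff OPG-lr-Feasible$(i,\ell)$ answers "yes" for some $1\le i\le q$. 2. OPG-lr-Feasible$(i,\ell)$ can be computed in time $O\bigl(t\prod_\tau(n_\tau+1)+q\sum_\tau\prod_{\tau'\ne\tau}(n_{\tau'}+1)\bigr)$,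 and D-OPG$_{LR}$ at $\ell$ for one perimeter can be decided in time $O\bigl(qt\prod_\tau(n_\tau+1)+q^2\sum_\tau\prod_{\tau'\ne\tau}(n_{\tau'}+1)\bigr)$, with absolute constants. 3. (Form of the optimum.) For $m\ge1$ perimeters and $\sum_\tau n_\tau\ge m$, the minimum $\ell^*$ exists, and there are a perimeter $k$, segments $i,i'$ of it and integers $0\le n'_\tau\le n_\tau$ with $\sum_\tau a_\tau n'_\tau>0$ and $\ell^*=len(S_{i\sim i'})/\sum_\tau a_\tau n'_\tau$. 4. (Bisection.) There is a program which, for one perimeter and $\sum_\tau n_\tau\ge1$, finds $\ell^*$ with at most $C_t\,q\log(\sum_\tau n_\tau+q)$ calls to OPG-lr-Feasible and, besides, a number of steps that is polynomial in $q\prod_\tau(n_\tau+1)$, where $C_t$ and the polynomial depend only on $t$. It uses the test as a black box: with any test $O(i,\ell)$ in its place for which there is a number $\ell_0$ of the form $len(S_{i\sim i'})/\sum_\tau a_\tau n'_\tau$ as in 3 such that, for all $\ell\ge0$, $O(i,\ell)$ holds for some $i$ iff $\ell\ge\ell_0$, it finds $\ell_0$ within the same bounds. 5. (Pseudo-polynomial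 time, one or several perimeters.) There is a program that computes $\ell^*$ and an optimal cover of any $m\ge1$ perimeters whenever $\sum_\tau n_\tau\ge m$ (and all $n_\tau\ge1$ in case $m\ge2$), in time $$\tilde O_t\Bigl((m-1)\Bigl(\frac{\prod_\tau n_\tau}{\max_\tau n_\tau}\Bigr)^2+\sum_{k=1}^m\Bigl(t\,q_k\prod_\tau(n_\tau+1)+q_k^2\sum_\tau\prod_{\tau'\neq\tau}(n_{\tau'}+1)\Bigr)\Bigr),$$ where $\tilde O_t$ hides a factor $C_t\log^{d_t}\bigl(\sum_\tau n_\tau+\sum_k q_k\bigr)$ with $C_t,d_t$ depending only on $t$. In particular OPG$_{LR}$ is solvable in pseudo-polynomial time for every fixed $t$. -/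

import Mathlib

open MeasureTheory
open scoped BigOperators

namespace OPG

noncomputable section

/-! ### Geometry: regions, perimeters, segments and gaps -/

abbrev Plane := EuclideanSpace ℝ (Fin 2)

/-- Length of a subset of the plane: its one-dimensional Hausdorff measure. -/
def len (A : Set Plane) : ℝ := (μH[1] A).toReal

/-- The point of the closed unit disc at angle `θ` on the unit circle. -/
def circlePt (θ : ℝ) : Metric.closedBall (0 : Plane) 1 :=
  ⟨!₂[Real.cos θ, Real.sin θ], by
    simp [EuclideanSpace.norm_eq, Fin.sum_univ_two]⟩

/-- A region: a subset of the plane with a homeomorphism onto the closed unit disc. -/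
structure Region where
  carrier : Set Plane
  disc : carrier ≃ₜ Metric.closedBall (0 : Plane) 1

namespace Region

/-- The boundary point of the region that the homeomorphism sends to angle `θ`. -/
def pt (R : Region) (θ : ℝ) : Plane := (R.disc.symm (circlePt θ) : Plane)

/-- The boundary of the region: the preimage of the unit circle. -/
def boundary (R : Region) : Set Plane := Set.range R.pt

/-- The closed boundary arc from angle `u` to angle `v`. -/
def arc (R : Region) (u v : ℝ) : Set Plane := R.pt '' Set.Icc u v

/-- The same arc without its endpoints. -/
def openArc (R : Region) (u v : ℝ) : Set Plane := R.pt '' Set.Ioo u v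

end Region

/-- A region with boundary of finite length, and the `q ≥ 1` boundary segments that have to be
guarded, in cyclic order: segment `i` runs from angle `left i` to angle `right i`. Distinct segments
are disjoint. For `q = 1` the only segment may be the whole boundary. -/
structure Perimeter extends Region where
  rectifiable : μH[1] toRegion.boundary ≠ ⊤
  q : ℕ
  q_pos : 0 < q
  left : Fin q → ℝ
  right : Fin q → ℝ
  left_lt_right : ∀ i, left i < right i
  right_lt_left : ∀ i j, i < j → right i < left j
  right_lt_wrap : ∀ i j, i < j → right j < left i + 2 * Real.pi
  right_le_wrap : ∀ i, right i ≤ left i + 2 * Real.pi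

namespace Perimeter

/-- Segment and gap indices are natural numbers read modulo `q`. -/
def idx (P : Perimeter) (r : ℕ) : Fin P.q := ⟨r % P.q, Nat.mod_lt _ P.q_pos⟩

/-- The segment `S_r`. -/
def seg (P : Perimeter) (r : ℕ) : Set Plane :=
  P.toRegion.arc (P.left (P.idx r)) (P.right (P.idx r))

/-- The angle at which the gap `G_r` ends, which is where the next segment begins. -/
def nextLeft (P : Perimeter) (r : ℕ) : ℝ :=
  if h : (P.idx r : ℕ) + 1 < P.q then P.left ⟨(P.idx r : ℕ) + 1, h⟩
  else P.left ⟨0, P.q_pos⟩ + 2 * Real.pi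

/-- The gap `G_r` between `S_r` and `S_{r+1}` (empty if the perimeter is the whole boundary). -/
def gap (P : Perimeter) (r : ℕ) : Set Plane :=
  P.toRegion.openArc (P.right (P.idx r)) (P.nextLeft r)

/-- The part of the boundary that has to be guarded. -/
def guarded (P : Perimeter) : Set Plane := ⋃ i : Fin P.q, P.seg i

/-- `S_i ∪ G_i ∪ S_{i+1} ∪ ⋯ ∪ G_{i+d-1} ∪ S_{i+d}`. -/
def chain (P : Perimeter) (i d : ℕ) : Set Plane :=
  (⋃ r ∈ Finset.range (d + 1), P.seg (i + r)) ∪ ⋃ r ∈ Finset.range d, P.gap (i + r)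

/-- `S_{i∼i'}`, which wraps around if `i' < i`. -/
def span (P : Perimeter) (i i' : Fin P.q) : Set Plane :=
  P.chain i (((i' : ℕ) + P.q - i) % P.q)

end Perimeter

/-! ### The optimization problem and its decision version -/

section Problem

variable {m t : ℕ}

/-- The robots: `n τ` robots of each type `τ`. -/
abbrev Robot (n : Fin t → ℕ) := (τ : Fin t) × Fin (n τ)

/-- A cover of the perimeters by the robots. Robot `j` guards the closed arc from angle `u j` to
angle `v j` on the boundary of region `place j`; distinct arcs share at most endpoints. -/
structure Cover (P : Fin m → Perimeter) (n : Fin t → ℕ) where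
  place : Robot n → Fin m
  u : Robot n → ℝ
  v : Robot n → ℝ
  u_le_v : ∀ j, u j ≤ v j
  v_le : ∀ j, v j ≤ u j + 2 * Real.pi
  covers : (⋃ k, (P k).guarded) ⊆ ⋃ j, (P (place j)).toRegion.arc (u j) (v j)
  nonoverlap : ∀ j j', j ≠ j' →
    Disjoint ((P (place j)).toRegion.openArc (u j) (v j))
      ((P (place j')).toRegion.arc (u j') (v j'))

/-- The set `C_j` guarded by robot `j`. -/
def Cover.part {P : Fin m → Perimeter} {n : Fin t → ℕ} (c : Cover P n) (j : Robot n) :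
    Set Plane := (P (c.place j)).toRegion.arc (c.u j) (c.v j)

/-- The largest ratio `len C_j / a_{τ_j}` of the cover. -/
def Cover.ratio {P : Fin m → Perimeter} {n : Fin t → ℕ} (c : Cover P n) (a : Fin t → ℕ) : ℝ :=
  ⨆ j : Robot n, len (c.part j) / (a j.1 : ℝ)

/-- `ℓ` is the optimal value: the least ratio of a cover. -/
def IsOptimum (P : Fin m → Perimeter) (n a : Fin t → ℕ) (ℓ : ℝ) : Prop :=
  IsLeast (Set.range fun c : Cover P n => c.ratio a) ℓ

/-- The decision problem: is there a cover in which a robot of type `τ` guards at most `cap τ`? -/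
def DOPG (P : Fin m → Perimeter) (n : Fin t → ℕ) (cap : Fin t → ℝ) : Prop :=
  ∃ c : Cover P n, ∀ j, len (c.part j) ≤ cap j.1

/-- The numbers `len S_{i∼i'} / ∑ a_τ n'_τ` with `n' ≤ n` and a nonzero denominator. -/
def candidates (P : Fin m → Perimeter) (n a : Fin t → ℕ) : Set ℝ :=
  {ℓ | ∃ (k : Fin m) (i i' : Fin (P k).q) (n' : Fin t → ℕ),
    (∀ τ, n' τ ≤ n τ) ∧ 0 < ∑ τ, a τ * n' τ ∧
      ℓ = len ((P k).span i i') / ((∑ τ, a τ * n' τ : ℕ) : ℝ)}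

end Problem

/-! ### The dynamic program -/

/-- Distance from the start of `S_i` to the start of `S_{i+r}`, along the boundary. -/
def segStart (P : Perimeter) (i r : ℕ) : ℝ :=
  ∑ r' ∈ Finset.range r, (len (P.seg (i + r')) + len (P.gap (i + r')))

/-- Distance from the start of `S_i` to the end of `S_{i+r}`, along the boundary. -/
def segEnd (P : Perimeter) (i r : ℕ) : ℝ := segStart P i r + len (P.seg (i + r))

/-- `inc P i L x`: the distance from the start of `S_i` that is dealt with when a stretch of length
`x` is appended to a distance `L`. It is `L + x`, or the end of a gap if `L + x` is in that gap. -/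
def inc (P : Perimeter) (i : ℕ) (L x : ℝ) : ℝ :=
  ((Finset.range P.q).filter fun r => segEnd P i r ≤ L + x).fold max (L + x)
    fun r => segStart P i (r + 1)

/-- The recursion of the dynamic program; the first argument is the number of robots in `x`. -/
def dpAux {t : ℕ} (P : Perimeter) (i : ℕ) (cap : Fin t → ℝ) : ℕ → (Fin t → ℕ) → ℝ
  | 0, _ => 0
  | s + 1, x => (Finset.univ.filter fun τ => x τ ≠ 0).fold max 0
      fun τ => inc P i (dpAux P i cap s (Function.update x τ (x τ - 1))) (cap τ)

/-- The entry `M[x]` of the `t`-dimensional array: the largest distance from the start of `S_i` that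
is dealt with by `x τ` robots of each type `τ`. -/
def dp {t : ℕ} (P : Perimeter) (i : ℕ) (cap : Fin t → ℝ) (x : Fin t → ℕ) : ℝ :=
  dpAux P i cap (∑ τ, x τ) x

/-- The feasibility test for starting segment `i` and candidate ratio `ℓ`; the chain is
`S_{i∼i-1}`. -/
def lrFeasible {t : ℕ} (P : Perimeter) (n a : Fin t → ℕ) (i : ℕ) (ℓ : ℝ) : Prop :=
  len (P.chain i (P.q - 1)) ≤ dp P i (fun τ => (a τ : ℝ) * ℓ) n

/-! ### The machine model: a real RAM

The memory consists of arrays of natural numbers and arrays of real numbers. A program is a fixed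
finite text, which names finitely many arrays. Natural numbers can be added, subtracted (truncated at
zero), halved (rounding down) and compared, and used as array indices. Real numbers can be added,
subtracted, multiplied, divided and compared exactly. There is no rounding of reals and the only
constants are natural numbers. Each operation costs one step. -/

structure State where
  nat : ℕ → ℕ → ℕ
  real : ℕ → ℕ → ℝ

def State.setNat (σ : State) (A i v : ℕ) : State :=
  { σ with nat := Function.update σ.nat A (Function.update (σ.nat A) i v) }

def State.setReal (σ : State) (A i : ℕ) (v : ℝ) : State :=
  { σ with real := Function.update σ.real A (Function.update (σ.real A) i v) }

inductive NatExp where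
  | lit (c : ℕ)
  | get (A : ℕ) (i : NatExp)
  | add (e f : NatExp)
  | sub (e f : NatExp)
  | half (e : NatExp)

def NatExp.eval (σ : State) : NatExp → ℕ
  | lit c => c
  | get A i => σ.nat A (i.eval σ)
  | add e f => e.eval σ + f.eval σ
  | sub e f => e.eval σ - f.eval σ
  | half e => e.eval σ / 2

def NatExp.cost : NatExp → ℕ
  | lit _ => 1
  | get _ i => i.cost + 1
  | add e f => e.cost + f.cost + 1
  | sub e f => e.cost + f.cost + 1
  | half e => e.cost + 1

inductive RealExp where
  | ofNat (e : NatExp)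
  | get (A : ℕ) (i : NatExp)
  | add (e f : RealExp)
  | sub (e f : RealExp)
  | mul (e f : RealExp)
  | div (e f : RealExp)

def RealExp.eval (σ : State) : RealExp → ℝ
  | ofNat e => (e.eval σ : ℝ)
  | get A i => σ.real A (i.eval σ)
  | add e f => e.eval σ + f.eval σ
  | sub e f => e.eval σ - f.eval σ
  | mul e f => e.eval σ * f.eval σ
  | div e f => e.eval σ / f.eval σ

def RealExp.cost : RealExp → ℕ
  | ofNat e => e.cost + 1
  | get _ i => i.cost + 1
  | add e f => e.cost + f.cost + 1
  | sub e f => e.cost + f.cost + 1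
  | mul e f => e.cost + f.cost + 1
  | div e f => e.cost + f.cost + 1

inductive Test where
  | natLe (e f : NatExp)
  | realLe (e f : RealExp)
  | not (b : Test)
  | and (b d : Test)

def Test.holds (σ : State) : Test → Prop
  | natLe e f => e.eval σ ≤ f.eval σ
  | realLe e f => e.eval σ ≤ f.eval σ
  | not b => ¬ b.holds σ
  | and b d => b.holds σ ∧ d.holds σ

def Test.cost : Test → ℕ
  | natLe e f => e.cost + f.cost + 1
  | realLe e f => e.cost + f.cost + 1
  | not b => b.cost + 1
  | and b d => b.cost + d.cost + 1

/-- Programs. `query A k e x` asks a subroutine for its answer on the natural number `e` and the real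
number `x`, and stores it (`1` for yes, `0` for no) in cell `k` of the array `A` of naturals. -/
inductive Prog where
  | skip
  | setNat (A : ℕ) (k e : NatExp)
  | setReal (A : ℕ) (k : NatExp) (x : RealExp)
  | seq (p p' : Prog)
  | cond (b : Test) (p p' : Prog)
  | loop (b : Test) (p : Prog)
  | query (A : ℕ) (k e : NatExp) (x : RealExp)

/-- `Exec O p σ σ' s c`: started in state `σ`, program `p` halts in state `σ'` after `s` steps and `c`
calls to the subroutine, whose answers are given by `O`. -/
inductive Exec (O : ℕ → ℝ → Prop) : Prog → State → State → ℕ → ℕ → Prop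
  | skip (σ : State) : Exec O .skip σ σ 1 0
  | setNat (A : ℕ) (k e : NatExp) (σ : State) :
      Exec O (.setNat A k e) σ (σ.setNat A (k.eval σ) (e.eval σ)) (k.cost + e.cost + 1) 0
  | setReal (A : ℕ) (k : NatExp) (x : RealExp) (σ : State) :
      Exec O (.setReal A k x) σ (σ.setReal A (k.eval σ) (x.eval σ)) (k.cost + x.cost + 1) 0
  | seq {p p' : Prog} {σ σ₁ σ₂ : State} {s s' c c' : ℕ} :
      Exec O p σ σ₁ s c → Exec O p' σ₁ σ₂ s' c' → Exec O (.seq p p') σ σ₂ (s + s') (c + c')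
  | condTrue {b : Test} {p p' : Prog} {σ σ₁ : State} {s c : ℕ} :
      b.holds σ → Exec O p σ σ₁ s c → Exec O (.cond b p p') σ σ₁ (b.cost + s) c
  | condFalse {b : Test} {p p' : Prog} {σ σ₁ : State} {s c : ℕ} :
      ¬ b.holds σ → Exec O p' σ σ₁ s c → Exec O (.cond b p p') σ σ₁ (b.cost + s) c
  | loopFalse {b : Test} {p : Prog} {σ : State} :
      ¬ b.holds σ → Exec O (.loop b p) σ σ b.cost 0
  | loopTrue {b : Test} {p : Prog} {σ σ₁ σ₂ : State} {s s' c c' : ℕ} :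
      b.holds σ → Exec O p σ σ₁ s c → Exec O (.loop b p) σ₁ σ₂ s' c' →
      Exec O (.loop b p) σ σ₂ (b.cost + s + s') (c + c')
  | queryYes (A : ℕ) (k e : NatExp) (x : RealExp) (σ : State) : O (e.eval σ) (x.eval σ) →
      Exec O (.query A k e x) σ (σ.setNat A (k.eval σ) 1) (k.cost + e.cost + x.cost + 1) 1
  | queryNo (A : ℕ) (k e : NatExp) (x : RealExp) (σ : State) : ¬ O (e.eval σ) (x.eval σ) →
      Exec O (.query A k e x) σ (σ.setNat A (k.eval σ) 0) (k.cost + e.cost + x.cost + 1) 1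

/-- Execution without a subroutine (every query is answered `0`): `p` halts after `s` steps. -/
def Run (p : Prog) (σ σ' : State) (s : ℕ) : Prop :=
  ∃ c, Exec (fun _ _ => False) p σ σ' s c

/-- The list `f` followed by zeros. -/
def pad {N : ℕ} {α : Type} [Zero α] (f : Fin N → α) (j : ℕ) : α :=
  if h : j < N then f ⟨j, h⟩ else 0

/-- The input as it stands in memory. Naturals: array `0` holds `m, t, i`, array `1` the numbers of
segments, arrays `2` and `3` the numbers `n τ` and `a τ`. Reals: array `0` holds `ℓ`, arrays `1` and
`2` the lengths of the segments and of the gaps, perimeter after perimeter. All other cells are `0`.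
(`i` and `ℓ` are arguments of the feasibility test.) -/
def input {m t : ℕ} (P : Fin m → Perimeter) (n a : Fin t → ℕ) (i : ℕ) (ℓ : ℝ) : State where
  nat A := match A with
    | 0 => pad ![m, t, i]
    | 1 => pad fun k => (P k).q
    | 2 => pad n
    | 3 => pad a
    | _ => fun _ => 0
  real A := match A with
    | 0 => pad ![ℓ]
    | 1 => pad fun j : Fin (∑ k, (P k).q) =>
        len ((P (finSigmaFinEquiv.symm j).1).seg (finSigmaFinEquiv.symm j).2)
    | 2 => pad fun j : Fin (∑ k, (P k).q) =>
        len ((P (finSigmaFinEquiv.symm j).1).gap (finSigmaFinEquiv.symm j).2)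
    | _ => fun _ => 0

/-- A yes-or-no output, in cell `0` of array `0` of naturals. -/
def Answers (σ : State) (p : Prop) : Prop := (p ∧ σ.nat 0 0 = 1) ∨ (¬ p ∧ σ.nat 0 0 = 0)

/-- The memory describes the cover `c`, robot after robot: the index of the region on whose boundary
the robot is (naturals, array `4`), the distance along the boundary from the start of the first
segment of that region to the start of the robot's arc (reals, array `3`), and the length of that arc
(reals, array `4`). -/
def Describes {m t : ℕ} {P : Fin m → Perimeter} {n : Fin t → ℕ} (σ : State) (c : Cover P n) :
    Prop :=
  ∀ j : Robot n,
    let p := P (c.place j)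
    let o := p.left ⟨0, p.q_pos⟩
    σ.nat 4 (finSigmaFinEquiv j) = c.place j ∧
      o ≤ c.u j ∧ c.u j < o + 2 * Real.pi ∧
      σ.real 3 (finSigmaFinEquiv j) = len (p.toRegion.arc o (c.u j)) ∧
      σ.real 4 (finSigmaFinEquiv j) = len (c.part j)

/-! ### Quantities in the running times -/

/-- `∏ (n_τ + 1)`, the number of entries of the array. -/
def cells {t : ℕ} (n : Fin t → ℕ) : ℕ := ∏ τ, (n τ + 1)

/-- `∑_τ ∏_{τ' ≠ τ} (n_{τ'} + 1)`. -/
def faces {t : ℕ} (n : Fin t → ℕ) : ℕ := ∑ τ, ∏ τ' ∈ Finset.univ.erase τ, (n τ' + 1)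

end

end OPG

open OPG

namespace OPG

noncomputable section

/-! ### Reasoning about programs -/

instance : Add NatExp := ⟨.add⟩
instance : Sub NatExp := ⟨.sub⟩
instance (k : ℕ) : OfNat NatExp k := ⟨.lit k⟩
instance : Add RealExp := ⟨.add⟩
instance : Sub RealExp := ⟨.sub⟩
instance : Mul RealExp := ⟨.mul⟩
instance : Div RealExp := ⟨.div⟩
instance (k : ℕ) : OfNat RealExp k := ⟨.ofNat (.lit k)⟩

/-- The natural number variable kept in cell `0` of array `A`. -/
abbrev nv (A : ℕ) : NatExp := .get A (.lit 0)

/-- The real variable kept in cell `0` of array `A`. -/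
abbrev rv (A : ℕ) : RealExp := .get A (.lit 0)

/-- Assignment to a natural number variable. -/
abbrev nset (A : ℕ) (e : NatExp) : Prog := .setNat A (.lit 0) e

/-- Assignment to a real variable. -/
abbrev rset (A : ℕ) (e : RealExp) : Prog := .setReal A (.lit 0) e

/-- Strict comparison of natural numbers. -/
abbrev natLt (e f : NatExp) : Test := .not (.natLe f e)

/-- Strict comparison of reals. -/
abbrev realLt (e f : RealExp) : Test := .not (.realLe f e)

infixr:60 " ;; " => Prog.seq

section Eval
variable (σ : State)

@[simp] theorem NatExp.eval_ofNat (k : ℕ) : (OfNat.ofNat k : NatExp).eval σ = k := rfl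
@[simp] theorem NatExp.eval_zero : (0 : NatExp).eval σ = 0 := rfl
@[simp] theorem NatExp.eval_one : (1 : NatExp).eval σ = 1 := rfl
@[simp] theorem NatExp.eval_lit (k : ℕ) : (NatExp.lit k).eval σ = k := rfl
@[simp] theorem NatExp.eval_get (A : ℕ) (e : NatExp) :
    (NatExp.get A e).eval σ = σ.nat A (e.eval σ) := rfl
@[simp] theorem NatExp.eval_add (e f : NatExp) : (e + f).eval σ = e.eval σ + f.eval σ := rfl
@[simp] theorem NatExp.eval_sub (e f : NatExp) : (e - f).eval σ = e.eval σ - f.eval σ := rfl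
@[simp] theorem NatExp.eval_half (e : NatExp) : (NatExp.half e).eval σ = e.eval σ / 2 := rfl
@[simp] theorem RealExp.eval_lit (k : ℕ) : (OfNat.ofNat k : RealExp).eval σ = (k : ℝ) := rfl
@[simp] theorem RealExp.eval_zero : (0 : RealExp).eval σ = 0 := Nat.cast_zero
@[simp] theorem RealExp.eval_one : (1 : RealExp).eval σ = 1 := Nat.cast_one
@[simp] theorem RealExp.eval_ofNat (e : NatExp) : (RealExp.ofNat e).eval σ = (e.eval σ : ℝ) := rfl
@[simp] theorem RealExp.eval_get (A : ℕ) (e : NatExp) :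
    (RealExp.get A e).eval σ = σ.real A (e.eval σ) := rfl
@[simp] theorem RealExp.eval_add (e f : RealExp) : (e + f).eval σ = e.eval σ + f.eval σ := rfl
@[simp] theorem RealExp.eval_sub (e f : RealExp) : (e - f).eval σ = e.eval σ - f.eval σ := rfl
@[simp] theorem RealExp.eval_mul (e f : RealExp) : (e * f).eval σ = e.eval σ * f.eval σ := rfl
@[simp] theorem RealExp.eval_div (e f : RealExp) : (e / f).eval σ = e.eval σ / f.eval σ := rfl
@[simp] theorem Test.holds_natLe (e f : NatExp) :
    (Test.natLe e f).holds σ ↔ e.eval σ ≤ f.eval σ := Iff.rfl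
@[simp] theorem Test.holds_realLe (e f : RealExp) :
    (Test.realLe e f).holds σ ↔ e.eval σ ≤ f.eval σ := Iff.rfl
@[simp] theorem Test.holds_not (b : Test) : (Test.not b).holds σ ↔ ¬ b.holds σ := Iff.rfl
@[simp] theorem Test.holds_and (b d : Test) :
    (Test.and b d).holds σ ↔ b.holds σ ∧ d.holds σ := Iff.rfl
@[simp] theorem State.setNat_real (A i v : ℕ) : (σ.setNat A i v).real = σ.real := rfl
@[simp] theorem State.setReal_nat (A i : ℕ) (v : ℝ) : (σ.setReal A i v).nat = σ.nat := rfl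
@[simp] theorem State.setNat_nat (A i v B : ℕ) : (σ.setNat A i v).nat B =
    if B = A then Function.update (σ.nat A) i v else σ.nat B := by
  simp only [State.setNat, Function.update_apply]
@[simp] theorem State.setReal_real (A i B : ℕ) (v : ℝ) : (σ.setReal A i v).real B =
    if B = A then Function.update (σ.real A) i v else σ.real B := by
  simp only [State.setReal, Function.update_apply]

end Eval

/-- Does the program write to the array `B` of naturals? -/
def Prog.wn : Prog → ℕ → Bool
  | .skip, _ => false
  | .setNat A _ _, B => Nat.beq A B
  | .setReal _ _ _, _ => false
  | .seq p p', B => p.wn B || p'.wn B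
  | .cond _ p p', B => p.wn B || p'.wn B
  | .loop _ p, B => p.wn B
  | .query A _ _ _, B => Nat.beq A B

/-- Does the program write to the array `B` of reals? -/
def Prog.wr : Prog → ℕ → Bool
  | .skip, _ => false
  | .setNat _ _ _, _ => false
  | .setReal A _ _, B => Nat.beq A B
  | .seq p p', B => p.wr B || p'.wr B
  | .cond _ p p', B => p.wr B || p'.wr B
  | .loop _ p, B => p.wr B
  | .query _ _ _ _, _ => false

/-- The states agree on the arrays that `p` does not write to. -/
structure Agree (p : Prog) (σ σ' : State) : Prop where
  nat : ∀ A, p.wn A = false → σ'.nat A = σ.nat A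
  real : ∀ A, p.wr A = false → σ'.real A = σ.real A

theorem Agree.refl (p : Prog) (σ : State) : Agree p σ σ := ⟨fun _ _ => rfl, fun _ _ => rfl⟩

theorem Agree.trans {p : Prog} {σ σ₁ σ₂ : State} (h : Agree p σ σ₁) (h' : Agree p σ₁ σ₂) :
    Agree p σ σ₂ :=
  ⟨fun A hA => (h'.nat A hA).trans (h.nat A hA), fun A hA => (h'.real A hA).trans (h.real A hA)⟩

theorem Agree.mono {p p' : Prog} {σ σ' : State} (h : Agree p σ σ')
    (hn : ∀ A, p'.wn A = false → p.wn A = false) (hr : ∀ A, p'.wr A = false → p.wr A = false) :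
    Agree p' σ σ' :=
  ⟨fun A hA => h.nat A (hn A hA), fun A hA => h.real A (hr A hA)⟩

theorem ne_of_beq_false {A B : ℕ} (h : Nat.beq A B = false) : B ≠ A := by
  rintro rfl; simp at h

theorem agree_setNat {p : Prog} {σ : State} {A i v : ℕ} (h : ∀ B, p.wn B = false → B ≠ A) :
    Agree p σ (σ.setNat A i v) :=
  ⟨fun B hB => by simp [h B hB], fun _ _ => rfl⟩

theorem Exec.agree {O : ℕ → ℝ → Prop} {p : Prog} {σ σ' : State} {s c : ℕ}
    (h : Exec O p σ σ' s c) : Agree p σ σ' := by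
  induction h with
  | skip σ => exact Agree.refl _ _
  | setNat A k e σ => exact agree_setNat fun B hB => ne_of_beq_false hB
  | setReal A k x σ =>
    exact ⟨fun _ _ => rfl, fun B hB => by simp [ne_of_beq_false hB]⟩
  | seq _ _ h h' =>
    exact (h.mono (fun A hA => by simp [Prog.wn] at hA; exact hA.1)
      (fun A hA => by simp [Prog.wr] at hA; exact hA.1)).trans
      (h'.mono (fun A hA => by simp [Prog.wn] at hA; exact hA.2)
      (fun A hA => by simp [Prog.wr] at hA; exact hA.2))
  | condTrue _ _ h =>
    exact h.mono (fun A hA => by simp [Prog.wn] at hA; exact hA.1)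
      (fun A hA => by simp [Prog.wr] at hA; exact hA.1)
  | condFalse _ _ h =>
    exact h.mono (fun A hA => by simp [Prog.wn] at hA; exact hA.2)
      (fun A hA => by simp [Prog.wr] at hA; exact hA.2)
  | loopFalse _ => exact Agree.refl _ _
  | loopTrue _ _ _ h h' =>
    exact Agree.trans (p := .loop _ _) (h.mono (fun _ hA => hA) (fun _ hA => hA)) h'
  | queryYes A k e x σ _ => exact agree_setNat fun B hB => ne_of_beq_false hB
  | queryNo A k e x σ _ => exact agree_setNat fun B hB => ne_of_beq_false hB

/-- Started in `σ`, the program halts within `T` steps and `K` calls in a state with `Q`. -/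
def Ex (O : ℕ → ℝ → Prop) (p : Prog) (σ : State) (T K : ℕ) (Q : State → Prop) : Prop :=
  ∃ σ' s c, Exec O p σ σ' s c ∧ s ≤ T ∧ c ≤ K ∧ Q σ'

variable {O : ℕ → ℝ → Prop}

theorem Ex.mono {p : Prog} {σ : State} {T T' K K' : ℕ} {Q Q' : State → Prop}
    (h : Ex O p σ T K Q) (hT : T ≤ T') (hK : K ≤ K') (hQ : ∀ σ', Agree p σ σ' → Q σ' → Q' σ') :
    Ex O p σ T' K' Q' := by
  obtain ⟨σ', s, c, he, hs, hc, hq⟩ := h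
  exact ⟨σ', s, c, he, hs.trans hT, hc.trans hK, hQ σ' he.agree hq⟩

theorem Ex.time {p : Prog} {σ : State} {T T' K : ℕ} {Q : State → Prop}
    (h : Ex O p σ T K Q) (hT : T ≤ T') : Ex O p σ T' K Q :=
  h.mono hT le_rfl fun _ _ => id

theorem Ex.seq {p p' : Prog} {σ : State} {T T' K K' : ℕ} {R Q : State → Prop}
    (h : Ex O p σ T K R) (h' : ∀ σ₁, Agree p σ σ₁ → R σ₁ → Ex O p' σ₁ T' K' Q) :
    Ex O (p ;; p') σ (T + T') (K + K') Q := by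
  obtain ⟨σ₁, s, c, he, hs, hc, hr⟩ := h
  obtain ⟨σ₂, s', c', he', hs', hc', hq⟩ := h' σ₁ he.agree hr
  exact ⟨σ₂, _, _, .seq he he', by omega, by omega, hq⟩

/-- `Ex.seq` for programs without calls. -/
theorem Ex.seq₀ {p p' : Prog} {σ : State} {T T' : ℕ} {R Q : State → Prop}
    (h : Ex O p σ T 0 R) (h' : ∀ σ₁, Agree p σ σ₁ → R σ₁ → Ex O p' σ₁ T' 0 Q) :
    Ex O (p ;; p') σ (T + T') 0 Q := Ex.seq h h'

theorem Ex.cond {b : Test} {p p' : Prog} {σ : State} {T K : ℕ} {Q : State → Prop}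
    (h : b.holds σ → Ex O p σ T K Q) (h' : ¬ b.holds σ → Ex O p' σ T K Q)
    (hc : b.cost ≤ 20 := by decide) :
    Ex O (.cond b p p') σ (20 + T) K Q := by
  by_cases hb : b.holds σ
  · obtain ⟨σ₁, s, c, he, hs, hc, hq⟩ := h hb
    exact ⟨σ₁, _, _, .condTrue hb he, by omega, hc, hq⟩
  · obtain ⟨σ₁, s, c, he, hs, hc, hq⟩ := h' hb
    exact ⟨σ₁, _, _, .condFalse hb he, by omega, hc, hq⟩

theorem Ex.loop_aux {b : Test} {p : Prog} {σ₀ : State} {N : ℕ} {T : ℕ → ℕ} {K : ℕ}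
    {I : ℕ → State → Prop} (hc : b.cost ≤ 20)
    (hb : ∀ k < N, ∀ σ, Agree p σ₀ σ → I k σ → b.holds σ ∧ Ex O p σ (T k) K (I (k + 1)))
    (he : ∀ σ, Agree p σ₀ σ → I N σ → ¬ b.holds σ) :
    ∀ j k, k + j = N → ∀ σ, Agree p σ₀ σ → I k σ →
      Ex O (.loop b p) σ (∑ i ∈ Finset.Ico k N, (T i + 20) + 20) (j * K)
        (fun σ' => I N σ') := by
  intro j
  induction j with
  | zero =>
    rintro k rfl σ ha hI
    exact ⟨σ, _, _, .loopFalse (he σ ha hI), by simp [hc], by simp, hI⟩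
  | succ j ih =>
    intro k hk σ ha hI
    obtain ⟨hb', σ₁, s, c, he₁, hs, hc₁, hI₁⟩ := hb k (by omega) σ ha hI
    have ha₁ : Agree p σ₀ σ₁ := ha.trans he₁.agree
    obtain ⟨σ₂, s', c', he₂, hs', hc', hI₂⟩ := ih (k + 1) (by omega) σ₁ ha₁ hI₁
    refine ⟨σ₂, _, _, .loopTrue hb' he₁ he₂, ?_, ?_, hI₂⟩
    · rw [Finset.sum_eq_sum_Ico_succ_bot (by omega : k < N)]
      omega
    · rw [Nat.succ_mul]; omega

/-- A loop that is run `N` times. -/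
theorem Ex.for {b : Test} {p : Prog} {σ : State} {K : ℕ} (N : ℕ) (T : ℕ → ℕ)
    (I : ℕ → State → Prop) (h0 : I 0 σ)
    (hb : ∀ k < N, ∀ σ', Agree p σ σ' → I k σ' → b.holds σ' ∧ Ex O p σ' (T k) K (I (k + 1)))
    (he : ∀ σ', Agree p σ σ' → I N σ' → ¬ b.holds σ') (hc : b.cost ≤ 20 := by decide) :
    Ex O (.loop b p) σ (∑ i ∈ Finset.range N, (T i + 20) + 20) (N * K) (I N) := by
  have := Ex.loop_aux (O := O) hc hb he N 0 (by simp) σ (Agree.refl _ _) h0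
  rwa [← Finset.range_eq_Ico] at this

/-- A loop without calls that is run `N` times, with a uniform bound for the time of a round. -/
theorem Ex.for₀ {b : Test} {p : Prog} {σ : State} (N : ℕ) (T : ℕ)
    (I : ℕ → State → Prop) (h0 : I 0 σ)
    (hb : ∀ k < N, ∀ σ', Agree p σ σ' → I k σ' → b.holds σ' ∧ Ex O p σ' T 0 (I (k + 1)))
    (he : ∀ σ', Agree p σ σ' → I N σ' → ¬ b.holds σ') (hc : b.cost ≤ 20 := by decide) :
    Ex O (.loop b p) σ (N * (T + 20) + 20) 0 (I N) := by
  have := Ex.for (O := O) N (fun _ => T) I h0 hb he hc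
  simpa using this

/-- A loop that is run at most `N` times. -/
theorem Ex.while {b : Test} {p : Prog} {σ : State} {T K : ℕ} (N : ℕ)
    (I : ℕ → State → Prop) (h0 : I N σ)
    (hb : ∀ k σ', Agree p σ σ' → I k σ' → b.holds σ' →
      ∃ k', k' + 1 = k ∧ Ex O p σ' T K (I k')) (hc : b.cost ≤ 20 := by decide) :
    Ex O (.loop b p) σ (N * (T + 20) + 20) (N * K)
      (fun σ' => ¬ b.holds σ' ∧ ∃ k, I k σ') := by
  suffices ∀ N σ', Agree p σ σ' → I N σ' →
      Ex O (.loop b p) σ' (N * (T + 20) + 20) (N * K)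
        (fun σ' => ¬ b.holds σ' ∧ ∃ k, I k σ') from this N σ (Agree.refl _ _) h0
  intro N
  induction N with
  | zero =>
    intro σ' ha hI
    by_cases h : b.holds σ'
    · obtain ⟨k', hk, -⟩ := hb 0 σ' ha hI h
      omega
    · exact ⟨σ', _, _, .loopFalse h, by simp [hc], by simp, h, 0, hI⟩
  | succ N ih =>
    intro σ' ha hI
    by_cases h : b.holds σ'
    · obtain ⟨k', hk, σ₁, s, c, he, hs, hc₁, hI₁⟩ := hb _ σ' ha hI h
      obtain rfl : k' = N := by omega
      obtain ⟨σ₂, s', c', he₂, hs', hc', hI₂⟩ := ih σ₁ (ha.trans he.agree) hI₁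
      refine ⟨σ₂, _, _, .loopTrue h he he₂, ?_, ?_, hI₂⟩
      · rw [Nat.succ_mul]; omega
      · rw [Nat.succ_mul]; omega
    · exact ⟨σ', _, _, .loopFalse h, by omega, by simp, h, _, hI⟩

/-! Programs without loops and calls -/

open Classical in
/-- The effect of a program without loops and calls. -/
def Prog.sem : Prog → State → State
  | .skip, σ => σ
  | .setNat A k e, σ => σ.setNat A (k.eval σ) (e.eval σ)
  | .setReal A k x, σ => σ.setReal A (k.eval σ) (x.eval σ)
  | .seq p p', σ => p'.sem (p.sem σ)
  | .cond b p p', σ => if b.holds σ then p.sem σ else p'.sem σ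
  | .loop _ _, σ => σ
  | .query _ _ _ _, σ => σ

/-- The program has no loops and calls. -/
def Prog.flat : Prog → Bool
  | .seq p p' => p.flat && p'.flat
  | .cond _ p p' => p.flat && p'.flat
  | .loop _ _ => false
  | .query _ _ _ _ => false
  | _ => true

/-- A bound for the number of steps of a program without loops and calls. -/
def Prog.tc : Prog → ℕ
  | .skip => 1
  | .setNat _ k e => k.cost + e.cost + 1
  | .setReal _ k x => k.cost + x.cost + 1
  | .seq p p' => p.tc + p'.tc
  | .cond b p p' => b.cost + (p.tc + p'.tc)
  | _ => 0

theorem Prog.exec_sem {p : Prog} (h : p.flat = true) (σ : State) :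
    Ex O p σ p.tc 0 (fun σ' => σ' = p.sem σ) := by
  induction p generalizing σ with
  | skip => exact ⟨σ, _, _, .skip σ, le_rfl, le_rfl, rfl⟩
  | setNat A k e => exact ⟨_, _, _, .setNat A k e σ, le_rfl, le_rfl, rfl⟩
  | setReal A k x => exact ⟨_, _, _, .setReal A k x σ, le_rfl, le_rfl, rfl⟩
  | seq p p' ih ih' =>
    simp only [Prog.flat, Bool.and_eq_true] at h
    refine Ex.seq₀ (ih h.1 σ) fun σ₁ _ h₁ => ?_
    rw [Prog.sem, ← h₁]
    exact ih' h.2 σ₁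
  | cond b p p' ih ih' =>
    simp only [Prog.flat, Bool.and_eq_true] at h
    by_cases hb : b.holds σ
    · obtain ⟨σ₁, s, c, he, hs, hc, hq⟩ := ih h.1 σ
      exact ⟨σ₁, _, _, .condTrue hb he, by rw [Prog.tc]; omega, hc, by rw [Prog.sem, if_pos hb, hq]⟩
    · obtain ⟨σ₁, s, c, he, hs, hc, hq⟩ := ih' h.2 σ
      exact ⟨σ₁, _, _, .condFalse hb he, by rw [Prog.tc]; omega, hc, by rw [Prog.sem, if_neg hb, hq]⟩
  | loop b p => simp [Prog.flat] at h
  | query => simp [Prog.flat] at h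

/-- The weakest precondition of a program without loops and calls. -/
def Prog.wp : Prog → (State → Prop) → State → Prop
  | .skip, Q, σ => Q σ
  | .setNat A k e, Q, σ => Q (σ.setNat A (k.eval σ) (e.eval σ))
  | .setReal A k x, Q, σ => Q (σ.setReal A (k.eval σ) (x.eval σ))
  | .seq p p', Q, σ => p.wp (p'.wp Q) σ
  | .cond b p p', Q, σ => (b.holds σ → p.wp Q σ) ∧ (¬ b.holds σ → p'.wp Q σ)
  | .loop _ _, _, _ => False
  | .query _ _ _ _, _, _ => False

theorem Prog.wp_sem {p : Prog} {Q : State → Prop} {σ : State} (h : p.wp Q σ) : Q (p.sem σ) := by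
  induction p generalizing σ Q with
  | seq p p' ih ih' => exact ih' (ih h)
  | cond b p p' ih ih' =>
    rw [Prog.sem]
    split_ifs with hb
    · exact ih (h.1 hb)
    · exact ih' (h.2 hb)
  | loop => exact h.elim
  | query => exact h.elim
  | _ => exact h

theorem Ex.flat {p : Prog} {σ : State} {T : ℕ} {Q : State → Prop} (hQ : p.wp Q σ)
    (h : p.flat = true := by rfl) (hT : p.tc ≤ T := by decide) : Ex O p σ T 0 Q :=
  (Prog.exec_sem h σ).mono hT le_rfl fun _ _ h' => h' ▸ Prog.wp_sem hQ

/-- A program without loops and calls in front of another program. -/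
theorem Ex.flat_seq {p p' : Prog} {σ : State} {T K : ℕ} {Q : State → Prop} (T₀ : ℕ)
    (h' : ∀ σ₁, σ₁ = p.sem σ → Agree p σ σ₁ → Ex O p' σ₁ T K Q)
    (h : p.flat = true := by rfl) (hT : p.tc ≤ T₀ := by decide) :
    Ex O (p ;; p') σ (T₀ + T) K Q := by
  have := Ex.seq ((Prog.exec_sem (O := O) h σ).time hT) fun σ₁ ha h₁ => h' σ₁ h₁ ha
  simpa using this

/-! ### Arc length on the boundary of a region -/

open Real in
theorem two_pi_pos' : (0 : ℝ) < 2 * Real.pi := by positivity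

namespace Region
variable (R : Region)

theorem continuous_circlePt : Continuous circlePt := by
  unfold circlePt
  refine Continuous.subtype_mk ?_ _
  refine (PiLp.continuous_toLp 2 _).comp ?_
  refine continuous_pi fun i => ?_
  fin_cases i
  · exact Real.continuous_cos
  · exact Real.continuous_sin

theorem continuous_pt : Continuous R.pt :=
  continuous_subtype_val.comp (R.disc.symm.continuous.comp continuous_circlePt)

theorem circlePt_eq_iff {θ θ' : ℝ} :
    circlePt θ = circlePt θ' ↔ ∃ k : ℤ, θ - θ' = 2 * Real.pi * k := by
  rw [← Real.Angle.angle_eq_iff_two_pi_dvd_sub]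
  constructor
  · intro h
    have h' : (!₂[Real.cos θ, Real.sin θ] : Plane) = !₂[Real.cos θ', Real.sin θ'] :=
      congrArg Subtype.val h
    have h0 := congrArg (fun x : Plane => x 0) h'
    have h1 := congrArg (fun x : Plane => x 1) h'
    exact Real.Angle.cos_sin_inj (by simpa using h0) (by simpa using h1)
  · intro h
    have h0 := congrArg Real.Angle.cos h
    have h1 := congrArg Real.Angle.sin h
    simp only [Real.Angle.cos_coe, Real.Angle.sin_coe] at h0 h1
    simp [circlePt, h0, h1]

theorem pt_eq_iff {θ θ' : ℝ} : R.pt θ = R.pt θ' ↔ ∃ k : ℤ, θ - θ' = 2 * Real.pi * k := by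
  rw [← circlePt_eq_iff]
  unfold pt
  rw [Subtype.coe_inj, R.disc.symm.injective.eq_iff]

theorem pt_add_int (θ : ℝ) (k : ℤ) : R.pt (θ + 2 * Real.pi * k) = R.pt θ :=
  R.pt_eq_iff.2 ⟨k, by ring⟩

theorem pt_add_two_pi (θ : ℝ) : R.pt (θ + 2 * Real.pi) = R.pt θ := by
  simpa using R.pt_add_int θ 1

/-- Points at an angular distance less than `2π` are equal only if the angles are. -/
theorem pt_inj {θ θ' : ℝ} (h : R.pt θ = R.pt θ') (h₁ : θ < θ' + 2 * Real.pi)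
    (h₂ : θ' < θ + 2 * Real.pi) : θ = θ' := by
  obtain ⟨k, hk⟩ := R.pt_eq_iff.1 h
  have hp := two_pi_pos'
  have hk1 : (k : ℝ) < 1 := by by_contra hc; push Not at hc; nlinarith
  have hk2 : (-1 : ℝ) < k := by by_contra hc; push Not at hc; nlinarith
  have : k = 0 := by
    have h1 : k < 1 := by exact_mod_cast hk1
    have h2 : -1 < k := by exact_mod_cast hk2
    omega
  subst this
  simpa [sub_eq_zero] using hk

theorem arc_add_int (u v : ℝ) (k : ℤ) :
    R.arc (u + 2 * Real.pi * k) (v + 2 * Real.pi * k) = R.arc u v := by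
  unfold arc
  rw [← Set.image_add_const_Icc, Set.image_image]
  simp [pt_add_int]

theorem openArc_add_int (u v : ℝ) (k : ℤ) :
    R.openArc (u + 2 * Real.pi * k) (v + 2 * Real.pi * k) = R.openArc u v := by
  unfold openArc
  rw [← Set.image_add_const_Ioo, Set.image_image]
  simp [pt_add_int]

theorem isCompact_arc (u v : ℝ) : IsCompact (R.arc u v) := isCompact_Icc.image R.continuous_pt

theorem measurableSet_arc (u v : ℝ) : MeasurableSet (R.arc u v) :=
  (R.isCompact_arc u v).isClosed.measurableSet

theorem arc_subset_boundary (u v : ℝ) : R.arc u v ⊆ R.boundary := Set.image_subset_range _ _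

theorem boundary_eq_arc (u : ℝ) : R.boundary = R.arc u (u + 2 * Real.pi) := by
  refine Set.Subset.antisymm ?_ (R.arc_subset_boundary _ _)
  rintro _ ⟨θ, rfl⟩
  have hp := two_pi_pos'
  refine ⟨toIcoMod hp u θ, ?_, ?_⟩
  · have := toIcoMod_mem_Ico hp u θ
    exact ⟨this.1, this.2.le⟩
  · rw [R.pt_eq_iff]
    refine ⟨-toIcoDiv hp u θ, ?_⟩
    have := self_sub_toIcoDiv_zsmul hp u θ
    rw [← this]
    simp; ring

theorem boundary_subset : R.boundary ⊆ R.carrier := by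
  rintro _ ⟨θ, rfl⟩
  exact (R.disc.symm (circlePt θ)).2

theorem len_point (x : Plane) : μH[1] ({x} : Set Plane) = 0 :=
  have := Measure.nullSingletonClass_hausdorff Plane (d := 1) one_pos
  measure_singleton x

end Region

namespace Perimeter
variable (P : Perimeter)

theorem arc_ne_top (u v : ℝ) : μH[1] (P.toRegion.arc u v) ≠ ⊤ :=
  ne_top_of_le_ne_top P.rectifiable (measure_mono (P.toRegion.arc_subset_boundary u v))

theorem len_arc_add {u v w : ℝ} (huv : u ≤ v) (hvw : v ≤ w) (hw : w ≤ u + 2 * Real.pi) :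
    len (P.toRegion.arc u w) = len (P.toRegion.arc u v) + len (P.toRegion.arc v w) := by
  have hp := two_pi_pos'
  have hun : P.toRegion.arc u w = P.toRegion.arc u v ∪ P.toRegion.arc v w := by
    unfold Region.arc
    rw [← Set.image_union, Set.Icc_union_Icc_eq_Icc huv hvw]
  have hd : AEDisjoint (μH[1]) (P.toRegion.arc u v) (P.toRegion.arc v w) := by
    refine measure_mono_null (t := {P.toRegion.pt u} ∪ {P.toRegion.pt v}) ?_
      (measure_union_null (Region.len_point _) (Region.len_point _))
    rintro _ ⟨⟨θ, hθ, rfl⟩, ⟨θ', hθ', h⟩⟩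
    rcases eq_or_lt_of_le hθ.1 with h0 | h0
    · left; simp [h0]
    · right
      have := P.toRegion.pt_inj h (by linarith [hθ.1, hθ'.2]) (by linarith [hθ.2, hθ'.1])
      have h1 : θ = v := le_antisymm hθ.2 (this ▸ hθ'.1)
      simp [h1]
  unfold len
  rw [hun, measure_union₀ (P.toRegion.measurableSet_arc v w).nullMeasurableSet hd,
    ENNReal.toReal_add (P.arc_ne_top _ _) (P.arc_ne_top _ _)]

theorem len_openArc (u v : ℝ) :
    len (P.toRegion.openArc u v) = len (P.toRegion.arc u v) := by
  unfold len
  congr 1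
  apply le_antisymm
  · exact measure_mono (Set.image_mono Set.Ioo_subset_Icc_self)
  · have : P.toRegion.arc u v ⊆
        P.toRegion.openArc u v ∪ ({P.toRegion.pt u} ∪ {P.toRegion.pt v}) := by
      rintro _ ⟨θ, hθ, rfl⟩
      rcases eq_or_lt_of_le hθ.1 with h0 | h0
      · right; left; simp [h0]
      rcases eq_or_lt_of_le hθ.2 with h1 | h1
      · right; right; simp [h1]
      · left; exact ⟨θ, ⟨h0, h1⟩, rfl⟩
    refine (measure_mono this).trans ((measure_union_le _ _).trans ?_)
    rw [measure_union_null (Region.len_point _) (Region.len_point _), add_zero]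

theorem len_arc_mono {u v u' v' : ℝ} (hu : u' ≤ u) (hv : v ≤ v') :
    len (P.toRegion.arc u v) ≤ len (P.toRegion.arc u' v') :=
  ENNReal.toReal_mono (P.arc_ne_top _ _)
    (measure_mono (Set.image_mono (Set.Icc_subset_Icc hu hv)))

theorem len_arc_pos {u v : ℝ} (h : u < v) : 0 < len (P.toRegion.arc u v) := by
  have hp := two_pi_pos'
  set w := min v (u + Real.pi) with hw
  have huw : u < w := lt_min h (by linarith)
  refine lt_of_lt_of_le ?_ (P.len_arc_mono le_rfl (min_le_left v (u + Real.pi)))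
  rw [← hw]
  refine ENNReal.toReal_pos ?_ (P.arc_ne_top _ _)
  intro h0
  set f : Plane → ℝ := fun x => dist x (P.toRegion.pt u) with hf
  have hl : LipschitzWith 1 f := LipschitzWith.dist_left _
  have h1 := hl.hausdorffMeasure_image_le zero_le_one (P.toRegion.arc u w)
  rw [h0, mul_zero] at h1
  have hne : P.toRegion.pt w ≠ P.toRegion.pt u := fun he => by
    have hw' : w ≤ u + Real.pi := min_le_right _ _
    have := P.toRegion.pt_inj he (by linarith) (by linarith)
    linarith
  have hsub : Set.Icc 0 (f (P.toRegion.pt w)) ⊆ f '' P.toRegion.arc u w := by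
    have hc : ContinuousOn (fun θ => f (P.toRegion.pt θ)) (Set.Icc u w) :=
      (hl.continuous.comp P.toRegion.continuous_pt).continuousOn
    have := intermediate_value_Icc huw.le hc
    rw [Region.arc, Set.image_image]
    simpa [hf] using this
  have h2 := (measure_mono hsub).trans h1
  rw [hausdorffMeasure_real, Real.volume_Icc] at h2
  have : 0 < f (P.toRegion.pt w) := dist_pos.2 hne
  simp at h2
  linarith

/-- The length of the boundary. -/
def total : ℝ := len P.toRegion.boundary

/-- The distance along the boundary from angle `0`, extended to all angles. -/
def dist (θ : ℝ) : ℝ :=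
  toIcoDiv two_pi_pos' 0 θ * P.total + len (P.toRegion.arc 0 (toIcoMod two_pi_pos' 0 θ))

theorem dist_sub {u v : ℝ} (huv : u ≤ v) (hv : v ≤ u + 2 * Real.pi) :
    len (P.toRegion.arc u v) = P.dist v - P.dist u := by
  have hp := two_pi_pos'
  obtain ⟨hu1, hu2⟩ := toIcoMod_mem_Ico hp 0 u
  obtain ⟨hv1, hv2⟩ := toIcoMod_mem_Ico hp 0 v
  have hue := self_sub_toIcoDiv_zsmul hp 0 u
  have hve := self_sub_toIcoDiv_zsmul hp 0 v
  unfold dist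
  set k := toIcoDiv hp 0 u
  set k' := toIcoDiv hp 0 v
  set u₀ := toIcoMod hp 0 u
  set v₀ := toIcoMod hp 0 v
  rw [zsmul_eq_mul] at hue hve
  have hu : u = u₀ + 2 * Real.pi * k := by linarith
  have hv' : v = v₀ + 2 * Real.pi * k' := by linarith
  have hT : P.total = len (P.toRegion.arc 0 (0 + 2 * Real.pi)) := by
    rw [total, P.toRegion.boundary_eq_arc 0]
  have hk1 : ((k' - k : ℤ) : ℝ) > -1 := by
    push_cast; by_contra hc; push Not at hc; nlinarith
  have hk2 : ((k' - k : ℤ) : ℝ) < 2 := by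
    push_cast; by_contra hc; push Not at hc; nlinarith
  have hk1' : k' - k > -1 := by exact_mod_cast hk1
  have hk2' : k' - k < 2 := by exact_mod_cast hk2
  rcases (by omega : k' = k ∨ k' = k + 1) with h | h
  · have h1 : u₀ ≤ v₀ := by rw [hu, hv', h] at huv; linarith
    rw [hu, hv', h, Region.arc_add_int, P.len_arc_add hu1 h1 (by linarith)]
    ring
  · have h1 : v₀ ≤ u₀ := by
      rw [hu, hv', h] at hv; push_cast at hv; linarith
    have e : v = (v₀ + 2 * Real.pi) + 2 * Real.pi * k := by rw [hv', h]; push_cast; ring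
    have e2 := P.toRegion.arc_add_int 0 v₀ 1
    have e3 := P.len_arc_add (u := u₀) (v := 0 + 2 * Real.pi) (w := v₀ + 2 * Real.pi)
      (by linarith) (by linarith) (by linarith)
    have e4 := P.len_arc_add (u := 0) (v := u₀) (w := 0 + 2 * Real.pi)
      (by linarith) (by linarith) (by linarith)
    simp only [Int.cast_one, mul_one] at e2
    rw [hu, e, Region.arc_add_int, e3, e2, h, hT, e4]
    push_cast
    ring

theorem dist_add_two_pi (θ : ℝ) : P.dist (θ + 2 * Real.pi) = P.dist θ + P.total := by
  have := P.dist_sub (u := θ) (v := θ + 2 * Real.pi) (by linarith [two_pi_pos']) le_rfl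
  rw [← P.toRegion.boundary_eq_arc θ] at this
  rw [total]; linarith

theorem dist_strictMono : StrictMono P.dist := by
  have hp := two_pi_pos'
  have key : ∀ n : ℕ, ∀ u v : ℝ, u < v → v ≤ u + 2 * Real.pi * (n + 1) → P.dist u < P.dist v := by
    intro n
    induction n with
    | zero =>
      intro u v h h'
      have := P.len_arc_pos h
      rw [P.dist_sub h.le (by simpa using h')] at this
      linarith
    | succ n ih =>
      intro u v h h'
      have base : P.dist u < P.dist (u + 2 * Real.pi) := by
        have := P.len_arc_pos (u := u) (v := u + 2 * Real.pi) (by linarith)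
        rw [P.dist_sub (by linarith) le_rfl] at this
        linarith
      rcases le_or_gt v (u + 2 * Real.pi) with h1 | h1
      · have := P.len_arc_pos h
        rw [P.dist_sub h.le h1] at this
        linarith
      · refine base.trans (ih _ _ h1 ?_)
        push_cast at h'; linarith
  intro u v h
  obtain ⟨n, hn⟩ := exists_nat_ge ((v - u) / (2 * Real.pi))
  refine key n u v h ?_
  rw [div_le_iff₀ hp] at hn
  nlinarith

theorem dist_continuous : Continuous P.dist := by
  rw [Metric.continuous_iff]
  intro θ ε hε
  set a : ℕ → Set Plane := fun n => P.toRegion.arc (θ - 1 / (n + 1)) (θ + 1 / (n + 1)) with ha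
  have hpos : ∀ n : ℕ, (0 : ℝ) < 1 / (n + 1) := fun n => Nat.one_div_pos_of_nat
  have hInter : ⋂ n, a n = {P.toRegion.pt θ} := by
    refine Set.Subset.antisymm ?_ ?_
    · intro x hx
      rw [Set.mem_iInter] at hx
      choose f hf hfx using hx
      have hlim : Filter.Tendsto f Filter.atTop (nhds θ) := by
        have h0 := tendsto_one_div_add_atTop_nhds_zero_nat (𝕜 := ℝ)
        refine tendsto_of_tendsto_of_tendsto_of_le_of_le (g := fun n : ℕ => θ - 1 / ((n : ℝ) + 1))
          (h := fun n : ℕ => θ + 1 / ((n : ℝ) + 1)) ?_ ?_ (fun n => (hf n).1) (fun n => (hf n).2)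
        · simpa using h0.const_sub θ
        · simpa using h0.const_add θ
      have h1 := (P.toRegion.continuous_pt.tendsto θ).comp hlim
      have h2 : (P.toRegion.pt ∘ f) = fun _ => x := funext hfx
      rw [h2] at h1
      exact tendsto_nhds_unique tendsto_const_nhds h1
    · rintro _ rfl
      rw [Set.mem_iInter]
      exact fun n => ⟨θ, ⟨by linarith [hpos n], by linarith [hpos n]⟩, rfl⟩
  have hanti : Antitone a := by
    intro n n' h
    refine Set.image_mono (Set.Icc_subset_Icc ?_ ?_)
    · have := Nat.one_div_le_one_div (α := ℝ) h; linarith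
    · have := Nat.one_div_le_one_div (α := ℝ) h; linarith
  have ht := tendsto_measure_iInter_atTop (μ := μH[1]) (s := a)
    (fun n => (P.toRegion.measurableSet_arc _ _).nullMeasurableSet) hanti ⟨0, P.arc_ne_top _ _⟩
  rw [hInter, Region.len_point] at ht
  have ht' := (ENNReal.tendsto_toReal ENNReal.zero_ne_top).comp ht
  obtain ⟨n, hn⟩ := (ht'.eventually (gt_mem_nhds (by simpa using hε))).exists
  have hn' : len (a n) < ε := hn
  have h1n : (1 : ℝ) / (n + 1) ≤ 1 := by
    rw [div_le_one (by positivity)]; linarith [(Nat.cast_nonneg n : (0 : ℝ) ≤ n)]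
  rw [ha, P.dist_sub (by linarith [hpos n]) (by linarith [hpos n, Real.pi_gt_three])] at hn'
  refine ⟨1 / (n + 1), hpos n, fun θ' hθ' => ?_⟩
  rw [Real.dist_eq, abs_lt] at hθ'
  have hm := P.dist_strictMono.monotone
  have h1 := hm (show θ - 1 / (n + 1) ≤ θ' by linarith)
  have h2 := hm (show θ' ≤ θ + 1 / (n + 1) by linarith)
  have h3 := hm (show θ - 1 / (n + 1) ≤ θ by linarith [hpos n])
  have h4 := hm (show θ ≤ θ + 1 / (n + 1) by linarith [hpos n])
  rw [Real.dist_eq, abs_lt]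
  constructor <;> linarith

theorem total_pos : 0 < P.total := by
  have := P.dist_strictMono (show (0 : ℝ) < 0 + 2 * Real.pi by linarith [two_pi_pos'])
  rw [P.dist_add_two_pi] at this
  linarith

/-- Every distance of less than a full turn from an angle is attained. -/
theorem exists_dist_eq (θ : ℝ) {s : ℝ} (h0 : 0 ≤ s) (h1 : s ≤ P.total) :
    ∃ θ', θ ≤ θ' ∧ θ' ≤ θ + 2 * Real.pi ∧ P.dist θ' = P.dist θ + s := by
  have := intermediate_value_Icc (show θ ≤ θ + 2 * Real.pi by linarith [two_pi_pos'])
    P.dist_continuous.continuousOn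
  rw [P.dist_add_two_pi] at this
  obtain ⟨θ', h, e⟩ := this (show P.dist θ + s ∈ _ from ⟨by linarith, by linarith⟩)
  exact ⟨θ', h.1, h.2, e⟩

/-! Segments and gaps in the universal cover of the boundary -/

/-- The angle at which `S_r` begins; the index `r` goes on after a full turn. -/
def lft (r : ℕ) : ℝ := P.left (P.idx r) + 2 * Real.pi * ((r / P.q : ℕ) : ℤ)

/-- The angle at which `S_r` ends; the index `r` goes on after a full turn. -/
def rgt (r : ℕ) : ℝ := P.right (P.idx r) + 2 * Real.pi * ((r / P.q : ℕ) : ℤ)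

theorem lft_add_q (r : ℕ) : P.lft (r + P.q) = P.lft r + 2 * Real.pi := by
  unfold lft idx
  simp only [Nat.add_mod_right, Nat.add_div_right _ P.q_pos]
  push_cast; ring

theorem rgt_add_q (r : ℕ) : P.rgt (r + P.q) = P.rgt r + 2 * Real.pi := by
  unfold rgt idx
  simp only [Nat.add_mod_right, Nat.add_div_right _ P.q_pos]
  push_cast; ring

theorem lft_lt_rgt (r : ℕ) : P.lft r < P.rgt r := by
  unfold lft rgt; linarith [P.left_lt_right (P.idx r)]

theorem nextLeft_eq (r : ℕ) :
    P.nextLeft r + 2 * Real.pi * ((r / P.q : ℕ) : ℤ) = P.lft (r + 1) := by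
  have hq := P.q_pos
  unfold nextLeft lft
  split_ifs with h
  · have h' : r % P.q + 1 < P.q := h
    have h1 : (r + 1) % P.q = r % P.q + 1 := by
      rw [Nat.add_mod, Nat.mod_eq_of_lt (show 1 < P.q by omega), Nat.mod_eq_of_lt h']
    have h2 : (r + 1) / P.q = r / P.q := by
      rw [Nat.succ_div, if_neg, add_zero]
      rw [Nat.dvd_iff_mod_eq_zero]; omega
    have h3 : P.idx (r + 1) = ⟨(P.idx r : ℕ) + 1, h⟩ := Fin.ext h1
    rw [h2, h3]
  · have h' : ¬ r % P.q + 1 < P.q := h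
    have hlt := Nat.mod_lt r hq
    have h0 : P.q ∣ r + 1 := by
      have e := Nat.div_add_mod r P.q
      have e1 : r + 1 = P.q * (r / P.q + 1) := by rw [mul_add]; omega
      exact ⟨_, e1⟩
    have h2 : (r + 1) / P.q = r / P.q + 1 := by rw [Nat.succ_div, if_pos h0]
    have h3 : P.idx (r + 1) = ⟨0, hq⟩ := Fin.ext (Nat.mod_eq_zero_of_dvd h0)
    rw [h2, h3]; push_cast; ring

theorem rgt_le_lft_succ (r : ℕ) : P.rgt r ≤ P.lft (r + 1) := by
  rw [← nextLeft_eq]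
  unfold rgt nextLeft
  have hq := P.q_pos
  split_ifs with h
  · have := P.right_lt_left (P.idx r) ⟨_, h⟩ (Fin.lt_def.2 (Nat.lt_succ_self _))
    linarith
  · by_cases h0 : (P.idx r : ℕ) = 0
    · have : P.idx r = ⟨0, hq⟩ := Fin.ext h0
      rw [this]; linarith [P.right_le_wrap ⟨0, hq⟩]
    · have := P.right_lt_wrap ⟨0, hq⟩ (P.idx r) (Fin.lt_def.2 (Nat.pos_of_ne_zero h0))
      linarith

theorem lft_mono : Monotone P.lft :=
  monotone_nat_of_le_succ fun r => (P.lft_lt_rgt r).le.trans (P.rgt_le_lft_succ r)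

theorem lft_succ_le (r : ℕ) : P.lft (r + 1) ≤ P.lft r + 2 * Real.pi := by
  rw [← lft_add_q]; exact P.lft_mono (by have := P.q_pos; omega)

theorem seg_eq (r : ℕ) : P.seg r = P.toRegion.arc (P.lft r) (P.rgt r) := by
  unfold seg lft rgt; rw [Region.arc_add_int]

theorem gap_eq (r : ℕ) : P.gap r = P.toRegion.openArc (P.rgt r) (P.lft (r + 1)) := by
  rw [← nextLeft_eq]; unfold gap rgt; rw [Region.openArc_add_int]

/-- The distance along the boundary of the start of `S_r`. -/
def st (r : ℕ) : ℝ := P.dist (P.lft r)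

/-- The distance along the boundary of the end of `S_r`. -/
def en (r : ℕ) : ℝ := P.dist (P.rgt r)

theorem st_lt_en (r : ℕ) : P.st r < P.en r := P.dist_strictMono (P.lft_lt_rgt r)

theorem en_le_st_succ (r : ℕ) : P.en r ≤ P.st (r + 1) :=
  P.dist_strictMono.monotone (P.rgt_le_lft_succ r)

theorem st_mono : Monotone P.st := fun _ _ h => P.dist_strictMono.monotone (P.lft_mono h)

theorem st_add_q (r : ℕ) : P.st (r + P.q) = P.st r + P.total := by
  unfold st; rw [lft_add_q, dist_add_two_pi]

theorem len_seg (r : ℕ) : len (P.seg r) = P.en r - P.st r := by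
  rw [seg_eq, P.dist_sub (P.lft_lt_rgt r).le]
  · rfl
  · exact (P.rgt_le_lft_succ r).trans (P.lft_succ_le r)

theorem len_gap (r : ℕ) : len (P.gap r) = P.st (r + 1) - P.en r := by
  rw [gap_eq, P.len_openArc, P.dist_sub (P.rgt_le_lft_succ r)]
  · rfl
  · linarith [P.lft_succ_le r, P.lft_lt_rgt r]

theorem segStart_eq (i r : ℕ) : segStart P i r = P.st (i + r) - P.st i := by
  unfold segStart
  simp only [len_seg, len_gap]
  have := Finset.sum_range_sub (fun r => P.st (i + r)) r
  rw [add_zero] at this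
  rw [← this]
  refine Finset.sum_congr rfl fun r' _ => ?_
  rw [add_assoc]; ring

theorem segEnd_eq (i r : ℕ) : segEnd P i r = P.en (i + r) - P.st i := by
  unfold segEnd; rw [segStart_eq, len_seg]; ring

theorem chain_eq (i d : ℕ) : P.chain i d = P.toRegion.arc (P.lft i) (P.rgt (i + d)) := by
  induction d with
  | zero => simp [chain, seg_eq]
  | succ d ih =>
    have : P.chain i (d + 1) = P.chain i d ∪ (P.gap (i + d) ∪ P.seg (i + (d + 1))) := by
      unfold chain
      rw [Finset.range_add_one (n := d + 1), Finset.range_add_one (n := d)]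
      simp only [Finset.set_biUnion_insert]
      ext x
      simp only [Set.mem_union]
      tauto
    rw [this, ih, gap_eq, seg_eq, Region.arc, Region.arc, Region.arc, Region.openArc,
      ← Set.image_union, ← Set.image_union]
    congr 1
    have h1 : P.lft i ≤ P.rgt (i + d) := (P.lft_mono (by omega)).trans (P.lft_lt_rgt _).le
    have h2 := P.rgt_le_lft_succ (i + d)
    have h3 := (P.lft_lt_rgt (i + (d + 1))).le
    rw [← add_assoc] at h3 ⊢
    ext x
    simp only [Set.mem_union, Set.mem_Icc, Set.mem_Ioo]
    constructor
    · rintro (⟨h, h'⟩ | ⟨h, h'⟩ | ⟨h, h'⟩) <;> constructor <;> linarith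
    · rintro ⟨h, h'⟩
      rcases le_or_gt x (P.rgt (i + d)) with h4 | h4
      · exact Or.inl ⟨h, h4⟩
      · rcases lt_or_ge x (P.lft (i + d + 1)) with h5 | h5
        · exact Or.inr (Or.inl ⟨h4, h5⟩)
        · exact Or.inr (Or.inr ⟨h5, h'⟩)

theorem rgt_le (i d : ℕ) (hd : d < P.q) : P.rgt (i + d) ≤ P.lft i + 2 * Real.pi := by
  rw [← lft_add_q]; exact (P.rgt_le_lft_succ _).trans (P.lft_mono (by omega))

theorem lft_le_rgt (i d : ℕ) : P.lft i ≤ P.rgt (i + d) :=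
  (P.lft_mono (by omega)).trans (P.lft_lt_rgt _).le

theorem len_chain (i d : ℕ) (hd : d < P.q) : len (P.chain i d) = segEnd P i d := by
  rw [chain_eq, segEnd_eq, P.dist_sub (P.lft_le_rgt i d) (P.rgt_le i d hd)]; rfl

theorem segStart_zero (i : ℕ) : segStart P i 0 = 0 := by simp [segStart]

theorem segStart_lt_segEnd (i r : ℕ) : segStart P i r < segEnd P i r := by
  rw [segStart_eq, segEnd_eq]; linarith [P.st_lt_en (i + r)]

theorem segEnd_le_segStart (i : ℕ) {r r' : ℕ} (h : r < r') : segEnd P i r ≤ segStart P i r' := by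
  rw [segStart_eq, segEnd_eq]
  linarith [P.en_le_st_succ (i + r), P.st_mono (show i + r + 1 ≤ i + r' by omega)]

theorem segStart_mono (i : ℕ) : Monotone (segStart P i) := fun r r' h => by
  rw [segStart_eq, segStart_eq]
  linarith [P.st_mono (show i + r ≤ i + r' by omega)]

theorem segEnd_mono (i : ℕ) : Monotone (segEnd P i) :=
  monotone_nat_of_le_succ fun r =>
    (P.segEnd_le_segStart i (Nat.lt_succ_self r)).trans (P.segStart_lt_segEnd i _).le

theorem segStart_q (i : ℕ) : segStart P i P.q = P.total := by
  rw [segStart_eq, st_add_q]; ring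

theorem segEnd_pos (i r : ℕ) : 0 < segEnd P i r :=
  lt_of_le_of_lt ((P.segStart_zero i) ▸ P.segStart_mono i (Nat.zero_le r))
    (P.segStart_lt_segEnd i r)

theorem segEnd_le_total (i r : ℕ) (hr : r < P.q) : segEnd P i r ≤ P.total := by
  rw [← P.segStart_q i]; exact P.segEnd_le_segStart i hr

theorem guarded_eq (i : ℕ) :
    P.guarded = ⋃ r ∈ Finset.range P.q, P.toRegion.arc (P.lft (i + r)) (P.rgt (i + r)) := by
  have hq := P.q_pos
  have hseg : ∀ r r' : ℕ, r % P.q = r' % P.q → P.seg r = P.seg r' := by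
    intro r r' h
    have : P.idx r = P.idx r' := Fin.ext h
    simp only [seg, this]
  unfold guarded
  ext x
  simp only [Set.mem_iUnion, Finset.mem_range, exists_prop, ← seg_eq]
  constructor
  · rintro ⟨j, hj⟩
    refine ⟨(j + (P.q - i % P.q)) % P.q, Nat.mod_lt _ hq, ?_⟩
    rw [hseg _ j]
    · exact hj
    · have h1 := Nat.mod_lt i hq
      have h2 := Nat.div_add_mod i P.q
      rw [Nat.add_mod_mod, show i + (↑j + (P.q - i % P.q)) = ↑j + P.q * (i / P.q + 1) by
        rw [mul_add]; omega]
      simp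
  · rintro ⟨r, _, h⟩
    refine ⟨⟨(i + r) % P.q, Nat.mod_lt _ hq⟩, ?_⟩
    rwa [hseg _ (i + r)]
    simp

end Perimeter

/-! ### The dynamic program -/

section Inc
variable (P : Perimeter) (i : ℕ)

theorem add_le_inc (L x : ℝ) : L + x ≤ inc P i L x :=
  (Finset.le_fold_max _).2 (Or.inl le_rfl)

theorem segStart_le_inc {L x : ℝ} {r : ℕ} (hr : r < P.q) (h : segEnd P i r ≤ L + x) :
    segStart P i (r + 1) ≤ inc P i L x :=
  (Finset.le_fold_max _).2
    (Or.inr ⟨r, Finset.mem_filter.2 ⟨Finset.mem_range.2 hr, h⟩, le_rfl⟩)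

theorem inc_cases (L x : ℝ) : inc P i L x = L + x ∨
    ∃ r < P.q, segEnd P i r ≤ L + x ∧ L + x ≤ segStart P i (r + 1) ∧
      inc P i L x = segStart P i (r + 1) := by
  rcases (Finset.le_fold_max (inc P i L x)).1 (le_refl (inc P i L x)) with h | ⟨r, hr, h⟩
  · exact Or.inl (le_antisymm h (add_le_inc P i L x))
  · rw [Finset.mem_filter, Finset.mem_range] at hr
    have := le_antisymm h (segStart_le_inc P i hr.1 hr.2)
    exact Or.inr ⟨r, hr.1, hr.2, this ▸ add_le_inc P i L x, this⟩

/-- A distance that is dealt with is not in a gap. -/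
theorem segStart_le_inc_of_segEnd_le {L x : ℝ} {r : ℕ} (hr : r < P.q)
    (h : segEnd P i r ≤ inc P i L x) : segStart P i (r + 1) ≤ inc P i L x := by
  rcases inc_cases P i L x with e | ⟨r', hr', h', -, e⟩
  · exact segStart_le_inc P i hr (e ▸ h)
  · rcases lt_or_ge r' r with h1 | h1
    · have := P.segStart_mono i (show r' + 1 ≤ r by omega)
      linarith [P.segStart_lt_segEnd i r]
    · rw [e]; exact P.segStart_mono i (by omega)

/-- `segStart i r ≤ s ≤ segEnd i r`, and `s` belongs to the part that is dealt with by `L`. -/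
def Below (r : ℕ) (L s : ℝ) : Prop := s ≤ L ∧ (s < L ∨ segStart P i r < s)

/-- What is dealt with by `inc P i L x` beyond `L` is in the interval from `L` to `L + x`. -/
theorem below_inc {L x s : ℝ} {r : ℕ} (hs' : segStart P i r ≤ s)
    (hs : s ≤ segEnd P i r) (h : Below P i r (inc P i L x) s) : Below P i r L s ∨ L ≤ s ∧ s ≤ L + x := by
  rcases lt_or_ge s L with h1 | h1
  · exact Or.inl ⟨h1.le, Or.inl h1⟩
  refine Or.inr ⟨h1, ?_⟩
  by_contra h2
  push Not at h2
  obtain ⟨h3, h4⟩ := h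
  rcases inc_cases P i L x with e | ⟨r', hr', h', -, e⟩
  · linarith
  · rw [e] at h3 h4
    rcases le_or_gt r r' with h5 | h5
    · linarith [P.segEnd_mono i h5]
    · have := P.segStart_mono i (show r' + 1 ≤ r by omega)
      rcases h4 with h4 | h4 <;> linarith

end Inc

/-- Remove a robot of type `τ`. -/
def drop {t : ℕ} (x : Fin t → ℕ) (τ : Fin t) : Fin t → ℕ := Function.update x τ (x τ - 1)

theorem sum_drop {t : ℕ} {x : Fin t → ℕ} {τ : Fin t} (h : x τ ≠ 0) :
    ∑ τ', drop x τ τ' + 1 = ∑ τ', x τ' := by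
  unfold drop
  rw [Finset.sum_update_of_mem (Finset.mem_univ τ),
    ← Finset.add_sum_erase _ _ (Finset.mem_univ τ), ← Finset.sdiff_singleton_eq_erase]
  omega

section Dp
variable {t : ℕ} (P : Perimeter) (i : ℕ) (cap : Fin t → ℝ)

theorem le_dp_iff {x : Fin t → ℕ} (hx : x ≠ 0) (B : ℝ) : B ≤ dp P i cap x ↔
    B ≤ 0 ∨ ∃ τ, x τ ≠ 0 ∧ B ≤ inc P i (dp P i cap (drop x τ)) (cap τ) := by
  obtain ⟨s, hs⟩ : ∃ s, ∑ τ, x τ = s + 1 := by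
    obtain ⟨τ, hτ⟩ := Function.ne_iff.1 hx
    have : x τ ≤ ∑ τ, x τ := Finset.single_le_sum (fun _ _ => Nat.zero_le _) (Finset.mem_univ τ)
    exact ⟨∑ τ, x τ - 1, by simp at hτ; omega⟩
  unfold dp
  rw [hs, dpAux, Finset.le_fold_max]
  refine or_congr Iff.rfl (exists_congr fun τ => ?_)
  simp only [Finset.mem_filter, Finset.mem_univ, true_and]
  refine and_congr_right fun h => ?_
  have := sum_drop h
  rw [show ∑ τ', drop x τ τ' = s by omega]
  rfl

theorem dp_zero : dp P i cap 0 = 0 := by simp [dp, dpAux]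

theorem dp_nonneg (x : Fin t → ℕ) : 0 ≤ dp P i cap x := by
  by_cases hx : x = 0
  · rw [hx, dp_zero]
  · exact (le_dp_iff P i cap hx 0).2 (Or.inl le_rfl)

theorem inc_dp_le {x : Fin t → ℕ} {τ : Fin t} (h : x τ ≠ 0) :
    inc P i (dp P i cap (drop x τ)) (cap τ) ≤ dp P i cap x :=
  (le_dp_iff P i cap (fun h0 => h (by rw [h0]; rfl)) _).2 (Or.inr ⟨τ, h, le_rfl⟩)

theorem dp_drop_add_le {x : Fin t → ℕ} {τ : Fin t} (h : x τ ≠ 0) :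
    dp P i cap (drop x τ) + cap τ ≤ dp P i cap x :=
  (add_le_inc P i _ _).trans (inc_dp_le P i cap h)

variable {cap} (hcap : ∀ τ, 0 ≤ cap τ)
include hcap

theorem exists_dp_eq {x : Fin t → ℕ} (hx : x ≠ 0) :
    ∃ τ, x τ ≠ 0 ∧ dp P i cap x = inc P i (dp P i cap (drop x τ)) (cap τ) := by
  rcases (le_dp_iff P i cap hx (dp P i cap x)).1 le_rfl with h | ⟨τ, h, h'⟩
  · obtain ⟨τ, hτ⟩ := Function.ne_iff.1 hx
    refine ⟨τ, hτ, le_antisymm (h.trans ?_) (inc_dp_le P i cap hτ)⟩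
    exact (add_nonneg (dp_nonneg P i cap _) (hcap τ)).trans (add_le_inc P i _ _)
  · exact ⟨τ, h, le_antisymm h' (inc_dp_le P i cap h)⟩

theorem dp_mono {x y : Fin t → ℕ} (h : x ≤ y) : dp P i cap x ≤ dp P i cap y := by
  obtain ⟨s, hs⟩ : ∃ s, ∑ τ, y τ = s := ⟨_, rfl⟩
  induction s generalizing y with
  | zero =>
    have hy : y = 0 := by
      ext τ
      have := (Finset.sum_eq_zero_iff.1 hs) τ (Finset.mem_univ τ)
      simpa using this
    have hx : x = 0 := le_antisymm (hy ▸ h) (fun τ => Nat.zero_le _)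
    rw [hx, hy]
  | succ s ih =>
    by_cases hxy : x = y
    · rw [hxy]
    obtain ⟨τ, hτ⟩ := Function.ne_iff.1 hxy
    have hlt : x τ < y τ := lt_of_le_of_ne (h τ) hτ
    have hy0 : y τ ≠ 0 := by omega
    have h1 : x ≤ drop y τ := fun τ' => by
      unfold drop
      by_cases e : τ' = τ
      · subst e; simp; omega
      · simpa [e] using h τ'
    have := ih h1 (by have := sum_drop hy0; omega)
    linarith [dp_drop_add_le P i cap hy0, hcap τ]

/-- The robots together deal with at least the sum of their capacities. -/
theorem sum_cap_le_dp (x : Fin t → ℕ) : ∑ τ, x τ * cap τ ≤ dp P i cap x := by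
  obtain ⟨s, hs⟩ : ∃ s, ∑ τ, x τ = s := ⟨_, rfl⟩
  induction s generalizing x with
  | zero =>
    have : ∀ τ, x τ = 0 := fun τ => Finset.sum_eq_zero_iff.1 hs τ (Finset.mem_univ τ)
    simp only [this, Nat.cast_zero, zero_mul, Finset.sum_const_zero]
    exact dp_nonneg P i cap x
  | succ s ih =>
    have hx : x ≠ 0 := by rintro rfl; simp at hs
    obtain ⟨τ, hτ⟩ := Function.ne_iff.1 hx
    have hτ' : x τ ≠ 0 := hτ
    refine le_trans ?_ (dp_drop_add_le P i cap hτ')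
    have h1 := ih (drop x τ) (by have := sum_drop hτ'; omega)
    refine le_trans (le_of_eq ?_) (add_le_add_left h1 _)
    rw [← Finset.add_sum_erase _ _ (Finset.mem_univ τ),
      ← Finset.add_sum_erase _ (fun τ' => (drop x τ τ' : ℝ) * cap τ') (Finset.mem_univ τ)]
    have h2 : ∑ τ' ∈ Finset.univ.erase τ, (drop x τ τ' : ℝ) * cap τ' =
        ∑ τ' ∈ Finset.univ.erase τ, (x τ' : ℝ) * cap τ' := by
      refine Finset.sum_congr rfl fun τ' h' => ?_
      rw [drop, Function.update_of_ne (Finset.ne_of_mem_erase h')]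
    rw [h2, drop, Function.update_self, Nat.cast_sub (by omega)]
    push_cast; ring

theorem segStart_le_dp {x : Fin t → ℕ} {r : ℕ} (hr : r < P.q) (h : segEnd P i r ≤ dp P i cap x) :
    segStart P i (r + 1) ≤ dp P i cap x := by
  by_cases hx : x = 0
  · rw [hx, dp_zero] at h
    exact absurd h (not_le.2 (P.segEnd_pos i r))
  · obtain ⟨τ, -, e⟩ := exists_dp_eq P i hcap hx
    rw [e] at h ⊢
    exact segStart_le_inc_of_segEnd_le P i hr h

/-- The number of elements of `J` of each type. -/
def tally {ι : Type*} (J : Finset ι) (τ : ι → Fin t) : Fin t → ℕ := fun τ' => (J.filter (τ · = τ')).card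

omit hcap in
theorem tally_erase {ι : Type*} [DecidableEq ι] {J : Finset ι} (τ : ι → Fin t) {j : ι} (hj : j ∈ J) :
    tally (J.erase j) τ = drop (tally J τ) (τ j) := by
  ext τ'
  unfold drop tally
  rw [Finset.filter_erase]
  by_cases e : τ' = τ j
  · subst e
    rw [Function.update_self, Finset.card_erase_of_mem (by simp [hj])]
  · rw [Function.update_of_ne e, Finset.erase_eq_of_notMem]
    simp [Ne.symm e]

omit hcap in
theorem tally_ne_zero {ι : Type*} {J : Finset ι} (τ : ι → Fin t) {j : ι} (hj : j ∈ J) :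
    tally J τ (τ j) ≠ 0 :=
  Finset.card_ne_zero_of_mem (Finset.mem_filter.2 ⟨hj, rfl⟩)

/-- Intervals that cover the segments up to `x` deal with `x`. -/
theorem le_dp_of_cover {ι : Type*} [DecidableEq ι] (τ : ι → Fin t) (lo hi : ι → ℝ)
    (J : Finset ι) (hlen : ∀ j ∈ J, hi j - lo j ≤ cap (τ j)) {r : ℕ} (hr : r < P.q) {x : ℝ}
    (hx : segStart P i r < x) (hx' : x ≤ segEnd P i r)
    (hc : ∀ r' < P.q, ∀ s, segStart P i r' ≤ s → s ≤ segEnd P i r' → s < x →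
      ∃ j ∈ J, lo j ≤ s ∧ s ≤ hi j) : x ≤ dp P i cap (tally J τ) := by
  obtain ⟨N, hN⟩ : ∃ N, J.card = N := ⟨_, rfl⟩
  induction N generalizing J r x with
  | zero =>
    rw [Finset.card_eq_zero] at hN
    obtain ⟨j, hj, -⟩ := hc r hr _ le_rfl (P.segStart_lt_segEnd i r).le hx
    simp [hN] at hj
  | succ N ih =>
    obtain ⟨j, hj, hlo, hhi⟩ : ∃ j ∈ J, lo j < x ∧ x ≤ hi j := by
      by_contra hcon
      push Not at hcon
      have h1 : ∀ᶠ s in nhdsWithin x (Set.Iio x), ∀ j ∈ J, ¬ (lo j ≤ s ∧ s ≤ hi j) := by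
        rw [Filter.eventually_all_finset]
        intro j hj
        rcases lt_or_ge (lo j) x with h | h
        · have := hcon j hj h
          filter_upwards [Ioo_mem_nhdsLT this] with s hs hs'
          linarith [hs.1]
        · filter_upwards [self_mem_nhdsWithin] with s hs hs'
          have : s < x := hs
          linarith
      obtain ⟨s, h2, h3⟩ := (h1.and (Ioo_mem_nhdsLT hx)).exists
      obtain ⟨j, hj, h4⟩ := hc r hr s h3.1.le (h3.2.le.trans hx') h3.2
      exact h2 j hj h4
    have hcov : ∀ l, l ≤ lo j → ∀ r' < P.q, ∀ s, segStart P i r' ≤ s → s ≤ segEnd P i r' → s < l →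
        ∃ j' ∈ J.erase j, lo j' ≤ s ∧ s ≤ hi j' := by
      intro l hl r' hr' s hs hs' hsl
      obtain ⟨j', hj', h⟩ := hc r' hr' s hs hs' (by linarith)
      refine ⟨j', Finset.mem_erase.2 ⟨?_, hj'⟩, h⟩
      rintro rfl
      linarith [h.1]
    have hcard : (J.erase j).card = N := by rw [Finset.card_erase_of_mem hj, hN]; rfl
    have hlen' : ∀ j' ∈ J.erase j, hi j' - lo j' ≤ cap (τ j') := fun j' h =>
      hlen j' (Finset.mem_of_mem_erase h)
    have key : lo j ≤ dp P i cap (tally (J.erase j) τ) := by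
      rcases le_or_gt (lo j) 0 with h0 | h0
      · exact h0.trans (dp_nonneg P i cap _)
      have hex : ∃ r', lo j ≤ segStart P i (r' + 1) :=
        ⟨r, hlo.le.trans (hx'.trans (P.segEnd_le_segStart i (Nat.lt_succ_self r)))⟩
      classical
      set r' := Nat.find hex with hr'
      have h1 : lo j ≤ segStart P i (r' + 1) := Nat.find_spec hex
      have h2 : segStart P i r' < lo j := by
        rcases Nat.eq_zero_or_pos r' with e | e
        · rw [e, P.segStart_zero]; exact h0
        · have := Nat.find_min hex (show r' - 1 < Nat.find hex by omega)
          rw [Nat.sub_add_cancel e] at this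
          exact not_le.1 this
      have h3 : r' < P.q := by
        by_contra h
        have := P.segStart_mono i (show r + 1 ≤ r' by omega)
        linarith [P.segEnd_le_segStart i (Nat.lt_succ_self r)]
      rcases le_or_gt (lo j) (segEnd P i r') with h4 | h4
      · exact ih (J.erase j) hlen' h3 h2 h4 (hcov _ le_rfl) hcard
      · have := ih (J.erase j) hlen' h3 (P.segStart_lt_segEnd i r') le_rfl
          (hcov _ h4.le) hcard
        exact h1.trans (segStart_le_dp P i hcap h3 this)
    rw [tally_erase τ hj] at key
    have := dp_drop_add_le P i cap (tally_ne_zero τ hj)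
    linarith [hlen j hj]

/-- The dynamic program, turned into intervals for the robots. -/
theorem exists_intervals {ι : Type*} [DecidableEq ι] (τ : ι → Fin t) {D : ℝ} (hD : 0 ≤ D)
    (J : Finset ι) : ∃ lo hi : ι → ℝ,
      (∀ j ∈ J, 0 ≤ lo j ∧ lo j ≤ hi j ∧ hi j ≤ D ∧ hi j ≤ dp P i cap (tally J τ) ∧
        hi j - lo j ≤ cap (τ j)) ∧
      (∀ j ∈ J, ∀ j' ∈ J, j ≠ j' → hi j ≤ lo j' ∨ hi j' ≤ lo j) ∧
      ∀ r < P.q, ∀ s, segStart P i r ≤ s → s ≤ segEnd P i r → s ≤ D →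
        Below P i r (dp P i cap (tally J τ)) s → ∃ j ∈ J, lo j ≤ s ∧ s ≤ hi j := by
  obtain ⟨N, hN⟩ : ∃ N, J.card = N := ⟨_, rfl⟩
  induction N generalizing J with
  | zero =>
    rw [Finset.card_eq_zero] at hN
    subst hN
    refine ⟨fun _ => 0, fun _ => 0, by simp, by simp, ?_⟩
    intro r hr s hs _ _ h
    have h0 : tally (∅ : Finset ι) τ = 0 := by ext; simp [tally]
    rw [h0, dp_zero] at h
    have h1 : 0 ≤ segStart P i r := P.segStart_zero i ▸ P.segStart_mono i (Nat.zero_le r)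
    obtain ⟨h2, h3 | h3⟩ := h <;> linarith
  | succ N ih =>
    have hne : tally J τ ≠ 0 := by
      obtain ⟨j, hj⟩ := Finset.card_pos.1 (by omega : 0 < J.card)
      exact fun h => tally_ne_zero τ hj (by rw [h]; rfl)
    obtain ⟨τ', h0, he⟩ := exists_dp_eq P i hcap hne
    obtain ⟨j, hj⟩ := Finset.card_ne_zero.1 h0
    rw [Finset.mem_filter] at hj
    obtain ⟨hj, rfl⟩ := hj
    rw [← tally_erase τ hj] at he
    obtain ⟨lo, hi, h1, h2, h3⟩ := ih (J.erase j) (by rw [Finset.card_erase_of_mem hj, hN]; rfl)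
    have hnn := dp_nonneg P i cap (tally (J.erase j) τ)
    have hle : dp P i cap (tally (J.erase j) τ) + cap (τ j) ≤ dp P i cap (tally J τ) :=
      he ▸ add_le_inc P i _ _
    set L := dp P i cap (tally (J.erase j) τ) with hL
    have hcj := hcap (τ j)
    have hne' : ∀ j' ∈ J, j' ≠ j → j' ∈ J.erase j := fun j' h h' => Finset.mem_erase.2 ⟨h', h⟩
    refine ⟨Function.update lo j (min L D), Function.update hi j (min (L + cap (τ j)) D), ?_, ?_, ?_⟩
    · intro j' hj'
      by_cases e : j' = j
      · subst e
        simp only [Function.update_self]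
        refine ⟨le_min hnn hD, min_le_min_right _ (by linarith), min_le_right _ _,
          (min_le_left _ _).trans hle, ?_⟩
        rcases min_cases L D with h | h <;> rcases min_cases (L + cap (τ j')) D with h' | h' <;>
          linarith
      · simp only [Function.update_of_ne e]
        obtain ⟨a1, a2, a3, a4, a5⟩ := h1 j' (hne' j' hj' e)
        exact ⟨a1, a2, a3, by linarith, a5⟩
    · intro j₁ hj₁ j₂ hj₂ hne₁₂
      by_cases e₁ : j₁ = j
      · subst e₁
        have e₂ : j₂ ≠ j₁ := hne₁₂.symm
        simp only [Function.update_self, Function.update_of_ne e₂]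
        obtain ⟨a1, a2, a3, a4, a5⟩ := h1 j₂ (hne' j₂ hj₂ e₂)
        exact Or.inr (le_min a4 a3)
      · by_cases e₂ : j₂ = j
        · subst e₂
          simp only [Function.update_self, Function.update_of_ne e₁]
          obtain ⟨a1, a2, a3, a4, a5⟩ := h1 j₁ (hne' j₁ hj₁ e₁)
          exact Or.inl (le_min a4 a3)
        · simp only [Function.update_of_ne e₁, Function.update_of_ne e₂]
          exact h2 _ (hne' _ hj₁ e₁) _ (hne' _ hj₂ e₂) hne₁₂
    · intro r hr s hs hs' hsD hb
      rw [he] at hb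
      rcases below_inc P i hs hs' hb with h | ⟨h, h'⟩
      · obtain ⟨j', hj', h4⟩ := h3 r hr s hs hs' hsD h
        refine ⟨j', Finset.mem_of_mem_erase hj', ?_⟩
        simpa only [Function.update_of_ne (Finset.ne_of_mem_erase hj')] using h4
      · refine ⟨j, hj, ?_⟩
        simp only [Function.update_self]
        exact ⟨(min_le_left _ _).trans h, le_min h' hsD⟩

end Dp

/-! ### Covers and the dynamic program -/

/-- The boundary distance from the start of the first segment, for a point at distance `s` from the
start of segment `i`. -/
def startDist (P : Perimeter) (i : ℕ) (s : ℝ) : ℝ :=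
  if P.total ≤ segStart P 0 i + s then segStart P 0 i + s - P.total else segStart P 0 i + s

section Single
variable {t : ℕ} (P : Perimeter) {cap : Fin t → ℝ}

/-- A boundary point that is not guarded lies in a gap. -/
theorem exists_gap_of_notMem {θ₀ : ℝ} (h : P.toRegion.pt θ₀ ∉ P.guarded) :
    ∃ i < P.q, ∃ θ, P.toRegion.pt θ = P.toRegion.pt θ₀ ∧ θ < P.lft i ∧
      P.rgt (i + (P.q - 1)) < θ + 2 * Real.pi := by
  have hq := P.q_pos
  have h0 : P.toRegion.pt θ₀ ∈ P.toRegion.arc (P.lft 0) (P.lft 0 + 2 * Real.pi) := by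
    rw [← P.toRegion.boundary_eq_arc]; exact ⟨_, rfl⟩
  obtain ⟨θ, ⟨hθ1, hθ2⟩, hθ⟩ := h0
  have hng : ∀ r < P.q, ¬ (P.lft r ≤ θ ∧ θ ≤ P.rgt r) := by
    intro r hr hc
    apply h
    rw [← hθ, P.guarded_eq 0]
    simp only [Set.mem_iUnion, Finset.mem_range, exists_prop, zero_add]
    exact ⟨r, hr, θ, hc, rfl⟩
  have hθ3 : θ ≠ P.lft 0 + 2 * Real.pi := by
    intro e
    apply h
    rw [← hθ, P.guarded_eq 0, e, Region.pt_add_two_pi]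
    simp only [Set.mem_iUnion, Finset.mem_range, exists_prop, zero_add]
    exact ⟨0, hq, _, ⟨le_rfl, (P.lft_lt_rgt 0).le⟩, rfl⟩
  have hex : ∃ r, θ < P.lft (r + 1) := by
    refine ⟨P.q - 1, ?_⟩
    rw [Nat.sub_add_cancel hq]
    have := P.lft_add_q 0
    rw [zero_add] at this
    rw [this]
    exact lt_of_le_of_ne hθ2 hθ3
  classical
  set r := Nat.find hex with hr
  have h1 : θ < P.lft (r + 1) := Nat.find_spec hex
  have h2 : P.lft r ≤ θ := by
    rcases Nat.eq_zero_or_pos r with e | e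
    · rw [e]; exact hθ1
    · have := Nat.find_min hex (show r - 1 < Nat.find hex by omega)
      rw [Nat.sub_add_cancel e] at this
      exact not_lt.1 this
  have h3 : r < P.q := by
    have : r ≤ P.q - 1 := by
      apply Nat.find_min' hex
      rw [Nat.sub_add_cancel hq]
      have := P.lft_add_q 0
      rw [zero_add] at this
      rw [this]
      exact lt_of_le_of_ne hθ2 hθ3
    omega
  have h4 : P.rgt r < θ := by
    by_contra hc
    exact hng r h3 ⟨h2, not_lt.1 hc⟩
  by_cases h5 : r + 1 < P.q
  · refine ⟨r + 1, h5, θ, hθ, h1, ?_⟩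
    rw [show r + 1 + (P.q - 1) = r + P.q by omega, P.rgt_add_q]
    linarith
  · have e : r + 1 = 0 + P.q := by omega
    refine ⟨0, hq, θ - 2 * Real.pi, ?_, ?_, ?_⟩
    · rw [← hθ, ← P.toRegion.pt_add_two_pi (θ - 2 * Real.pi), sub_add_cancel]
    · rw [e, P.lft_add_q] at h1; linarith
    · rw [show 0 + (P.q - 1) = r by omega]; linarith

/-- Arcs that cover the guarded part can be rearranged as in the dynamic program. -/
theorem exists_le_dp_of_arcs (hcap : ∀ τ, 0 ≤ cap τ) {ι : Type*} [DecidableEq ι] (J : Finset ι)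
    (τ : ι → Fin t) (u v : ι → ℝ) (huv : ∀ j, u j ≤ v j) (hv : ∀ j, v j ≤ u j + 2 * Real.pi)
    (hlen : ∀ j ∈ J, len (P.toRegion.arc (u j) (v j)) ≤ cap (τ j))
    (hcov : P.guarded ⊆ ⋃ j ∈ J, P.toRegion.arc (u j) (v j)) :
    ∃ i < P.q, segEnd P i (P.q - 1) ≤ dp P i cap (tally J τ) := by
  have hq := P.q_pos
  have hp := two_pi_pos'
  by_cases hall : P.toRegion.boundary ⊆ ⋃ j ∈ J, P.toRegion.arc (u j) (v j)
  · refine ⟨0, hq, (P.segEnd_le_total 0 _ (by omega)).trans ?_⟩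
    refine le_trans ?_ (sum_cap_le_dp P 0 hcap _)
    have h1 : P.total ≤ ∑ j ∈ J, len (P.toRegion.arc (u j) (v j)) := by
      unfold Perimeter.total len
      rw [← ENNReal.toReal_sum fun j _ => P.arc_ne_top _ _]
      refine ENNReal.toReal_mono (ENNReal.sum_ne_top.2 fun j _ => P.arc_ne_top _ _) ?_
      exact (measure_mono hall).trans (measure_biUnion_finset_le J _)
    refine h1.trans ((Finset.sum_le_sum hlen).trans (le_of_eq ?_))
    rw [← Finset.sum_fiberwise J τ]
    refine Finset.sum_congr rfl fun τ' _ => ?_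
    rw [Finset.sum_congr rfl fun j hj => by rw [(Finset.mem_filter.1 hj).2]]
    simp [tally]
  · obtain ⟨_, ⟨θ₀, rfl⟩, hx⟩ := Set.not_subset.1 hall
    obtain ⟨i, hi, θ, hθ, h1, h2⟩ := exists_gap_of_notMem P fun h => hx (hcov h)
    refine ⟨i, hi, ?_⟩
    rw [← hθ] at hx
    simp only [Set.mem_iUnion, exists_prop, not_exists, not_and] at hx
    set k : ι → ℤ := fun j => -toIcoDiv hp θ (u j)
    have hk : ∀ j, θ ≤ u j + 2 * Real.pi * k j ∧ u j + 2 * Real.pi * k j < θ + 2 * Real.pi := by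
      intro j
      have h3 := toIcoMod_mem_Ico hp θ (u j)
      have h4 := self_sub_toIcoDiv_zsmul hp θ (u j)
      rw [zsmul_eq_mul] at h4
      have h5 : u j + 2 * Real.pi * k j = toIcoMod hp θ (u j) := by
        rw [← h4]; push_cast [k]; ring
      rw [h5]; exact h3
    have hlift : ∀ j ∈ J, θ < u j + 2 * Real.pi * k j ∧
        v j + 2 * Real.pi * k j < θ + 2 * Real.pi := by
      intro j hj
      have h3 := hx j hj
      rw [← P.toRegion.arc_add_int (u j) (v j) (k j)] at h3
      constructor
      · refine lt_of_le_of_ne (hk j).1 fun e => h3 ⟨θ, ⟨e.ge, ?_⟩, rfl⟩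
        rw [e]; linarith [huv j]
      · by_contra hc
        refine h3 ⟨θ + 2 * Real.pi, ⟨(hk j).2.le, not_lt.1 hc⟩, P.toRegion.pt_add_two_pi θ⟩
    have hd := P.dist_strictMono.monotone
    refine le_dp_of_cover P i hcap τ (fun j => P.dist (u j + 2 * Real.pi * k j) - P.st i)
      (fun j => P.dist (v j + 2 * Real.pi * k j) - P.st i) J ?_ (r := P.q - 1) (by omega)
      (P.segStart_lt_segEnd i _) le_rfl ?_
    · intro j hj
      have h3 := hlen j hj
      rw [← P.toRegion.arc_add_int (u j) (v j) (k j),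
        P.dist_sub (by linarith [huv j]) (by linarith [hv j])] at h3
      linarith
    · intro r hr s hs hs' _
      rw [P.segStart_eq] at hs
      rw [P.segEnd_eq] at hs'
      obtain ⟨φ, hφ, e⟩ := intermediate_value_Icc (P.lft_lt_rgt (i + r)).le
        P.dist_continuous.continuousOn
        (show P.st i + s ∈ Set.Icc (P.dist (P.lft (i + r))) (P.dist (P.rgt (i + r))) from
          ⟨by rw [← Perimeter.st]; linarith, by rw [← Perimeter.en]; linarith⟩)
      have hg : P.toRegion.pt φ ∈ P.guarded := by
        rw [P.guarded_eq i]
        simp only [Set.mem_iUnion, Finset.mem_range, exists_prop]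
        exact ⟨r, hr, φ, hφ, rfl⟩
      have hg' := hcov hg
      simp only [Set.mem_iUnion, exists_prop] at hg'
      obtain ⟨j, hj, hm⟩ := hg'
      rw [← P.toRegion.arc_add_int (u j) (v j) (k j)] at hm
      obtain ⟨φ', hφ', he⟩ := hm
      have h3 := hlift j hj
      have h4 : P.lft i ≤ φ := (P.lft_mono (by omega)).trans hφ.1
      have h5 : φ ≤ P.rgt (i + (P.q - 1)) := by
        refine hφ.2.trans ?_
        rcases eq_or_lt_of_le (show r ≤ P.q - 1 by omega) with e | e
        · rw [e]
        · exact (P.rgt_le_lft_succ _).trans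
            ((P.lft_mono (by omega)).trans (P.lft_lt_rgt (i + (P.q - 1))).le)
      have h6 := P.toRegion.pt_inj he (by linarith [hφ'.2]) (by linarith [hφ'.1])
      subst h6
      refine ⟨j, hj, ?_, ?_⟩
      · have := hd hφ'.1; linarith
      · have := hd hφ'.2; linarith

end Single

section Several
variable {m t : ℕ} (P : Fin m → Perimeter) (n : Fin t → ℕ)

/-- Intervals on the boundaries, measured from given segments, form a cover. -/
theorem exists_cover (hdisj : Pairwise fun k k' => Disjoint (P k).carrier (P k').carrier)
    (place : Robot n → Fin m) (i : Fin m → ℕ) (hi : ∀ k, i k < (P k).q) (lo hi' : Robot n → ℝ)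
    (h0 : ∀ j, 0 ≤ lo j) (hle : ∀ j, lo j ≤ hi' j)
    (hD : ∀ j, hi' j ≤ segEnd (P (place j)) (i (place j)) ((P (place j)).q - 1))
    (hno : ∀ j j', j ≠ j' → place j = place j' → hi' j ≤ lo j' ∨ hi' j' ≤ lo j)
    (hcov : ∀ k, ∀ r < (P k).q, ∀ s, segStart (P k) (i k) r ≤ s → s ≤ segEnd (P k) (i k) r →
      ∃ j, place j = k ∧ lo j ≤ s ∧ s ≤ hi' j) :
    ∃ c : Cover P n, c.place = place ∧ ∀ j, len (c.part j) = hi' j - lo j ∧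
      (P (place j)).left ⟨0, (P (place j)).q_pos⟩ ≤ c.u j ∧
      c.u j < (P (place j)).left ⟨0, (P (place j)).q_pos⟩ + 2 * Real.pi ∧
      len ((P (place j)).toRegion.arc ((P (place j)).left ⟨0, (P (place j)).q_pos⟩) (c.u j)) =
        startDist (P (place j)) (i (place j)) (lo j) := by
  have hp := two_pi_pos'
  have hmono : ∀ k, StrictMono (P k).dist := fun k => (P k).dist_strictMono
  have hDt : ∀ j, hi' j ≤ (P (place j)).total := fun j =>
    (hD j).trans ((P (place j)).segEnd_le_total _ _ (by have := (P (place j)).q_pos; omega))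
  choose x hx1 hx2 hx3 using fun j => (P (place j)).exists_dist_eq
    ((P (place j)).lft (i (place j))) (h0 j) ((hle j).trans (hDt j))
  choose y hy1 hy2 hy3 using fun j => (P (place j)).exists_dist_eq
    ((P (place j)).lft (i (place j))) ((h0 j).trans (hle j)) (hDt j)
  have hxy : ∀ j, x j ≤ y j := fun j => by
    rw [← (hmono (place j)).le_iff_le, hx3, hy3]; linarith [hle j]
  set o : Fin m → ℝ := fun k => (P k).left ⟨0, (P k).q_pos⟩ with ho
  have hol : ∀ k, (P k).lft 0 = o k := by
    intro k
    have h1 : (P k).idx 0 = ⟨0, (P k).q_pos⟩ := Fin.ext (Nat.zero_mod _)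
    simp [Perimeter.lft, h1, ho]
  have hlo : ∀ k, o k ≤ (P k).lft (i k) ∧ (P k).lft (i k) < o k + 2 * Real.pi := by
    intro k
    rw [← hol]
    refine ⟨(P k).lft_mono (Nat.zero_le _), ?_⟩
    have h1 := (P k).rgt_le 0 (i k) (hi k)
    rw [zero_add] at h1
    exact ((P k).lft_lt_rgt _).trans_le h1
  set w : Robot n → ℤ := fun j => if o (place j) + 2 * Real.pi ≤ x j then -1 else 0 with hw
  have hwr : ∀ j, o (place j) ≤ x j + 2 * Real.pi * w j ∧
      x j + 2 * Real.pi * w j < o (place j) + 2 * Real.pi := by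
    intro j
    have h1 := hlo (place j)
    have h2 := hx1 j
    have h3 := hx2 j
    by_cases h : o (place j) + 2 * Real.pi ≤ x j
    · simp only [hw, h, if_true]; push_cast; constructor <;> linarith
    · simp only [hw, h, if_false]; push_cast; constructor <;> linarith
  have hap : ∀ j, (P (place j)).toRegion.arc (x j + 2 * Real.pi * w j) (y j + 2 * Real.pi * w j) =
      (P (place j)).toRegion.arc (x j) (y j) := fun j => Region.arc_add_int _ _ _ _
  have hoap : ∀ j, (P (place j)).toRegion.openArc (x j + 2 * Real.pi * w j)
      (y j + 2 * Real.pi * w j) =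
      (P (place j)).toRegion.openArc (x j) (y j) := fun j => Region.openArc_add_int _ _ _ _
  have hlenarc : ∀ j, len ((P (place j)).toRegion.arc (x j) (y j)) = hi' j - lo j := fun j => by
    rw [(P (place j)).dist_sub (hxy j) (by linarith [hx1 j, hy2 j]), hx3, hy3]; ring
  refine ⟨⟨place, fun j => x j + 2 * Real.pi * w j, fun j => y j + 2 * Real.pi * w j,
    fun j => by linarith [hxy j], fun j => by linarith [hx1 j, hy2 j], ?_, ?_⟩, rfl, ?_⟩
  · refine Set.iUnion_subset fun k => ?_
    rw [(P k).guarded_eq (i k)]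
    refine Set.iUnion₂_subset fun r hr => ?_
    rw [Finset.mem_range] at hr
    rintro _ ⟨φ, hφ, rfl⟩
    have h1 := (hmono k).monotone hφ.1
    have h2 := (hmono k).monotone hφ.2
    obtain ⟨j, rfl, h3, h4⟩ := hcov k r hr ((P k).dist φ - (P k).st (i k))
      (by rw [(P k).segStart_eq]; unfold Perimeter.st at *; linarith)
      (by rw [(P k).segEnd_eq]; unfold Perimeter.en at *; linarith)
    refine Set.mem_iUnion.2 ⟨j, ?_⟩
    rw [hap]
    refine ⟨φ, ⟨?_, ?_⟩, rfl⟩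
    · rw [← (hmono (place j)).le_iff_le, hx3]; unfold Perimeter.st at *; linarith
    · rw [← (hmono (place j)).le_iff_le, hy3]; unfold Perimeter.st at *; linarith
  · intro j j' hne
    rw [hap, hoap]
    by_cases hpl : place j = place j'
    · rw [Set.disjoint_left]
      rintro _ ⟨φ, hφ, rfl⟩ ⟨φ', hφ', he⟩
      have a1 := hx1 j
      have a2 := hy2 j
      have a3 := hx1 j'
      have a4 := hy2 j'
      have b1 := hx3 j'
      have b2 := hy3 j'
      rw [← hpl] at he a3 a4 b1 b2
      have h6 := (P (place j)).toRegion.pt_inj he (by linarith [hφ'.2, hφ.1])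
        (by linarith [hφ'.1, hφ.2])
      subst h6
      have c1 := (hmono (place j)).lt_iff_lt.2 hφ.1
      have c2 := (hmono (place j)).lt_iff_lt.2 hφ.2
      have c3 := (hmono (place j)).monotone hφ'.1
      have c4 := (hmono (place j)).monotone hφ'.2
      rw [hx3] at c1
      rw [hy3] at c2
      rw [b1] at c3
      rw [b2] at c4
      rcases hno j j' hne hpl with h | h <;> linarith
    · refine (hdisj hpl).mono ?_ ?_
      · exact ((Set.image_mono Set.Ioo_subset_Icc_self).trans
          (Region.arc_subset_boundary _ _ _)).trans (Region.boundary_subset _)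
      · exact (Region.arc_subset_boundary _ _ _).trans (Region.boundary_subset _)
  · intro j
    refine ⟨?_, (hwr j).1, (hwr j).2, ?_⟩
    · rw [← hlenarc]; unfold Cover.part; simp only; rw [hap]
    · simp only
      have h1 : (P (place j)).dist (o (place j) + 2 * Real.pi) ≤ (P (place j)).dist (x j) ↔
        o (place j) + 2 * Real.pi ≤ x j := (hmono (place j)).le_iff_le
      have e0 : (P (place j)).st 0 = (P (place j)).dist (o (place j)) := by
        rw [Perimeter.st, hol]
      rw [(P (place j)).dist_sub (hwr j).1 (hwr j).2.le]
      unfold startDist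
      rw [(P (place j)).segStart_eq, zero_add, e0]
      rw [(P (place j)).dist_add_two_pi, hx3] at h1
      have h2 : (P (place j)).dist ((P (place j)).lft (i (place j))) =
        (P (place j)).st (i (place j)) := rfl
      rw [h2] at h1
      by_cases h : o (place j) + 2 * Real.pi ≤ x j
      · have h3 := h1.2 h
        rw [if_pos (by linarith)]
        have h4 := (P (place j)).dist_add_two_pi (x j + 2 * Real.pi * w j)
        have h5 : x j + 2 * Real.pi * w j + 2 * Real.pi = x j := by
          simp only [hw, h, if_true]; push_cast; ring
        rw [h5, hx3, h2] at h4
        linarith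
      · have h3 := mt h1.1 h
        rw [if_neg (by intro hc; exact h3 (by linarith))]
        have h5 : x j + 2 * Real.pi * w j = x j := by
          simp only [hw, h, if_false]; push_cast; ring
        rw [h5, hx3, h2]; ring

/-- The robots can be distributed over the perimeters so that each perimeter can be covered. -/
def Feas (cap : Fin t → ℝ) : Prop :=
  ∃ N : Fin m → Fin t → ℕ, (∀ τ, ∑ k, N k τ = n τ) ∧
    ∀ k, ∃ i < (P k).q, segEnd (P k) i ((P k).q - 1) ≤ dp (P k) i cap (N k)

/-- Every robot is counted at one place. -/
theorem sum_tally (place : Robot n → Fin m) (τ : Fin t) :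
    ∑ k, tally (Finset.univ.filter (place · = k)) (fun j : Robot n => j.1) τ = n τ := by
  unfold tally
  have h1 : ∀ k, ((Finset.univ.filter (place · = k)).filter (fun j : Robot n => j.1 = τ)) =
      ((Finset.univ.filter (fun j : Robot n => j.1 = τ)).filter (place · = k)) := fun k => by
    rw [Finset.filter_comm]
  simp only [h1]
  rw [← Finset.card_eq_sum_card_fiberwise (fun _ _ => Finset.mem_univ _)]
  rw [← Fintype.card_fin (n τ), ← Finset.card_univ]
  symm
  refine Finset.card_bij (fun r _ => ⟨τ, r⟩) (by simp) (by simp) ?_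
  rintro ⟨τ', r⟩ h
  simp only [Finset.mem_filter, Finset.mem_univ, true_and] at h
  obtain rfl : τ' = τ := h
  exact ⟨r, Finset.mem_univ _, rfl⟩

/-- Robots of given types, given the number of robots of each type at each place. -/
theorem exists_place (N : Fin m → Fin t → ℕ) (hN : ∀ τ, ∑ k, N k τ = n τ) :
    ∃ place : Robot n → Fin m, ∀ k,
      tally (Finset.univ.filter (place · = k)) (fun j : Robot n => j.1) = N k := by
  refine ⟨fun j => (finSigmaFinEquiv.symm (Fin.cast (hN j.1).symm j.2)).1, fun k => ?_⟩
  ext τ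
  unfold tally
  rw [Finset.filter_filter, ← Fintype.card_fin (N k τ), ← Finset.card_univ]
  symm
  refine Finset.card_bij (fun r _ => ⟨τ, Fin.cast (hN τ) (finSigmaFinEquiv ⟨k, r⟩)⟩) ?_ ?_ ?_
  · intro r _; simp
  · intro r _ r' _ h
    simpa using h
  · rintro ⟨τ', r⟩ h
    simp only [Finset.mem_filter, Finset.mem_univ, true_and] at h
    obtain ⟨h1, h2⟩ := h
    obtain rfl : τ' = τ := h2
    subst h1
    exact ⟨(finSigmaFinEquiv.symm (Fin.cast (hN τ').symm r)).2, Finset.mem_univ _, by simp⟩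

variable {P n} {cap : Fin t → ℝ}

theorem dopg_iff (hdisj : Pairwise fun k k' => Disjoint (P k).carrier (P k').carrier)
    (hcap : ∀ τ, 0 ≤ cap τ) : DOPG P n cap ↔ Feas P n cap := by
  classical
  constructor
  · rintro ⟨c, hc⟩
    refine ⟨fun k => tally (Finset.univ.filter (c.place · = k)) (fun j : Robot n => j.1), ?_, ?_⟩
    · exact sum_tally n c.place
    · intro k
      refine exists_le_dp_of_arcs (P k) hcap _ (fun j : Robot n => j.1) c.u c.v c.u_le_v c.v_le ?_ ?_
      · intro j hj
        have := hc j
        rw [Finset.mem_filter] at hj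
        rw [Cover.part, hj.2] at this
        exact this
      · intro x hx
        have := c.covers (Set.mem_iUnion.2 ⟨k, hx⟩)
        obtain ⟨j, hj⟩ := Set.mem_iUnion.1 this
        have hk : c.place j = k := by
          by_contra hne
          refine Set.disjoint_left.1 (hdisj hne) (Region.boundary_subset _
            (Region.arc_subset_boundary _ _ _ hj)) ?_
          rw [(P k).guarded_eq 0] at hx
          simp only [Set.mem_iUnion] at hx
          obtain ⟨r, _, hx⟩ := hx
          exact Region.boundary_subset _ (Region.arc_subset_boundary _ _ _ hx)
        refine Set.mem_iUnion₂.2 ⟨j, by simp [hk], ?_⟩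
        rw [← hk]; exact hj
  · rintro ⟨N, hN, h⟩
    obtain ⟨place, hplace⟩ := exists_place n N hN
    choose i hi hdp using h
    have hJ := fun k => exists_intervals (P k) (i k) hcap (fun j : Robot n => j.1)
      ((P k).segEnd_pos (i k) ((P k).q - 1)).le (Finset.univ.filter (place · = k))
    choose lo hi' h1 h2 h3 using hJ
    simp only [hplace] at h1 h3
    have hmem : ∀ j, j ∈ Finset.univ.filter (place · = place j) := by simp
    obtain ⟨c, -, hc⟩ := exists_cover P n hdisj place i hi (fun j => lo (place j) j)
      (fun j => hi' (place j) j) (fun j => (h1 _ j (hmem j)).1) (fun j => (h1 _ j (hmem j)).2.1)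
      (fun j => (h1 _ j (hmem j)).2.2.1)
      (fun j j' hne hpl => by
        have := h2 (place j) j (hmem j) j' (by simp [hpl]) hne
        rwa [hpl] at this ⊢)
      (by
        intro k r hr s hs hs'
        have hsD : s ≤ segEnd (P k) (i k) ((P k).q - 1) :=
          hs'.trans ((P k).segEnd_mono (i k) (by omega))
        obtain ⟨j, hj, h⟩ := h3 k r hr s hs hs' hsD
          ⟨hsD.trans (hdp k), by
            rcases eq_or_lt_of_le hs with e | e
            · left
              have := (P k).segStart_lt_segEnd (i k) r
              have := (P k).segEnd_mono (i k) (show r ≤ (P k).q - 1 by omega)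
              linarith [hdp k]
            · exact Or.inr e⟩
        obtain rfl : place j = k := by simpa using hj
        exact ⟨j, rfl, h⟩)
    exact ⟨c, fun j => (hc j).1 ▸ (h1 _ j (hmem j)).2.2.2.2⟩

end Several

/-! ### The form of the optimum -/

theorem dpAux_comp {t : ℕ} (P : Perimeter) (i : ℕ) (cap : Fin t → ℝ) (ρ : Equiv.Perm (Fin t))
    (s : ℕ) (x : Fin t → ℕ) : dpAux P i (cap ∘ ρ) s (x ∘ ρ) = dpAux P i cap s x := by
  induction s generalizing x with
  | zero => rfl
  | succ s ih =>
    refine eq_of_forall_le_iff fun B => ?_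
    rw [dpAux, dpAux, Finset.le_fold_max, Finset.le_fold_max]
    refine or_congr Iff.rfl ?_
    simp only [Finset.mem_filter, Finset.mem_univ, true_and, Function.comp_apply]
    have h : ∀ τ v, Function.update (x ∘ ρ) τ v = Function.update x (ρ τ) v ∘ ρ := by
      intro τ v
      ext τ'
      simp [Function.update_apply, ρ.injective.eq_iff]
    simp only [h, ih]
    exact ρ.exists_congr_left.trans (by simp)

theorem dp_comp {t : ℕ} (P : Perimeter) (i : ℕ) (cap : Fin t → ℝ) (ρ : Equiv.Perm (Fin t))
    (x : Fin t → ℕ) : dp P i (cap ∘ ρ) (x ∘ ρ) = dp P i cap x := by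
  unfold dp
  rw [dpAux_comp]
  congr 1
  exact Equiv.sum_comp ρ x

theorem segStart_mod (P : Perimeter) (i r : ℕ) : segStart P (i % P.q) r = segStart P i r := by
  have h : ∀ r', P.idx (i % P.q + r') = P.idx (i + r') := fun r' => Fin.ext (by simp [Perimeter.idx])
  unfold segStart
  refine Finset.sum_congr rfl fun r' _ => ?_
  simp only [Perimeter.seg, Perimeter.gap, Perimeter.nextLeft, h]

theorem segEnd_mod (P : Perimeter) (i r : ℕ) : segEnd P (i % P.q) r = segEnd P i r := by
  have h : P.idx (i % P.q + r) = P.idx (i + r) := Fin.ext (by simp [Perimeter.idx])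
  unfold segEnd
  rw [segStart_mod]
  simp only [Perimeter.seg, h]

theorem dp_zero_cap {t : ℕ} (P : Perimeter) (i : ℕ) (x : Fin t → ℕ) :
    dp P i (fun _ => 0) x = 0 := by
  obtain ⟨s, hs⟩ : ∃ s, ∑ τ, x τ = s := ⟨_, rfl⟩
  induction s generalizing x with
  | zero => unfold dp; rw [hs]; rfl
  | succ s ih =>
    have hx : x ≠ 0 := by rintro rfl; simp at hs
    obtain ⟨τ, hτ, e⟩ := exists_dp_eq P i (cap := fun _ : Fin t => 0) (fun _ => le_rfl) hx
    rw [e, ih _ (by have := sum_drop hτ; omega)]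
    rcases inc_cases P i 0 0 with h | ⟨r, -, h, -⟩
    · rw [h, add_zero]
    · linarith [P.segEnd_pos i r]

section Candidates
variable {m t : ℕ} {P : Fin m → Perimeter} {n a : Fin t → ℕ}

theorem mem_candidates_iff {ℓ : ℝ} : ℓ ∈ candidates P n a ↔
    ∃ (k : Fin m) (i d : ℕ) (n' : Fin t → ℕ), i < (P k).q ∧ d < (P k).q ∧ (∀ τ, n' τ ≤ n τ) ∧
      0 < ∑ τ, a τ * n' τ ∧ ℓ = segEnd (P k) i d / ((∑ τ, a τ * n' τ : ℕ) : ℝ) := by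
  constructor
  · rintro ⟨k, i, i', n', h1, h2, rfl⟩
    have hd := Nat.mod_lt ((i' : ℕ) + (P k).q - i) (P k).q_pos
    exact ⟨k, i, _, n', i.2, hd, h1, h2, by rw [Perimeter.span, Perimeter.len_chain _ _ _ hd]⟩
  · rintro ⟨k, i, d, n', hi, hd, h1, h2, rfl⟩
    refine ⟨k, ⟨i, hi⟩, ⟨(i + d) % (P k).q, Nat.mod_lt _ (P k).q_pos⟩, n', h1, h2, ?_⟩
    have e : ((i + d) % (P k).q + (P k).q - i) % (P k).q = d := by
      rcases lt_or_ge (i + d) (P k).q with h | h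
      · rw [Nat.mod_eq_of_lt h, show i + d + (P k).q - i = d + (P k).q by omega, Nat.add_mod_right,
          Nat.mod_eq_of_lt hd]
      · rw [Nat.mod_eq_sub_mod h, Nat.mod_eq_of_lt (show i + d - (P k).q < (P k).q by omega),
          show i + d - (P k).q + (P k).q - i = d by omega, Nat.mod_eq_of_lt hd]
    rw [Perimeter.span]
    simp only
    rw [e, Perimeter.len_chain _ _ _ hd]

theorem candidates_pos {ℓ : ℝ} (h : ℓ ∈ candidates P n a) : 0 < ℓ := by
  obtain ⟨k, i, d, n', -, -, -, h2, rfl⟩ := mem_candidates_iff.1 h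
  have := (P k).segEnd_pos i d
  positivity

theorem candidates_finite : (candidates P n a).Finite := by
  have hfin : (Set.Iic n).Finite := Set.finite_Iic n
  refine ((Set.finite_univ (α := (k : Fin m) × Fin (P k).q × Fin (P k).q)).prod hfin).image
    (fun z => len ((P z.1.1).span z.1.2.1 z.1.2.2) / ((∑ τ, a τ * z.2 τ : ℕ) : ℝ)) |>.subset ?_
  rintro _ ⟨k, i, i', n', h1, h2, rfl⟩
  exact ⟨⟨⟨k, i, i'⟩, n'⟩, ⟨Set.mem_univ _, h1⟩, rfl⟩

/-- Rounding the ratio down to a candidate does not change feasibility. -/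
theorem segEnd_le_dp_of_candidates {k : Fin m} {i : ℕ} {ℓ c : ℝ}
    (hc : 0 ≤ c) (hcℓ : c ≤ ℓ) (hcand : ∀ x ∈ candidates P n a, x ≤ ℓ → x ≤ c) {x : Fin t → ℕ}
    (hx : x ≤ n) (h : segEnd (P k) i ((P k).q - 1) ≤ dp (P k) i (fun τ => a τ * ℓ) x) :
    segEnd (P k) i ((P k).q - 1) ≤ dp (P k) i (fun τ => a τ * c) x := by
  have hcap : ∀ τ, 0 ≤ (a τ : ℝ) * ℓ := fun τ => mul_nonneg (Nat.cast_nonneg _) (hc.trans hcℓ)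
  have hcap' : ∀ τ, 0 ≤ (a τ : ℝ) * c := fun τ => mul_nonneg (Nat.cast_nonneg _) hc
  have hround : ∀ r r' (y : Fin t → ℕ), y ≤ n → r ≤ r' → r' < (P k).q →
      segEnd (P k) i r' ≤ segStart (P k) i r + ℓ * (∑ τ, a τ * y τ : ℕ) →
      segEnd (P k) i r' ≤ segStart (P k) i r + c * (∑ τ, a τ * y τ : ℕ) := by
    intro r r' y hy hr hr' h
    have h1 : segEnd (P k) (i + r) (r' - r) = segEnd (P k) i r' - segStart (P k) i r := by
      rw [Perimeter.segEnd_eq, Perimeter.segEnd_eq, Perimeter.segStart_eq,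
        show i + r + (r' - r) = i + r' by omega]; ring
    have h2 := (P k).segEnd_pos (i + r) (r' - r)
    have hpos : 0 < ∑ τ, a τ * y τ := by
      by_contra h0
      rw [show ∑ τ, a τ * y τ = 0 by omega] at h
      simp at h
      linarith
    have hpos' : (0 : ℝ) < (∑ τ, a τ * y τ : ℕ) := by exact_mod_cast hpos
    have h3 := hcand _ (mem_candidates_iff.2 ⟨k, (i + r) % (P k).q, r' - r, y,
      Nat.mod_lt _ (P k).q_pos, by omega, hy, hpos, rfl⟩)
    rw [segEnd_mod, h1, div_le_iff₀ hpos', div_le_iff₀ hpos'] at h3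
    linarith [h3 (by linarith)]
  have key : ∀ s (x : Fin t → ℕ), ∑ τ, x τ = s → x ≤ n → ∃ r ≤ (P k).q, ∃ y ≤ x,
      dp (P k) i (fun τ => a τ * ℓ) x ≤ segStart (P k) i r + ℓ * (∑ τ, a τ * y τ : ℕ) ∧
      segStart (P k) i r + c * (∑ τ, a τ * y τ : ℕ) ≤ dp (P k) i (fun τ => a τ * c) x := by
    intro s
    induction s with
    | zero =>
      intro x hs hx
      have hx0 : x = 0 := by
        ext τ; simpa using Finset.sum_eq_zero_iff.1 hs τ (Finset.mem_univ τ)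
      subst hx0
      refine ⟨0, Nat.zero_le _, 0, le_rfl, ?_⟩
      simp [dp_zero, Perimeter.segStart_zero]
    | succ s ih =>
      intro x hs hx
      have hx0 : x ≠ 0 := by rintro rfl; simp at hs
      obtain ⟨τ, hτ, e⟩ := exists_dp_eq (P k) i hcap hx0
      have hdx : drop x τ ≤ x := fun τ' => by
        unfold drop; by_cases h : τ' = τ
        · subst h; simp
        · simp [h]
      obtain ⟨r, hr, y, hy, h1, h2⟩ := ih (drop x τ) (by have := sum_drop hτ; omega)
        (hdx.trans hx)
      set y' : Fin t → ℕ := Function.update y τ (y τ + 1) with hy'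
      have hy'x : y' ≤ x := fun τ' => by
        by_cases h : τ' = τ
        · subst h
          have := hy τ'
          simp only [drop, Function.update_self] at this
          simp only [hy', Function.update_self]; omega
        · have := hy τ'
          simp only [drop, Function.update_of_ne h] at this
          simpa only [hy', Function.update_of_ne h] using this
      have hsum : ∑ τ', a τ' * y' τ' = ∑ τ', a τ' * y τ' + a τ := by
        rw [← Finset.add_sum_erase _ _ (Finset.mem_univ τ),
          ← Finset.add_sum_erase _ (fun τ' => a τ' * y τ') (Finset.mem_univ τ)]
        rw [Finset.sum_congr rfl fun τ' h' => by
          rw [hy', Function.update_of_ne (Finset.ne_of_mem_erase h')]]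
        simp only [hy', Function.update_self]; ring
      have hdpc := inc_dp_le (P k) i (fun τ => (a τ : ℝ) * c) hτ
      have hA : dp (P k) i (fun τ => a τ * ℓ) (drop x τ) + a τ * ℓ ≤
          segStart (P k) i r + ℓ * (∑ τ, a τ * y' τ : ℕ) := by
        rw [hsum]; push_cast at h1 ⊢; linarith
      have hB : segStart (P k) i r + c * (∑ τ, a τ * y' τ : ℕ) ≤
          dp (P k) i (fun τ => a τ * c) (drop x τ) + a τ * c := by
        rw [hsum]; push_cast at h2 ⊢; linarith
      have hB' := hB.trans ((add_le_inc (P k) i _ _).trans hdpc)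
      rcases inc_cases (P k) i (dp (P k) i (fun τ => a τ * ℓ) (drop x τ)) (a τ * ℓ) with
        h3 | ⟨r', hr', h4, h5, h3⟩
      · exact ⟨r, hr, y', hy'x, by rw [e, h3]; exact hA, hB'⟩
      · rcases lt_or_ge r' r with h6 | h6
        · refine ⟨r, hr, y', hy'x, ?_, hB'⟩
          rw [e, h3]
          have := (P k).segStart_mono i (show r' + 1 ≤ r by omega)
          have : 0 ≤ ℓ * (∑ τ, a τ * y' τ : ℕ) := mul_nonneg (hc.trans hcℓ) (Nat.cast_nonneg _)
          linarith
        · refine ⟨r' + 1, hr', 0, fun _ => Nat.zero_le _, by rw [e, h3]; simp, ?_⟩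
          have h7 := hround r r' y' (hy'x.trans hx) h6 hr' (h4.trans hA)
          have h8 := segStart_le_inc (P k) i hr' (h7.trans hB)
          simpa using h8.trans hdpc
  obtain ⟨r, hr, y, hy, h1, h2⟩ := key _ x rfl hx
  rcases eq_or_lt_of_le hr with e | e
  · have h3 := (P k).segEnd_le_segStart i (show (P k).q - 1 < r by have := (P k).q_pos; omega)
    have : 0 ≤ c * (∑ τ, a τ * y τ : ℕ) := mul_nonneg hc (Nat.cast_nonneg _)
    linarith
  · exact (hround r ((P k).q - 1) y (hy.trans hx) (by omega) (by omega) (h.trans h1)).trans h2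

theorem exists_candidate_le (hm : 1 ≤ m) {ℓ : ℝ} (hℓ : 0 ≤ ℓ)
    (h : Feas P n fun τ => a τ * ℓ) :
    ∃ c ∈ candidates P n a, c ≤ ℓ ∧ Feas P n fun τ => a τ * c := by
  obtain ⟨N, hN, hk⟩ := h
  have hNn : ∀ k, N k ≤ n := fun k τ => by
    rw [← hN τ]; exact Finset.single_le_sum (f := fun k => N k τ) (fun _ _ => Nat.zero_le _) (Finset.mem_univ k)
  have main : ∀ c, 0 ≤ c → c ≤ ℓ → (∀ x ∈ candidates P n a, x ≤ ℓ → x ≤ c) →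
      Feas P n fun τ => a τ * c := fun c hc hcℓ hcand =>
    ⟨N, hN, fun k => by
      obtain ⟨i, hi, h⟩ := hk k
      exact ⟨i, hi, segEnd_le_dp_of_candidates hc hcℓ hcand (hNn k) h⟩⟩
  have hfin : (candidates P n a ∩ Set.Iic ℓ).Finite := candidates_finite.inter_of_left _
  by_cases hne : (candidates P n a ∩ Set.Iic ℓ).Nonempty
  · obtain ⟨c, ⟨hc1, hc2⟩, hmax⟩ := Set.exists_max_image _ id hfin hne
    exact ⟨c, hc1, hc2, main c (candidates_pos hc1).le hc2 fun x hx hxℓ => hmax x ⟨hx, hxℓ⟩⟩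
  · obtain ⟨N', -, h⟩ := main 0 le_rfl hℓ fun x hx hxℓ => absurd ⟨x, hx, hxℓ⟩ hne
    obtain ⟨i, -, h⟩ := h ⟨0, hm⟩
    simp only [mul_zero] at h
    rw [dp_zero_cap] at h
    exact absurd h (not_le.2 (Perimeter.segEnd_pos _ _ _))

theorem feas_of_large (ha : ∀ τ, 0 < a τ) (hm : 1 ≤ m) (hmn : m ≤ ∑ τ, n τ) {ℓ : ℝ}
    (hℓ : ∀ k, (P k).total ≤ ℓ) (hℓ0 : 0 ≤ ℓ) : Feas P n fun τ => a τ * ℓ := by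
  classical
  have hcard : Fintype.card (Fin m) ≤ Fintype.card (Robot n) := by simpa using hmn
  obtain ⟨f⟩ := Function.Embedding.nonempty_of_card_le hcard
  have : Nonempty (Fin m) := ⟨⟨0, hm⟩⟩
  set place : Robot n → Fin m := Function.invFun f with hplace
  refine ⟨fun k => tally (Finset.univ.filter (place · = k)) (fun j : Robot n => j.1), ?_, ?_⟩
  · exact sum_tally n place
  · intro k
    refine ⟨0, (P k).q_pos, ?_⟩
    refine ((P k).segEnd_le_total 0 _ (by have := (P k).q_pos; omega)).trans ((hℓ k).trans ?_)
    have hcap : ∀ τ, 0 ≤ (a τ : ℝ) * ℓ := fun τ => mul_nonneg (Nat.cast_nonneg _) hℓ0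
    refine le_trans ?_ (sum_cap_le_dp (P k) 0 hcap _)
    have hj : place (f k) = k := Function.leftInverse_invFun f.injective k
    have h1 := tally_ne_zero (J := Finset.univ.filter (place · = k)) (fun j : Robot n => j.1)
      (j := f k) (by simp [hj])
    refine le_trans ?_ (Finset.single_le_sum (fun τ _ => mul_nonneg (Nat.cast_nonneg _) (hcap τ))
      (Finset.mem_univ (f k).1))
    have h2 : (1 : ℝ) ≤ (tally (Finset.univ.filter (place · = k)) (fun j : Robot n => j.1)
      (f k).1 : ℕ) := by exact_mod_cast Nat.one_le_iff_ne_zero.2 h1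
    have h3 : (1 : ℝ) ≤ a (f k).1 := by exact_mod_cast ha _
    have h4 : ℓ ≤ a (f k).1 * ℓ := le_mul_of_one_le_left hℓ0 h3
    exact h4.trans (le_mul_of_one_le_left (hcap _) h2)

theorem dopg_mono {x y : ℝ} (hxy : x ≤ y) (h : DOPG P n fun τ => (a τ : ℝ) * x) :
    DOPG P n fun τ => (a τ : ℝ) * y := by
  obtain ⟨c, hc⟩ := h
  exact ⟨c, fun j => (hc j).trans (mul_le_mul_of_nonneg_left hxy (Nat.cast_nonneg _))⟩

theorem len_part_le (ha : ∀ τ, 0 < a τ) (c : Cover P n) (j : Robot n) :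
    len (c.part j) ≤ a j.1 * c.ratio a := by
  have h1 : (0 : ℝ) < a j.1 := by exact_mod_cast ha _
  rw [← div_le_iff₀' h1]
  exact le_ciSup (f := fun j : Robot n => len (c.part j) / (a j.1 : ℝ)) (Set.finite_range _).bddAbove j

theorem ratio_nonneg (c : Cover P n) : 0 ≤ c.ratio a :=
  Real.iSup_nonneg fun _ => div_nonneg ENNReal.toReal_nonneg (Nat.cast_nonneg _)

theorem ratio_le (ha : ∀ τ, 0 < a τ) {c : Cover P n} {ℓ : ℝ} (hℓ : 0 ≤ ℓ)
    (h : ∀ j, len (c.part j) ≤ a j.1 * ℓ) : c.ratio a ≤ ℓ := by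
  refine Real.iSup_le (fun j => ?_) hℓ
  have h1 : (0 : ℝ) < a j.1 := by exact_mod_cast ha _
  rw [div_le_iff₀' h1]
  exact h j

variable (hdisj : Pairwise fun k k' => Disjoint (P k).carrier (P k').carrier)
include hdisj

theorem exists_optimum (ha : ∀ τ, 0 < a τ) (hm : 1 ≤ m) (hmn : m ≤ ∑ τ, n τ) :
    ∃ ℓ, IsOptimum P n a ℓ ∧ ℓ ∈ candidates P n a := by
  have hcap : ∀ x : ℝ, 0 ≤ x → ∀ τ, 0 ≤ (a τ : ℝ) * x := fun x hx τ =>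
    mul_nonneg (Nat.cast_nonneg _) hx
  have hL : ∀ k, 0 ≤ (P k).total := fun k => (P k).total_pos.le
  have hbig := feas_of_large (P := P) (n := n) (ℓ := ∑ k, (P k).total) ha hm hmn
    (fun k => Finset.single_le_sum (fun k _ => hL k) (Finset.mem_univ k))
    (Finset.sum_nonneg fun k _ => hL k)
  obtain ⟨c₀, hc₀, -, hf₀⟩ := exists_candidate_le hm (Finset.sum_nonneg fun k _ => hL k) hbig
  have hfin : (candidates P n a ∩ {x | Feas P n fun τ => a τ * x}).Finite :=
    candidates_finite.inter_of_left _
  obtain ⟨ℓ, ⟨h1, h2⟩, hmin⟩ := Set.exists_min_image _ id hfin ⟨c₀, hc₀, hf₀⟩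
  have hlow : ∀ c : Cover P n, ℓ ≤ c.ratio a := by
    intro c
    have h3 := (dopg_iff hdisj (hcap _ (ratio_nonneg c))).1 ⟨c, len_part_le ha c⟩
    obtain ⟨x, hx1, hx2, hx3⟩ := exists_candidate_le hm (ratio_nonneg c) h3
    exact (hmin x ⟨hx1, hx3⟩).trans hx2
  have hℓ := candidates_pos h1
  obtain ⟨c, hc⟩ := (dopg_iff hdisj (hcap _ hℓ.le)).2 h2
  refine ⟨ℓ, ⟨⟨c, le_antisymm (ratio_le ha hℓ.le hc) (hlow c)⟩, ?_⟩, h1⟩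
  rintro _ ⟨c, rfl⟩
  exact hlow c

omit hdisj in
theorem dopg_iff_le (ha : ∀ τ, 0 < a τ) {ℓ : ℝ} (h : IsOptimum P n a ℓ) {x : ℝ} (hx : 0 ≤ x) :
    (DOPG P n fun τ => (a τ : ℝ) * x) ↔ ℓ ≤ x := by
  constructor
  · rintro ⟨c, hc⟩
    exact (h.2 ⟨c, rfl⟩).trans (ratio_le ha hx hc)
  · intro hle
    obtain ⟨c, rfl⟩ := h.1
    exact dopg_mono hle ⟨c, len_part_le ha c⟩

theorem feas_iff_le (ha : ∀ τ, 0 < a τ) {ℓ : ℝ} (h : IsOptimum P n a ℓ) {x : ℝ} (hx : 0 ≤ x) :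
    (Feas P n fun τ => (a τ : ℝ) * x) ↔ ℓ ≤ x := by
  rw [← dopg_iff hdisj fun τ => mul_nonneg (Nat.cast_nonneg _) hx, dopg_iff_le ha h hx]

end Candidates

theorem lrFeasible_iff {t : ℕ} (P : Perimeter) (n a : Fin t → ℕ) (i : ℕ) (ℓ : ℝ) :
    lrFeasible P n a i ℓ ↔ segEnd P i (P.q - 1) ≤ dp P i (fun τ => (a τ : ℝ) * ℓ) n := by
  unfold lrFeasible
  rw [P.len_chain _ _ (by have := P.q_pos; omega)]

theorem dopg_iff_lrFeasible {t : ℕ} (P : Perimeter) (n a : Fin t → ℕ) {ℓ : ℝ} (hℓ : 0 ≤ ℓ) :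
    DOPG (fun _ : Fin 1 => P) n (fun τ => (a τ : ℝ) * ℓ) ↔
      ∃ i : Fin P.q, lrFeasible P n a i ℓ := by
  rw [dopg_iff (fun k k' h => absurd (Subsingleton.elim k k') h)
    fun τ => mul_nonneg (Nat.cast_nonneg _) hℓ]
  simp only [lrFeasible_iff]
  constructor
  · rintro ⟨N, hN, h⟩
    obtain ⟨i, hi, h⟩ := h 0
    have : N 0 = n := by ext τ; simpa using hN τ
    exact ⟨⟨i, hi⟩, this ▸ h⟩
  · rintro ⟨i, h⟩
    exact ⟨fun _ => n, by simp, fun _ => ⟨i, i.2, h⟩⟩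

/-! ### Flat indices of the `t`-dimensional array -/

/-- The distance of cells that differ by one in coordinate `τ`. -/
def stride (n : ℕ → ℕ) (τ : ℕ) : ℕ := ∏ τ' ∈ Finset.range τ, (n τ' + 1)

/-- Coordinate `τ` of cell `c`. -/
def digit (n : ℕ → ℕ) (c τ : ℕ) : ℕ := c / stride n τ % (n τ + 1)

/-- The coordinates of cell `c`. -/
def vec (n : ℕ → ℕ) (t c : ℕ) : Fin t → ℕ := fun τ => digit n c τ

/-- The cell with coordinates `x`. -/
def flat (n : ℕ → ℕ) (t : ℕ) (x : ℕ → ℕ) : ℕ := ∑ τ ∈ Finset.range t, x τ * stride n τ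

/-- The number of lines of the array in direction `τ`. -/
def face (n : ℕ → ℕ) (t τ : ℕ) : ℕ := ∏ τ' ∈ (Finset.range t).erase τ, (n τ' + 1)

section Stride
variable (n : ℕ → ℕ)

theorem stride_pos (τ : ℕ) : 0 < stride n τ := Finset.prod_pos fun _ _ => Nat.succ_pos _

theorem stride_zero : stride n 0 = 1 := rfl

theorem stride_succ (τ : ℕ) : stride n (τ + 1) = stride n τ * (n τ + 1) := Finset.prod_range_succ _ _

theorem stride_dvd {τ τ' : ℕ} (h : τ ≤ τ') : stride n τ ∣ stride n τ' :=
  Finset.prod_dvd_prod_of_subset _ _ _ (Finset.range_mono h)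

theorem face_mul {t τ : ℕ} (h : τ < t) : (n τ + 1) * face n t τ = stride n t :=
  Finset.mul_prod_erase _ (fun τ => n τ + 1) (Finset.mem_range.2 h)

theorem face_pos (t τ : ℕ) : 0 < face n t τ := Finset.prod_pos fun _ _ => Nat.succ_pos _

theorem digit_le (c τ : ℕ) : digit n c τ ≤ n τ := Nat.lt_succ_iff.1 (Nat.mod_lt _ (Nat.succ_pos _))

theorem digit_zero (τ : ℕ) : digit n 0 τ = 0 := by simp [digit]

theorem digit_eq (c τ : ℕ) : digit n c τ = c % stride n (τ + 1) / stride n τ := by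
  rw [stride_succ, Nat.mod_mul_right_div_self, digit]

/-- The coordinates of the next cell. -/
theorem digit_succ (c τ : ℕ) : digit n (c + 1) τ =
    if stride n τ ∣ c + 1 then (if digit n c τ = n τ then 0 else digit n c τ + 1)
    else digit n c τ := by
  unfold digit
  rw [Nat.succ_div]
  split_ifs with h h'
  · rw [← Nat.mod_add_mod, h', Nat.mod_self]
  · have h1 := Nat.mod_lt (c / stride n τ) (Nat.succ_pos (n τ))
    simp only [Nat.succ_eq_add_one] at h1
    rw [← Nat.mod_add_mod, Nat.mod_eq_of_lt (by omega)]
  · rfl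

theorem stride_succ_dvd_iff (c τ : ℕ) : stride n (τ + 1) ∣ c + 1 ↔
    stride n τ ∣ c + 1 ∧ digit n c τ = n τ := by
  constructor
  · intro h
    have h1 : stride n τ ∣ c + 1 := (stride_dvd n (Nat.le_succ τ)).trans h
    refine ⟨h1, ?_⟩
    obtain ⟨b, hb⟩ := h1
    have hs := stride_pos n τ
    have hb' : c / stride n τ + 1 = b := by
      have := Nat.succ_div (a := c) (b := stride n τ)
      rw [if_pos ⟨b, hb⟩, hb, Nat.mul_div_cancel_left _ hs] at this
      omega
    rw [hb, stride_succ] at h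
    have h2 : n τ + 1 ∣ b := Nat.dvd_of_mul_dvd_mul_left hs h
    rw [← hb'] at h2
    unfold digit
    obtain ⟨e, he⟩ := h2
    have h3 : 0 < e := Nat.pos_of_ne_zero fun h => by simp [h] at he
    obtain ⟨f, rfl⟩ : ∃ f, e = f + 1 := ⟨e - 1, by omega⟩
    have h4 : c / stride n τ = n τ + (n τ + 1) * f := by rw [mul_add] at he; omega
    rw [h4, Nat.add_mul_mod_self_left, Nat.mod_eq_of_lt (Nat.lt_succ_self _)]
  · rintro ⟨⟨b, hb⟩, h⟩
    have hs := stride_pos n τ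
    have hb' : c / stride n τ + 1 = b := by
      have := Nat.succ_div (a := c) (b := stride n τ)
      rw [if_pos ⟨b, hb⟩, hb, Nat.mul_div_cancel_left _ hs] at this
      omega
    unfold digit at h
    have h1 := Nat.div_add_mod (c / stride n τ) (n τ + 1)
    rw [h] at h1
    rw [hb, stride_succ]
    refine Nat.mul_dvd_mul_left _ ⟨c / stride n τ / (n τ + 1) + 1, ?_⟩
    rw [← hb', mul_add]; omega

theorem stride_le_of_digit {c τ : ℕ} (h : digit n c τ ≠ 0) : stride n τ ≤ c := by
  by_contra hc
  exact h (by rw [digit, Nat.div_eq_of_lt (not_le.1 hc), Nat.zero_mod])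

theorem digit_sub {c τ : ℕ} (h : digit n c τ ≠ 0) (τ' : ℕ) :
    digit n (c - stride n τ) τ' = if τ' = τ then digit n c τ - 1 else digit n c τ' := by
  have hle := stride_le_of_digit n h
  obtain ⟨b, rfl⟩ : ∃ b, c = b + stride n τ := ⟨c - stride n τ, by omega⟩
  rw [Nat.add_sub_cancel]
  have hs := stride_pos n τ
  have hdiv : (b + stride n τ) / stride n τ = b / stride n τ + 1 := Nat.add_div_right _ hs
  have hd0 : b / stride n τ % (n τ + 1) + 1 < n τ + 1 + 1 :=
    Nat.succ_lt_succ (Nat.mod_lt _ (Nat.succ_pos _))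
  have hd : (b / stride n τ + 1) % (n τ + 1) = b / stride n τ % (n τ + 1) + 1 := by
    have h1 : (b / stride n τ + 1) % (n τ + 1) ≠ 0 := by
      rw [← hdiv]; exact h
    rw [← Nat.mod_add_mod] at h1 ⊢
    rcases eq_or_lt_of_le (Nat.lt_succ_iff.1 hd0) with e | e
    · rw [e, Nat.mod_self] at h1; exact absurd rfl h1
    · exact Nat.mod_eq_of_lt e
  split_ifs with e
  · subst e
    unfold digit
    rw [hdiv, hd, Nat.add_sub_cancel]
  · rcases lt_or_gt_of_ne e with h1 | h1
    · rw [digit_eq, digit_eq]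
      congr 1
      obtain ⟨k, hk⟩ := stride_dvd n (show τ' + 1 ≤ τ from h1)
      rw [hk, Nat.add_mul_mod_self_left]
    · unfold digit
      congr 1
      obtain ⟨k, hk⟩ := stride_dvd n (show τ + 1 ≤ τ' from h1)
      rw [hk, stride_succ, ← Nat.div_div_eq_div_mul, ← Nat.div_div_eq_div_mul,
        ← Nat.div_div_eq_div_mul, ← Nat.div_div_eq_div_mul, hdiv]
      congr 1
      rw [Nat.succ_div, if_neg, add_zero]
      rw [Nat.dvd_iff_mod_eq_zero, hd]; omega

theorem vec_sub {t c : ℕ} {τ : Fin t} (h : digit n c τ ≠ 0) :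
    vec n t (c - stride n τ) = drop (vec n t c) τ := by
  ext τ'
  unfold vec drop
  rw [digit_sub n h, Function.update_apply]
  simp only [Fin.ext_iff]

theorem vec_zero (t : ℕ) : vec n t 0 = 0 := by ext; simp [vec, digit_zero]

theorem flat_digit {t c : ℕ} (h : c < stride n t) : flat n t (digit n c) = c := by
  have key : ∀ τ, flat n τ (digit n c) = c % stride n τ := by
    intro τ
    induction τ with
    | zero => simp [flat, stride_zero, Nat.mod_one]
    | succ τ ih =>
      unfold flat at ih ⊢
      rw [Finset.sum_range_succ, ih, stride_succ, Nat.mod_mul, digit]; ring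
  rw [key, Nat.mod_eq_of_lt h]

theorem flat_lt {t : ℕ} {x : ℕ → ℕ} (h : ∀ τ < t, x τ ≤ n τ) : flat n t x < stride n t := by
  induction t with
  | zero => simp [flat, stride_zero]
  | succ t ih =>
    have h1 := ih fun τ hτ => h τ (by omega)
    unfold flat at h1 ⊢
    rw [Finset.sum_range_succ, stride_succ]
    have h2 : x t * stride n t ≤ n t * stride n t := Nat.mul_le_mul_right _ (h t (by omega))
    calc _ < stride n t + n t * stride n t := by omega
      _ = _ := by ring

theorem digit_flat {t : ℕ} {x : ℕ → ℕ} (h : ∀ τ < t, x τ ≤ n τ) {τ : ℕ} (hτ : τ < t) :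
    digit n (flat n t x) τ = x τ := by
  have h1 : ∀ d, ∃ b, flat n (τ + 1 + d) x = flat n (τ + 1) x + stride n (τ + 1) * b := by
    intro d
    induction d with
    | zero => exact ⟨0, by simp⟩
    | succ d ih =>
      obtain ⟨b, hb⟩ := ih
      obtain ⟨k, hk⟩ := stride_dvd n (show τ + 1 ≤ τ + 1 + d by omega)
      refine ⟨b + x (τ + 1 + d) * k, ?_⟩
      rw [show τ + 1 + (d + 1) = τ + 1 + d + 1 by omega]
      unfold flat at hb ⊢
      rw [Finset.sum_range_succ, hb, hk]; ring
  obtain ⟨b, hb⟩ := h1 (t - (τ + 1))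
  rw [show τ + 1 + (t - (τ + 1)) = t by omega] at hb
  have h2 : flat n (τ + 1) x < stride n (τ + 1) := flat_lt n fun τ' h' => h τ' (by omega)
  have h3 : flat n τ x < stride n τ := flat_lt n fun τ' h' => h τ' (by omega)
  rw [digit_eq, hb, Nat.add_mul_mod_self_left, Nat.mod_eq_of_lt h2]
  have h4 : flat n (τ + 1) x = flat n τ x + stride n τ * x τ := by
    unfold flat; rw [Finset.sum_range_succ]; ring
  rw [h4, Nat.add_mul_div_left _ _ (stride_pos n τ), Nat.div_eq_of_lt h3, zero_add]

theorem exists_vec {t : ℕ} {x : Fin t → ℕ} (h : ∀ τ : Fin t, x τ ≤ n τ) :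
    ∃ c < stride n t, vec n t c = x := by
  have h' : ∀ τ < t, pad x τ ≤ n τ := fun τ hτ => by simpa [pad, hτ] using h ⟨τ, hτ⟩
  refine ⟨flat n t (pad x), flat_lt n h', ?_⟩
  ext τ
  rw [vec, digit_flat n h' τ.2]; simp [pad]

theorem eq_of_vec_eq {t c c' : ℕ} (hc : c < stride n t) (hc' : c' < stride n t)
    (h : vec n t c = vec n t c') : c = c' := by
  rw [← flat_digit n hc, ← flat_digit n hc']
  refine Finset.sum_congr rfl fun τ hτ => ?_
  rw [show digit n c τ = digit n c' τ from congrFun h ⟨τ, Finset.mem_range.1 hτ⟩]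

/-- Cells can be added if no coordinate gets too large. -/
theorem digit_add {t c c' : ℕ} (hc : c < stride n t) (hc' : c' < stride n t)
    (h : ∀ τ < t, digit n c τ + digit n c' τ ≤ n τ) :
    c + c' < stride n t ∧ ∀ τ < t, digit n (c + c') τ = digit n c τ + digit n c' τ := by
  have e : c + c' = flat n t (fun τ => digit n c τ + digit n c' τ) := by
    conv_lhs => rw [← flat_digit n hc, ← flat_digit n hc']
    unfold flat
    rw [← Finset.sum_add_distrib]
    exact Finset.sum_congr rfl fun τ _ => by ring
  rw [e]
  exact ⟨flat_lt n h, fun τ hτ => digit_flat n h hτ⟩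

theorem vec_last (t : ℕ) : vec n t (stride n t - 1) = fun τ : Fin t => n τ := by
  obtain ⟨c, hc, h⟩ := exists_vec n (t := t) (x := fun τ : Fin t => n τ) fun _ => le_rfl
  suffices stride n t - 1 = c by rw [this, h]
  have h1 := flat_digit n (show stride n t - 1 < stride n t by have := stride_pos n t; omega)
  have h2 := flat_digit n hc
  have h3 : flat n t (digit n (stride n t - 1)) ≤ flat n t (digit n c) := by
    refine Finset.sum_le_sum fun τ hτ => Nat.mul_le_mul_right _ ?_
    rw [show digit n c τ = n τ from congrFun h ⟨τ, Finset.mem_range.1 hτ⟩]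
    exact digit_le n _ _
  omega

/-- The number of cells at the end of their line in direction `τ`. -/
theorem card_digit_eq_le {t τ : ℕ} (hτ : τ < t) :
    ((Finset.range (stride n t)).filter fun c => digit n c τ = n τ).card ≤ face n t τ := by
  obtain ⟨R, hR⟩ := stride_dvd n (show τ + 1 ≤ t from hτ)
  have hs := stride_pos n τ
  have hface : face n t τ = stride n τ * R := by
    have := face_mul n hτ
    rw [hR, stride_succ] at this
    have h2 : (n τ + 1) * face n t τ = (n τ + 1) * (stride n τ * R) := by rw [this]; ring
    exact Nat.eq_of_mul_eq_mul_left (Nat.succ_pos _) h2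
  rw [hface, ← Finset.card_range (stride n τ), ← Finset.card_range R, ← Finset.card_product]
  refine Finset.card_le_card_of_injOn (fun c => (c % stride n τ, c / stride n (τ + 1))) ?_ ?_
  · intro c hc
    simp only [Finset.coe_filter, Finset.mem_range, Set.mem_ofPred_eq] at hc
    simp only [Finset.coe_product, Set.mem_prod, Finset.mem_coe,
      Finset.mem_range]
    refine ⟨Nat.mod_lt _ hs, ?_⟩
    rw [Nat.div_lt_iff_lt_mul (stride_pos n _), mul_comm, ← hR]
    exact hc.1
  · intro c hc c' hc' h
    simp only [Finset.coe_filter, Finset.mem_range, Set.mem_ofPred_eq] at hc hc'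
    simp only [Prod.mk.injEq] at h
    have h1 := Nat.div_add_mod c (stride n (τ + 1))
    have h2 := Nat.div_add_mod c' (stride n (τ + 1))
    have h3 : c % stride n (τ + 1) = c' % stride n (τ + 1) := by
      rw [stride_succ, Nat.mod_mul, Nat.mod_mul, h.1]
      congr 2
      exact hc.2.trans hc'.2.symm
    rw [← h1, ← h2, h.2, h3]

/-- The steps of a pointer that moves forward along each line sum up to its final values. -/
theorem sum_pointer_le {t τ q : ℕ} (hτ : τ < t) (f : ℕ → ℕ) (hq : ∀ c, f c ≤ q)
    (h0 : ∀ c, digit n c τ = 0 → f c = 0)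
    (hmono : ∀ c, digit n c τ ≠ 0 → f (c - stride n τ) ≤ f c) :
    ∑ c ∈ Finset.range (stride n t), (if digit n c τ = 0 then 0 else f c - f (c - stride n τ)) ≤
      q * face n t τ := by
  classical
  set A := Finset.range (stride n t)
  have hb : ∀ c, digit n c τ ≠ 0 → c ∈ A → c - stride n τ ∈ A := fun c _ hc => by
    simp only [A, Finset.mem_range] at hc ⊢; omega
  have h1 : ∑ c ∈ A, (if digit n c τ = 0 then 0 else f c - f (c - stride n τ)) +
      ∑ c ∈ A.filter (fun c => digit n c τ ≠ 0), f (c - stride n τ) = ∑ c ∈ A, f c := by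
    rw [Finset.sum_filter, ← Finset.sum_add_distrib]
    refine Finset.sum_congr rfl fun c _ => ?_
    by_cases h : digit n c τ = 0
    · simp [h, h0 c h]
    · simp only [h, if_false, not_false_eq_true, if_true, ne_eq]
      have := hmono c h; omega
  have h2 : ∑ c ∈ A.filter (fun c => digit n c τ ≠ 0), f (c - stride n τ) =
      ∑ c ∈ A.filter (fun c => digit n c τ ≠ n τ), f c := by
    refine Finset.sum_bij (fun c _ => c - stride n τ) ?_ ?_ ?_ fun _ _ => rfl
    · intro c hc
      rw [Finset.mem_filter] at hc ⊢
      refine ⟨hb c hc.2 hc.1, ?_⟩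
      rw [digit_sub n hc.2, if_pos rfl]
      have := digit_le n c τ
      have := hc.2
      omega
    · intro c hc c' hc' e
      rw [Finset.mem_filter] at hc hc'
      have := stride_le_of_digit n hc.2
      have := stride_le_of_digit n hc'.2
      omega
    · intro c hc
      rw [Finset.mem_filter] at hc
      have hle := digit_le n c τ
      have hlt : digit n c τ + 1 < n τ + 1 := by have := hc.2; omega
      have hd : digit n (c + stride n τ) τ = digit n c τ + 1 := by
        unfold digit at hlt ⊢
        rw [Nat.add_div_right _ (stride_pos n τ), ← Nat.mod_add_mod,
          Nat.mod_eq_of_lt hlt]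
      refine ⟨c + stride n τ, ?_, by simp⟩
      rw [Finset.mem_filter]
      refine ⟨?_, by omega⟩
      have hcA : c < stride n t := Finset.mem_range.1 hc.1
      obtain ⟨R, hR⟩ := stride_dvd n (show τ + 1 ≤ t from hτ)
      rw [Finset.mem_range]
      have e1 := Nat.div_add_mod c (stride n (τ + 1))
      have e2 : c / stride n (τ + 1) < R := by
        rw [Nat.div_lt_iff_lt_mul (stride_pos n _), mul_comm, ← hR]; exact hcA
      have e3 : c % stride n (τ + 1) + stride n τ < stride n (τ + 1) + 0 := by
        rw [stride_succ, Nat.mod_mul]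
        have e4 := Nat.mod_lt c (stride_pos n τ)
        have e5 : stride n τ * (digit n c τ + 1) ≤ stride n τ * n τ :=
          Nat.mul_le_mul_left _ (by omega)
        unfold digit at e5
        rw [mul_add] at e5 ⊢
        omega
      have e6 : stride n (τ + 1) * (c / stride n (τ + 1) + 1) ≤ stride n (τ + 1) * R :=
        Nat.mul_le_mul_left _ e2
      rw [hR]
      rw [mul_add] at e6
      omega
  have h3 : ∑ c ∈ A.filter (fun c => digit n c τ = n τ), f c +
      ∑ c ∈ A.filter (fun c => digit n c τ ≠ n τ), f c = ∑ c ∈ A, f c :=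
    Finset.sum_filter_add_sum_filter_not _ _ _
  have h4 : ∑ c ∈ A.filter (fun c => digit n c τ = n τ), f c ≤ q * face n t τ := by
    refine (Finset.sum_le_card_nsmul _ _ q fun c _ => hq c).trans ?_
    rw [smul_eq_mul, mul_comm]
    exact Nat.mul_le_mul_left _ (card_digit_eq_le n hτ)
  omega

theorem cells_eq {t : ℕ} (x : Fin t → ℕ) (h : ∀ τ : Fin t, n τ = x τ) : stride n t = cells x := by
  unfold stride cells
  rw [Finset.prod_range]
  exact Finset.prod_congr rfl fun τ _ => by rw [h]

theorem faces_eq {t : ℕ} (x : Fin t → ℕ) (h : ∀ τ : Fin t, n τ = x τ) :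
    ∑ τ ∈ Finset.range t, face n t τ = faces x := by
  unfold faces
  rw [Finset.sum_range]
  refine Finset.sum_congr rfl fun τ _ => ?_
  have h1 := face_mul n τ.2
  have h2 := Finset.mul_prod_erase Finset.univ (fun τ' => x τ' + 1) (Finset.mem_univ τ)
  rw [cells_eq n x h, cells, ← h2, h] at h1
  exact Nat.eq_of_mul_eq_mul_left (Nat.succ_pos _) h1

end Stride

theorem cells_comp {t : ℕ} (n : Fin t → ℕ) (ρ : Equiv.Perm (Fin t)) : cells (n ∘ ρ) = cells n :=
  Equiv.prod_comp ρ fun τ => n τ + 1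

theorem faces_comp {t : ℕ} (n : Fin t → ℕ) (ρ : Equiv.Perm (Fin t)) : faces (n ∘ ρ) = faces n := by
  have h : ∀ τ (x : Fin t → ℕ), ∏ τ' ∈ Finset.univ.erase τ, (x τ' + 1) = cells x / (x τ + 1) := by
    intro τ x
    rw [cells, ← Finset.mul_prod_erase Finset.univ (fun τ' => x τ' + 1) (Finset.mem_univ τ),
      Nat.mul_div_cancel_left _ (Nat.succ_pos _)]
  unfold faces
  simp only [h, cells_comp]
  exact Equiv.sum_comp ρ fun τ => cells n / (n τ + 1)

/-! ### Preparation: the order of the types, strides, coordinates and weights -/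

/-- Copy the types, and swap a most frequent one with the last one. -/
def setupTypes : Prog :=
  (nset 20 (.get 0 1) ;; nset 21 (.get 0 0) ;; nset 30 0 ;; nset 34 0) ;;
  .loop (natLt (nv 30) (nv 20)) (
    .setNat 10 (nv 30) (.get 2 (nv 30)) ;;
    .setNat 11 (nv 30) (.get 3 (nv 30)) ;;
    .setNat 12 (nv 30) (nv 30) ;;
    .cond (.natLe (.get 2 (nv 34)) (.get 2 (nv 30))) (nset 34 (nv 30)) .skip ;;
    nset 30 (nv 30 + 1)) ;;
  (nset 35 (nv 20 - 1) ;;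
   .setNat 10 (nv 34) (.get 2 (nv 35)) ;; .setNat 10 (nv 35) (.get 2 (nv 34)) ;;
   .setNat 11 (nv 34) (.get 3 (nv 35)) ;; .setNat 11 (nv 35) (.get 3 (nv 34)) ;;
   .setNat 12 (nv 34) (nv 35) ;; .setNat 12 (nv 35) (nv 34))

theorem setupTypes_spec {O : ℕ → ℝ → Prop} (σ : State) (t m : ℕ) (ht : 1 ≤ t)
    (h1 : σ.nat 0 1 = t) (h0 : σ.nat 0 0 = m) :
    Ex O setupTypes σ (100 * t + 100) 0 (fun σ' => ∃ b < t, (∀ τ < t, σ.nat 2 τ ≤ σ.nat 2 b) ∧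
      σ'.nat 20 0 = t ∧ σ'.nat 21 0 = m ∧ ∀ τ < t, σ'.nat 10 τ = σ.nat 2 (Equiv.swap b (t - 1) τ) ∧
        σ'.nat 11 τ = σ.nat 3 (Equiv.swap b (t - 1) τ) ∧
        σ'.nat 12 τ = Equiv.swap b (t - 1) τ) := by
  refine Ex.time (Ex.flat_seq 20 fun σ₁ e₁ a₁ => Ex.seq₀ (Ex.for₀ t 50
    (fun k σ' => σ'.nat 30 0 = k ∧ σ'.nat 20 0 = t ∧ σ'.nat 21 0 = m ∧ σ'.nat 34 0 < t ∧
    (∀ τ < k, σ.nat 2 τ ≤ σ.nat 2 (σ'.nat 34 0)) ∧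
    ∀ τ < k, σ'.nat 10 τ = σ.nat 2 τ ∧ σ'.nat 11 τ = σ.nat 3 τ ∧ σ'.nat 12 τ = τ)
    ?_ ?_ ?_)
    fun σ₂ a₂ h₂ => Ex.flat (T := 50) ?_) (by omega)
  · simp [e₁, Prog.sem, h1, h0]; omega
  · intro k hk σ' ha hI
    have e2 : σ'.nat 2 = σ.nat 2 := (ha.nat 2 rfl).trans (a₁.nat 2 rfl)
    have e3 : σ'.nat 3 = σ.nat 3 := (ha.nat 3 rfl).trans (a₁.nat 3 rfl)
    obtain ⟨i1, i2, i3, i4, i5, i6⟩ := hI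
    refine ⟨by simp [i1, i2, hk], Ex.flat ?_⟩
    simp [Prog.wp, i1, i2, i3, i4, e2, e3, hk, Function.update_apply]
    refine ⟨fun hc => ⟨fun τ hτ => ?_, fun τ hτ => ?_⟩, fun hc => ⟨fun τ hτ => ?_, fun τ hτ => ?_⟩⟩
    · rcases Nat.lt_or_eq_of_le hτ with h | rfl
      · exact (i5 τ h).trans hc
      · exact le_rfl
    · split_ifs with e
      · simp [e]
      · exact i6 τ (by omega)
    · rcases Nat.lt_or_eq_of_le hτ with h | rfl
      · exact i5 τ h
      · exact hc.le
    · split_ifs with e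
      · simp [e]
      · exact i6 τ (by omega)
  · rintro σ' - ⟨i1, i2, -⟩
    simp [i1, i2]
  · obtain ⟨i1, i2, i3, i4, i5, i6⟩ := h₂
    have e2 : σ₂.nat 2 = σ.nat 2 := (a₂.nat 2 rfl).trans (a₁.nat 2 rfl)
    have e3 : σ₂.nat 3 = σ.nat 3 := (a₂.nat 3 rfl).trans (a₁.nat 3 rfl)
    refine ⟨σ₂.nat 34 0, i4, i5, ?_⟩
    simp [i2, i3, e2, e3, Function.update_apply, Equiv.swap_apply_def]
    intro τ hτ
    obtain ⟨j1, j2, j3⟩ := i6 τ hτ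
    refine ⟨?_, ?_, ?_⟩ <;> split_ifs <;> simp_all

/-- Strides and numbers of cells. -/
def setupStrides : Prog :=
  (.setNat 13 0 1 ;; .setNat 14 0 (nv 20) ;; nset 30 0) ;;
  .loop (natLt (nv 30) (nv 20)) (
    (nset 31 0 ;; nset 32 0 ;; nset 33 0) ;;
    .loop (.natLe (nv 33) (.get 10 (nv 30))) (
      nset 31 (nv 31 + .get 13 (nv 30)) ;; nset 32 (nv 32 + .get 14 (nv 30)) ;;
      nset 33 (nv 33 + 1)) ;;
    (nset 30 (nv 30 + 1) ;; .setNat 13 (nv 30) (nv 31) ;; .setNat 14 (nv 30) (nv 32))) ;;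
  (nset 22 (.get 13 (nv 20)) ;; nset 23 (.get 13 (nv 20 - 1)))

theorem add_one_le_stride (n : ℕ → ℕ) {τ t : ℕ} (h : τ < t) : n τ + 1 ≤ stride n t := by
  rw [← face_mul n h]
  exact Nat.le_mul_of_pos_right _ (face_pos n t τ)

theorem setupStrides_spec {O : ℕ → ℝ → Prop} (σ : State) (t : ℕ) (n : ℕ → ℕ)
    (hn : σ.nat 10 = n) (h20 : σ.nat 20 0 = t) :
    Ex O setupStrides σ (300 * (t * stride n t) + 100) 0 (fun σ' =>
      (∀ τ ≤ t, σ'.nat 13 τ = stride n τ ∧ σ'.nat 14 τ = stride n τ * t) ∧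
      σ'.nat 22 0 = stride n t ∧ σ'.nat 23 0 = stride n (t - 1)) := by
  refine Ex.time (Ex.flat_seq 20 fun σ₁ e₁ a₁ => Ex.seq₀ (Ex.for₀ t
    (20 + (stride n t * (50 + 20) + 20 + 30))
    (fun k σ' => σ'.nat 30 0 = k ∧
      ∀ τ ≤ k, σ'.nat 13 τ = stride n τ ∧ σ'.nat 14 τ = stride n τ * t)
    ?_ ?_ ?_)
    fun σ₂ a₂ h₂ => Ex.flat (T := 50) ?_) ?_
  · simp [e₁, Prog.sem, h20, stride_zero]
  · rintro k hk σ' ha ⟨i1, i2⟩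
    have e20 : σ'.nat 20 0 = t := by rw [ha.nat 20 rfl, a₁.nat 20 rfl, h20]
    have e10 : σ'.nat 10 = n := by rw [ha.nat 10 rfl, a₁.nat 10 rfl, hn]
    refine ⟨by simp [i1, e20, hk], ?_⟩
    refine Ex.time (Ex.flat_seq 20 fun σ₃ e₃ a₃ => Ex.seq₀ (Ex.for₀ (n k + 1) 50
      (fun j σ' => σ'.nat 33 0 = j ∧ σ'.nat 31 0 = j * stride n k ∧
        σ'.nat 32 0 = j * (stride n k * t)) ?_ ?_ ?_)
      fun σ₄ a₄ h₄ => Ex.flat (T := 30) ?_) ?_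
    · simp [e₃, Prog.sem]
    · rintro j hj σ₅ a₅ ⟨j1, j2, j3⟩
      have f30 : σ₅.nat 30 0 = k := by rw [a₅.nat 30 rfl, a₃.nat 30 rfl, i1]
      have f10 : σ₅.nat 10 = n := by rw [a₅.nat 10 rfl, a₃.nat 10 rfl, e10]
      have f13 : σ₅.nat 13 k = stride n k := by
        rw [a₅.nat 13 rfl, a₃.nat 13 rfl, (i2 k le_rfl).1]
      have f14 : σ₅.nat 14 k = stride n k * t := by
        rw [a₅.nat 14 rfl, a₃.nat 14 rfl, (i2 k le_rfl).2]
      refine ⟨by simp [j1, f30, f10]; omega, Ex.flat ?_⟩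
      simp [Prog.wp, j1, j2, j3, f30, f13, f14]
      constructor <;> ring
    · rintro σ₅ a₅ ⟨j1, -⟩
      have f30 : σ₅.nat 30 0 = k := by rw [a₅.nat 30 rfl, a₃.nat 30 rfl, i1]
      have f10 : σ₅.nat 10 = n := by rw [a₅.nat 10 rfl, a₃.nat 10 rfl, e10]
      simp [j1, f30, f10]
    · obtain ⟨j1, j2, j3⟩ := h₄
      have f30 : σ₄.nat 30 0 = k := by rw [a₄.nat 30 rfl, a₃.nat 30 rfl, i1]
      have f13 : σ₄.nat 13 = σ'.nat 13 := by rw [a₄.nat 13 rfl, a₃.nat 13 rfl]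
      have f14 : σ₄.nat 14 = σ'.nat 14 := by rw [a₄.nat 14 rfl, a₃.nat 14 rfl]
      simp [Prog.wp, j2, j3, f30, f13, f14, Function.update_apply]
      intro τ hτ
      split_ifs with e
      · subst e; rw [stride_succ]; constructor <;> ring
      · exact i2 τ (by omega)
    · have := add_one_le_stride n hk
      have := Nat.mul_le_mul_right (50 + 20) this
      omega
  · rintro σ' ha ⟨i1, -⟩
    have e20 : σ'.nat 20 0 = t := by rw [ha.nat 20 rfl, a₁.nat 20 rfl, h20]
    simp [i1, e20]
  · obtain ⟨i1, i2⟩ := h₂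
    have e20 : σ₂.nat 20 0 = t := by rw [a₂.nat 20 rfl, a₁.nat 20 rfl, h20]
    simp [Prog.wp, e20]
    exact ⟨i2, (i2 t le_rfl).1, (i2 (t - 1) (by omega)).1⟩
  · have h1 := stride_pos n t
    have h2 : t ≤ t * stride n t := Nat.le_mul_of_pos_right _ h1
    nlinarith

/-- Coordinates and weights of all cells. The weight of cell `0` is replaced by the capability of
the last type. -/
def setupCells : Prog :=
  (nset 32 0 ;; nset 33 0) ;;
  .loop (natLt (nv 32) (nv 22)) (
    (nset 30 0 ;; nset 31 1) ;;
    .loop (natLt (nv 30) (nv 20)) (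
      .cond (.natLe 1 (.get 15 (nv 33 + nv 30)))
        (.setNat 16 (nv 32) (.get 16 (nv 32 - .get 13 (nv 30)) + .get 11 (nv 30))) .skip ;;
      .cond (.natLe 1 (nv 31))
        (.cond (.natLe (.get 10 (nv 30)) (.get 15 (nv 33 + nv 30)))
          (.setNat 15 (nv 33 + nv 20 + nv 30) 0)
          (.setNat 15 (nv 33 + nv 20 + nv 30) (.get 15 (nv 33 + nv 30) + 1) ;; nset 31 0))
        (.setNat 15 (nv 33 + nv 20 + nv 30) (.get 15 (nv 33 + nv 30))) ;;
      nset 30 (nv 30 + 1)) ;;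
    (nset 32 (nv 32 + 1) ;; nset 33 (nv 33 + nv 20))) ;;
  .setNat 16 0 (.get 11 (nv 20 - 1))

/-- The weight of a cell: the sum of the capabilities of its robots. -/
def weight (n a : ℕ → ℕ) (t c : ℕ) : ℕ := ∑ τ ∈ Finset.range t, a τ * digit n c τ

theorem weight_zero (n a : ℕ → ℕ) (t : ℕ) : weight n a t 0 = 0 := by simp [weight, digit_zero]

theorem weight_sub (n a : ℕ → ℕ) {t c τ : ℕ} (hτ : τ < t) (h : digit n c τ ≠ 0) :
    weight n a t (c - stride n τ) + a τ = weight n a t c := by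
  unfold weight
  rw [← Finset.add_sum_erase _ _ (Finset.mem_range.2 hτ),
    ← Finset.add_sum_erase _ (fun τ' => a τ' * digit n c τ') (Finset.mem_range.2 hτ)]
  rw [Finset.sum_congr rfl fun τ' h' => by
    rw [digit_sub n h, if_neg (Finset.ne_of_mem_erase h')], digit_sub n h, if_pos rfl]
  obtain ⟨b, hb⟩ := Nat.exists_eq_succ_of_ne_zero h
  rw [hb, Nat.succ_sub_one, Nat.succ_eq_add_one]; ring

theorem exists_digit_ne_zero (n : ℕ → ℕ) {t c : ℕ} (hc : c < stride n t) (h : c ≠ 0) :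
    ∃ τ < t, digit n c τ ≠ 0 := by
  by_contra hcon
  push Not at hcon
  apply h
  rw [← flat_digit n hc, flat]
  exact Finset.sum_eq_zero fun τ hτ => by rw [hcon τ (Finset.mem_range.1 hτ), zero_mul]

theorem setupCells_spec {O : ℕ → ℝ → Prop} (σ : State) (t : ℕ) (n a : ℕ → ℕ) (ht : 1 ≤ t)
    (hn : σ.nat 10 = n) (ha : σ.nat 11 = a) (h20 : σ.nat 20 0 = t) (h22 : σ.nat 22 0 = stride n t)
    (h13 : ∀ τ ≤ t, σ.nat 13 τ = stride n τ) (h15 : ∀ τ, σ.nat 15 τ = 0) (h16 : σ.nat 16 0 = 0) :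
    Ex O setupCells σ (300 * (t * stride n t) + 100) 0 (fun σ' =>
      (∀ c < stride n t, ∀ τ < t, σ'.nat 15 (c * t + τ) = digit n c τ) ∧
      ∀ c < stride n t, σ'.nat 16 c = if c = 0 then a (t - 1) else weight n a t c) := by
  refine Ex.time (Ex.flat_seq 20 fun σ₁ e₁ a₁ => Ex.seq₀ (Ex.for₀ (stride n t)
    (20 + (t * (120 + 20) + 20 + 20))
    (fun c σ' => σ'.nat 32 0 = c ∧ σ'.nat 33 0 = c * t ∧ σ'.nat 16 0 = 0 ∧
      (∀ c' ≤ c, ∀ τ < t, σ'.nat 15 (c' * t + τ) = digit n c' τ) ∧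
      ∀ c' < c, σ'.nat 16 c' = weight n a t c')
    ?_ ?_ ?_)
    fun σ₂ a₂ h₂ => Ex.flat (T := 20) ?_) ?_
  · simp [e₁, Prog.sem, h16, h15, digit_zero]
  · rintro c hc σ' a' ⟨i1, i2, i3, i4, i5⟩
    have e20 : σ'.nat 20 0 = t := by rw [a'.nat 20 rfl, a₁.nat 20 rfl, h20]
    have e22 : σ'.nat 22 0 = stride n t := by rw [a'.nat 22 rfl, a₁.nat 22 rfl, h22]
    refine ⟨by simp [i1, e22, hc], ?_⟩
    refine Ex.flat_seq 20 fun σ₃ e₃ a₃ => Ex.seq₀ (Ex.for₀ t 120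
      (fun k σ' => σ'.nat 30 0 = k ∧ σ'.nat 31 0 = (if stride n k ∣ c + 1 then 1 else 0) ∧
        σ'.nat 16 0 = 0 ∧
        (∀ c' ≤ c, ∀ τ < t, σ'.nat 15 (c' * t + τ) = digit n c' τ) ∧
        (∀ τ < k, σ'.nat 15 (c * t + t + τ) = digit n (c + 1) τ) ∧
        (∀ c' < c, σ'.nat 16 c' = weight n a t c') ∧
        ((∃ τ < k, digit n c τ ≠ 0) → σ'.nat 16 c = weight n a t c)) ?_ ?_ ?_)
      fun σ₄ a₄ h₄ => Ex.flat (T := 20) ?_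
    · have f15 : σ₃.nat 15 = σ'.nat 15 := a₃.nat 15 rfl
      have f16 : σ₃.nat 16 = σ'.nat 16 := a₃.nat 16 rfl
      refine ⟨by simp [e₃, Prog.sem], by simp [e₃, Prog.sem, stride_zero], ?_, ?_, ?_, ?_, ?_⟩
      · rw [f16, i3]
      · rw [f15]; exact i4
      · simp
      · rw [f16]; exact i5
      · simp
    · rintro k hk σ₅ a₅ ⟨j1, j2, j3, j4, j5, j6, j7⟩
      have f32 : σ₅.nat 32 0 = c := by rw [a₅.nat 32 rfl, a₃.nat 32 rfl, i1]
      have f33 : σ₅.nat 33 0 = c * t := by rw [a₅.nat 33 rfl, a₃.nat 33 rfl, i2]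
      have f20 : σ₅.nat 20 0 = t := by rw [a₅.nat 20 rfl, a₃.nat 20 rfl, e20]
      have f10 : σ₅.nat 10 = n := by
        rw [a₅.nat 10 rfl, a₃.nat 10 rfl, a'.nat 10 rfl, a₁.nat 10 rfl, hn]
      have f11 : σ₅.nat 11 = a := by
        rw [a₅.nat 11 rfl, a₃.nat 11 rfl, a'.nat 11 rfl, a₁.nat 11 rfl, ha]
      have f13 : σ₅.nat 13 k = stride n k := by
        rw [a₅.nat 13 rfl, a₃.nat 13 rfl, a'.nat 13 rfl, a₁.nat 13 rfl, h13 k hk.le]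
      have f15 : σ₅.nat 15 (c * t + k) = digit n c k := j4 c le_rfl k hk
      have hdl := digit_le n c k
      have hdiv := stride_succ_dvd_iff n c k
      have hdig := digit_succ n c k
      have hnew : ∀ v, v = digit n (c + 1) k →
          (∀ c' ≤ c, ∀ τ < t, Function.update (σ₅.nat 15) (c * t + t + k) v (c' * t + τ) =
            digit n c' τ) ∧
          ∀ τ < k + 1, Function.update (σ₅.nat 15) (c * t + t + k) v (c * t + t + τ) =
            digit n (c + 1) τ := by
        rintro v rfl
        constructor
        · intro c' hc' τ hτ
          have : c' * t ≤ c * t := Nat.mul_le_mul_right t hc'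
          rw [Function.update_of_ne (by omega), j4 c' hc' τ hτ]
        · intro τ hτ
          by_cases e : τ = k
          · rw [e, Function.update_self]
          · rw [Function.update_of_ne (by omega), j5 τ (by omega)]
      refine ⟨by simp [j1, f20, hk], Ex.time (Ex.seq₀ (T := 50) (T' := 70) (R := fun σ' =>
        σ'.nat 16 0 = 0 ∧ (∀ c' < c, σ'.nat 16 c' = weight n a t c') ∧
          ((∃ τ < k + 1, digit n c τ ≠ 0) → σ'.nat 16 c = weight n a t c))
        (Ex.flat ?_) fun σ₆ a₆ h₆ => Ex.flat ?_) le_rfl⟩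
      · refine ⟨fun hd => ?_, fun hd => ?_⟩
        · simp [j1, f33, f15] at hd
          have hs := stride_pos n k
          have hle := stride_le_of_digit n (show digit n c k ≠ 0 by omega)
          simp only [Prog.wp, State.setNat_nat, NatExp.eval_get, NatExp.eval_sub, NatExp.eval_add,
            NatExp.eval_lit, j1, f32, f13, f11, if_true]
          refine ⟨?_, fun c' hc' => ?_, fun _ => ?_⟩
          · rw [Function.update_of_ne (by omega), j3]
          · rw [Function.update_of_ne (by omega), j6 c' hc']
          · rw [Function.update_self, j6 _ (by omega), weight_sub n a hk (by omega)]
        · simp [j1, f33, f15] at hd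
          refine ⟨j3, j6, ?_⟩
          rintro ⟨τ, hτ, h⟩
          refine j7 ⟨τ, ?_, h⟩
          rcases Nat.lt_succ_iff_lt_or_eq.1 hτ with h' | rfl
          · exact h'
          · omega
      · obtain ⟨w1, w2, w3⟩ := h₆
        have g30 : σ₆.nat 30 0 = k := by rw [a₆.nat 30 rfl, j1]
        have g31 : σ₆.nat 31 0 = if stride n k ∣ c + 1 then 1 else 0 := by rw [a₆.nat 31 rfl, j2]
        have g33 : σ₆.nat 33 0 = c * t := by rw [a₆.nat 33 rfl, f33]
        have g20 : σ₆.nat 20 0 = t := by rw [a₆.nat 20 rfl, f20]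
        have g10 : σ₆.nat 10 = n := by rw [a₆.nat 10 rfl, f10]
        have g15 : σ₆.nat 15 = σ₅.nat 15 := a₆.nat 15 rfl
        refine ⟨fun hcar => ⟨fun hn => ?_, fun hn => ?_⟩, fun hcar => ?_⟩
        · replace hcar : stride n k ∣ c + 1 := by
            by_contra h; simp [g31, h] at hcar
          simp [g30, g33, g10, g15, f15] at hn
          have hn' : digit n c k = n k := le_antisymm hdl hn
          simp [Prog.wp, g30, g31, g33, g20, hcar]
          rw [g15]
          obtain ⟨u1, u2⟩ := hnew 0 (by rw [hdig, if_pos hcar, if_pos hn'])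
          refine ⟨?_, w1, u1, fun τ hτ => u2 τ (by omega), w2, fun τ hτ h => w3 ⟨τ, by omega, h⟩⟩
          exact hdiv.2 ⟨hcar, hn'⟩
        · replace hcar : stride n k ∣ c + 1 := by
            by_contra h; simp [g31, h] at hcar
          simp [g30, g33, g10, g15, f15] at hn
          have hn' : digit n c k ≠ n k := by omega
          simp [Prog.wp, g30, g33, g20]
          rw [g15, f15]
          obtain ⟨u1, u2⟩ := hnew (digit n c k + 1) (by rw [hdig, if_pos hcar, if_neg hn'])
          exact ⟨fun h => hn' (hdiv.1 h).2, w1, u1, fun τ hτ => u2 τ (by omega), w2,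
            fun τ hτ h => w3 ⟨τ, by omega, h⟩⟩
        · simp [g31] at hcar
          simp [Prog.wp, g30, g31, g33, g20, hcar]
          rw [g15, f15]
          obtain ⟨u1, u2⟩ := hnew (digit n c k) (by rw [hdig, if_neg hcar])
          exact ⟨fun h => hcar (hdiv.1 h).1, w1, u1, fun τ hτ => u2 τ (by omega), w2,
            fun τ hτ h => w3 ⟨τ, by omega, h⟩⟩
    · rintro σ₅ a₅ ⟨j1, -⟩
      have f20 : σ₅.nat 20 0 = t := by rw [a₅.nat 20 rfl, a₃.nat 20 rfl, e20]
      simp [j1, f20]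
    · obtain ⟨j1, j2, j3, j4, j5, j6, j7⟩ := h₄
      have f32 : σ₄.nat 32 0 = c := by rw [a₄.nat 32 rfl, a₃.nat 32 rfl, i1]
      have f33 : σ₄.nat 33 0 = c * t := by rw [a₄.nat 33 rfl, a₃.nat 33 rfl, i2]
      have f20 : σ₄.nat 20 0 = t := by rw [a₄.nat 20 rfl, a₃.nat 20 rfl, e20]
      refine ⟨by simp [f32], by simp [f33, f20, Nat.succ_mul], by simpa using j3, ?_, ?_⟩
      · intro c' hc' τ hτ
        simp
        rcases Nat.lt_succ_iff_lt_or_eq.1 (Nat.lt_succ_of_le hc') with h | rfl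
        · exact j4 c' (by omega) τ hτ
        · rw [Nat.succ_mul]; exact j5 τ hτ
      · intro c' hc'
        simp
        rcases Nat.lt_succ_iff_lt_or_eq.1 hc' with h | rfl
        · exact j6 c' h
        · by_cases h0 : c' = 0
          · subst h0; rw [j3, weight_zero]
          · exact j7 (exists_digit_ne_zero n hc h0)
  · rintro σ' a' ⟨i1, -⟩
    have e22 : σ'.nat 22 0 = stride n t := by rw [a'.nat 22 rfl, a₁.nat 22 rfl, h22]
    simp [i1, e22]
  · obtain ⟨i1, i2, i3, i4, i5⟩ := h₂
    have e20 : σ₂.nat 20 0 = t := by rw [a₂.nat 20 rfl, a₁.nat 20 rfl, h20]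
    have e11 : σ₂.nat 11 = a := by rw [a₂.nat 11 rfl, a₁.nat 11 rfl, ha]
    refine ⟨fun c hc τ hτ => by simpa using i4 c hc.le τ hτ, fun c hc => ?_⟩
    simp [e20, e11, Function.update_apply]
    split_ifs with h
    · rfl
    · exact i5 c hc
  · have h1 := stride_pos n t
    have h2 : stride n t ≤ t * stride n t := Nat.le_mul_of_pos_left _ ht
    nlinarith

/-- The preparation for all programs. -/
def setup : Prog := setupTypes ;; setupStrides ;; setupCells

/-- What the preparation leaves in memory: `t` types and `m` perimeters, with `n τ` robots of type
`τ` and capability `a τ`. -/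
structure Ready (t m : ℕ) (n a : ℕ → ℕ) (σ : State) : Prop where
  n_eq : σ.nat 10 = n
  a_eq : σ.nat 11 = a
  t_eq : σ.nat 20 0 = t
  m_eq : σ.nat 21 0 = m
  stride_eq : ∀ τ ≤ t, σ.nat 13 τ = stride n τ
  tstride_eq : ∀ τ ≤ t, σ.nat 14 τ = stride n τ * t
  cells_eq : σ.nat 22 0 = stride n t
  lines_eq : σ.nat 23 0 = stride n (t - 1)
  digit_eq : ∀ c < stride n t, ∀ τ < t, σ.nat 15 (c * t + τ) = digit n c τ
  weight_eq : ∀ c < stride n t, σ.nat 16 c = if c = 0 then a (t - 1) else weight n a t c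

theorem Ready.agree {t m : ℕ} {n a : ℕ → ℕ} {σ σ' : State} {p : Prog} (h : Ready t m n a σ)
    (ha : Agree p σ σ') (hp : ∀ A ∈ [10, 11, 13, 14, 15, 16, 20, 21, 22, 23], p.wn A = false := by decide) :
    Ready t m n a σ' := by
  have e : ∀ A ∈ [10, 11, 13, 14, 15, 16, 20, 21, 22, 23], σ'.nat A = σ.nat A :=
    fun A hA => ha.nat A (hp A hA)
  simp only [List.mem_cons, List.not_mem_nil, or_false, forall_eq_or_imp, forall_eq] at e
  obtain ⟨e1, e2, e3, e4, e5, e6, e7, e8, e9, e10⟩ := e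
  obtain ⟨h1, h2, h3, h4, h5, h6, h7, h8, h9, h10⟩ := h
  constructor <;> simp only [*] <;> assumption

theorem setup_spec {O : ℕ → ℝ → Prop} (σ : State) (t m : ℕ) (n a : Fin t → ℕ) (ht : 1 ≤ t)
    (h1 : σ.nat 0 1 = t) (h0 : σ.nat 0 0 = m) (hn : ∀ τ : Fin t, σ.nat 2 τ = n τ)
    (ha : ∀ τ : Fin t, σ.nat 3 τ = a τ) (h15 : ∀ τ, σ.nat 15 τ = 0) (h16 : σ.nat 16 0 = 0) :
    Ex O setup σ (700 * (t * cells n) + 300) 0 (fun σ' => ∃ ρ : Equiv.Perm (Fin t),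
      (∀ τ, n τ ≤ n (ρ ⟨t - 1, by omega⟩)) ∧ Ready t m (σ'.nat 10) (σ'.nat 11) σ' ∧
      ∀ τ : Fin t, σ'.nat 10 τ = n (ρ τ) ∧ σ'.nat 11 τ = a (ρ τ) ∧ σ'.nat 12 τ = ρ τ) := by
  refine Ex.time (Ex.seq₀ (setupTypes_spec σ t m ht h1 h0) (T' := 300 * (t * cells n) + 100 +
    (300 * (t * cells n) + 100)) fun σ₁ a₁ h₁ => ?_) ?_
  · obtain ⟨b, hb, hmax, h20, h21, hsw⟩ := h₁
    set ρ : Equiv.Perm (Fin t) := Equiv.swap ⟨b, hb⟩ ⟨t - 1, by omega⟩ with hρ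
    have hρv : ∀ τ : Fin t, Equiv.swap b (t - 1) τ = (ρ τ : ℕ) := by
      intro τ
      simp only [hρ, Equiv.swap_apply_def, Fin.ext_iff]
      split_ifs <;> rfl
    have hn10 : ∀ τ : Fin t, σ₁.nat 10 τ = n (ρ τ) := fun τ => by
      rw [(hsw τ τ.2).1, hρv, hn]
    have hcells : stride (σ₁.nat 10) t = cells n := by
      rw [cells_eq _ (n ∘ ρ) hn10, cells_comp]
    rw [← hcells]
    refine Ex.seq₀ (setupStrides_spec σ₁ t _ rfl h20) fun σ₂ a₂ h₂ => ?_
    obtain ⟨h13, h22, h23⟩ := h₂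
    have e10 : σ₂.nat 10 = σ₁.nat 10 := a₂.nat 10 rfl
    have e11 : σ₂.nat 11 = σ₁.nat 11 := a₂.nat 11 rfl
    have e20 : σ₂.nat 20 0 = t := by rw [a₂.nat 20 rfl, h20]
    have e15 : σ₂.nat 15 = σ.nat 15 := (a₂.nat 15 rfl).trans (a₁.nat 15 rfl)
    have e16 : σ₂.nat 16 = σ.nat 16 := (a₂.nat 16 rfl).trans (a₁.nat 16 rfl)
    refine (setupCells_spec σ₂ t (σ₁.nat 10) (σ₁.nat 11) ht e10 e11 e20 h22 (fun τ h => (h13 τ h).1)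
      (by simpa [e15] using h15) (by rw [e16, h16])).mono le_rfl le_rfl fun σ₃ a₃ h₃ => ?_
    have f10 : σ₃.nat 10 = σ₁.nat 10 := (a₃.nat 10 rfl).trans e10
    have f11 : σ₃.nat 11 = σ₁.nat 11 := (a₃.nat 11 rfl).trans e11
    have f12 : σ₃.nat 12 = σ₁.nat 12 := (a₃.nat 12 rfl).trans (a₂.nat 12 rfl)
    have f13 : σ₃.nat 13 = σ₂.nat 13 := a₃.nat 13 rfl
    have f14 : σ₃.nat 14 = σ₂.nat 14 := a₃.nat 14 rfl
    refine ⟨ρ, fun τ => ?_, ?_, fun τ => ?_⟩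
    · have := hmax τ τ.2
      rw [hn τ, show b = ((⟨b, hb⟩ : Fin t) : ℕ) from rfl, hn] at this
      rwa [hρ, Equiv.swap_apply_right]
    · rw [f10, f11]
      refine ⟨f10, f11, ?_, ?_, ?_, ?_, ?_, ?_, h₃.1, h₃.2⟩
      · rw [a₃.nat 20 rfl, e20]
      · rw [a₃.nat 21 rfl, a₂.nat 21 rfl, h21]
      · intro τ h; rw [f13]; exact (h13 τ h).1
      · intro τ h; rw [f14]; exact (h13 τ h).2
      · rw [a₃.nat 22 rfl, h22]
      · rw [a₃.nat 23 rfl, h23]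
    · rw [f10, f11, f12]
      obtain ⟨j1, j2, j3⟩ := hsw τ τ.2
      exact ⟨hn10 τ, by rw [j2, hρv, ha], by rw [j3, hρv]⟩
  · have h2 : 0 < cells n := Finset.prod_pos fun _ _ => Nat.succ_pos _
    have h3 : t ≤ t * cells n := Nat.le_mul_of_pos_right _ h2
    omega

/-! ### The program for the dynamic program -/

theorem Ex.forT {O : ℕ → ℝ → Prop} {b : Test} {p : Prog} {σ : State} (N : ℕ) (T : ℕ → ℕ)
    (I : ℕ → State → Prop) (h0 : I 0 σ)
    (hb : ∀ k < N, ∀ σ', Agree p σ σ' → I k σ' → b.holds σ' ∧ Ex O p σ' (T k) 0 (I (k + 1)))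
    (he : ∀ σ', Agree p σ σ' → I N σ' → ¬ b.holds σ') (hc : b.cost ≤ 20 := by decide) :
    Ex O (.loop b p) σ (∑ i ∈ Finset.range N, (T i + 20) + 20) 0 (I N) := by
  simpa using Ex.for (O := O) N T I h0 hb he hc

/-- The number of segments of the chain that end at distance at most `y`. -/
def cnt (P : Perimeter) (i : ℕ) (y : ℝ) : ℕ :=
  ((Finset.range P.q).filter fun r => segEnd P i r ≤ y).card

section Cnt
variable (P : Perimeter) (i : ℕ)

theorem cnt_le (y : ℝ) : cnt P i y ≤ P.q :=
  (Finset.card_filter_le _ _).trans (Finset.card_range _).le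

theorem lt_cnt_iff {y : ℝ} {r : ℕ} : r < cnt P i y ↔ r < P.q ∧ segEnd P i r ≤ y := by
  have key : ∀ N, ∀ r, r < ((Finset.range N).filter fun r => segEnd P i r ≤ y).card ↔
      r < N ∧ segEnd P i r ≤ y := by
    intro N
    induction N with
    | zero => simp
    | succ N ih =>
      intro r
      rw [Finset.range_add_one, Finset.filter_insert]
      split_ifs with h
      · have hall : (Finset.range N).filter (fun r => segEnd P i r ≤ y) = Finset.range N := by
          refine Finset.filter_true_of_mem fun r hr => ?_
          exact (P.segEnd_mono i (Finset.mem_range.1 hr).le).trans h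
        rw [hall, Finset.card_insert_of_notMem (by simp), Finset.card_range]
        refine ⟨fun h' => ⟨h', (P.segEnd_mono i (by omega)).trans h⟩, fun h' => h'.1⟩
      · rw [ih]
        refine and_congr_left fun h' => ⟨fun h'' => by omega, fun h'' => ?_⟩
        rcases Nat.lt_succ_iff_lt_or_eq.1 h'' with h3 | rfl
        · exact h3
        · exact absurd h' h
  exact key P.q r

theorem cnt_mono {y y' : ℝ} (h : y ≤ y') : cnt P i y ≤ cnt P i y' :=
  Finset.card_le_card fun r hr => by
    rw [Finset.mem_filter] at hr ⊢; exact ⟨hr.1, hr.2.trans h⟩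

theorem inc_eq {L x : ℝ} (h : 0 ≤ L + x) : inc P i L x =
    if L + x ≤ segStart P i (cnt P i (L + x)) then segStart P i (cnt P i (L + x)) else L + x := by
  have h1 : segStart P i (cnt P i (L + x)) ≤ inc P i L x := by
    rcases Nat.eq_zero_or_pos (cnt P i (L + x)) with h0 | h0
    · rw [h0, P.segStart_zero]; exact h.trans (add_le_inc P i L x)
    · obtain ⟨h2, h3⟩ := (lt_cnt_iff P i (y := L + x) (r := cnt P i (L + x) - 1)).1 (by omega)
      have := segStart_le_inc P i h2 h3
      rwa [Nat.sub_add_cancel h0] at this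
  rcases inc_cases P i L x with e | ⟨r, hr, h2, h3, e⟩
  · split_ifs with h'
    · exact le_antisymm (e.trans_le h') h1
    · exact e
  · have h4 : segStart P i (r + 1) ≤ segStart P i (cnt P i (L + x)) :=
      P.segStart_mono i ((lt_cnt_iff P i).2 ⟨hr, h2⟩)
    rw [if_pos (h3.trans h4)]
    exact le_antisymm (e.trans_le h4) h1

end Cnt

/-- The memory holds perimeter `P`, whose lengths begin at cell `off`, and the starting segment. -/
structure AtPerim (P : Perimeter) (off i : ℕ) (σ : State) : Prop where
  q_eq : σ.nat 24 0 = P.q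
  off_eq : σ.nat 25 0 = off
  start_eq : σ.nat 26 0 = i
  seg_eq : ∀ r < P.q, σ.real 1 (off + r) = len (P.seg r)
  gap_eq : ∀ r < P.q, σ.real 2 (off + r) = len (P.gap r)

theorem AtPerim.of_eq {P : Perimeter} {off i : ℕ} {σ σ' : State} (h : AtPerim P off i σ)
    (h1 : σ'.nat 24 = σ.nat 24) (h2 : σ'.nat 25 = σ.nat 25) (h3 : σ'.nat 26 = σ.nat 26)
    (h4 : σ'.real 1 = σ.real 1) (h5 : σ'.real 2 = σ.real 2) : AtPerim P off i σ' :=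
  ⟨by rw [h1, h.q_eq], by rw [h2, h.off_eq], by rw [h3, h.start_eq], by rw [h4]; exact h.seg_eq,
    by rw [h5]; exact h.gap_eq⟩

/-- Distances of the ends of segments from the start of the chain. -/
def dpPrefix : Prog :=
  (nset 31 0 ;; nset 34 (nv 26) ;; .setReal 12 0 0) ;;
  .loop (natLt (nv 31) (nv 24)) (
    .setReal 13 (nv 31) (.get 12 (nv 31) + .get 1 (nv 25 + nv 34)) ;;
    .setReal 12 (nv 31 + 1) (.get 13 (nv 31) + .get 2 (nv 25 + nv 34)) ;;
    nset 34 (nv 34 + 1) ;;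
    .cond (.natLe (nv 24) (nv 34)) (nset 34 0) .skip ;;
    nset 31 (nv 31 + 1))

theorem seg_mod (P : Perimeter) (r : ℕ) : P.seg (r % P.q) = P.seg r := by
  have h : P.idx (r % P.q) = P.idx r := Fin.ext (Nat.mod_mod _ _)
  simp only [Perimeter.seg, h]

theorem gap_mod (P : Perimeter) (r : ℕ) : P.gap (r % P.q) = P.gap r := by
  have h : P.idx (r % P.q) = P.idx r := Fin.ext (Nat.mod_mod _ _)
  simp only [Perimeter.gap, Perimeter.nextLeft, h]

theorem dpPrefix_spec {O : ℕ → ℝ → Prop} {σ : State} {P : Perimeter} {off i : ℕ}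
    (h : AtPerim P off i σ) (hi : i < P.q) :
    Ex O dpPrefix σ (120 * P.q + 50) 0 (fun σ' => (∀ r ≤ P.q, σ'.real 12 r = segStart P i r) ∧
      ∀ r < P.q, σ'.real 13 r = segEnd P i r) := by
  obtain ⟨hq, hoff, hst, hseg, hgap⟩ := h
  refine Ex.time (Ex.flat_seq 20 fun σ₁ e₁ a₁ => (Ex.for₀ P.q 90
    (fun k σ' => σ'.nat 31 0 = k ∧ σ'.nat 34 0 = (i + k) % P.q ∧
      (∀ r ≤ k, σ'.real 12 r = segStart P i r) ∧ ∀ r < k, σ'.real 13 r = segEnd P i r)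
    ?_ ?_ ?_).mono le_rfl le_rfl fun σ' _ h => ⟨h.2.2.1, h.2.2.2⟩) (by omega)
  · simp [e₁, Prog.sem, hst, P.segStart_zero, Nat.mod_eq_of_lt hi]
  · rintro k hk σ' a' ⟨i1, i2, i3, i4⟩
    have e24 : σ'.nat 24 0 = P.q := by rw [a'.nat 24 rfl, a₁.nat 24 rfl, hq]
    have e25 : σ'.nat 25 0 = off := by rw [a'.nat 25 rfl, a₁.nat 25 rfl, hoff]
    have hm := Nat.mod_lt (i + k) P.q_pos
    have r1 : σ'.real 1 (off + (i + k) % P.q) = len (P.seg (i + k)) := by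
      rw [a'.real 1 rfl, a₁.real 1 rfl, hseg _ hm, seg_mod]
    have r2 : σ'.real 2 (off + (i + k) % P.q) = len (P.gap (i + k)) := by
      rw [a'.real 2 rfl, a₁.real 2 rfl, hgap _ hm, gap_mod]
    have hs : segStart P i (k + 1) = segEnd P i k + len (P.gap (i + k)) := by
      unfold segEnd segStart; rw [Finset.sum_range_succ]; ring
    have he : segEnd P i k = segStart P i k + len (P.seg (i + k)) := rfl
    have hmod : (i + (k + 1)) % P.q =
        if P.q ≤ (i + k) % P.q + 1 then 0 else (i + k) % P.q + 1 := by
      split_ifs with h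
      · have h1 := Nat.div_add_mod (i + k) P.q
        have h2 : i + (k + 1) = P.q * ((i + k) / P.q + 1) := by rw [mul_add]; omega
        rw [h2, Nat.mul_mod_right]
      · rw [← add_assoc, ← Nat.mod_add_mod, Nat.mod_eq_of_lt (by omega)]
    refine ⟨by simp [i1, e24, hk], Ex.flat ?_⟩
    simp [Prog.wp, i1, i2, e24, e25, r1, r2, i3 k le_rfl, Function.update_apply, hs, ← he]
    refine ⟨fun h => ⟨by rw [hmod, if_pos h], fun r hr => ?_, fun r hr => ?_⟩,
      fun h => ⟨by rw [hmod, if_neg (by omega)], fun r hr => ?_, fun r hr => ?_⟩⟩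
    · split_ifs with e
      · rw [e, hs]
      · exact i3 r (by omega)
    · split_ifs with e
      · rw [e]
      · exact i4 r (by omega)
    · split_ifs with e
      · rw [e, hs]
      · exact i3 r (by omega)
    · split_ifs with e
      · rw [e]
      · exact i4 r (by omega)
  · rintro σ' a' ⟨i1, -⟩
    have e24 : σ'.nat 24 0 = P.q := by rw [a'.nat 24 rfl, a₁.nat 24 rfl, hq]
    simp [i1, e24]

/-- Entry for cell `c` and type `τ`: move the pointer of the line and update the maximum. -/
def dpStep : Prog :=
  .cond (.natLe 1 (.get 15 (nv 33 + nv 30)))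
    ((rset 21 (.get 11 (nv 32 - .get 13 (nv 30)) + .get 10 (nv 30)) ;;
      nset 36 (.get 17 (nv 33 + nv 30 - .get 14 (nv 30)))) ;;
     .loop (.and (natLt (nv 36) (nv 24)) (.realLe (.get 13 (nv 36)) (rv 21)))
       (nset 36 (nv 36 + 1)) ;;
     (.setNat 17 (nv 33 + nv 30) (nv 36) ;;
      .cond (.realLe (rv 21) (.get 12 (nv 36))) (rset 21 (.get 12 (nv 36))) .skip ;;
      .cond (.realLe (rv 20) (rv 21)) (rset 20 (rv 21) ;; nset 35 (nv 30)) .skip))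
    (.setNat 17 (nv 33 + nv 30) 0)

/-- The table of the dynamic program. -/
def dpMain : Prog :=
  (nset 32 0 ;; nset 33 0) ;;
  .loop (natLt (nv 32) (nv 22)) (
    (rset 20 0 ;; nset 35 (nv 20) ;; nset 30 0) ;;
    .loop (natLt (nv 30) (nv 20)) (dpStep ;; nset 30 (nv 30 + 1)) ;;
    (.setReal 11 (nv 32) (rv 20) ;; .setNat 18 (nv 32) (nv 35) ;;
     nset 32 (nv 32 + 1) ;; nset 33 (nv 33 + nv 20)))

/-- The table entry for cell `c`. -/
def tab (P : Perimeter) (i t : ℕ) (n : ℕ → ℕ) (cap : ℕ → ℝ) (c : ℕ) : ℝ :=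
  dp P i (fun τ : Fin t => cap τ) (vec n t c)

/-- The final position of the pointer for cell `c` and type `τ`. -/
def ptr (P : Perimeter) (i t : ℕ) (n : ℕ → ℕ) (cap : ℕ → ℝ) (c τ : ℕ) : ℕ :=
  if digit n c τ = 0 then 0 else cnt P i (tab P i t n cap (c - stride n τ) + cap τ)

/-- The choice `τ` attains the maximum for cell `c`. -/
def IsChoice (P : Perimeter) (i t : ℕ) (n : ℕ → ℕ) (cap : ℕ → ℝ) (c τ : ℕ) : Prop :=
  τ < t ∧ digit n c τ ≠ 0 ∧
    tab P i t n cap c = inc P i (tab P i t n cap (c - stride n τ)) (cap τ)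

section Tab
variable {P : Perimeter} {i t : ℕ} {n : ℕ → ℕ} {cap : ℕ → ℝ}

theorem tab_nonneg (c : ℕ) : 0 ≤ tab P i t n cap c := dp_nonneg _ _ _ _

theorem inc_tab_le {c τ : ℕ} (hτ : τ < t) (h : digit n c τ ≠ 0) :
    inc P i (tab P i t n cap (c - stride n τ)) (cap τ) ≤ tab P i t n cap c := by
  have := inc_dp_le P i (fun τ : Fin t => cap τ) (x := vec n t c) (τ := ⟨τ, hτ⟩) h
  rwa [← vec_sub (τ := ⟨τ, hτ⟩) n h] at this

theorem tab_zero : tab P i t n cap 0 = 0 := by unfold tab; rw [vec_zero, dp_zero]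

variable (hcap : ∀ τ < t, 0 ≤ cap τ)
include hcap

theorem exists_isChoice {c : ℕ} (hc : c < stride n t) (h0 : c ≠ 0) :
    ∃ τ, IsChoice P i t n cap c τ := by
  obtain ⟨τ, hτ, h⟩ := exists_digit_ne_zero n hc h0
  obtain ⟨τ', h1, h2⟩ := exists_dp_eq P i (cap := fun τ : Fin t => cap τ) (fun τ => hcap τ τ.2)
    (x := vec n t c) (fun e => h (congrFun e ⟨τ, hτ⟩))
  refine ⟨τ', τ'.2, h1, ?_⟩
  unfold tab
  rw [h2, vec_sub n h1]

theorem ptr_mono {c τ : ℕ} (hτ : τ < t) (h : digit n c τ ≠ 0) :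
    ptr P i t n cap (c - stride n τ) τ ≤ ptr P i t n cap c τ := by
  unfold ptr
  rw [if_neg h]
  split_ifs with h'
  · exact Nat.zero_le _
  · refine cnt_mono P i ?_
    have h1 := inc_tab_le (P := P) (i := i) (cap := cap) hτ h'
    have h2 := add_le_inc P i (tab P i t n cap (c - stride n τ - stride n τ)) (cap τ)
    linarith [hcap τ hτ]

theorem dpStep_spec {O : ℕ → ℝ → Prop} {σ : State} {m off : ℕ} {a : ℕ → ℕ} (hr : Ready t m n a σ)
    (hP : AtPerim P off i σ) (hcap' : ∀ τ < t, σ.real 10 τ = cap τ)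
    (hst : ∀ r ≤ P.q, σ.real 12 r = segStart P i r) (hen : ∀ r < P.q, σ.real 13 r = segEnd P i r)
    {c k : ℕ} (hc : c < stride n t) (hk : k < t) (h32 : σ.nat 32 0 = c) (h33 : σ.nat 33 0 = c * t)
    (h30 : σ.nat 30 0 = k) (htab : ∀ c' < c, σ.real 11 c' = tab P i t n cap c')
    (hptr : ∀ c' < c, ∀ τ < t, σ.nat 17 (c' * t + τ) = ptr P i t n cap c' τ) :
    Ex O dpStep σ (200 + 40 * (if digit n c k = 0 then 0 else
      ptr P i t n cap c k - ptr P i t n cap (c - stride n k) k)) 0 (fun σ' =>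
        σ'.nat 17 = Function.update (σ.nat 17) (c * t + k) (ptr P i t n cap c k) ∧
        ((digit n c k = 0 ∧ σ'.real 20 0 = σ.real 20 0 ∧ σ'.nat 35 0 = σ.nat 35 0) ∨
         (digit n c k ≠ 0 ∧
          σ.real 20 0 ≤ inc P i (tab P i t n cap (c - stride n k)) (cap k) ∧
          σ'.real 20 0 = inc P i (tab P i t n cap (c - stride n k)) (cap k) ∧ σ'.nat 35 0 = k) ∨
         (digit n c k ≠ 0 ∧
          inc P i (tab P i t n cap (c - stride n k)) (cap k) < σ.real 20 0 ∧
          σ'.real 20 0 = σ.real 20 0 ∧ σ'.nat 35 0 = σ.nat 35 0))) := by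
  have h15 := hr.digit_eq c hc k hk
  have h13 := hr.stride_eq k hk.le
  have h14 := hr.tstride_eq k hk.le
  refine Ex.time (Ex.cond (T := 180 + 40 * (if digit n c k = 0 then 0 else
      ptr P i t n cap c k - ptr P i t n cap (c - stride n k) k)) (fun hd => ?_)
      fun hd => ?_) (by omega)
  · have hd' : digit n c k ≠ 0 := by
      simp [h33, h30, h15] at hd; omega
    have hs := stride_pos n k
    have hle := stride_le_of_digit n hd'
    set y := tab P i t n cap (c - stride n k) + cap k with hy
    have hy0 : 0 ≤ y := add_nonneg (tab_nonneg _) (hcap k hk)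
    set p₀ := ptr P i t n cap (c - stride n k) k with hp₀
    have hpc : ptr P i t n cap c k = cnt P i y := by unfold ptr; rw [if_neg hd']
    have hpm : p₀ ≤ cnt P i y := hpc ▸ ptr_mono hcap hk hd'
    rw [if_neg hd', hpc]
    have hcq := cnt_le P i y
    refine Ex.time (Ex.flat_seq 40 fun σ₁ e₁ a₁ => Ex.seq₀ (Ex.for₀
      (cnt P i y - p₀) 20 (fun k σ' => σ'.nat 36 0 = p₀ + k) ?_ ?_ ?_)
      fun σ₂ a₂ h₂ => Ex.flat (T := 100) ?_) ?_
    · have h1 : c * t + k - stride n k * t = (c - stride n k) * t + k := by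
        rw [Nat.sub_mul]
        have := Nat.mul_le_mul_right t hle
        omega
      simp [e₁, Prog.sem, h30, h33, h14]
      rw [h1, hptr _ (by omega) _ hk]
    · intro j hj σ' a' hI
      have f24 : σ'.nat 24 0 = P.q := by rw [a'.nat 24 rfl, a₁.nat 24 rfl, hP.q_eq]
      have f13 : σ'.real 13 = σ.real 13 := (a'.real 13 rfl).trans (a₁.real 13 rfl)
      have f21 : σ'.real 21 0 = y := by
        rw [a'.real 21 rfl, e₁]
        simp [Prog.sem, h30, h32, h13, htab _ (show c - stride n k < c by omega), hcap' k hk, hy]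
      obtain ⟨b1, b2⟩ := (lt_cnt_iff P i).1 (show p₀ + j < cnt P i y by omega)
      refine ⟨by simp [hI, f24, f13, f21, hen _ b1, b1, b2], Ex.flat ?_⟩
      simp [Prog.wp, hI]; omega
    · intro σ' a' hI
      have f24 : σ'.nat 24 0 = P.q := by rw [a'.nat 24 rfl, a₁.nat 24 rfl, hP.q_eq]
      have f13 : σ'.real 13 = σ.real 13 := (a'.real 13 rfl).trans (a₁.real 13 rfl)
      have f21 : σ'.real 21 0 = y := by
        rw [a'.real 21 rfl, e₁]
        simp [Prog.sem, h30, h32, h13, htab _ (show c - stride n k < c by omega), hcap' k hk, hy]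
      rw [show p₀ + (cnt P i y - p₀) = cnt P i y by omega] at hI
      have := mt (lt_cnt_iff P i (r := cnt P i y) (y := y)).2 (lt_irrefl _)
      simp only [Test.holds_and, Test.holds_not, Test.holds_natLe, Test.holds_realLe,
        NatExp.eval_get, NatExp.eval_lit, RealExp.eval_get, hI, f24, f13, f21]
      intro hcon
      have hlt : cnt P i y < P.q := not_le.1 hcon.1
      rw [hen _ hlt] at hcon
      exact this ⟨hlt, hcon.2⟩
    · rw [show p₀ + (cnt P i y - p₀) = cnt P i y by omega] at h₂
      have f12 : σ₂.real 12 = σ.real 12 := (a₂.real 12 rfl).trans (a₁.real 12 rfl)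
      have f20 : σ₂.real 20 = σ.real 20 := (a₂.real 20 rfl).trans (a₁.real 20 rfl)
      have f21 : σ₂.real 21 0 = y := by
        rw [a₂.real 21 rfl, e₁]
        simp [Prog.sem, h30, h32, h13, htab _ (show c - stride n k < c by omega), hcap' k hk, hy]
      have f33 : σ₂.nat 33 0 = c * t := by rw [a₂.nat 33 rfl, a₁.nat 33 rfl, h33]
      have f30 : σ₂.nat 30 0 = k := by rw [a₂.nat 30 rfl, a₁.nat 30 rfl, h30]
      have f17 : σ₂.nat 17 = σ.nat 17 := (a₂.nat 17 rfl).trans (a₁.nat 17 rfl)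
      have f35 : σ₂.nat 35 = σ.nat 35 := (a₂.nat 35 rfl).trans (a₁.nat 35 rfl)
      have hinc := inc_eq P i (L := tab P i t n cap (c - stride n k)) (x := cap k) hy0
      rw [← hy] at hinc
      simp [Prog.wp, h₂, f12, f20, f21, f33, f30, f17, f35, hst _ hcq, hd']
      refine ⟨fun h => ?_, fun h => ?_⟩
      · rw [if_pos h] at hinc
        rw [← hinc]
        exact ⟨fun h => Or.inl ⟨h, rfl⟩, fun h => Or.inr h⟩
      · rw [if_neg (not_le.2 h)] at hinc
        rw [← hinc]
        exact ⟨fun h => Or.inl ⟨h, rfl⟩, fun h => Or.inr h⟩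
    · omega
  · have hd' : digit n c k = 0 := by
      simp [h33, h30, h15] at hd; omega
    refine Ex.flat (hT := le_trans (by decide : _ ≤ 180) (by omega)) ?_
    simp [Prog.wp, h33, h30, hd', ptr]

theorem dpMain_spec {O : ℕ → ℝ → Prop} {σ : State} {m off : ℕ} {a : ℕ → ℕ} (ht : 1 ≤ t)
    (hr : Ready t m n a σ) (hP : AtPerim P off i σ) (hcap' : ∀ τ < t, σ.real 10 τ = cap τ)
    (hst : ∀ r ≤ P.q, σ.real 12 r = segStart P i r)
    (hen : ∀ r < P.q, σ.real 13 r = segEnd P i r) :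
    Ex O dpMain σ (500 * (t * stride n t) + 40 * (P.q * ∑ τ ∈ Finset.range t, face n t τ) + 50) 0
      (fun σ' => (∀ c < stride n t, σ'.real 11 c = tab P i t n cap c) ∧
        ∀ c < stride n t, c ≠ 0 → IsChoice P i t n cap c (σ'.nat 18 c)) := by
  set g : ℕ → ℕ → ℕ := fun c k => if digit n c k = 0 then 0 else
      ptr P i t n cap c k - ptr P i t n cap (c - stride n k) k with hg
  refine Ex.time (Ex.flat_seq 20 fun σ₁ e₁ a₁ => (Ex.forT (stride n t)
    (fun c => 20 + ((∑ k ∈ Finset.range t, (200 + 40 * g c k + 20 + 20) + 20) + 40))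
    (fun c σ' => σ'.nat 32 0 = c ∧ σ'.nat 33 0 = c * t ∧
      (∀ c' < c, σ'.real 11 c' = tab P i t n cap c') ∧
      (∀ c' < c, ∀ τ < t, σ'.nat 17 (c' * t + τ) = ptr P i t n cap c' τ) ∧
      ∀ c' < c, c' ≠ 0 → IsChoice P i t n cap c' (σ'.nat 18 c'))
    ?_ ?_ ?_).mono le_rfl le_rfl fun σ' _ h => ⟨h.2.2.1, h.2.2.2.2⟩) ?_
  · simp [e₁, Prog.sem]
  · rintro c hc σ' a' ⟨i1, i2, i3, i4, i5⟩
    have hr' : Ready t m n a σ' := (hr.agree a₁).agree a'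
    refine ⟨by simp [i1, hr'.cells_eq, hc], ?_⟩
    refine Ex.flat_seq 20 fun σ₃ e₃ a₃ => Ex.seq₀ (Ex.forT t _
      (fun k σ' => σ'.nat 30 0 = k ∧
        (∀ c' < c, ∀ τ < t, σ'.nat 17 (c' * t + τ) = ptr P i t n cap c' τ) ∧
        (∀ τ < k, σ'.nat 17 (c * t + τ) = ptr P i t n cap c τ) ∧
        (∀ τ < k, digit n c τ ≠ 0 →
          inc P i (tab P i t n cap (c - stride n τ)) (cap τ) ≤ σ'.real 20 0) ∧
        ((σ'.real 20 0 = 0 ∧ ∀ τ < k, digit n c τ = 0) ∨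
          (σ'.nat 35 0 < k ∧ digit n c (σ'.nat 35 0) ≠ 0 ∧ σ'.real 20 0 =
            inc P i (tab P i t n cap (c - stride n (σ'.nat 35 0))) (cap (σ'.nat 35 0)))))
      ?_ ?_ ?_)
      fun σ₄ a₄ h₄ => Ex.flat (T := 40) ?_
    · have f17 : σ₃.nat 17 = σ'.nat 17 := a₃.nat 17 rfl
      refine ⟨by simp [e₃, Prog.sem], by rw [f17]; exact i4, by simp, by simp, Or.inl ⟨?_, by simp⟩⟩
      simp [e₃, Prog.sem]
    · rintro k hk σ₅ a₅ ⟨j1, j2, j3, j4, j5⟩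
      have hr₃ := hr'.agree a₃
      have hr₅ := hr₃.agree a₅
      have f10 : σ₅.real 10 = σ.real 10 := by
        rw [a₅.real 10 rfl, a₃.real 10 rfl, a'.real 10 rfl, a₁.real 10 rfl]
      have f12 : σ₅.real 12 = σ.real 12 := by
        rw [a₅.real 12 rfl, a₃.real 12 rfl, a'.real 12 rfl, a₁.real 12 rfl]
      have f13 : σ₅.real 13 = σ.real 13 := by
        rw [a₅.real 13 rfl, a₃.real 13 rfl, a'.real 13 rfl, a₁.real 13 rfl]
      have f11 : σ₅.real 11 = σ'.real 11 := by rw [a₅.real 11 rfl, a₃.real 11 rfl]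
      have hP₅ : AtPerim P off i σ₅ := by
        refine hP.of_eq ?_ ?_ ?_ ?_ ?_
        · rw [a₅.nat 24 rfl, a₃.nat 24 rfl, a'.nat 24 rfl, a₁.nat 24 rfl]
        · rw [a₅.nat 25 rfl, a₃.nat 25 rfl, a'.nat 25 rfl, a₁.nat 25 rfl]
        · rw [a₅.nat 26 rfl, a₃.nat 26 rfl, a'.nat 26 rfl, a₁.nat 26 rfl]
        · rw [a₅.real 1 rfl, a₃.real 1 rfl, a'.real 1 rfl, a₁.real 1 rfl]
        · rw [a₅.real 2 rfl, a₃.real 2 rfl, a'.real 2 rfl, a₁.real 2 rfl]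
      have f32 : σ₅.nat 32 0 = c := by rw [a₅.nat 32 rfl, a₃.nat 32 rfl, i1]
      have f33 : σ₅.nat 33 0 = c * t := by rw [a₅.nat 33 rfl, a₃.nat 33 rfl, i2]
      refine ⟨by simp [j1, hr₅.t_eq, hk], Ex.seq₀ (dpStep_spec hcap hr₅ hP₅ (by rwa [f10])
        (by rwa [f12]) (by rwa [f13]) hc hk f32 f33 j1 (by rwa [f11]) j2) fun σ₆ a₆ h₆ =>
        Ex.flat (T := 20) ?_⟩
      obtain ⟨u1, u2⟩ := h₆
      have g30 : σ₆.nat 30 0 = k := by rw [a₆.nat 30 rfl, j1]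
      simp only [Prog.wp, State.setNat_nat, State.setNat_real, NatExp.eval_lit, NatExp.eval_add,
        NatExp.eval_get, NatExp.eval_one, g30, Nat.reduceEqDiff, if_true, if_false,
        Function.update_self, u1]
      refine ⟨trivial, ?_, ?_, ?_, ?_⟩
      · intro c' hc' τ hτ
        have : (c' + 1) * t ≤ c * t := Nat.mul_le_mul_right t hc'
        rw [Nat.succ_mul] at this
        rw [Function.update_of_ne (by omega), j2 c' hc' τ hτ]
      · intro τ hτ
        by_cases e : τ = k
        · rw [e, Function.update_self]
        · rw [Function.update_of_ne (by omega), j3 τ (by omega)]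
      · intro τ hτ hd
        rcases Nat.lt_succ_iff_lt_or_eq.1 hτ with h | rfl
        · have := j4 τ h hd
          rcases u2 with ⟨-, e, -⟩ | ⟨-, e', e, -⟩ | ⟨-, e', e, -⟩
          · rwa [e]
          · rw [e]; exact this.trans e'
          · rwa [e]
        · rcases u2 with ⟨e, -⟩ | ⟨-, -, e, -⟩ | ⟨-, e', e, -⟩
          · exact absurd e hd
          · rw [e]
          · rw [e]; exact e'.le
      · rcases u2 with ⟨hd, e, e'⟩ | ⟨hd, -, e, e'⟩ | ⟨hd, hlt, e, e'⟩
        · rw [e, e']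
          rcases j5 with ⟨j, j'⟩ | ⟨j, j'⟩
          · refine Or.inl ⟨j, fun τ hτ => ?_⟩
            rcases Nat.lt_succ_iff_lt_or_eq.1 hτ with h | rfl
            · exact j' τ h
            · exact hd
          · exact Or.inr ⟨by omega, j'⟩
        · rw [e, e']
          exact Or.inr ⟨by omega, hd, rfl⟩
        · rw [e, e']
          rcases j5 with ⟨j, j'⟩ | ⟨j, j'⟩
          · rw [j] at hlt
            have := add_le_inc P i (tab P i t n cap (c - stride n k)) (cap k)
            have := tab_nonneg (P := P) (i := i) (t := t) (n := n) (cap := cap) (c - stride n k)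
            linarith [hcap k hk]
          · exact Or.inr ⟨by omega, j'⟩
    · rintro σ₅ a₅ ⟨j1, -⟩
      have hr₅ := (hr'.agree a₃).agree a₅
      simp [j1, hr₅.t_eq]
    · obtain ⟨j1, j2, j3, j4, j5⟩ := h₄
      have hr₄ := (hr'.agree a₃).agree a₄
      have f32 : σ₄.nat 32 0 = c := by rw [a₄.nat 32 rfl, a₃.nat 32 rfl, i1]
      have f33 : σ₄.nat 33 0 = c * t := by rw [a₄.nat 33 rfl, a₃.nat 33 rfl, i2]
      have f11 : σ₄.real 11 = σ'.real 11 := by rw [a₄.real 11 rfl, a₃.real 11 rfl]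
      have f18 : σ₄.nat 18 = σ'.nat 18 := by rw [a₄.nat 18 rfl, a₃.nat 18 rfl]
      have hbest : σ₄.real 20 0 = tab P i t n cap c := by
        by_cases h0 : c = 0
        · rcases j5 with ⟨j, -⟩ | ⟨-, j, -⟩
          · rw [j, h0, tab_zero]
          · rw [h0, digit_zero] at j; exact absurd rfl j
        · obtain ⟨τ, hτ, hd, e⟩ := exists_isChoice (P := P) (i := i) hcap hc h0
          refine le_antisymm ?_ (e.trans_le (j4 τ hτ hd))
          rcases j5 with ⟨-, j⟩ | ⟨j, j', e'⟩
          · exact absurd (j τ hτ) hd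
          · rw [e']; exact inc_tab_le j j'
      simp only [Prog.wp, State.setNat_nat, State.setNat_real, State.setReal_real,
        State.setReal_nat, NatExp.eval_lit, NatExp.eval_add, RealExp.eval_get,
        NatExp.eval_get, NatExp.eval_one, f32, f33, f11, f18, hbest, hr₄.t_eq, Nat.reduceEqDiff,
        if_true, if_false, Function.update_self]
      refine ⟨trivial, by ring, ?_, ?_, ?_⟩
      · intro c' hc'
        by_cases e : c' = c
        · rw [e, Function.update_self]
        · rw [Function.update_of_ne e, i3 c' (by omega)]
      · intro c' hc' τ hτ
        by_cases e : c' = c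
        · rw [e]; exact j3 τ hτ
        · exact j2 c' (by omega) τ hτ
      · intro c' hc' h0
        by_cases e : c' = c
        · subst e
          rw [Function.update_self]
          rcases j5 with ⟨-, j⟩ | ⟨j, j', e'⟩
          · obtain ⟨τ, hτ, hd⟩ := exists_digit_ne_zero n hc h0
            exact absurd (j τ hτ) hd
          · exact ⟨j, j', hbest ▸ e'⟩
        · rw [Function.update_of_ne e]; exact i5 c' (by omega) h0
  · rintro σ' a' ⟨i1, -⟩
    have hr' : Ready t m n a σ' := (hr.agree a₁).agree a'
    simp [i1, hr'.cells_eq]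
  · have h1 : ∑ c ∈ Finset.range (stride n t), ∑ k ∈ Finset.range t, g c k ≤
        P.q * ∑ τ ∈ Finset.range t, face n t τ := by
      rw [Finset.sum_comm, Finset.mul_sum]
      refine Finset.sum_le_sum fun τ hτ => ?_
      rw [Finset.mem_range] at hτ
      refine sum_pointer_le n hτ (fun c => ptr P i t n cap c τ) (fun c => ?_) (fun c h => ?_)
        (fun c h => ptr_mono hcap hτ h)
      · unfold ptr; split_ifs
        · exact Nat.zero_le _
        · exact cnt_le _ _ _
      · unfold ptr; rw [if_pos h]
    have h2 : stride n t ≤ t * stride n t := Nat.le_mul_of_pos_left _ ht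
    have h3 : ∀ c, ∑ k ∈ Finset.range t, (200 + 40 * g c k + 20 + 20) =
        t * 240 + 40 * ∑ k ∈ Finset.range t, g c k := by
      intro c
      simp only [Finset.sum_add_distrib, ← Finset.mul_sum, Finset.sum_const, Finset.card_range,
        smul_eq_mul]
      ring
    simp only [h3]
    have h4 : ∑ c ∈ Finset.range (stride n t), (20 + (t * 240 + 40 * ∑ k ∈ Finset.range t, g c k +
        20 + 40) + 20) = stride n t * (t * 240 + 100) +
        40 * ∑ c ∈ Finset.range (stride n t), ∑ k ∈ Finset.range t, g c k := by
      simp only [Finset.sum_add_distrib, ← Finset.mul_sum, Finset.sum_const, Finset.card_range,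
        smul_eq_mul]
      ring
    rw [h4]
    nlinarith

end Tab

/-- The dynamic program for one perimeter and starting segment. -/
def dpRun : Prog := dpPrefix ;; dpMain

/-- What the dynamic program leaves in memory. -/
structure Solved (P : Perimeter) (i t : ℕ) (n : ℕ → ℕ) (cap : ℕ → ℝ) (σ : State) : Prop where
  st_eq : ∀ r ≤ P.q, σ.real 12 r = segStart P i r
  en_eq : ∀ r < P.q, σ.real 13 r = segEnd P i r
  tab_eq : ∀ c < stride n t, σ.real 11 c = tab P i t n cap c
  choice : ∀ c < stride n t, c ≠ 0 → IsChoice P i t n cap c (σ.nat 18 c)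

/-- Running time of the dynamic program. -/
def dpTime (q t : ℕ) (n : ℕ → ℕ) : ℕ :=
  500 * (t * stride n t) + 160 * (q * ∑ τ ∈ Finset.range t, face n t τ) + 100

theorem le_mul_sum_face (q : ℕ) {t : ℕ} (n : ℕ → ℕ) (ht : 1 ≤ t) :
    q ≤ q * ∑ τ ∈ Finset.range t, face n t τ := by
  refine Nat.le_mul_of_pos_right _ (lt_of_lt_of_le (face_pos n t 0) ?_)
  exact Finset.single_le_sum (f := face n t) (fun _ _ => Nat.zero_le _) (Finset.mem_range.2 ht)

theorem dpRun_spec {O : ℕ → ℝ → Prop} {P : Perimeter} {i t : ℕ} {n : ℕ → ℕ} {cap : ℕ → ℝ}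
    {σ : State} {m off : ℕ} {a : ℕ → ℕ} (ht : 1 ≤ t) (hcap : ∀ τ < t, 0 ≤ cap τ)
    (hr : Ready t m n a σ) (hP : AtPerim P off i σ) (hi : i < P.q)
    (hcap' : ∀ τ < t, σ.real 10 τ = cap τ) :
    Ex O dpRun σ (dpTime P.q t n) 0 (Solved P i t n cap) := by
  refine Ex.time (Ex.seq₀ (dpPrefix_spec hP hi) fun σ₁ a₁ h₁ =>
    (dpMain_spec (off := off) hcap ht (hr.agree a₁) ?_ ?_ h₁.1 h₁.2).mono le_rfl le_rfl
      fun σ₂ a₂ h₂ => ⟨?_, ?_, h₂.1, h₂.2⟩) ?_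
  · exact hP.of_eq (by rw [a₁.nat 24 rfl]) (by rw [a₁.nat 25 rfl]) (by rw [a₁.nat 26 rfl])
      (by rw [a₁.real 1 rfl]) (by rw [a₁.real 2 rfl])
  · rwa [a₁.real 10 rfl]
  · rw [a₂.real 12 rfl]; exact h₁.1
  · rw [a₂.real 13 rfl]; exact h₁.2
  · have := le_mul_sum_face P.q n ht
    unfold dpTime
    omega

/-! ### The feasibility test and the decision problem for one perimeter -/

theorem finSigmaFinEquiv_val {m : ℕ} (q : Fin m → ℕ) (k : Fin m) (r : Fin (q k)) :
    (finSigmaFinEquiv ⟨k, r⟩ : ℕ) = ∑ k' ∈ Finset.range k, pad q k' + r := by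
  rw [finSigmaFinEquiv_apply, Finset.sum_range]
  congr 1
  refine Finset.sum_congr rfl fun k' _ => ?_
  have h : (k' : ℕ) < m := k'.2.trans k.2
  simp only [pad, h, dif_pos]
  rfl

theorem pad_val {α : Type} [Zero α] {N : ℕ} (f : Fin N → α) (j : Fin N) : pad f j = f j := by
  simp [pad]

theorem sum_range_pad {M : Type} [AddCommMonoid M] {N : ℕ} (f : Fin N → M) :
    ∑ k ∈ Finset.range N, pad f k = ∑ k, f k := by
  rw [Finset.sum_range]
  exact Finset.sum_congr rfl fun k _ => pad_val f k

/-- The cell at which the lengths of the `k`-th perimeter begin. -/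
def offset {m : ℕ} (P : Fin m → Perimeter) (k : ℕ) : ℕ :=
  ∑ k' ∈ Finset.range k, pad (fun k => (P k).q) k'

section Input
variable {m t : ℕ} (P : Fin m → Perimeter) (n a : Fin t → ℕ) (i : ℕ) (ℓ : ℝ)

theorem input_q (k : Fin m) : (input P n a i ℓ).nat 1 k = (P k).q := pad_val (fun k => (P k).q) k
theorem input_n (τ : Fin t) : (input P n a i ℓ).nat 2 τ = n τ := pad_val n τ
theorem input_a (τ : Fin t) : (input P n a i ℓ).nat 3 τ = a τ := pad_val a τ

theorem input_seg (k : Fin m) {r : ℕ} (hr : r < (P k).q) :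
    (input P n a i ℓ).real 1 (offset P k + r) = len ((P k).seg r) := by
  have h := finSigmaFinEquiv_val (fun k => (P k).q) k ⟨r, hr⟩
  rw [offset, ← h]
  show pad (fun j : Fin (∑ k, (P k).q) =>
    len ((P (finSigmaFinEquiv.symm j).1).seg (finSigmaFinEquiv.symm j).2)) _ = _
  rw [pad_val, Equiv.symm_apply_apply]

theorem input_gap (k : Fin m) {r : ℕ} (hr : r < (P k).q) :
    (input P n a i ℓ).real 2 (offset P k + r) = len ((P k).gap r) := by
  have h := finSigmaFinEquiv_val (fun k => (P k).q) k ⟨r, hr⟩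
  rw [offset, ← h]
  show pad (fun j : Fin (∑ k, (P k).q) =>
    len ((P (finSigmaFinEquiv.symm j).1).gap (finSigmaFinEquiv.symm j).2)) _ = _
  rw [pad_val, Equiv.symm_apply_apply]

theorem setup_input {O : ℕ → ℝ → Prop} (ht : 1 ≤ t) :
    Ex O setup (input P n a i ℓ) (700 * (t * cells n) + 300) 0 (fun σ' => ∃ ρ : Equiv.Perm (Fin t),
      (∀ τ, n τ ≤ n (ρ ⟨t - 1, by omega⟩)) ∧ Ready t m (σ'.nat 10) (σ'.nat 11) σ' ∧
      ∀ τ : Fin t, σ'.nat 10 τ = n (ρ τ) ∧ σ'.nat 11 τ = a (ρ τ) ∧ σ'.nat 12 τ = ρ τ) :=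
  setup_spec _ t m n a ht rfl rfl (input_n P n a i ℓ) (input_a P n a i ℓ) (fun _ => rfl) rfl

end Input

theorem tab_last {t : ℕ} {n' : ℕ → ℕ} {cap' : ℕ → ℝ} {n : Fin t → ℕ} {cap : Fin t → ℝ}
    {ρ : Equiv.Perm (Fin t)} (hn : ∀ τ : Fin t, n' τ = n (ρ τ))
    (hcap : ∀ τ : Fin t, cap' τ = cap (ρ τ)) (P : Perimeter) (i : ℕ) :
    tab P i t n' cap' (stride n' t - 1) = dp P i cap n := by
  have h1 : (fun τ : Fin t => cap' τ) = cap ∘ ρ := funext hcap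
  have h2 : (fun τ : Fin t => n' τ) = n ∘ ρ := funext hn
  rw [tab, vec_last, h1, h2, dp_comp]

/-- The largest lengths that the robots may guard for the ratio in real variable `22`. -/
def caps : Prog :=
  nset 30 0 ;; .loop (natLt (nv 30) (nv 20))
    (.setReal 10 (nv 30) (.ofNat (.get 11 (nv 30)) * rv 22) ;; nset 30 (nv 30 + 1))

theorem caps_spec {O : ℕ → ℝ → Prop} {σ : State} {t m : ℕ} {n a : ℕ → ℕ} (hr : Ready t m n a σ) :
    Ex O caps σ (70 * t + 40) 0 (fun σ' => ∀ τ < t, σ'.real 10 τ = a τ * σ.real 22 0) := by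
  refine Ex.time (Ex.flat_seq 20 fun σ₁ e₁ a₁ => (Ex.for₀ t 50
    (fun k σ' => σ'.nat 30 0 = k ∧ ∀ τ < k, σ'.real 10 τ = a τ * σ.real 22 0)
    ?_ ?_ ?_).mono le_rfl le_rfl fun σ' _ h => h.2) (by omega)
  · simp [e₁, Prog.sem]
  · rintro k hk σ' a' ⟨i1, i2⟩
    have hr' := (hr.agree a₁).agree a'
    have f22 : σ'.real 22 = σ.real 22 := (a'.real 22 rfl).trans (a₁.real 22 rfl)
    refine ⟨by simp [i1, hr'.t_eq, hk], Ex.flat ?_⟩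
    simp [Prog.wp, i1, hr'.a_eq, f22, Function.update_apply]
    intro τ hτ
    split_ifs with e
    · rw [e]
    · exact i2 τ (by omega)
  · rintro σ' a' ⟨i1, -⟩
    have hr' := (hr.agree a₁).agree a'
    simp [i1, hr'.t_eq]

/-- Is the chain covered? -/
def chainTest : Test := .realLe (.get 13 (nv 24 - 1)) (.get 11 (nv 22 - 1))

theorem chainTest_holds {P : Perimeter} {i t m : ℕ} {n a : ℕ → ℕ} {cap : ℕ → ℝ} {σ : State}
    (hr : Ready t m n a σ) (h : Solved P i t n cap σ) (hq : σ.nat 24 0 = P.q) :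
    chainTest.holds σ ↔ segEnd P i (P.q - 1) ≤ tab P i t n cap (stride n t - 1) := by
  have := P.q_pos
  have := stride_pos n t
  simp [chainTest, hq, hr.cells_eq, h.en_eq _ (show P.q - 1 < P.q by omega),
    h.tab_eq _ (show stride n t - 1 < stride n t by omega)]

/-- The preparations for one perimeter. -/
def onePerim (i : NatExp) : Prog := nset 24 (.get 1 0) ;; nset 25 0 ;; nset 26 i

/-- The feasibility test. -/
def feasProg : Prog :=
  setup ;; rset 22 (.get 0 0) ;; caps ;; onePerim (.get 0 2) ;; dpRun ;;
    .cond chainTest (nset 0 1) (nset 0 0)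

/-- The program for the decision problem with one perimeter. -/
def decideProg : Prog :=
  setup ;; rset 22 (.get 0 0) ;; caps ;; (onePerim 0 ;; nset 0 0) ;;
    .loop (natLt (nv 26) (nv 24))
      (dpRun ;; .cond chainTest (nset 0 1) .skip ;; nset 26 (nv 26 + 1))

theorem dpTime_eq {t q : ℕ} {n' : ℕ → ℕ} {n : Fin t → ℕ} {ρ : Equiv.Perm (Fin t)}
    (hn : ∀ τ : Fin t, n' τ = n (ρ τ)) :
    dpTime q t n' = 500 * (t * cells n) + 160 * (q * faces n) + 100 := by
  rw [dpTime, cells_eq _ (n ∘ ρ) hn, faces_eq _ (n ∘ ρ) hn, cells_comp, faces_comp]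

theorem cells_pos {t : ℕ} (n : Fin t → ℕ) : 0 < cells n := Finset.prod_pos fun _ _ => Nat.succ_pos _

theorem le_mul_cells {t : ℕ} (n : Fin t → ℕ) : t ≤ t * cells n :=
  Nat.le_mul_of_pos_right _ (cells_pos n)

theorem Ex.run {p : Prog} {σ : State} {T K : ℕ} {Q : State → Prop}
    (h : Ex (fun _ _ => False) p σ T K Q) : ∃ σ' s, Run p σ σ' s ∧ Q σ' ∧ s ≤ T := by
  obtain ⟨σ', s, c, he, hs, -, hq⟩ := h
  exact ⟨σ', s, ⟨c, he⟩, hq, hs⟩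

section One
variable {t : ℕ} (P : Perimeter) (n a : Fin t → ℕ)

theorem feasProg_spec (ht : 1 ≤ t) {i : ℕ} (hi : i < P.q) {ℓ : ℝ} (hℓ : 0 ≤ ℓ) :
    Ex (fun _ _ => False) feasProg (input (fun _ : Fin 1 => P) n a i ℓ)
      (2000 * (t * cells n + P.q * faces n)) 0 (fun σ => Answers σ (lrFeasible P n a i ℓ)) := by
  refine Ex.time (Ex.seq₀ (setup_input _ n a i ℓ ht) (T' := 100 + ((70 * t + 40) + (100 +
    ((500 * (t * cells n) + 160 * (P.q * faces n) + 100) + 60)))) fun σ₁ a₁ h₁ => ?_) ?_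
  · obtain ⟨ρ, -, hr, hsw⟩ := h₁
    set n' := σ₁.nat 10
    set a' := σ₁.nat 11
    refine Ex.flat_seq 100 fun σ₂ e₂ a₂ => ?_
    have hr₂ := hr.agree a₂
    refine Ex.seq₀ (caps_spec hr₂) fun σ₃ a₃ h₃ => Ex.flat_seq 100 fun σ₄ e₄ a₄ => ?_
    have f22 : σ₂.real 22 0 = ℓ := by
      rw [e₂]; simp [Prog.sem]; rw [a₁.real 0 rfl]; rfl
    rw [f22] at h₃
    have hr₄ := (hr₂.agree a₃).agree a₄
    have hP : AtPerim P 0 i σ₄ := by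
      have g0 : σ₃.nat 0 = (input (fun _ : Fin 1 => P) n a i ℓ).nat 0 := by
        rw [a₃.nat 0 rfl, a₂.nat 0 rfl, a₁.nat 0 rfl]
      have g1 : σ₃.nat 1 = (input (fun _ : Fin 1 => P) n a i ℓ).nat 1 := by
        rw [a₃.nat 1 rfl, a₂.nat 1 rfl, a₁.nat 1 rfl]
      refine ⟨?_, by simp [e₄, Prog.sem, onePerim], ?_, fun r hr => ?_, fun r hr => ?_⟩
      · simp [e₄, Prog.sem, onePerim, g1]; exact input_q _ n a i ℓ 0
      · simp [e₄, Prog.sem, onePerim, g0]; rfl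
      · rw [a₄.real 1 rfl, a₃.real 1 rfl, a₂.real 1 rfl, a₁.real 1 rfl]
        exact input_seg _ n a i ℓ 0 hr
      · rw [a₄.real 2 rfl, a₃.real 2 rfl, a₂.real 2 rfl, a₁.real 2 rfl]
        exact input_gap _ n a i ℓ 0 hr
    rw [← dpTime_eq (fun τ => (hsw τ).1)]
    refine Ex.seq₀ (dpRun_spec (cap := fun τ => a' τ * ℓ) ht
      (fun τ _ => mul_nonneg (Nat.cast_nonneg _) hℓ) hr₄ hP hi (by rwa [a₄.real 10 rfl]))
      fun σ₅ a₅ h₅ => ?_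
    have hc := chainTest_holds (hr₄.agree a₅) h₅ (by rw [a₅.nat 24 rfl, hP.q_eq])
    rw [tab_last (fun τ => (hsw τ).1) (cap := fun τ => (a τ : ℝ) * ℓ)
      (fun τ => by rw [(hsw τ).2.1]), ← lrFeasible_iff] at hc
    refine Ex.flat ⟨fun h => ?_, fun h => ?_⟩
    · exact Or.inl ⟨hc.1 h, by simp⟩
    · exact Or.inr ⟨mt hc.2 h, by simp⟩
  · have h1 := le_mul_cells n
    have h2 : t * cells n ≤ t * cells n + P.q * faces n := Nat.le_add_right _ _
    omega

theorem decideProg_spec (ht : 1 ≤ t) {ℓ : ℝ} (hℓ : 0 ≤ ℓ) :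
    Ex (fun _ _ => False) decideProg (input (fun _ : Fin 1 => P) n a 0 ℓ)
      (3000 * (P.q * t * cells n + P.q ^ 2 * faces n)) 0
      (fun σ => Answers σ (DOPG (fun _ : Fin 1 => P) n fun τ => (a τ : ℝ) * ℓ)) := by
  refine Ex.time (Ex.seq₀ (setup_input _ n a 0 ℓ ht) (T' := 100 + ((70 * t + 40) + (100 +
    (P.q * ((500 * (t * cells n) + 160 * (P.q * faces n) + 100) + 60 + 20) + 20))))
    fun σ₁ a₁ h₁ => ?_) ?_
  · obtain ⟨ρ, -, hr, hsw⟩ := h₁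
    set n' := σ₁.nat 10
    set a' := σ₁.nat 11
    refine Ex.flat_seq 100 fun σ₂ e₂ a₂ => ?_
    have hr₂ := hr.agree a₂
    refine Ex.seq₀ (caps_spec hr₂) fun σ₃ a₃ h₃ => Ex.flat_seq 100 fun σ₄ e₄ a₄ => ?_
    have f22 : σ₂.real 22 0 = ℓ := by
      rw [e₂]; simp [Prog.sem]; rw [a₁.real 0 rfl]; rfl
    rw [f22] at h₃
    have hr₄ := (hr₂.agree a₃).agree a₄
    have hP : AtPerim P 0 0 σ₄ := by
      have g1 : σ₃.nat 1 = (input (fun _ : Fin 1 => P) n a 0 ℓ).nat 1 := by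
        rw [a₃.nat 1 rfl, a₂.nat 1 rfl, a₁.nat 1 rfl]
      refine ⟨?_, by simp [e₄, Prog.sem, onePerim], by simp [e₄, Prog.sem, onePerim],
        fun r hr => ?_, fun r hr => ?_⟩
      · simp [e₄, Prog.sem, onePerim, g1]; exact input_q _ n a 0 ℓ 0
      · rw [a₄.real 1 rfl, a₃.real 1 rfl, a₂.real 1 rfl, a₁.real 1 rfl]
        exact input_seg _ n a 0 ℓ 0 hr
      · rw [a₄.real 2 rfl, a₃.real 2 rfl, a₂.real 2 rfl, a₁.real 2 rfl]
        exact input_gap _ n a 0 ℓ 0 hr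
    rw [← dpTime_eq (fun τ => (hsw τ).1), dopg_iff_lrFeasible P n a hℓ]
    refine (Ex.for₀ P.q _ (fun k σ' => σ'.nat 26 0 = k ∧
      Answers σ' (∃ i < k, lrFeasible P n a i ℓ)) ?_ ?_ ?_).mono le_rfl le_rfl ?_
    · exact ⟨hP.start_eq, Or.inr ⟨by simp, by simp [e₄, Prog.sem, onePerim]⟩⟩
    · rintro k hk σ' a'' ⟨i1, i2⟩
      have hr' := hr₄.agree a''
      have f24 : σ'.nat 24 0 = P.q := by rw [a''.nat 24 rfl, hP.q_eq]
      have hP' : AtPerim P 0 k σ' := ⟨f24, by rw [a''.nat 25 rfl, hP.off_eq], i1,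
        by rw [a''.real 1 rfl]; exact hP.seg_eq, by rw [a''.real 2 rfl]; exact hP.gap_eq⟩
      refine ⟨by simp [i1, f24, hk], Ex.seq₀ (dpRun_spec (cap := fun τ => a' τ * ℓ) ht
        (fun τ _ => mul_nonneg (Nat.cast_nonneg _) hℓ) hr' hP' hk
        (by rwa [a''.real 10 rfl, a₄.real 10 rfl])) fun σ₅ a₅ h₅ => ?_⟩
      have hc := chainTest_holds (hr'.agree a₅) h₅ (by rw [a₅.nat 24 rfl, f24])
      rw [tab_last (fun τ => (hsw τ).1) (cap := fun τ => (a τ : ℝ) * ℓ)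
        (fun τ => by rw [(hsw τ).2.1]), ← lrFeasible_iff] at hc
      have f26 : σ₅.nat 26 0 = k := by rw [a₅.nat 26 rfl, i1]
      have f0 : σ₅.nat 0 = σ'.nat 0 := a₅.nat 0 rfl
      refine Ex.flat (T := 60) ⟨fun h => ?_, fun h => ?_⟩
      · refine ⟨by simp [f26], Or.inl ⟨⟨k, by omega, hc.1 h⟩, by simp⟩⟩
      · refine ⟨by simp [f26], ?_⟩
        have e : (∃ i < k + 1, lrFeasible P n a i ℓ) ↔ ∃ i < k, lrFeasible P n a i ℓ := by
          refine ⟨fun ⟨j, hj, hf⟩ => ⟨j, ?_, hf⟩, fun ⟨j, hj, hf⟩ => ⟨j, by omega, hf⟩⟩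
          rcases Nat.lt_succ_iff_lt_or_eq.1 hj with h' | rfl
          · exact h'
          · exact absurd (hc.2 hf) h
        rw [e]
        simpa [Answers, f0] using i2
    · rintro σ' a'' ⟨i1, -⟩
      have f24 : σ'.nat 24 0 = P.q := by rw [a''.nat 24 rfl, hP.q_eq]
      simp [i1, f24]
    · rintro σ' - ⟨-, h⟩
      have e : (∃ i < P.q, lrFeasible P n a i ℓ) ↔ ∃ i : Fin P.q, lrFeasible P n a i ℓ :=
        ⟨fun ⟨i, hi, h⟩ => ⟨⟨i, hi⟩, h⟩, fun ⟨i, h⟩ => ⟨i, i.2, h⟩⟩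
      rwa [e] at h
  · have h1 := le_mul_cells n
    have h2 := P.q_pos
    have h3 : t * cells n ≤ P.q * (t * cells n) := Nat.le_mul_of_pos_left _ h2
    have h4 : P.q ≤ P.q * (t * cells n) := Nat.le_mul_of_pos_right _ (by omega)
    have h5 : P.q * ((500 * (t * cells n) + 160 * (P.q * faces n) + 100) + 60 + 20) =
      500 * (P.q * (t * cells n)) + 160 * (P.q ^ 2 * faces n) + 180 * P.q := by ring
    rw [h5, mul_assoc P.q t]
    omega

end One

/-! ### Sorting -/

/-- `f` is nondecreasing on the interval from `lo` up to but not including `hi`. -/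
def SortedOn (f : ℕ → ℝ) (lo hi : ℕ) : Prop := ∀ x y, lo ≤ x → x ≤ y → y < hi → f x ≤ f y

/-- Merge the sorted blocks `[lo, mid)` and `[mid, hi)`. -/
def mergeProg : Prog :=
  (nset 45 (nv 42) ;; nset 46 (nv 43) ;; nset 47 (nv 42)) ;;
  .loop (natLt (nv 47) (nv 44)) (
    .cond (.and (natLt (nv 45) (nv 43)) (.not (.and (natLt (nv 46) (nv 44))
        (realLt (.get 40 (nv 46)) (.get 40 (nv 45))))))
      (.setReal 41 (nv 47) (.get 40 (nv 45)) ;; nset 45 (nv 45 + 1))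
      (.setReal 41 (nv 47) (.get 40 (nv 46)) ;; nset 46 (nv 46 + 1)) ;;
    nset 47 (nv 47 + 1)) ;;
  nset 47 (nv 42) ;;
  .loop (natLt (nv 47) (nv 44)) (.setReal 40 (nv 47) (.get 41 (nv 47)) ;; nset 47 (nv 47 + 1))

/-- The state of a merge: the elements before `p` and `r` have been moved to `g`. -/
structure Merging (f g : ℕ → ℝ) (lo mid hi p r : ℕ) : Prop where
  lo_le : lo ≤ p
  le_mid : p ≤ mid
  mid_le : mid ≤ r
  le_hi : r ≤ hi
  sorted : SortedOn g lo (p + r - mid)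
  below₁ : ∀ x y, lo ≤ x → x < p + r - mid → p ≤ y → y < mid → g x ≤ f y
  below₂ : ∀ x y, lo ≤ x → x < p + r - mid → r ≤ y → y < hi → g x ≤ f y
  mem : ∀ x, lo ≤ x → x < p + r - mid → ∃ y, lo ≤ y ∧ y < hi ∧ g x = f y
  mem₁ : ∀ y, lo ≤ y → y < p → ∃ x, lo ≤ x ∧ x < p + r - mid ∧ g x = f y
  mem₂ : ∀ y, mid ≤ y → y < r → ∃ x, lo ≤ x ∧ x < p + r - mid ∧ g x = f y

theorem Merging.step {f g : ℕ → ℝ} {lo mid hi p r p' r' y : ℕ} (h : Merging f g lo mid hi p r)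
    (hf₁ : SortedOn f lo mid) (hf₂ : SortedOn f mid hi)
    (hy : (p' = p + 1 ∧ r' = r ∧ y = p ∧ p < mid ∧ (r < hi → f p ≤ f r)) ∨
      (p' = p ∧ r' = r + 1 ∧ y = r ∧ r < hi ∧ (p < mid → f r ≤ f p))) :
    Merging f (Function.update g (p + r - mid) (f y)) lo mid hi p' r' := by
  obtain ⟨h1, h2, h3, h4, h5, h6, h7, h8, h9, h10⟩ := h
  have ho : p' + r' - mid = p + r - mid + 1 := by omega
  have hu : ∀ x, x < p + r - mid → Function.update g (p + r - mid) (f y) x = g x :=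
    fun x hx => Function.update_of_ne (by omega) _ _
  have hself : Function.update g (p + r - mid) (f y) (p + r - mid) = f y := Function.update_self _ _ _
  have hlow : ∀ x, lo ≤ x → x < p + r - mid → g x ≤ f y := by
    intro x hx hx'
    rcases hy with ⟨-, -, rfl, e, -⟩ | ⟨-, -, rfl, e, -⟩
    · exact h6 x _ hx hx' le_rfl e
    · exact h7 x _ hx hx' le_rfl e
  have hup₁ : ∀ y', p' ≤ y' → y' < mid → f y ≤ f y' := by
    intro y' hy' hm
    rcases hy with ⟨rfl, -, rfl, e, -⟩ | ⟨rfl, -, rfl, e, e'⟩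
    · exact hf₁ _ _ h1 (by omega) hm
    · exact (e' (by omega)).trans (hf₁ _ _ h1 hy' hm)
  have hup₂ : ∀ y', r' ≤ y' → y' < hi → f y ≤ f y' := by
    intro y' hy' hm
    rcases hy with ⟨-, rfl, rfl, e, e'⟩ | ⟨-, rfl, rfl, e, -⟩
    · exact (e' (by omega)).trans (hf₂ _ _ h3 hy' hm)
    · exact hf₂ _ _ h3 (by omega) hm
  have hcase : ∀ x, x < p + r - mid + 1 → x < p + r - mid ∨ x = p + r - mid := by omega
  refine ⟨by omega, by omega, by omega, by omega, ?_, ?_, ?_, ?_, ?_, ?_⟩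
  · intro x x' hx hx' hx''
    rw [ho] at hx''
    rcases hcase x' hx'' with e' | rfl
    · rw [hu x (by omega), hu x' e']; exact h5 x x' hx hx' e'
    · rcases hcase x (by omega) with e | rfl
      · rw [hu x e, hself]; exact hlow x hx e
      · exact le_rfl
  · intro x y' hx hx' hy₁ hy₂
    rw [ho] at hx'
    rcases hcase x hx' with e | rfl
    · rw [hu x e]; exact h6 x y' hx e (by omega) hy₂
    · rw [hself]; exact hup₁ y' hy₁ hy₂
  · intro x y' hx hx' hy₁ hy₂
    rw [ho] at hx'
    rcases hcase x hx' with e | rfl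
    · rw [hu x e]; exact h7 x y' hx e (by omega) hy₂
    · rw [hself]; exact hup₂ y' hy₁ hy₂
  · intro x hx hx'
    rw [ho] at hx'
    rcases hcase x hx' with e | rfl
    · rw [hu x e]; exact h8 x hx e
    · rw [hself]; exact ⟨y, by omega, by omega, rfl⟩
  · intro y' hy₁ hy₂
    rw [ho]
    by_cases e : y' < p
    · obtain ⟨x, hx, hx', e'⟩ := h9 y' hy₁ e
      exact ⟨x, hx, by omega, by rw [hu x hx', e']⟩
    · exact ⟨_, by omega, Nat.lt_succ_self _, by rw [hself]; congr 1; omega⟩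
  · intro y' hy₁ hy₂
    rw [ho]
    by_cases e : y' < r
    · obtain ⟨x, hx, hx', e'⟩ := h10 y' hy₁ e
      exact ⟨x, hx, by omega, by rw [hu x hx', e']⟩
    · exact ⟨_, by omega, Nat.lt_succ_self _, by rw [hself]; congr 1; omega⟩

/-- The result of rearranging `f` on the interval from `lo` up to `hi`. -/
structure Rearranged (f g : ℕ → ℝ) (lo hi : ℕ) : Prop where
  outside : ∀ x, x < lo ∨ hi ≤ x → g x = f x
  mem : ∀ x, lo ≤ x → x < hi → ∃ y, lo ≤ y ∧ y < hi ∧ g x = f y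
  mem' : ∀ y, lo ≤ y → y < hi → ∃ x, lo ≤ x ∧ x < hi ∧ g x = f y

theorem mergeProg_spec {O : ℕ → ℝ → Prop} {σ : State} {lo mid hi : ℕ} (h42 : σ.nat 42 0 = lo)
    (h43 : σ.nat 43 0 = mid) (h44 : σ.nat 44 0 = hi) (h1 : lo ≤ mid) (h2 : mid ≤ hi)
    (hf₁ : SortedOn (σ.real 40) lo mid) (hf₂ : SortedOn (σ.real 40) mid hi) :
    Ex O mergeProg σ (150 * (hi - lo) + 100) 0 (fun σ' =>
      Rearranged (σ.real 40) (σ'.real 40) lo hi ∧ SortedOn (σ'.real 40) lo hi) := by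
  refine Ex.time (Ex.flat_seq 20 fun σ₁ e₁ a₁ => Ex.seq₀ (Ex.for₀ (hi - lo) 60
    (fun k σ' => σ'.nat 47 0 = lo + k ∧ σ'.nat 45 0 + σ'.nat 46 0 = mid + lo + k ∧
      Merging (σ.real 40) (σ'.real 41) lo mid hi (σ'.nat 45 0) (σ'.nat 46 0)) ?_ ?_ ?_)
    fun σ₂ a₂ h₂ => Ex.flat_seq 10 fun σ₃ e₃ a₃ =>
      (Ex.for₀ (hi - lo) 30 (fun k σ' => σ'.nat 47 0 = lo + k ∧
      ∀ x, σ'.real 40 x = if lo ≤ x ∧ x < lo + k then σ₂.real 41 x else σ.real 40 x)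
      ?_ ?_ ?_).mono le_rfl le_rfl ?_) (by omega)
  · simp [e₁, Prog.sem, h42, h43]
    refine ⟨by omega, le_rfl, h1, le_rfl, h2, ?_, ?_, ?_, ?_, ?_, ?_⟩
    · intro x y hx hy hy'; omega
    · intro x y hx hy hy'; omega
    · intro x y hx hy hy'; omega
    · intro x hx hy; omega
    · intro x hx hy; omega
    · intro x hx hy; omega
  · rintro k hk σ' a' ⟨i1, i2, i3⟩
    have f43 : σ'.nat 43 0 = mid := by rw [a'.nat 43 rfl, a₁.nat 43 rfl, h43]
    have f44 : σ'.nat 44 0 = hi := by rw [a'.nat 44 rfl, a₁.nat 44 rfl, h44]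
    have f40 : σ'.real 40 = σ.real 40 := (a'.real 40 rfl).trans (a₁.real 40 rfl)
    have ho : lo + k = σ'.nat 45 0 + σ'.nat 46 0 - mid := by omega
    have := i3.mid_le
    have := i3.le_hi
    have := i3.lo_le
    have := i3.le_mid
    refine ⟨by simp [i1, f44]; omega, Ex.flat ⟨fun hb => ?_, fun hb => ?_⟩⟩
    · simp [f43, f44, f40] at hb
      simp [Prog.wp, i1, f40]
      refine ⟨by omega, by omega, ?_⟩
      rw [ho]
      exact i3.step hf₁ hf₂ (Or.inl ⟨rfl, rfl, rfl, hb.1, hb.2⟩)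
    · simp [f43, f44, f40] at hb
      simp [Prog.wp, i1, f40]
      refine ⟨by omega, by omega, ?_⟩
      rw [ho]
      refine i3.step hf₁ hf₂ (Or.inr ⟨rfl, rfl, rfl, ?_, fun h => (hb h).2.le⟩)
      by_cases h : σ'.nat 45 0 < mid
      · exact (hb h).1
      · omega
  · rintro σ' a' ⟨i1, -⟩
    have f44 : σ'.nat 44 0 = hi := by rw [a'.nat 44 rfl, a₁.nat 44 rfl, h44]
    simp [i1, f44]; omega
  · have f42 : σ₂.nat 42 0 = lo := by rw [a₂.nat 42 rfl, a₁.nat 42 rfl, h42]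
    have f40 : σ₂.real 40 = σ.real 40 := (a₂.real 40 rfl).trans (a₁.real 40 rfl)
    simp [e₃, Prog.sem, f42, f40]
  · rintro k hk σ' a' ⟨i1, i2⟩
    have f44 : σ'.nat 44 0 = hi := by
      rw [a'.nat 44 rfl, a₃.nat 44 rfl, a₂.nat 44 rfl, a₁.nat 44 rfl, h44]
    have f41 : σ'.real 41 = σ₂.real 41 := (a'.real 41 rfl).trans (a₃.real 41 rfl)
    refine ⟨by simp [i1, f44]; omega, Ex.flat ?_⟩
    simp [Prog.wp, i1, f41, Function.update_apply, add_assoc]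
    intro x
    split_ifs with c1 c2 c3 c4 c5
    · rw [c1]
    · omega
    · rw [i2 x, if_pos (by omega)]
    · rw [i2 x, if_neg (by omega)]
  · rintro σ' a' ⟨i1, -⟩
    have f44 : σ'.nat 44 0 = hi := by
      rw [a'.nat 44 rfl, a₃.nat 44 rfl, a₂.nat 44 rfl, a₁.nat 44 rfl, h44]
    simp [i1, f44]; omega
  · rintro σ' - ⟨-, i2⟩
    obtain ⟨j1, j2, j3⟩ := h₂
    have hp : σ₂.nat 45 0 = mid := by have := j3.le_mid; have := j3.le_hi; omega
    have hr : σ₂.nat 46 0 = hi := by omega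
    rw [hp, hr] at j3
    obtain ⟨-, -, -, -, k5, -, -, k8, k9, k10⟩ := j3
    rw [show mid + hi - mid = hi by omega] at *
    have hin : ∀ x, lo ≤ x → x < hi → σ'.real 40 x = σ₂.real 41 x := fun x hx hx' => by
      rw [i2 x, if_pos (by omega)]
    refine ⟨⟨fun x hx => by rw [i2 x, if_neg (by omega)], fun x hx hx' => ?_, fun y hy hy' => ?_⟩, ?_⟩
    · rw [hin x hx hx']; exact k8 x hx hx'
    · rcases Nat.lt_or_ge y mid with h | h
      · obtain ⟨x, hx, hx', e⟩ := k9 y hy h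
        exact ⟨x, hx, hx', by rw [hin x hx hx', e]⟩
      · obtain ⟨x, hx, hx', e⟩ := k10 y h hy'
        exact ⟨x, hx, hx', by rw [hin x hx hx', e]⟩
    · intro x y hx hxy hy
      rw [hin x hx (by omega), hin y (by omega) hy]
      exact k5 x y hx hxy hy

theorem Rearranged.widen {f g : ℕ → ℝ} {lo hi N : ℕ} (h : Rearranged f g lo hi) (hN : hi ≤ N) :
    Rearranged f g 0 N := by
  refine ⟨fun x hx => h.outside x (by omega), fun x _ hx' => ?_, fun x _ hx' => ?_⟩
  · by_cases e : lo ≤ x ∧ x < hi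
    · obtain ⟨y, -, hy', e⟩ := h.mem x e.1 e.2
      exact ⟨y, by omega, by omega, e⟩
    · exact ⟨x, by omega, hx', h.outside x (by omega)⟩
  · by_cases e : lo ≤ x ∧ x < hi
    · obtain ⟨y, -, hy', e⟩ := h.mem' x e.1 e.2
      exact ⟨y, by omega, by omega, e⟩
    · exact ⟨x, by omega, hx', h.outside x (by omega)⟩

theorem Rearranged.trans {f g k : ℕ → ℝ} {lo hi : ℕ} (h : Rearranged f g lo hi)
    (h' : Rearranged g k lo hi) : Rearranged f k lo hi := by
  refine ⟨fun x hx => (h'.outside x hx).trans (h.outside x hx), fun x hx hx' => ?_,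
    fun x hx hx' => ?_⟩
  · obtain ⟨y, hy, hy', e⟩ := h'.mem x hx hx'
    obtain ⟨z, hz, hz', e'⟩ := h.mem y hy hy'
    exact ⟨z, hz, hz', e.trans e'⟩
  · obtain ⟨y, hy, hy', e⟩ := h.mem' x hx hx'
    obtain ⟨z, hz, hz', e'⟩ := h'.mem' y hy hy'
    exact ⟨z, hz, hz', e'.trans e⟩

theorem Rearranged.refl (f : ℕ → ℝ) (lo hi : ℕ) : Rearranged f f lo hi :=
  ⟨fun _ _ => rfl, fun x hx hx' => ⟨x, hx, hx', rfl⟩, fun x hx hx' => ⟨x, hx, hx', rfl⟩⟩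

/-- One pass of the sort: merge adjacent blocks of the width in variable `41`. -/
def passProg : Prog :=
  nset 42 0 ;;
  .loop (natLt (nv 42) (nv 40)) (
    (nset 43 (nv 42 + nv 41) ;; .cond (natLt (nv 40) (nv 43)) (nset 43 (nv 40)) .skip ;;
     nset 44 (nv 42 + nv 41 + nv 41) ;; .cond (natLt (nv 40) (nv 44)) (nset 44 (nv 40)) .skip) ;;
    mergeProg ;;
    nset 42 (nv 42 + nv 41 + nv 41))

theorem passProg_spec {O : ℕ → ℝ → Prop} {σ : State} {N w : ℕ} (hw : 0 < w) (h40 : σ.nat 40 0 = N)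
    (h41 : σ.nat 41 0 = w) (hf : ∀ j, SortedOn (σ.real 40) (j * w) (min ((j + 1) * w) N)) :
    Ex O passProg σ (400 * N + 100) 0 (fun σ' => Rearranged (σ.real 40) (σ'.real 40) 0 N ∧
      ∀ j, SortedOn (σ'.real 40) (j * (2 * w)) (min ((j + 1) * (2 * w)) N)) := by
  set B := (N + (2 * w - 1)) / (2 * w) with hB
  have hB1 : ∀ k, k < B ↔ k * (2 * w) < N := by
    intro k
    rw [hB, Nat.lt_div_iff_mul_lt (by omega)]
    omega
  refine Ex.time (Ex.flat_seq 10 fun σ₁ e₁ a₁ => (Ex.forT B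
    (fun k => 100 + (150 * (min ((k + 1) * (2 * w)) N - min (k * (2 * w)) N) + 100 + 20))
    (fun k σ' => σ'.nat 42 0 = k * (2 * w) ∧ Rearranged (σ.real 40) (σ'.real 40) 0 N ∧
      (∀ j < k, SortedOn (σ'.real 40) (j * (2 * w)) (min ((j + 1) * (2 * w)) N)) ∧
      ∀ j, 2 * k ≤ j → SortedOn (σ'.real 40) (j * w) (min ((j + 1) * w) N))
      ?_ ?_ ?_).mono le_rfl le_rfl ?_) ?_
  · have f40 : σ₁.real 40 = σ.real 40 := a₁.real 40 rfl
    rw [f40]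
    refine ⟨by simp [e₁, Prog.sem], .refl _ _ _, by simp, fun j _ => hf j⟩
  · rintro k hk σ' a' ⟨i1, i2, i3, i4⟩
    have g40 : σ'.nat 40 0 = N := by rw [a'.nat 40 rfl, a₁.nat 40 rfl, h40]
    have g41 : σ'.nat 41 0 = w := by rw [a'.nat 41 rfl, a₁.nat 41 rfl, h41]
    have hlo := (hB1 k).1 hk
    have m1 : (2 * k + 1) * w = k * (2 * w) + w := by ring
    have m2 : (2 * k + 1 + 1) * w = k * (2 * w) + w + w := by ring
    have m3 : (k + 1) * (2 * w) = k * (2 * w) + w + w := by ring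
    refine ⟨by simp [i1, g40]; exact hlo, ?_⟩
    refine Ex.flat_seq 100 fun σ₂ e₂ a₂ => ?_
    have g : σ₂.nat 42 0 = k * (2 * w) ∧ σ₂.nat 43 0 = min ((2 * k + 1) * w) N ∧
        σ₂.nat 44 0 = min ((k + 1) * (2 * w)) N := by
      rw [e₂]
      refine Prog.wp_sem (Q := fun s => s.nat 42 0 = k * (2 * w) ∧
        s.nat 43 0 = min ((2 * k + 1) * w) N ∧ s.nat 44 0 = min ((k + 1) * (2 * w)) N) ?_
      simp [Prog.wp, i1, g40, g41]
      omega
    obtain ⟨g42, g43, g44⟩ := g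
    have gr : σ₂.real 40 = σ'.real 40 := a₂.real 40 rfl
    refine Ex.seq₀ ((mergeProg_spec g42 g43 g44 (by omega) (by omega) ?_ ?_).time ?_)
      fun σ₃ a₃ h₃ => Ex.flat (T := 20) ?_
    · have := i4 (2 * k) le_rfl
      rw [gr]
      rwa [show 2 * k * w = k * (2 * w) by ring] at this
    · have := i4 (2 * k + 1) (by omega)
      rw [m2, ← m3] at this
      rw [gr]
      intro x y hx
      by_cases e : (2 * k + 1) * w ≤ N
      · exact this x y (by omega)
      · omega
    · rw [min_eq_left hlo.le]
    · obtain ⟨u1, u2⟩ := h₃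
      rw [gr] at u1
      have w42 : σ₃.nat 42 0 = k * (2 * w) := by rw [a₃.nat 42 rfl, g42]
      have w41 : σ₃.nat 41 0 = w := by rw [a₃.nat 41 rfl, a₂.nat 41 rfl, g41]
      simp [Prog.wp, w42, w41]
      refine ⟨by omega, i2.trans (u1.widen (by omega)), fun j hj => ?_, fun j hj => ?_⟩
      · by_cases e : j = k
        · rw [e]; exact u2
        · have : (j + 1) * (2 * w) ≤ k * (2 * w) := Nat.mul_le_mul_right _ (by omega)
          intro x y hx hxy hy
          rw [u1.outside x (by omega), u1.outside y (by omega)]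
          exact i3 j (by omega) x y hx hxy hy
      · have : (2 * k + 1 + 1) * w ≤ j * w := Nat.mul_le_mul_right _ (by omega)
        intro x y hx hxy hy
        rw [u1.outside x (by omega), u1.outside y (by omega)]
        exact i4 j (by omega) x y hx hxy hy
  · rintro σ' a' ⟨i1, -⟩
    have g40 : σ'.nat 40 0 = N := by rw [a'.nat 40 rfl, a₁.nat 40 rfl, h40]
    have := (hB1 B).not.1 (lt_irrefl _)
    simp [i1, g40]; omega
  · rintro σ' - ⟨-, i2, i3, -⟩
    refine ⟨i2, fun j => ?_⟩
    by_cases e : j < B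
    · exact i3 j e
    · have := (hB1 j).not.1 e
      intro x y hx hxy hy
      omega
  · have hmono : Monotone fun k => min (k * (2 * w)) N := fun k k' h =>
      min_le_min_right _ (Nat.mul_le_mul_right _ h)
    have h1 := Finset.sum_range_tsub hmono B
    have hBN : B ≤ N := by
      by_contra hcon
      have := (hB1 N).1 (by omega)
      nlinarith
    have h2 : ∑ k ∈ Finset.range B, (100 + (150 * (min ((k + 1) * (2 * w)) N - min (k * (2 * w)) N) +
        100 + 20) + 20) = 150 * ∑ k ∈ Finset.range B,
          (min ((k + 1) * (2 * w)) N - min (k * (2 * w)) N) + 240 * B := by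
      rw [Finset.mul_sum, mul_comm 240, ← smul_eq_mul B, ← Finset.card_range B, ← Finset.sum_const,
        Finset.card_range, ← Finset.sum_add_distrib]
      exact Finset.sum_congr rfl fun k _ => by ring
    rw [h2, h1]
    have : min (B * (2 * w)) N ≤ N := min_le_right _ _
    omega

/-- Sort the first entries, whose number is in variable `40`, of the array `40`. -/
def sortProg : Prog :=
  nset 41 1 ;; .loop (natLt (nv 41) (nv 40)) (passProg ;; nset 41 (nv 41 + nv 41))

theorem sortProg_spec {O : ℕ → ℝ → Prop} {σ : State} {N : ℕ} (h40 : σ.nat 40 0 = N) :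
    Ex O sortProg σ (Nat.clog 2 N * (400 * N + 140) + 40) 0 (fun σ' =>
      Rearranged (σ.real 40) (σ'.real 40) 0 N ∧ SortedOn (σ'.real 40) 0 N) := by
  refine Ex.time (Ex.flat_seq 10 fun σ₁ e₁ a₁ => (Ex.for₀ (Nat.clog 2 N)
    (400 * N + 100 + 20) (fun k σ' => σ'.nat 41 0 = 2 ^ k ∧
      Rearranged (σ.real 40) (σ'.real 40) 0 N ∧
      ∀ j, SortedOn (σ'.real 40) (j * 2 ^ k) (min ((j + 1) * 2 ^ k) N))
      ?_ ?_ ?_).mono le_rfl le_rfl ?_) ?_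
  · rw [a₁.real 40 rfl]
    refine ⟨by simp [e₁, Prog.sem], .refl _ _ _, fun j x y hx hxy hy => ?_⟩
    obtain rfl : x = y := by omega
    exact le_rfl
  · rintro k hk σ' a' ⟨i1, i2, i3⟩
    have g40 : σ'.nat 40 0 = N := by rw [a'.nat 40 rfl, a₁.nat 40 rfl, h40]
    have := (Nat.lt_clog_iff_pow_lt (b := 2) (by norm_num)).1 hk
    refine ⟨by simp [i1, g40, this], Ex.seq₀ (passProg_spec (by positivity) g40 i1 i3)
      fun σ₂ a₂ h₂ => Ex.flat (T := 20) ?_⟩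
    have g41 : σ₂.nat 41 0 = 2 ^ k := by rw [a₂.nat 41 rfl, i1]
    simp only [Prog.wp, State.setNat_nat, State.setNat_real, NatExp.eval_add, NatExp.eval_get,
      NatExp.eval_lit, g41, if_true, Function.update_self]
    rw [show 2 ^ (k + 1) = 2 * 2 ^ k by ring]
    exact ⟨by ring, i2.trans h₂.1, h₂.2⟩
  · rintro σ' a' ⟨i1, -⟩
    have g40 : σ'.nat 40 0 = N := by rw [a'.nat 40 rfl, a₁.nat 40 rfl, h40]
    have := (Nat.lt_clog_iff_pow_lt (b := 2) (x := N) (by norm_num)).not.1 (lt_irrefl _)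
    simp [i1, g40]; omega
  · rintro σ' - ⟨-, i2, i3⟩
    have := (Nat.lt_clog_iff_pow_lt (b := 2) (x := N) (by norm_num)).not.1 (lt_irrefl _)
    refine ⟨i2, ?_⟩
    have h := i3 0
    rwa [zero_mul, zero_add, one_mul, min_eq_right (by omega)] at h
  · rw [show 400 * N + 100 + 20 + 20 = 400 * N + 140 by ring]; omega

/-! ### The search for the optimum -/

theorem beq_eq_decide (A B : ℕ) : Nat.beq A B = decide (A = B) := by
  rw [Bool.eq_iff_iff, decide_eq_true_iff]; exact Nat.beq_eq ▸ Iff.rfl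

/-- The program `test` decides whether the number in real variable `22` is at least `ℓ`, in every
state that satisfies `G`, within `T` steps and `K` calls, and does not write to the arrays that are
used by the search. -/
structure Decides (O : ℕ → ℝ → Prop) (test : Prog) (G : State → Prop) (ℓ : ℝ) (T K : ℕ) : Prop where
  spec : ∀ σ, G σ → 0 ≤ σ.real 22 0 → Ex O test σ T K fun σ' =>
    (σ'.nat 5 0 = 1 ∧ ℓ ≤ σ.real 22 0) ∨ (σ'.nat 5 0 = 0 ∧ ¬ ℓ ≤ σ.real 22 0)
  stable : ∀ σ σ', G σ → (∀ A < 40, test.wn A = false → σ'.nat A = σ.nat A) →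
    (∀ A < 40, A ≠ 22 → test.wr A = false → σ'.real A = σ.real A) → G σ'
  nat_frame : ∀ A ∈ [40, 48, 49, 50, 55, 56, 57, 58, 59, 60], test.wn A = false
  real_frame : ∀ A ∈ [22, 40, 42, 43], test.wr A = false

theorem Decides.agree {O : ℕ → ℝ → Prop} {test p : Prog} {G : State → Prop} {ℓ : ℝ} {T K : ℕ}
    (h : Decides O test G ℓ T K) {σ σ' : State} (ha : Agree p σ σ') (hσ : G σ)
    (hn : ∀ A < 40, (∀ B, 40 ≤ B → Nat.beq B A = false) → test.wn A = false → p.wn A = false)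
    (hr : ∀ A < 40, (∀ B, 40 ≤ B → Nat.beq B A = false) → Nat.beq 22 A = false →
      test.wr A = false → p.wr A = false) : G σ' := by
  have key : ∀ A < 40, ∀ B, 40 ≤ B → Nat.beq B A = false := fun A hA B hB =>
    Bool.eq_false_iff.2 fun e => by have := Nat.eq_of_beq_eq_true e; omega
  refine h.stable σ σ' hσ (fun A hA ht => ha.nat A (hn A hA (key A hA) ht))
    fun A hA h22 ht => ha.real A (hr A hA (key A hA) ?_ ht)
  exact Bool.eq_false_iff.2 fun e => h22 (Nat.eq_of_beq_eq_true e).symm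

/-- Replace real variable `42` by the smallest number in the sorted array `40` that passes the
test, if this is smaller. -/
def bsearchProg (test : Prog) : Prog :=
  (nset 48 0 ;; nset 49 (nv 40)) ;;
  .loop (natLt (nv 48) (nv 49)) (
    (nset 50 (.half (nv 48 + nv 49)) ;; rset 22 (.get 40 (nv 50))) ;; test ;;
    .cond (.natLe 1 (nv 5)) (nset 49 (nv 50)) (nset 48 (nv 50 + 1))) ;;
  .cond (natLt (nv 48) (nv 40))
    (.cond (.realLe (.get 40 (nv 48)) (rv 42)) (rset 42 (.get 40 (nv 48))) .skip) .skip

section Search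
variable {O : ℕ → ℝ → Prop} {test : Prog} {G : State → Prop} {ℓ : ℝ} {T K : ℕ}

theorem bsearchProg_spec (ht : Decides O test G ℓ T K) {σ : State} (hσ : G σ) {N : ℕ}
    (h40 : σ.nat 40 0 = N) (hs : SortedOn (σ.real 40) 0 N) (h0 : ∀ j < N, 0 ≤ σ.real 40 j)
    (hb : ℓ ≤ σ.real 42 0) :
    Ex O (bsearchProg test) σ ((Nat.log 2 N + 1) * (T + 100) + 200) ((Nat.log 2 N + 1) * K)
      (fun σ' => σ'.real 42 0 ≤ σ.real 42 0 ∧ ℓ ≤ σ'.real 42 0 ∧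
        ∀ j < N, ℓ ≤ σ.real 40 j → σ'.real 42 0 ≤ σ.real 40 j) := by
  refine Ex.mono (Ex.flat_seq 20 fun σ₁ e₁ a₁ => Ex.seq (Ex.while
    (T := 30 + (T + 50)) (K := K) (Nat.log 2 N + 1)
    (fun k σ' => σ'.nat 49 0 < σ'.nat 48 0 + 2 ^ k ∧ σ'.nat 48 0 ≤ σ'.nat 49 0 ∧ σ'.nat 49 0 ≤ N ∧
      (∀ j < σ'.nat 48 0, ¬ ℓ ≤ σ.real 40 j) ∧
      ∀ j, σ'.nat 49 0 ≤ j → j < N → ℓ ≤ σ.real 40 j) ?_ ?_)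
    fun σ₂ a₂ h₂ => Ex.flat (T := 70) ?_) ?_ ?_ fun _ _ h => h
  · have := Nat.lt_pow_succ_log_self (b := 2) (by norm_num) N
    simp [e₁, Prog.sem, h40, this]
    intro j hj hj'; omega
  · rintro k σ' a' ⟨i1, i2, i3, i4, i5⟩ hlt
    have hlt : σ'.nat 48 0 < σ'.nat 49 0 := not_le.1 hlt
    have f40 : σ'.real 40 = σ.real 40 := by
      rw [a'.real 40 (by simp [Prog.wr, ht.real_frame, beq_eq_decide]), a₁.real 40 rfl]
    have hG : G σ' := ht.agree a' (ht.agree a₁ hσ (fun A hA hB _ => by simp [Prog.wn, hB])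
      fun A hA hB _ _ => by simp [Prog.wr]) (fun A hA hB h => by simp [Prog.wn, hB, h])
      fun A hA hB h22 h => by simp [Prog.wr, h22, h]
    obtain _ | k := k
    · simp at i1; omega
    set M := (σ'.nat 48 0 + σ'.nat 49 0) / 2 with hM
    have hMN : M < N := by omega
    refine ⟨k, rfl, Ex.flat_seq 30 fun σ₃ e₃ a₃ => ?_⟩
    have g22 : σ₃.real 22 0 = σ.real 40 M := by simp [e₃, Prog.sem, f40, hM]
    have g50 : σ₃.nat 50 0 = M := by simp [e₃, Prog.sem, hM]
    have hG₃ : G σ₃ := ht.agree a₃ hG (fun A hA hB h => by simp [Prog.wn, hB])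
      fun A hA hB h22 h => by simp [Prog.wr, h22]
    refine (Ex.seq (ht.spec σ₃ hG₃ (by rw [g22]; exact h0 M hMN)) fun σ₄ a₄ h₄ =>
      Ex.flat (T := 50) ?_)
    rw [g22] at h₄
    have w50 : σ₄.nat 50 0 = M := by rw [a₄.nat 50 (ht.nat_frame _ (by decide)), g50]
    have w48 : σ₄.nat 48 0 = σ'.nat 48 0 := by
      rw [a₄.nat 48 (ht.nat_frame _ (by decide)), a₃.nat 48 rfl]
    have w49 : σ₄.nat 49 0 = σ'.nat 49 0 := by
      rw [a₄.nat 49 (ht.nat_frame _ (by decide)), a₃.nat 49 rfl]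
    have hpow : 2 ^ (k + 1) = 2 * 2 ^ k := by ring
    refine ⟨fun h => ?_, fun h => ?_⟩
    · simp at h
      have hl : ℓ ≤ σ.real 40 M := by
        rcases h₄ with h' | h'
        · exact h'.2
        · omega
      simp [Prog.wp, w50, w48]
      refine ⟨by omega, by omega, by omega, fun j hj => not_le.1 (i4 j hj), fun j hj hj' => ?_⟩
      exact hl.trans (hs M j (Nat.zero_le _) hj hj')
    · simp at h
      have hl : ¬ ℓ ≤ σ.real 40 M := by
        rcases h₄ with h' | h'
        · omega
        · exact h'.2
      simp only [Prog.wp, State.setNat_nat, NatExp.eval_add, NatExp.eval_get,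
        NatExp.eval_lit, NatExp.eval_one, w50, w49, if_true, Function.update_self, if_false,
        Nat.reduceEqDiff]
      refine ⟨by omega, by omega, by omega, fun j hj h' => hl ?_, i5⟩
      exact h'.trans (hs j M (Nat.zero_le _) (by omega) hMN)
  · obtain ⟨hn, k, -, i2, i3, i4, i5⟩ := h₂
    have f40 : σ₂.real 40 = σ.real 40 := by
      rw [a₂.real 40 (by simp [Prog.wr, ht.real_frame, beq_eq_decide]), a₁.real 40 rfl]
    have f42 : σ₂.real 42 = σ.real 42 := by
      rw [a₂.real 42 (by simp [Prog.wr, ht.real_frame, beq_eq_decide]), a₁.real 42 rfl]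
    have g40 : σ₂.nat 40 0 = N := by
      rw [a₂.nat 40 (by simp [Prog.wn, ht.nat_frame, beq_eq_decide]), a₁.nat 40 rfl, h40]
    simp at hn
    have he : σ₂.nat 49 0 = σ₂.nat 48 0 := by omega
    rw [he] at i5 i3
    have hmin : ∀ j < N, ℓ ≤ σ.real 40 j → σ₂.nat 48 0 < N ∧ σ.real 40 (σ₂.nat 48 0) ≤ σ.real 40 j := by
      intro j hj hl
      have h1 : σ₂.nat 48 0 ≤ j := by
        by_contra hcon
        exact i4 j (by omega) hl
      exact ⟨by omega, hs _ _ (Nat.zero_le _) h1 hj⟩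
    refine ⟨fun hlt => ⟨fun hle => ?_, fun hle => ?_⟩, fun hlt => ?_⟩
    · simp [g40] at hlt
      simp [f40, f42] at hle
      simp [Prog.wp, f40]
      exact ⟨hle, i5 _ le_rfl hlt, fun j hj hl => (hmin j hj hl).2⟩
    · simp [f40, f42] at hle
      simp [Prog.wp, f42]
      exact ⟨hb, fun j hj hl => hle.le.trans (hmin j hj hl).2⟩
    · simp [g40] at hlt
      simp [Prog.wp, f42]
      refine ⟨hb, fun j hj hl => ?_⟩
      have := (hmin j hj hl).1
      omega
  · have : (Nat.log 2 N + 1) * (30 + (T + 50) + 20) = (Nat.log 2 N + 1) * (T + 100) := by ring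
    omega
  · omega

/-- The number at position `p ≥ 1` of the `j`-th decreasing list. -/
def entry (σ : State) (j p : ℕ) : ℝ :=
  σ.real 43 j / (σ.nat 55 j + σ.nat 60 0 * ((p - 1 : ℕ) : ℝ))

/-- The expression for the number in list `nv 58` that is tried at this stage. -/
def tryExp : RealExp :=
  .get 43 (nv 58) / (.ofNat (.get 55 (nv 58)) +
    .ofNat (nv 60) * .ofNat (.get 56 (nv 58) + nv 57 - 1))

/-- Try, in each list, the number at the distance given by variable `57` from the position in
array `56`, and move forward where the number is at least the current bound. -/
def stageProg (test : Prog) : Prog :=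
  (nset 58 0 ;; .loop (natLt (nv 58) (nv 40)) (
    .cond (.natLe (.get 56 (nv 58) + nv 57) (nv 59)) (.setReal 40 (nv 58) tryExp)
      (.setReal 40 (nv 58) 0) ;; nset 58 (nv 58 + 1))) ;;
  sortProg ;; bsearchProg test ;;
  nset 58 0 ;; .loop (natLt (nv 58) (nv 40)) (
    .cond (.natLe (.get 56 (nv 58) + nv 57) (nv 59))
      (.cond (.realLe (rv 42) tryExp) (.setNat 56 (nv 58) (.get 56 (nv 58) + nv 57)) .skip) .skip ;;
    nset 58 (nv 58 + 1))

/-- Running time of a stage. -/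
def stageTime (N T : ℕ) : ℕ :=
  200 * N + Nat.clog 2 N * (400 * N + 140) + (Nat.log 2 N + 1) * (T + 100) + 400

theorem stageProg_spec (ht : Decides O test G ℓ T K) {σ : State} (hσ : G σ) {N : ℕ}
    (h40 : σ.nat 40 0 = N) (h0 : ∀ j < N, 0 ≤ σ.real 43 j) (hb : ℓ ≤ σ.real 42 0) :
    Ex O (stageProg test) σ (stageTime N T) ((Nat.log 2 N + 1) * K) (fun σ' =>
      ℓ ≤ σ'.real 42 0 ∧ σ'.real 42 0 ≤ σ.real 42 0 ∧
      (∀ j < N, σ.nat 56 j + σ.nat 57 0 ≤ σ.nat 59 0 → ℓ ≤ entry σ j (σ.nat 56 j + σ.nat 57 0) →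
        σ'.real 42 0 ≤ entry σ j (σ.nat 56 j + σ.nat 57 0)) ∧
      ∀ j < N, σ'.nat 56 j = if σ.nat 56 j + σ.nat 57 0 ≤ σ.nat 59 0 ∧
        σ'.real 42 0 ≤ entry σ j (σ.nat 56 j + σ.nat 57 0) then σ.nat 56 j + σ.nat 57 0
        else σ.nat 56 j) := by
  set st := σ.nat 57 0 with hst
  refine Ex.mono (Ex.seq (Ex.flat_seq 10 fun σ₁ e₁ a₁ => Ex.for₀ N 80
    (fun k σ' => σ'.nat 58 0 = k ∧ ∀ j < k, σ'.real 40 j =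
      if σ.nat 56 j + st ≤ σ.nat 59 0 then entry σ j (σ.nat 56 j + st) else 0)
    ?_ ?_ ?_)
    fun σ₂ a₂ h₂ => Ex.seq (K' := (Nat.log 2 N + 1) * K + (0 + 0))
    (sortProg_spec (N := N) (by rw [a₂.nat 40 rfl, h40])) fun σ₃ a₃ h₃ =>
    Ex.seq (bsearchProg_spec ht (ht.agree a₃ (ht.agree a₂ hσ ?_ ?_) ?_ ?_) (N := N) ?_ h₃.2 ?_ ?_)
    fun σ₄ a₄ h₄ => Ex.flat_seq 10 fun σ₅ e₅ a₅ =>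
    (Ex.for₀ N 80 (fun k σ' => σ'.nat 58 0 = k ∧
      (∀ j < k, σ'.nat 56 j = if σ.nat 56 j + st ≤ σ.nat 59 0 ∧
        σ₄.real 42 0 ≤ entry σ j (σ.nat 56 j + st) then σ.nat 56 j + st else σ.nat 56 j) ∧
      ∀ j, k ≤ j → σ'.nat 56 j = σ.nat 56 j) ?_ ?_ ?_).mono le_rfl le_rfl ?_)
      ?_ ?_ fun _ _ h => h
  · simp [e₁, Prog.sem]
  · rintro k hk σ' a' ⟨i1, i2⟩
    have g40 : σ'.nat 40 0 = N := by rw [a'.nat 40 rfl, a₁.nat 40 rfl, h40]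
    have g55 : σ'.nat 55 = σ.nat 55 := by rw [a'.nat 55 rfl, a₁.nat 55 rfl]
    have g56 : σ'.nat 56 = σ.nat 56 := by rw [a'.nat 56 rfl, a₁.nat 56 rfl]
    have g57 : σ'.nat 57 0 = st := by rw [a'.nat 57 rfl, a₁.nat 57 rfl]
    have g59 : σ'.nat 59 0 = σ.nat 59 0 := by rw [a'.nat 59 rfl, a₁.nat 59 rfl]
    have g60 : σ'.nat 60 0 = σ.nat 60 0 := by rw [a'.nat 60 rfl, a₁.nat 60 rfl]
    have g43 : σ'.real 43 = σ.real 43 := by rw [a'.real 43 rfl, a₁.real 43 rfl]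
    refine ⟨by simp [i1, g40, hk], Ex.flat ?_⟩
    simp [Prog.wp, tryExp, i1, g55, g56, g57, g59, g60, g43, Function.update_apply]
    refine ⟨fun h j hj => ?_, fun h j hj => ?_⟩
    · split_ifs with e e' e'
      · rw [e]; rfl
      · rw [e] at e'; exact absurd h e'
      · rw [i2 j (by omega), if_pos e']
      · rw [i2 j (by omega), if_neg e']
    · split_ifs with e e' e'
      · rw [e] at e'; omega
      · rfl
      · rw [i2 j (by omega), if_pos e']
      · rw [i2 j (by omega), if_neg e']
  · rintro σ' a' ⟨i1, -⟩
    have g40 : σ'.nat 40 0 = N := by rw [a'.nat 40 rfl, a₁.nat 40 rfl, h40]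
    simp [i1, g40]
  · intro A hA hB _; simp [Prog.wn, hB]
  · intro A hA hB _ _; simp [Prog.wr, hB]
  · intro A hA hB _; simp [Prog.wn, sortProg, passProg, mergeProg, hB]
  · intro A hA hB _ _; simp [Prog.wr, sortProg, passProg, mergeProg, hB]
  · rw [a₃.nat 40 rfl, a₂.nat 40 rfl, h40]
  · intro j hj
    obtain ⟨y, -, hy, e⟩ := h₃.1.mem j (Nat.zero_le _) hj
    rw [e, h₂.2 y hy]
    split_ifs
    · exact div_nonneg (h0 y hy) (by positivity)
    · exact le_rfl
  · rwa [a₃.real 42 rfl, a₂.real 42 rfl]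
  · have w56 : σ₅.nat 56 = σ.nat 56 := by
      rw [a₅.nat 56 rfl, a₄.nat 56 (by simp [Prog.wn, bsearchProg, ht.nat_frame, beq_eq_decide]), a₃.nat 56 rfl,
        a₂.nat 56 rfl]
    rw [w56]
    exact ⟨by simp [e₅, Prog.sem], by simp, fun _ _ => rfl⟩
  · rintro k hk σ' a' ⟨i1, i2, i3⟩
    have fr : ∀ A ∈ [40, 55, 57, 59, 60], σ'.nat A = σ.nat A := by
      intro A hA
      rw [a'.nat A (by revert A; decide), a₅.nat A (by revert A; decide), a₄.nat A ?_,
        a₃.nat A (by revert A; decide), a₂.nat A (by revert A; decide)]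
      have h1 := ht.nat_frame A (by revert A; decide)
      have h2 : Nat.beq 48 A = false ∧ Nat.beq 49 A = false ∧ Nat.beq 50 A = false := by
        clear h1; revert A; decide
      simp [bsearchProg, Prog.wn, h1, h2]
    simp only [List.mem_cons, List.not_mem_nil, or_false, forall_eq_or_imp, forall_eq] at fr
    obtain ⟨g40, g55, g57, g59, g60⟩ := fr
    have g43 : σ'.real 43 = σ.real 43 := by
      rw [a'.real 43 rfl, a₅.real 43 rfl,
        a₄.real 43 (by simp [Prog.wr, bsearchProg, ht.real_frame, beq_eq_decide]), a₃.real 43 rfl, a₂.real 43 rfl]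
    have g42 : σ'.real 42 = σ₄.real 42 := (a'.real 42 rfl).trans (a₅.real 42 rfl)
    have g56 := i3 k le_rfl
    refine ⟨by simp [i1, g40, h40, hk], Ex.flat ?_⟩
    have hent : σ.real 43 k / (σ.nat 55 k + σ.nat 60 0 * ((σ.nat 56 k + st - 1 : ℕ) : ℝ)) =
      entry σ k (σ.nat 56 k + st) := rfl
    simp [Prog.wp, tryExp, i1, g55, g56, g57, g59, g60, g43, g42, Function.update_apply, hent,
      ← hst]
    refine ⟨fun h => ⟨fun h' => ⟨fun j hj => ?_, fun j hj => ?_⟩, fun h' => ⟨fun j hj => ?_,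
      fun j hj => i3 j (by omega)⟩⟩, fun h => ⟨fun j hj => ?_, fun j hj => i3 j (by omega)⟩⟩
    · by_cases e : j = k
      · rw [if_pos e, e, if_pos ⟨h, h'⟩]
      · rw [if_neg e, i2 j (by omega)]
    · rw [if_neg (by omega), i3 j (by omega)]
    · by_cases e : j = k
      · rw [e, if_neg (fun c => absurd c.2 (not_le.2 h')), g56]
      · exact i2 j (by omega)
    · by_cases e : j = k
      · rw [e, if_neg (fun c => absurd c.1 (by omega)), g56]
      · exact i2 j (by omega)
  · rintro σ' a' ⟨i1, -⟩
    have g40 : σ'.nat 40 0 = N := by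
      rw [a'.nat 40 rfl, a₅.nat 40 rfl, a₄.nat 40 (by simp [Prog.wn, bsearchProg, ht.nat_frame, beq_eq_decide]),
        a₃.nat 40 rfl, a₂.nat 40 rfl, h40]
    simp [i1, g40]
  · rintro σ' a' ⟨-, i2, -⟩
    have g42 : σ'.real 42 = σ₄.real 42 := (a'.real 42 rfl).trans (a₅.real 42 rfl)
    rw [g42]
    obtain ⟨j1, j2, j3⟩ := h₄
    rw [a₃.real 42 rfl, a₂.real 42 rfl] at j1
    refine ⟨j2, j1, fun j hj hin hl => ?_, i2⟩
    obtain ⟨x, -, hx, e⟩ := h₃.1.mem' j (Nat.zero_le _) hj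
    rw [h₂.2 j hj, if_pos hin] at e
    rw [← e] at hl ⊢
    exact j3 x hx hl
  · unfold stageTime; omega
  · omega

/-- Find the optimum in the lists, with steps that are halved from stage to stage. -/
def searchProg (test : Prog) : Prog :=
  nset 57 1 ;; .loop (natLt (nv 57) (nv 59)) (nset 57 (nv 57 + nv 57)) ;;
  .loop (.natLe 1 (nv 57)) (stageProg test ;; nset 57 (.half (nv 57)))

theorem entry_lt {σ : State} {j p p' : ℕ} (h43 : 0 < σ.real 43 j) (h55 : 0 < σ.nat 55 j)
    (h60 : 0 < σ.nat 60 0) (hp : 1 ≤ p) (hpp : p < p') : entry σ j p' < entry σ j p := by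
  unfold entry
  have h1 : (0 : ℝ) < σ.nat 55 j := by exact_mod_cast h55
  have h2 : (0 : ℝ) < σ.nat 60 0 := by exact_mod_cast h60
  have h3 : ((p - 1 : ℕ) : ℝ) < ((p' - 1 : ℕ) : ℝ) := by exact_mod_cast (by omega : p - 1 < p' - 1)
  refine div_lt_div_of_pos_left h43 (by positivity) ?_
  have := mul_lt_mul_of_pos_left h3 h2
  linarith

theorem searchProg_spec (ht : Decides O test G ℓ T K) {σ : State} (hσ : G σ) {N M : ℕ}
    (h40 : σ.nat 40 0 = N) (h43 : ∀ j < N, 0 < σ.real 43 j) (h55 : ∀ j < N, 0 < σ.nat 55 j)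
    (h56 : ∀ j, σ.nat 56 j = 0) (h59 : σ.nat 59 0 = M) (h60 : 0 < σ.nat 60 0)
    (hb : ℓ ≤ σ.real 42 0) {j₀ p₀ : ℕ} (hj₀ : j₀ < N) (hp₀ : 1 ≤ p₀) (hp₁ : p₀ ≤ M)
    (hl : entry σ j₀ p₀ = ℓ) :
    Ex O (searchProg test) σ ((Nat.clog 2 M + 1) * (stageTime N T + 100) + 100)
      ((Nat.clog 2 M + 1) * ((Nat.log 2 N + 1) * K)) (fun σ' => σ'.real 42 0 = ℓ) := by
  refine Ex.mono (Ex.flat_seq 10 fun σ₁ e₁ a₁ => Ex.seq (Ex.for₀ (Nat.clog 2 M)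
    20 (fun k σ' => σ'.nat 57 0 = 2 ^ k) ?_ ?_ ?_) fun σ₂ a₂ h₂ =>
    (Ex.for (Nat.clog 2 M + 1) (fun _ => stageTime N T + 20) (fun k σ' =>
      σ'.nat 57 0 = 2 ^ Nat.clog 2 M / 2 ^ k ∧ σ'.nat 56 j₀ ≤ p₀ ∧
      p₀ < σ'.nat 56 j₀ + (if k ≤ Nat.clog 2 M then 2 * (2 ^ Nat.clog 2 M / 2 ^ k) else 1) ∧
      ℓ ≤ σ'.real 42 0 ∧ (1 ≤ σ'.nat 56 j₀ → σ'.real 42 0 ≤ entry σ j₀ (σ'.nat 56 j₀)))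
      (K := (Nat.log 2 N + 1) * K) ?_ ?_ ?_).mono le_rfl le_rfl ?_)
    ?_ ?_ fun _ _ h => h
  · simp [e₁, Prog.sem]
  · rintro k hk σ' a' i1
    have g59 : σ'.nat 59 0 = M := by rw [a'.nat 59 rfl, a₁.nat 59 rfl, h59]
    have := (Nat.lt_clog_iff_pow_lt (b := 2) (by norm_num)).1 hk
    refine ⟨by simp [i1, g59, this], Ex.flat ?_⟩
    simp [Prog.wp, i1]
    ring
  · rintro σ' a' i1
    have g59 : σ'.nat 59 0 = M := by rw [a'.nat 59 rfl, a₁.nat 59 rfl, h59]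
    have := (Nat.lt_clog_iff_pow_lt (b := 2) (x := M) (by norm_num)).not.1 (lt_irrefl _)
    simp [i1, g59]; omega
  · have := (Nat.lt_clog_iff_pow_lt (b := 2) (x := M) (by norm_num)).not.1 (lt_irrefl _)
    have g56 : σ₂.nat 56 j₀ = 0 := by rw [a₂.nat 56 rfl, a₁.nat 56 rfl, h56]
    have g42 : σ₂.real 42 0 = σ.real 42 0 := by rw [a₂.real 42 rfl, a₁.real 42 rfl]
    rw [g56, g42]
    simp [h₂]
    exact ⟨by omega, hb⟩
  · rintro k hk σ' a' ⟨i1, i2, i3, i4, i5⟩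
    set s := 2 ^ Nat.clog 2 M / 2 ^ k with hs
    rw [if_pos (by omega)] at i3
    have hs' : s = 2 ^ (Nat.clog 2 M - k) := Nat.pow_div (by omega) (by norm_num)
    have hs1 : 1 ≤ s := by rw [hs']; exact Nat.one_le_two_pow
    have fr : ∀ A ∈ [40, 55, 59, 60], σ'.nat A = σ.nat A := by
      intro A hA
      rw [a'.nat A ?_, a₂.nat A (by revert A; decide), a₁.nat A (by revert A; decide)]
      have h1 := ht.nat_frame A (by revert A; decide)
      have h2 : ∀ B ∈ [41, 42, 43, 44, 45, 46, 47, 48, 49, 50, 56, 57, 58], Nat.beq B A = false := by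
        clear h1; revert A; decide
      simp at h2
      simp [stageProg, sortProg, passProg, mergeProg, bsearchProg, Prog.wn, h1, h2]
    simp only [List.mem_cons, List.not_mem_nil, or_false, forall_eq_or_imp, forall_eq] at fr
    obtain ⟨g40, g55, g59, g60⟩ := fr
    have g43 : σ'.real 43 = σ.real 43 := by
      rw [a'.real 43 (by simp [Prog.wr, stageProg, sortProg, passProg, mergeProg, bsearchProg,
        ht.real_frame, beq_eq_decide]), a₂.real 43 rfl, a₁.real 43 rfl]
    have hG : G σ' := by
      refine ht.agree a' (ht.agree a₂ (ht.agree a₁ hσ ?_ ?_) ?_ ?_) ?_ ?_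
      · intro A hA hB _; simp [Prog.wn, hB]
      · intro A hA hB _ _; simp [Prog.wr]
      · intro A hA hB _; simp [Prog.wn, hB]
      · intro A hA hB _ _; simp [Prog.wr]
      · intro A hA hB h
        simp [stageProg, sortProg, passProg, mergeProg, bsearchProg, Prog.wn, hB, h]
      · intro A hA hB h22 h
        simp [stageProg, sortProg, passProg, mergeProg, bsearchProg, Prog.wr, hB, h, h22]
    have hent : ∀ p, entry σ' j₀ p = entry σ j₀ p := fun p => by
      simp only [entry, g43, g55, g60]
    refine ⟨by simp [i1]; exact hs1, ?_⟩
    refine Ex.mono (Ex.seq (stageProg_spec ht hG (N := N) (by rw [g40, h40])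
      (by rw [g43]; exact fun j hj => (h43 j hj).le) i4) fun σ₃ a₃ h₃ =>
      Ex.flat (T := 20) ?_) le_rfl (by omega) fun _ _ h => h
    obtain ⟨u1, u2, u3, u4⟩ := h₃
    have v3 := u3 j₀ hj₀
    have v4 := u4 j₀ hj₀
    rw [i1, g59, h59, hent] at v3 v4
    have w57 : σ₃.nat 57 0 = s := by
      rw [a₃.nat 57 (by simp [stageProg, sortProg, passProg, mergeProg, bsearchProg, Prog.wn,
        ht.nat_frame, beq_eq_decide]), i1]
    have hhalf : s / 2 = 2 ^ Nat.clog 2 M / 2 ^ (k + 1) := by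
      rw [hs, Nat.div_div_eq_div_mul, pow_succ]
    have hnew : (if k + 1 ≤ Nat.clog 2 M then 2 * (s / 2) else 1) = s := by
      split_ifs with h
      · obtain ⟨r, hr⟩ : ∃ r, Nat.clog 2 M - k = r + 1 := ⟨Nat.clog 2 M - k - 1, by omega⟩
        rw [hs', hr, pow_succ]; omega
      · rw [hs', show Nat.clog 2 M - k = 0 by omega]; rfl
    have hle : ∀ p, 1 ≤ p → p ≤ p₀ → ℓ ≤ entry σ j₀ p := by
      intro p hp hpp
      rcases Nat.lt_or_eq_of_le hpp with h | rfl
      · rw [← hl]; exact (entry_lt (h43 _ hj₀) (h55 _ hj₀) h60 hp h).le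
      · exact hl.ge
    have hgt : ∀ p, p₀ < p → entry σ j₀ p < ℓ := fun p hpp => by
      rw [← hl]; exact entry_lt (h43 _ hj₀) (h55 _ hj₀) h60 hp₀ hpp
    simp only [Prog.wp, State.setNat_nat, State.setNat_real, NatExp.eval_half, NatExp.eval_get,
      NatExp.eval_lit, w57, if_true, Function.update_self, if_false, Nat.reduceEqDiff, ← hhalf, hnew]
    refine ⟨trivial, ?_⟩
    by_cases c : σ'.nat 56 j₀ + s ≤ p₀
    · have hB := v3 (c.trans hp₁) (hle _ (by omega) c)
      rw [if_pos ⟨c.trans hp₁, hB⟩] at v4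
      rw [v4]
      exact ⟨c, by omega, u1, fun _ => hB⟩
    · rw [if_neg (fun h => absurd (u1.trans h.2) (not_le.2 (hgt _ (by omega))))] at v4
      rw [v4]
      exact ⟨i2, by omega, u1, fun h => u2.trans (i5 h)⟩
  · rintro σ' a' ⟨i1, -⟩
    have : 2 ^ Nat.clog 2 M / 2 ^ (Nat.clog 2 M + 1) = 0 :=
      Nat.div_eq_of_lt (Nat.pow_lt_pow_right (by norm_num) (by omega))
    simp [i1, this]
  · rintro σ' - ⟨-, i2, i3, i4, i5⟩
    rw [if_neg (by omega)] at i3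
    have e : σ'.nat 56 j₀ = p₀ := by omega
    rw [e, hl] at i5
    exact le_antisymm (i5 hp₀) i4
  · simp only [Finset.sum_const, Finset.card_range, smul_eq_mul]
    have : (Nat.clog 2 M + 1) * (stageTime N T + 100) =
      (Nat.clog 2 M + 1) * (stageTime N T + 20 + 20) + (Nat.clog 2 M + 1) * 60 := by ring
    omega
  · omega

end Search

/-! ### The lists of candidates -/

/-- The memory holds the numbers of segments and the lengths of the perimeters. -/
structure HasInput {m : ℕ} (P : Fin m → Perimeter) (σ : State) : Prop where
  q_eq : ∀ k : Fin m, σ.nat 1 k = (P k).q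
  seg_eq : ∀ k : Fin m, ∀ r < (P k).q, σ.real 1 (offset P k + r) = len ((P k).seg r)
  gap_eq : ∀ k : Fin m, ∀ r < (P k).q, σ.real 2 (offset P k + r) = len ((P k).gap r)

theorem HasInput.of_eq {m : ℕ} {P : Fin m → Perimeter} {σ σ' : State} (h : HasInput P σ)
    (h1 : σ'.nat 1 = σ.nat 1) (h2 : σ'.real 1 = σ.real 1) (h3 : σ'.real 2 = σ.real 2) :
    HasInput P σ' :=
  ⟨by rw [h1]; exact h.q_eq, by rw [h2]; exact h.seg_eq, by rw [h3]; exact h.gap_eq⟩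

theorem HasInput.agree {m : ℕ} {P : Fin m → Perimeter} {σ σ' : State} {p : Prog} (h : HasInput P σ)
    (ha : Agree p σ σ') (hp : p.wn 1 = false ∧ p.wr 1 = false ∧ p.wr 2 = false := by decide) :
    HasInput P σ' :=
  h.of_eq (ha.nat 1 hp.1) (ha.real 1 hp.2.1) (ha.real 2 hp.2.2)

theorem hasInput_input {m t : ℕ} (P : Fin m → Perimeter) (n a : Fin t → ℕ) (i : ℕ) (ℓ : ℝ) :
    HasInput P (input P n a i ℓ) :=
  ⟨input_q P n a i ℓ, fun k _ => input_seg P n a i ℓ k, fun k _ => input_gap P n a i ℓ k⟩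

theorem HasInput.atPerim {m : ℕ} {P : Fin m → Perimeter} {σ : State} (h : HasInput P σ) (k : Fin m)
    {i : ℕ} (h24 : σ.nat 24 0 = (P k).q) (h25 : σ.nat 25 0 = offset P k) (h26 : σ.nat 26 0 = i) :
    AtPerim (P k) (offset P k) i σ :=
  ⟨h24, h25, h26, h.seg_eq k, h.gap_eq k⟩

theorem offset_zero {m : ℕ} (P : Fin m → Perimeter) : offset P 0 = 0 := rfl

theorem offset_succ {m : ℕ} (P : Fin m → Perimeter) (k : Fin m) :
    offset P (k + 1) = offset P k + (P k).q := by
  rw [offset, Finset.sum_range_succ, pad_val]; rfl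

theorem sum_range_offset {m : ℕ} (P : Fin m → Perimeter) (f : ℕ → ℝ) {N : ℕ} (hN : N ≤ m) :
    ∑ j ∈ Finset.range (offset P N), f j =
      ∑ k ∈ Finset.range N, ∑ r ∈ Finset.range (pad (fun k => (P k).q) k), f (offset P k + r) := by
  induction N with
  | zero => simp [offset_zero]
  | succ N ih =>
    rw [Finset.sum_range_succ, ← ih (by omega), offset, Finset.sum_range_succ, Finset.sum_range_add]
    rfl

/-- The sum of all lengths. -/
def sumProg : Prog :=
  (nset 58 0 ;; rset 42 0) ;; .loop (natLt (nv 58) (nv 25))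
    (rset 42 (rv 42 + (.get 1 (nv 58) + .get 2 (nv 58))) ;; nset 58 (nv 58 + 1))

theorem sumProg_spec {O : ℕ → ℝ → Prop} {m : ℕ} {P : Fin m → Perimeter} {σ : State}
    (h : HasInput P σ) (h25 : σ.nat 25 0 = offset P m) :
    Ex O sumProg σ (60 * offset P m + 50) 0 (fun σ' => σ'.real 42 0 = ∑ k, (P k).total) := by
  refine Ex.time (Ex.flat_seq 20 fun σ₁ e₁ a₁ => (Ex.for₀ (offset P m) 40
    (fun k σ' => σ'.nat 58 0 = k ∧ σ'.real 42 0 = ∑ j ∈ Finset.range k, (σ.real 1 j + σ.real 2 j))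
    ?_ ?_ ?_).mono le_rfl le_rfl ?_) (by omega)
  · simp [e₁, Prog.sem]
  · rintro k hk σ' a' ⟨i1, i2⟩
    have g25 : σ'.nat 25 0 = offset P m := by rw [a'.nat 25 rfl, a₁.nat 25 rfl, h25]
    have g1 : σ'.real 1 = σ.real 1 := (a'.real 1 rfl).trans (a₁.real 1 rfl)
    have g2 : σ'.real 2 = σ.real 2 := (a'.real 2 rfl).trans (a₁.real 2 rfl)
    refine ⟨by simp [i1, g25, hk], Ex.flat ?_⟩
    simp [Prog.wp, i1, i2, g1, g2, Finset.sum_range_succ]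
  · rintro σ' a' ⟨i1, -⟩
    have g25 : σ'.nat 25 0 = offset P m := by rw [a'.nat 25 rfl, a₁.nat 25 rfl, h25]
    simp [i1, g25]
  · rintro σ' - ⟨-, i2⟩
    rw [i2, sum_range_offset P _ le_rfl, Finset.sum_range]
    refine Finset.sum_congr rfl fun k _ => ?_
    rw [pad_val, ← (P k).segStart_q 0, segStart]
    refine Finset.sum_congr rfl fun r hr => ?_
    rw [Finset.mem_range] at hr
    rw [h.seg_eq k r hr, h.gap_eq k r hr, zero_add]

/-- The lists in memory, `N` in number, contain the lists for the lengths and cells in `C`. -/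
structure Listing {m : ℕ} (P : Fin m → Perimeter) (C : Fin m → ℕ → ℕ → ℕ → Prop) (N : ℕ)
    (σ : State) : Prop where
  N_eq : σ.nat 40 0 = N
  pos : ∀ j < N, 0 < σ.real 43 j ∧ 0 < σ.nat 55 j
  all : ∀ k i d y, C k i d y → ∃ j < N, σ.real 43 j = segEnd (P k) i d ∧ σ.nat 55 j = σ.nat 16 y

theorem Listing.of_eq {m : ℕ} {P : Fin m → Perimeter} {C C' : Fin m → ℕ → ℕ → ℕ → Prop} {N N' : ℕ}
    {σ σ' : State} (h : Listing P C N σ) (hN : N = N') (h40 : σ'.nat 40 = σ.nat 40)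
    (h43 : σ'.real 43 = σ.real 43) (h55 : σ'.nat 55 = σ.nat 55) (h16 : σ'.nat 16 = σ.nat 16)
    (hC : ∀ k i d y, C' k i d y → C k i d y) : Listing P C' N' σ' := by
  subst hN
  refine ⟨by rw [h40, h.N_eq], ?_, ?_⟩
  · rw [h43, h55]; exact h.pos
  · rw [h43, h55, h16]; exact fun k i d y hc => h.all k i d y (hC k i d y hc)

/-- Append the lists for the length of a chain. -/
def listRow : Prog :=
  nset 54 0 ;; .loop (natLt (nv 54) (nv 61))
    (.setReal 43 (nv 40) (.get 13 (nv 53)) ;; .setNat 55 (nv 40) (.get 16 (nv 54)) ;;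
      nset 40 (nv 40 + 1) ;; nset 54 (nv 54 + 1))

/-- Append the lists for a starting segment. -/
def listStart : Prog :=
  dpPrefix ;; nset 53 0 ;; .loop (natLt (nv 53) (nv 24)) (listRow ;; nset 53 (nv 53 + 1))

/-- Append the lists for a perimeter. -/
def listPerim : Prog :=
  (nset 24 (.get 1 (nv 51)) ;; nset 26 0) ;;
  .loop (natLt (nv 26) (nv 24)) (listStart ;; nset 26 (nv 26 + 1)) ;;
  (nset 25 (nv 25 + nv 24) ;; nset 51 (nv 51 + 1))

/-- Write all lists. -/
def listAll : Prog :=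
  (nset 40 0 ;; nset 51 0 ;; nset 25 0) ;; .loop (natLt (nv 51) (nv 21)) listPerim

section Lists
variable {O : ℕ → ℝ → Prop} {m : ℕ} {P : Fin m → Perimeter} {C : Fin m → ℕ → ℕ → ℕ → Prop} {N Y : ℕ}
  {σ : State}

theorem listRow_spec {k : Fin m} {i d : ℕ} (h : Listing P C N σ) (hY : σ.nat 61 0 = Y)
    (hd : σ.nat 53 0 = d) (h13 : σ.real 13 d = segEnd (P k) i d) (hW : ∀ y < Y, 0 < σ.nat 16 y) :
    Ex O listRow σ (70 * Y + 40) 0 (Listing P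
      (fun k' i' d' y' => C k' i' d' y' ∨ k' = k ∧ i' = i ∧ d' = d ∧ y' < Y) (N + Y)) := by
  refine Ex.time (Ex.flat_seq 10 fun σ₁ e₁ a₁ => (Ex.for₀ Y 50
    (fun y σ' => σ'.nat 54 0 = y ∧ Listing P
      (fun k' i' d' y' => C k' i' d' y' ∨ k' = k ∧ i' = i ∧ d' = d ∧ y' < y) (N + y) σ')
    ?_ ?_ ?_).mono le_rfl le_rfl fun _ _ h => h.2) (by omega)
  · refine ⟨by simp [e₁, Prog.sem], h.of_eq rfl (a₁.nat 40 rfl) (a₁.real 43 rfl) (a₁.nat 55 rfl)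
      (a₁.nat 16 rfl) fun k' i' d' y' hc => ?_⟩
    rcases hc with hc | hc
    · exact hc
    · omega
  · rintro y hy σ' a' ⟨i1, i2⟩
    have g61 : σ'.nat 61 0 = Y := by rw [a'.nat 61 rfl, a₁.nat 61 rfl, hY]
    have g53 : σ'.nat 53 0 = d := by rw [a'.nat 53 rfl, a₁.nat 53 rfl, hd]
    have g16 : σ'.nat 16 = σ.nat 16 := (a'.nat 16 rfl).trans (a₁.nat 16 rfl)
    have g13 : σ'.real 13 = σ.real 13 := (a'.real 13 rfl).trans (a₁.real 13 rfl)
    refine ⟨by simp [i1, g61, hy], Ex.flat ?_⟩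
    simp only [Prog.wp, State.setNat_nat, State.setReal_nat, State.setReal_real,
      NatExp.eval_add, NatExp.eval_get, NatExp.eval_lit, NatExp.eval_one, RealExp.eval_get, i1, g53,
      g13, g16, h13, i2.N_eq, if_true, Function.update_self, if_false, Nat.reduceEqDiff]
    refine ⟨trivial, ?_, ?_, ?_⟩
    · simp [add_assoc]
    · intro j hj
      simp [Function.update_apply]
      split_ifs with e
      · exact ⟨(P k).segEnd_pos i d, hW y hy⟩
      · exact i2.pos j (by omega)
    · intro k' i' d' y' hc
      simp [Function.update_apply]
      by_cases e : k' = k ∧ i' = i ∧ d' = d ∧ y' = y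
      · obtain ⟨rfl, rfl, rfl, rfl⟩ := e
        refine ⟨N + y', by omega, ?_, ?_⟩
        · rw [if_pos rfl]
        · rw [if_pos rfl, g16]
      · obtain ⟨j, hj, e1, e2⟩ := i2.all k' i' d' y' (hc.imp_right fun hc => by omega)
        refine ⟨j, by omega, ?_, ?_⟩
        · rw [if_neg (by omega), e1]
        · rw [if_neg (by omega), e2]
  · rintro σ' a' ⟨i1, -⟩
    have g61 : σ'.nat 61 0 = Y := by rw [a'.nat 61 rfl, a₁.nat 61 rfl, hY]
    simp [i1, g61]

theorem listStart_spec {k : Fin m} {i off : ℕ} (hP : AtPerim (P k) off i σ) (hi : i < (P k).q)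
    (h : Listing P C N σ) (hY : σ.nat 61 0 = Y) (hY1 : 1 ≤ Y) (hW : ∀ y < Y, 0 < σ.nat 16 y) :
    Ex O listStart σ (300 * ((P k).q * Y) + 100) 0 (Listing P
      (fun k' i' d' y' => C k' i' d' y' ∨ k' = k ∧ i' = i ∧ d' < (P k).q ∧ y' < Y)
      (N + (P k).q * Y)) := by
  refine Ex.time (Ex.seq₀ (dpPrefix_spec hP hi) fun σ₁ a₁ h₁ => Ex.flat_seq 10
    fun σ₂ e₂ a₂ => (Ex.for₀ (P k).q (70 * Y + 40 + 20)
    (fun d σ' => σ'.nat 53 0 = d ∧ Listing P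
      (fun k' i' d' y' => C k' i' d' y' ∨ k' = k ∧ i' = i ∧ d' < d ∧ y' < Y) (N + d * Y) σ')
    ?_ ?_ ?_).mono le_rfl le_rfl fun _ _ h => h.2) ?_
  · refine ⟨by simp [e₂, Prog.sem], h.of_eq (by simp) ?_ ?_ ?_ ?_ fun k' i' d' y' hc => ?_⟩
    · exact (a₂.nat 40 rfl).trans (a₁.nat 40 rfl)
    · exact (a₂.real 43 rfl).trans (a₁.real 43 rfl)
    · exact (a₂.nat 55 rfl).trans (a₁.nat 55 rfl)
    · exact (a₂.nat 16 rfl).trans (a₁.nat 16 rfl)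
    · rcases hc with hc | hc
      · exact hc
      · omega
  · rintro d hd σ' a' ⟨i1, i2⟩
    have g61 : σ'.nat 61 0 = Y := by rw [a'.nat 61 rfl, a₂.nat 61 rfl, a₁.nat 61 rfl, hY]
    have g24 : σ'.nat 24 0 = (P k).q := by rw [a'.nat 24 rfl, a₂.nat 24 rfl, a₁.nat 24 rfl, hP.q_eq]
    have g16 : σ'.nat 16 = σ.nat 16 := by rw [a'.nat 16 rfl, a₂.nat 16 rfl, a₁.nat 16 rfl]
    have g13 : σ'.real 13 d = segEnd (P k) i d := by
      rw [a'.real 13 rfl, a₂.real 13 rfl, h₁.2 d hd]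
    refine ⟨by simp [i1, g24, hd], Ex.seq₀ (listRow_spec (k := k) (i := i) i2 g61 i1 g13
      (by rwa [g16])) fun σ₃ a₃ h₃ => Ex.flat (T := 20) ?_⟩
    have w53 : σ₃.nat 53 0 = d := by rw [a₃.nat 53 rfl, i1]
    refine ⟨by simp [w53], h₃.of_eq (by ring) rfl rfl rfl rfl fun k' i' d' y' hc => ?_⟩
    rcases hc with hc | ⟨hc1, hc2, hc3, hc4⟩
    · exact Or.inl (Or.inl hc)
    · rcases Nat.lt_succ_iff_lt_or_eq.1 hc3 with h' | h'
      · exact Or.inl (Or.inr ⟨hc1, hc2, h', hc4⟩)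
      · exact Or.inr ⟨hc1, hc2, h', hc4⟩
  · rintro σ' a' ⟨i1, -⟩
    have g24 : σ'.nat 24 0 = (P k).q := by rw [a'.nat 24 rfl, a₂.nat 24 rfl, a₁.nat 24 rfl, hP.q_eq]
    simp [i1, g24]
  · have h1 : (P k).q ≤ (P k).q * Y := Nat.le_mul_of_pos_right _ hY1
    have h2 : (P k).q * (70 * Y + 40 + 20 + 20) = 70 * ((P k).q * Y) + 80 * (P k).q := by ring
    omega

theorem listPerim_spec {k : Fin m} (hin : HasInput P σ) (h51 : σ.nat 51 0 = k)
    (h25 : σ.nat 25 0 = offset P k)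
    (h : Listing P C N σ) (hY : σ.nat 61 0 = Y) (hY1 : 1 ≤ Y) (hW : ∀ y < Y, 0 < σ.nat 16 y) :
    Ex O listPerim σ (500 * ((P k).q ^ 2 * Y) + 100) 0 (fun σ' => σ'.nat 51 0 = k + 1 ∧
      σ'.nat 25 0 = offset P (k + 1) ∧ σ'.nat 24 0 = (P k).q ∧ Listing P
      (fun k' i' d' y' => C k' i' d' y' ∨ k' = k ∧ i' < (P k).q ∧ d' < (P k).q ∧ y' < Y)
      (N + (P k).q ^ 2 * Y) σ') := by
  refine Ex.time (Ex.flat_seq 20 fun σ₁ e₁ a₁ => Ex.seq₀ (Ex.for₀ (P k).q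
    (300 * ((P k).q * Y) + 100 + 20) (fun i σ' => σ'.nat 26 0 = i ∧ Listing P
      (fun k' i' d' y' => C k' i' d' y' ∨ k' = k ∧ i' < i ∧ d' < (P k).q ∧ y' < Y)
      (N + i * ((P k).q * Y)) σ')
    ?_ ?_ ?_) fun σ₂ a₂ h₂ => Ex.flat (T := 30) ?_) ?_
  · refine ⟨by simp [e₁, Prog.sem], h.of_eq (by simp) (a₁.nat 40 rfl) (a₁.real 43 rfl)
      (a₁.nat 55 rfl) (a₁.nat 16 rfl) fun k' i' d' y' hc => ?_⟩
    rcases hc with hc | hc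
    · exact hc
    · omega
  · rintro i hi σ' a' ⟨i1, i2⟩
    have g61 : σ'.nat 61 0 = Y := by rw [a'.nat 61 rfl, a₁.nat 61 rfl, hY]
    have g24 : σ'.nat 24 0 = (P k).q := by
      rw [a'.nat 24 rfl, e₁]; simp [Prog.sem, h51, hin.q_eq]
    have g25 : σ'.nat 25 0 = offset P k := by rw [a'.nat 25 rfl, a₁.nat 25 rfl, h25]
    have g16 : σ'.nat 16 = σ.nat 16 := (a'.nat 16 rfl).trans (a₁.nat 16 rfl)
    have hin' : HasInput P σ' := (hin.agree a₁).agree a'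
    refine ⟨by simp [i1, g24, hi], Ex.seq₀ (listStart_spec (hin'.atPerim k g24 g25 i1) hi i2 g61 hY1
      (by rwa [g16])) fun σ₃ a₃ h₃ => Ex.flat (T := 20) ?_⟩
    have w26 : σ₃.nat 26 0 = i := by rw [a₃.nat 26 rfl, i1]
    refine ⟨by simp [w26], h₃.of_eq (by ring) rfl rfl rfl rfl fun k' i' d' y' hc => ?_⟩
    rcases hc with hc | ⟨hc1, hc2, hc3, hc4⟩
    · exact Or.inl (Or.inl hc)
    · rcases Nat.lt_succ_iff_lt_or_eq.1 hc2 with h' | h'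
      · exact Or.inl (Or.inr ⟨hc1, h', hc3, hc4⟩)
      · exact Or.inr ⟨hc1, h', hc3, hc4⟩
  · rintro σ' a' ⟨i1, -⟩
    have g24 : σ'.nat 24 0 = (P k).q := by
      rw [a'.nat 24 rfl, e₁]; simp [Prog.sem, h51, hin.q_eq]
    simp [i1, g24]
  · obtain ⟨i1, i2⟩ := h₂
    have g24 : σ₂.nat 24 0 = (P k).q := by
      rw [a₂.nat 24 rfl, e₁]; simp [Prog.sem, h51, hin.q_eq]
    have g25 : σ₂.nat 25 0 = offset P k := by rw [a₂.nat 25 rfl, a₁.nat 25 rfl, h25]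
    have g51 : σ₂.nat 51 0 = k := by rw [a₂.nat 51 rfl, a₁.nat 51 rfl, h51]
    exact ⟨by simp [g51], by simp [g25, g24, offset_succ], by simp [g24],
      i2.of_eq (by ring) rfl rfl rfl rfl fun _ _ _ _ hc => hc⟩
  · have h1 : (P k).q ≤ (P k).q * (P k).q * Y := by
      rw [mul_assoc]
      exact Nat.le_mul_of_pos_right _ (Nat.mul_pos (P k).q_pos hY1)
    have h2 : (P k).q * (300 * ((P k).q * Y) + 100 + 20 + 20) =
      300 * ((P k).q * (P k).q * Y) + 140 * (P k).q := by ring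
    rw [h2, pow_two]
    omega

theorem listAll_spec (hin : HasInput P σ) (h21 : σ.nat 21 0 = m) (hY : σ.nat 61 0 = Y) (hY1 : 1 ≤ Y)
    (hW : ∀ y < Y, 0 < σ.nat 16 y) :
    Ex O listAll σ (700 * ((∑ k, (P k).q ^ 2) * Y) + 100) 0 (fun σ' => σ'.nat 25 0 = offset P m ∧
      (∀ k : Fin m, (k : ℕ) + 1 = m → σ'.nat 24 0 = (P k).q) ∧ Listing P
      (fun k i d y => i < (P k).q ∧ d < (P k).q ∧ y < Y) ((∑ k, (P k).q ^ 2) * Y) σ') := by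
  set f : ℕ → ℕ := pad fun k => (P k).q ^ 2 with hf
  refine Ex.time (Ex.flat_seq 20 fun σ₁ e₁ a₁ => (Ex.forT m
    (fun k => 500 * (f k * Y) + 100) (fun k σ' => σ'.nat 51 0 = k ∧ σ'.nat 25 0 = offset P k ∧
      (∀ k' : Fin m, (k' : ℕ) + 1 = k → σ'.nat 24 0 = (P k').q) ∧ Listing P
      (fun k' i' d' y' => (k' : ℕ) < k ∧ i' < (P k').q ∧ d' < (P k').q ∧ y' < Y)
      ((∑ k' ∈ Finset.range k, f k') * Y) σ')
    ?_ ?_ ?_).mono le_rfl le_rfl ?_) ?_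
  · refine ⟨by simp [e₁, Prog.sem], by simp [e₁, Prog.sem, offset_zero], by simp,
      by simp [e₁, Prog.sem], by simp, ?_⟩
    rintro k i d y ⟨h, -⟩
    omega
  · rintro k hk σ' a' ⟨i1, i2, i3, i4⟩
    have g61 : σ'.nat 61 0 = Y := by rw [a'.nat 61 rfl, a₁.nat 61 rfl, hY]
    have g21 : σ'.nat 21 0 = m := by rw [a'.nat 21 rfl, a₁.nat 21 rfl, h21]
    have g16 : σ'.nat 16 = σ.nat 16 := (a'.nat 16 rfl).trans (a₁.nat 16 rfl)
    have hin' : HasInput P σ' := (hin.agree a₁).agree a'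
    have hfk : f k = (P ⟨k, hk⟩).q ^ 2 := pad_val (fun k => (P k).q ^ 2) ⟨k, hk⟩
    refine ⟨by simp [i1, g21, hk], ?_⟩
    rw [hfk]
    refine (listPerim_spec (k := ⟨k, hk⟩) hin' i1 i2 i4 g61 hY1 (by rwa [g16])).mono le_rfl le_rfl ?_
    rintro σ₂ a₂ ⟨u1, u2, u3, u4⟩
    refine ⟨u1, u2, fun k' hk' => ?_, u4.of_eq ?_ rfl rfl rfl rfl fun k' i' d' y' hc => ?_⟩
    · obtain rfl : k' = ⟨k, hk⟩ := Fin.ext (by simpa using hk')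
      exact u3
    · rw [Finset.sum_range_succ, add_mul, hfk]
    · rcases Nat.lt_succ_iff_lt_or_eq.1 hc.1 with h' | h'
      · exact Or.inl ⟨h', hc.2⟩
      · obtain rfl : k' = ⟨k, hk⟩ := Fin.ext h'
        exact Or.inr ⟨rfl, hc.2⟩
  · rintro σ' a' ⟨i1, -⟩
    have g21 : σ'.nat 21 0 = m := by rw [a'.nat 21 rfl, a₁.nat 21 rfl, h21]
    simp [i1, g21]
  · rintro σ' - ⟨-, i2, i3, i4⟩
    refine ⟨i2, i3, i4.of_eq (by rw [hf, sum_range_pad]) rfl rfl rfl rfl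
      fun k i d y hc => ⟨k.2, hc⟩⟩
  · have h1 : m ≤ (∑ k, (P k).q ^ 2) * Y := by
      refine le_trans ?_ (Nat.le_mul_of_pos_right _ hY1)
      calc m = ∑ _k : Fin m, 1 := by simp
        _ ≤ _ := Finset.sum_le_sum fun k _ => Nat.one_le_pow _ _ (P k).q_pos
    have h2 : ∑ k ∈ Finset.range m, (500 * (f k * Y) + 100 + 20) =
        500 * ((∑ k, (P k).q ^ 2) * Y) + 120 * m := by
      rw [Finset.sum_add_distrib, Finset.sum_add_distrib, ← Finset.mul_sum, ← Finset.sum_mul, hf,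
        sum_range_pad]
      simp; ring
    omega

end Lists

/-! ### Bisection with the feasibility test as a subroutine -/

theorem Ex.query {O : ℕ → ℝ → Prop} {A : ℕ} {k e : NatExp} {x : RealExp} {σ : State}
    {Q : State → Prop} (h : O (e.eval σ) (x.eval σ) → Q (σ.setNat A (k.eval σ) 1))
    (h' : ¬ O (e.eval σ) (x.eval σ) → Q (σ.setNat A (k.eval σ) 0)) :
    Ex O (.query A k e x) σ (k.cost + e.cost + x.cost + 1) 1 Q := by
  by_cases hO : O (e.eval σ) (x.eval σ)
  · exact ⟨_, _, _, .queryYes A k e x σ hO, le_rfl, le_rfl, h hO⟩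
  · exact ⟨_, _, _, .queryNo A k e x σ hO, le_rfl, le_rfl, h' hO⟩

/-- Does some starting segment pass the test? -/
def queryTest : Prog :=
  (nset 5 0 ;; nset 26 0) ;; .loop (natLt (nv 26) (nv 24))
    (.query 62 0 (nv 26) (rv 22) ;;
      (.cond (.natLe 1 (nv 62)) (nset 5 1) .skip ;; nset 26 (nv 26 + 1)))

theorem queryTest_spec {O : ℕ → ℝ → Prop} {q : ℕ} {ℓ : ℝ}
    (hO : ∀ x : ℝ, 0 ≤ x → ((∃ i : Fin q, O i x) ↔ ℓ ≤ x)) :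
    Decides O queryTest (fun σ => σ.nat 24 0 = q) ℓ (80 * q + 50) q := by
  refine ⟨fun σ hσ hx => ?_, fun σ σ' h hn _ => by rw [hn 24 (by norm_num) rfl, h], by decide,
    by decide⟩
  refine Ex.mono (Ex.flat_seq 20 fun σ₁ e₁ a₁ => (Ex.for q (fun _ => 60) (K := 1)
    (fun k σ' => σ'.nat 26 0 = k ∧ ((σ'.nat 5 0 = 1 ∧ ∃ i < k, O i (σ.real 22 0)) ∨
      (σ'.nat 5 0 = 0 ∧ ¬ ∃ i < k, O i (σ.real 22 0)))) ?_ ?_ ?_).mono le_rfl le_rfl ?_)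
    (T' := 80 * q + 50) ?_ (by omega) fun _ _ h => h
  · simp [e₁, Prog.sem]
  · rintro k hk σ' a' ⟨i1, i2⟩
    have g24 : σ'.nat 24 0 = q := by rw [a'.nat 24 rfl, a₁.nat 24 rfl, hσ]
    have g22 : σ'.real 22 = σ.real 22 := by rw [a'.real 22 rfl, a₁.real 22 rfl]
    have hsucc : ∀ p : ℕ → Prop, (∃ i < k + 1, p i) ↔ (∃ i < k, p i) ∨ p k := by
      intro p
      constructor
      · rintro ⟨i, hi, h⟩
        rcases Nat.lt_succ_iff_lt_or_eq.1 hi with h' | rfl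
        · exact Or.inl ⟨i, h', h⟩
        · exact Or.inr h
      · rintro (⟨i, hi, h⟩ | h)
        · exact ⟨i, by omega, h⟩
        · exact ⟨k, by omega, h⟩
    refine ⟨by simp [i1, g24, hk], ?_⟩
    rw [hsucc]
    refine Ex.mono (Ex.seq (Ex.query (Q := fun s => s.nat 26 0 = k ∧ s.nat 5 0 = σ'.nat 5 0 ∧
      ((s.nat 62 0 = 1 ∧ O k (σ.real 22 0)) ∨ (s.nat 62 0 = 0 ∧ ¬ O k (σ.real 22 0))))
      (fun h => ?_) fun h => ?_) fun σ₂ a₂ h₂ => Ex.flat (T := 40) ?_) (by decide)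
      le_rfl fun _ _ h => h
    · simp [i1, g22] at h ⊢
      exact h
    · simp [i1, g22] at h ⊢
      exact h
    · obtain ⟨j1, j2, j3⟩ := h₂
      refine ⟨fun h => ?_, fun h => ?_⟩
      · simp at h
        have : O k (σ.real 22 0) := by
          rcases j3 with j3 | j3
          · exact j3.2
          · omega
        simp [Prog.wp, j1, this]
      · simp at h
        have : ¬ O k (σ.real 22 0) := by
          rcases j3 with j3 | j3
          · omega
          · exact j3.2
        simp only [Prog.wp, State.setNat_nat, NatExp.eval_add, NatExp.eval_get, NatExp.eval_lit,
          NatExp.eval_one, j1, j2, this, or_false, if_true, Function.update_self, if_false,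
          Nat.reduceEqDiff]
        exact ⟨trivial, i2⟩
  · rintro σ' a' ⟨i1, -⟩
    have g24 : σ'.nat 24 0 = q := by rw [a'.nat 24 rfl, a₁.nat 24 rfl, hσ]
    simp [i1, g24]
  · rintro σ' - ⟨-, h⟩
    rw [← hO _ hx]
    have e : (∃ i < q, O i (σ.real 22 0)) ↔ ∃ i : Fin q, O i (σ.real 22 0) :=
      ⟨fun ⟨i, hi, h⟩ => ⟨⟨i, hi⟩, h⟩, fun ⟨i, h⟩ => ⟨i, i.2, h⟩⟩
    rwa [e] at h
  · simp; omega

/-- The bisection. -/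
def bisectProg : Prog :=
  setup ;; nset 61 (nv 22) ;; listAll ;; sumProg ;; (nset 59 1 ;; nset 57 1) ;;
    stageProg queryTest ;; rset 0 (rv 42)

theorem weight_eq_sum (n a : ℕ → ℕ) (t c : ℕ) :
    weight n a t c = ∑ τ : Fin t, a τ * vec n t c τ := Finset.sum_range _

theorem weight_pos {n a : ℕ → ℕ} {t c : ℕ} (ha : ∀ τ < t, 0 < a τ) (hc : c < stride n t)
    (h : c ≠ 0) : 0 < weight n a t c := by
  obtain ⟨τ, hτ, hd⟩ := exists_digit_ne_zero n hc h
  exact lt_of_lt_of_le (Nat.mul_pos (ha τ hτ) (Nat.pos_of_ne_zero hd))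
    (Finset.single_le_sum (f := fun τ => a τ * digit n c τ) (fun _ _ => Nat.zero_le _)
      (Finset.mem_range.2 hτ))

theorem Ready.weight_pos {t m : ℕ} {n a : ℕ → ℕ} {σ : State} (h : Ready t m n a σ) (ht : 1 ≤ t)
    (ha : ∀ τ < t, 0 < a τ) {c : ℕ} (hc : c < stride n t) : 0 < σ.nat 16 c := by
  rw [h.weight_eq c hc]
  split_ifs with e
  · exact ha _ (by omega)
  · exact OPG.weight_pos ha hc e

theorem exists_cell {t : ℕ} {n' a' : ℕ → ℕ} {n a : Fin t → ℕ} {ρ : Equiv.Perm (Fin t)}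
    (hn : ∀ τ : Fin t, n' τ = n (ρ τ)) (ha : ∀ τ : Fin t, a' τ = a (ρ τ)) {x : Fin t → ℕ}
    (hx : ∀ τ, x τ ≤ n τ) : ∃ c < stride n' t, weight n' a' t c = ∑ τ, a τ * x τ := by
  obtain ⟨c, hc, e⟩ := exists_vec n' (x := x ∘ ρ) fun τ => by rw [hn]; exact hx _
  refine ⟨c, hc, ?_⟩
  rw [weight_eq_sum, e]
  refine Eq.trans ?_ (Equiv.sum_comp ρ fun τ => a τ * x τ)
  exact Finset.sum_congr rfl fun τ _ => by rw [ha]; rfl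

theorem natLog_le {N S e : ℕ} (hS : 2 ≤ S) (h : N ≤ S ^ e) :
    (Nat.log 2 N : ℝ) ≤ 2 * e * Real.log S := by
  rcases Nat.eq_zero_or_pos N with rfl | hN
  · have : 0 ≤ Real.log S := Real.log_natCast_nonneg S
    simp; positivity
  have h1 : (2 : ℝ) ^ Nat.log 2 N ≤ (S : ℝ) ^ e := by
    exact_mod_cast (Nat.pow_log_le_self 2 hN.ne').trans h
  have h2 := Real.log_le_log (by positivity) h1
  rw [Real.log_pow, Real.log_pow] at h2
  have h3 := Real.log_two_gt_d9
  have h4 : (0 : ℝ) ≤ Nat.log 2 N := Nat.cast_nonneg _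
  nlinarith

theorem one_le_two_mul_log {S : ℕ} (hS : 2 ≤ S) : (1 : ℝ) ≤ 2 * Real.log S := by
  have h1 : Real.log 2 ≤ Real.log S := Real.log_le_log (by norm_num) (by exact_mod_cast hS)
  have h3 := Real.log_two_gt_d9
  linarith

theorem clog_le_log_add_one (N : ℕ) : Nat.clog 2 N ≤ Nat.log 2 N + 1 := by
  rw [Nat.clog_le_iff_le_pow (by norm_num)]
  exact (Nat.lt_pow_succ_log_self (by norm_num) N).le

theorem cells_le_pow {t : ℕ} (n : Fin t → ℕ) : cells n ≤ (∑ τ, n τ + 1) ^ t := by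
  calc cells n ≤ ∏ _τ : Fin t, (∑ τ, n τ + 1) := Finset.prod_le_prod' fun τ _ =>
        Nat.succ_le_succ (Finset.single_le_sum (fun _ _ => Nat.zero_le _) (Finset.mem_univ τ))
    _ = _ := by simp

theorem le_sum_total {m t : ℕ} {P : Fin m → Perimeter} {n a : Fin t → ℕ} {ℓ : ℝ}
    (h : ℓ ∈ candidates P n a) : ℓ ≤ ∑ k, (P k).total := by
  obtain ⟨k, i, d, x, hi, hd, hx, hpos, rfl⟩ := mem_candidates_iff.1 h
  have h1 : (1 : ℝ) ≤ ((∑ τ, a τ * x τ : ℕ) : ℝ) := by exact_mod_cast hpos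
  calc segEnd (P k) i d / ((∑ τ, a τ * x τ : ℕ) : ℝ) ≤ segEnd (P k) i d :=
        div_le_self ((P k).segEnd_pos i d).le h1
    _ ≤ (P k).total := (P k).segEnd_le_total i d hd
    _ ≤ _ := Finset.single_le_sum (f := fun k => (P k).total) (fun k _ => (P k).total_pos.le)
        (Finset.mem_univ k)

/-- The running time of the bisection. -/
def bisectTime (t q c : ℕ) : ℕ :=
  700 * (t * c) + 700 * (q ^ 2 * c) + 60 * q + stageTime (q ^ 2 * c) (80 * q + 50) + 700

theorem bisectProg_spec {t : ℕ} (P : Perimeter) (n a : Fin t → ℕ) (ht : 1 ≤ t) (ha : ∀ τ, 0 < a τ)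
    {O : ℕ → ℝ → Prop} {ℓ : ℝ} (hc : ℓ ∈ candidates (fun _ : Fin 1 => P) n a)
    (hO : ∀ x : ℝ, 0 ≤ x → ((∃ i : Fin P.q, O i x) ↔ ℓ ≤ x)) :
    Ex O bisectProg (input (fun _ : Fin 1 => P) n a 0 0) (bisectTime t P.q (cells n))
      ((Nat.log 2 (P.q ^ 2 * cells n) + 1) * P.q) (fun σ => σ.real 0 0 = ℓ) := by
  set P' : Fin 1 → Perimeter := fun _ => P with hP'
  have hin := hasInput_input P' n a 0 0
  have hsq : ∑ k, (P' k).q ^ 2 = P.q ^ 2 := by simp [hP']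
  have hoff : offset P' 1 = P.q :=
    (offset_succ P' 0).trans (by simp [offset_zero, hP'])
  refine Ex.mono (Ex.seq (setup_input P' n a 0 0 ht) (T' := 20 + ((700 * (P.q ^ 2 * cells n) + 100) +
    ((60 * P.q + 50) + (20 + (stageTime (P.q ^ 2 * cells n) (80 * P.q + 50) + 20)))))
    (K' := 0 + (0 + ((Nat.log 2 (P.q ^ 2 * cells n) + 1) * P.q + 0)))
    fun σ₁ a₁ h₁ => ?_) (T' := bisectTime t P.q (cells n)) ?_ (by omega) fun _ _ h => h
  · obtain ⟨ρ, -, hr, hsw⟩ := h₁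
    set n' := σ₁.nat 10
    set a' := σ₁.nat 11
    have hcells : stride n' t = cells n := by
      rw [cells_eq n' (n ∘ ρ) fun τ => (hsw τ).1, cells_comp]
    have ha' : ∀ τ < t, 0 < a' τ := fun τ hτ => by
      have := (hsw ⟨τ, hτ⟩).2.1
      simp only at this
      rw [this]; exact ha _
    refine Ex.flat_seq 20 fun σ₂ e₂ a₂ => ?_
    have hin₂ : HasInput P' σ₂ := (hin.agree a₁).agree a₂
    have g61 : σ₂.nat 61 0 = cells n := by simp [e₂, Prog.sem, hr.cells_eq, hcells]
    have hr₂ := hr.agree a₂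
    have hl := listAll_spec (O := O) hin₂ hr₂.m_eq g61 (cells_pos n)
      fun y hy => hr₂.weight_pos ht ha' (hcells ▸ hy)
    rw [hsq] at hl
    refine Ex.seq hl fun σ₃ a₃ h₃ => ?_
    obtain ⟨h25, h24, hlist⟩ := h₃
    have hin₃ : HasInput P' σ₃ := hin₂.agree a₃
    have hs := sumProg_spec (O := O) hin₃ h25
    rw [hoff] at hs
    refine Ex.seq hs fun σ₄ a₄ h₄ => Ex.flat_seq 20 fun σ₅ e₅ a₅ => ?_
    have q24 : σ₅.nat 24 0 = P.q := by rw [a₅.nat 24 rfl, a₄.nat 24 rfl]; exact h24 0 rfl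
    have q40 : σ₅.nat 40 0 = P.q ^ 2 * cells n := by
      rw [a₅.nat 40 rfl, a₄.nat 40 rfl, hlist.N_eq]
    have q42 : σ₅.real 42 0 = ∑ k, (P' k).total := by rw [a₅.real 42 rfl, h₄]
    have q43 : σ₅.real 43 = σ₃.real 43 := (a₅.real 43 rfl).trans (a₄.real 43 rfl)
    have q55 : σ₅.nat 55 = σ₃.nat 55 := (a₅.nat 55 rfl).trans (a₄.nat 55 rfl)
    have q56 : σ₅.nat 56 = fun _ => 0 := by
      rw [a₅.nat 56 rfl, a₄.nat 56 rfl, a₃.nat 56 rfl, a₂.nat 56 rfl, a₁.nat 56 rfl]; rfl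
    have q57 : σ₅.nat 57 0 = 1 := by simp [e₅, Prog.sem]
    have q59 : σ₅.nat 59 0 = 1 := by simp [e₅, Prog.sem]
    have q16 : σ₃.nat 16 = σ₂.nat 16 := a₃.nat 16 rfl
    refine Ex.seq (stageProg_spec (queryTest_spec hO) q24 q40
      (by rw [q43]; exact fun j hj => (hlist.pos j hj).1.le) (by rw [q42]; exact le_sum_total hc))
      fun σ₆ a₆ h₆ => Ex.flat ?_
    obtain ⟨u1, -, u3, -⟩ := h₆
    simp [Prog.wp]
    refine le_antisymm ?_ u1
    obtain ⟨k, i, d, x, hi, hd, hx, hpos, e⟩ := mem_candidates_iff.1 hc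
    obtain ⟨c, hcl, hw⟩ := exists_cell (fun τ => (hsw τ).1) (fun τ => (hsw τ).2.1) hx
    obtain ⟨j, hj, e1, e2⟩ := hlist.all k i d c ⟨hi, hd, hcells ▸ hcl⟩
    have hc0 : c ≠ 0 := by
      rintro rfl
      rw [weight_zero] at hw
      omega
    rw [q16, hr₂.weight_eq c hcl, if_neg hc0, hw] at e2
    have hent : entry σ₅ j 1 = ℓ := by
      rw [e]; simp [entry, q43, q55, e1, e2]
    have := u3 j hj
    rw [q56, q57, q59] at this
    simp only [zero_add] at this
    rw [hent] at this
    exact this le_rfl le_rfl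
  · unfold bisectTime; omega

theorem bisectTime_le (t q c : ℕ) (hq : 1 ≤ q) (hc : 1 ≤ c) :
    bisectTime t q c ≤ (700 * t + 5000) * (q * c) ^ 4 := by
  unfold bisectTime stageTime
  set X := q * c with hX
  have hX1 : 1 ≤ X := Nat.mul_pos hq hc
  have h1 : c ≤ X := Nat.le_mul_of_pos_left _ hq
  have h2 : q ≤ X := Nat.le_mul_of_pos_right _ hc
  have h3 : q ^ 2 * c ≤ X ^ 2 := by
    rw [hX, mul_pow]
    exact Nat.mul_le_mul_left _ (Nat.le_self_pow (by norm_num) c)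
  set N := q ^ 2 * c
  have h4 : Nat.clog 2 N ≤ N + 1 := (clog_le_log_add_one N).trans (Nat.succ_le_succ (Nat.log_le_self 2 N))
  have h5 : Nat.log 2 N ≤ N := Nat.log_le_self 2 N
  have e1 : X ≤ X ^ 4 := Nat.le_self_pow (by norm_num) X
  have e2 : X ^ 2 ≤ X ^ 4 := Nat.pow_le_pow_right hX1 (by norm_num)
  have e3 : X ^ 3 ≤ X ^ 4 := Nat.pow_le_pow_right hX1 (by norm_num)
  have f1 : t * c ≤ t * X ^ 4 := Nat.mul_le_mul_left _ (h1.trans e1)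
  have f2 : Nat.clog 2 N * (400 * N + 140) ≤ (X ^ 2 + 1) * (400 * X ^ 2 + 140) :=
    Nat.mul_le_mul (by omega) (by omega)
  have f3 : (Nat.log 2 N + 1) * (80 * q + 50 + 100) ≤ (X ^ 2 + 1) * (80 * X + 150) :=
    Nat.mul_le_mul (by omega) (by omega)
  have f4 : (X ^ 2 + 1) * (400 * X ^ 2 + 140) = 400 * X ^ 4 + 540 * X ^ 2 + 140 := by ring
  have f5 : (X ^ 2 + 1) * (80 * X + 150) = 80 * X ^ 3 + 150 * X ^ 2 + 80 * X + 150 := by ring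
  have f6 : (700 * t + 5000) * X ^ 4 = 700 * (t * X ^ 4) + 5000 * X ^ 4 := by ring
  rw [f6]
  omega

theorem bisect {t : ℕ} (ht : 1 ≤ t) (P : Perimeter) (n a : Fin t → ℕ) (hn : 1 ≤ ∑ τ, n τ)
    (ha : ∀ τ, 0 < a τ) (O : ℕ → ℝ → Prop) (ℓ : ℝ)
    (h : (O = lrFeasible P n a ∧ IsOptimum (fun _ : Fin 1 => P) n a ℓ) ∨
      (ℓ ∈ candidates (fun _ : Fin 1 => P) n a ∧
        ∀ x : ℝ, 0 ≤ x → ((∃ i : Fin P.q, O i x) ↔ ℓ ≤ x))) :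
    ∃ (σ : State) (s c : ℕ), Exec O bisectProg (input (fun _ : Fin 1 => P) n a 0 0) σ s c ∧
      σ.real 0 0 = ℓ ∧
      (c : ℝ) ≤ (700 * t + 5000 : ℕ) * (P.q * Real.log ((∑ τ, n τ + P.q : ℕ) : ℝ)) ∧
      (s : ℝ) ≤ (700 * t + 5000 : ℕ) * (P.q * cells n : ℝ) ^ 4 := by
  have hdisj : Pairwise fun k k' : Fin 1 => Disjoint P.carrier P.carrier :=
    fun k k' h => absurd (Subsingleton.elim k k') h
  have h' : ℓ ∈ candidates (fun _ : Fin 1 => P) n a ∧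
      ∀ x : ℝ, 0 ≤ x → ((∃ i : Fin P.q, O i x) ↔ ℓ ≤ x) := by
    rcases h with ⟨rfl, hopt⟩ | h
    · obtain ⟨ℓ', hopt', hc⟩ := exists_optimum (P := fun _ : Fin 1 => P) hdisj ha le_rfl hn
      obtain rfl : ℓ = ℓ' := hopt.unique hopt'
      exact ⟨hc, fun x hx => by
        rw [← dopg_iff_lrFeasible P n a hx, dopg_iff_le ha hopt hx]⟩
    · exact h
  obtain ⟨σ, s, c, he, hs, hc, hq⟩ := bisectProg_spec P n a ht ha h'.1 h'.2
  refine ⟨σ, s, c, he, hq, ?_, ?_⟩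
  · set S := ∑ τ, n τ + P.q with hS
    have hq := P.q_pos
    have hS2 : 2 ≤ S := by omega
    have hN : P.q ^ 2 * cells n ≤ S ^ (t + 2) := by
      rw [pow_add, mul_comm]
      exact Nat.mul_le_mul ((cells_le_pow n).trans (Nat.pow_le_pow_left (by omega) _))
        (Nat.pow_le_pow_left (by omega) _)
    have h1 := natLog_le hS2 hN
    have h2 := one_le_two_mul_log hS2
    have h3 : ((Nat.log 2 (P.q ^ 2 * cells n) + 1 : ℕ) : ℝ) ≤ (700 * t + 5000 : ℕ) * Real.log S := by
      push_cast at h1 ⊢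
      have : 0 ≤ (t : ℝ) * Real.log S := mul_nonneg (Nat.cast_nonneg _) (by linarith)
      nlinarith
    calc (c : ℝ) ≤ ((Nat.log 2 (P.q ^ 2 * cells n) + 1 : ℕ) : ℝ) * P.q := by exact_mod_cast hc
      _ ≤ (700 * t + 5000 : ℕ) * Real.log S * P.q :=
        mul_le_mul_of_nonneg_right h3 (Nat.cast_nonneg _)
      _ = _ := by ring
  · exact_mod_cast hs.trans (bisectTime_le t P.q (cells n) P.q_pos (cells_pos n))

/-! ### Distributing the robots over the perimeters -/

section Cells
variable (n : ℕ → ℕ) {t : ℕ}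

theorem stride_pred (ht : 1 ≤ t) : stride n t = stride n (t - 1) * (n (t - 1) + 1) := by
  rw [← stride_succ, Nat.sub_add_cancel ht]

theorem digit_last_eq_zero {y : ℕ} (hy : y < stride n (t - 1)) : digit n y (t - 1) = 0 := by
  rw [digit, Nat.div_eq_of_lt hy, Nat.zero_mod]

theorem cell_lt (ht : 1 ≤ t) {y z : ℕ} (hy : y < stride n (t - 1)) (hz : z ≤ n (t - 1)) :
    y + stride n (t - 1) * z < stride n t := by
  rw [stride_pred n ht, mul_add, mul_one]
  have := Nat.mul_le_mul_left (stride n (t - 1)) hz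
  omega

theorem digit_cell {y z τ : ℕ} (hτ : τ < t) (hy : y < stride n (t - 1)) (hz : z ≤ n (t - 1)) :
    digit n (y + stride n (t - 1) * z) τ = if τ = t - 1 then z else digit n y τ := by
  split_ifs with h
  · rw [h, digit, Nat.add_mul_div_left _ _ (stride_pos n _), Nat.div_eq_of_lt hy, zero_add,
      Nat.mod_eq_of_lt (by omega)]
  · obtain ⟨b, hb⟩ := stride_dvd n (show τ + 1 ≤ t - 1 by omega)
    rw [digit_eq, digit_eq, hb, mul_assoc, Nat.add_mul_mod_self_left]

theorem cell_div_le (ht : 1 ≤ t) {c : ℕ} (hc : c < stride n t) : c / stride n (t - 1) ≤ n (t - 1) := by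
  rw [stride_pred n ht] at hc
  exact Nat.lt_succ_iff.1 (Nat.div_lt_of_lt_mul hc)

theorem digit_last {c : ℕ} (ht : 1 ≤ t) (hc : c < stride n t) :
    digit n c (t - 1) = c / stride n (t - 1) := by
  rw [digit, Nat.mod_eq_of_lt (Nat.lt_succ_of_le (cell_div_le n ht hc))]

/-- The two cells can be added. -/
def Fit (n : ℕ → ℕ) (t y y' : ℕ) : Prop := ∀ τ < t, digit n y τ + digit n y' τ ≤ n τ

theorem Fit.add {n : ℕ → ℕ} {y y' : ℕ} (ht : 1 ≤ t) (hy : y < stride n (t - 1))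
    (hy' : y' < stride n (t - 1)) (h : Fit n t y y') : y + y' < stride n (t - 1) ∧
      ∀ τ < t, digit n (y + y') τ = digit n y τ + digit n y' τ := by
  obtain ⟨h1, h2⟩ := digit_add n hy hy' fun τ hτ => h τ (by omega)
  refine ⟨h1, fun τ hτ => ?_⟩
  by_cases e : τ = t - 1
  · rw [e, digit_last_eq_zero n h1, digit_last_eq_zero n hy, digit_last_eq_zero n hy']
  · exact h2 τ (by omega)

end Cells

theorem tab_mono {P : Perimeter} {i t : ℕ} {n : ℕ → ℕ} {cap : ℕ → ℝ} (hcap : ∀ τ < t, 0 ≤ cap τ)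
    {c c' : ℕ} (h : ∀ τ < t, digit n c τ ≤ digit n c' τ) :
    tab P i t n cap c ≤ tab P i t n cap c' :=
  dp_mono P i (fun τ => hcap τ τ.2) fun τ => h τ τ.2

/-- Of the first `I` starting segments, `i` is one that allows to cover the perimeter with the robots
of the line `y` and the smallest number `h` of robots of the last type. -/
structure Fills (P : Perimeter) (t : ℕ) (n : ℕ → ℕ) (cap : ℕ → ℝ) (I y h i : ℕ) : Prop where
  le : h ≤ n (t - 1) + 1
  sound : h ≤ n (t - 1) → i < I ∧
    segEnd P i (P.q - 1) ≤ tab P i t n cap (y + stride n (t - 1) * h)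
  complete : ∀ j < I, ∀ z ≤ n (t - 1),
    segEnd P j (P.q - 1) ≤ tab P j t n cap (y + stride n (t - 1) * z) → h ≤ z

/-- `g'` is obtained from `g` and `h` by combining the pairs of lines that satisfy `C`. -/
structure Conv (t : ℕ) (n : ℕ → ℕ) (C : ℕ → ℕ → Prop) (g h g' ch : ℕ → ℕ) : Prop where
  sound : ∀ y < stride n (t - 1), g' y ≤ n (t - 1) → ch y ≤ y ∧ Fit n t (y - ch y) (ch y) ∧
    g (y - ch y) ≤ n (t - 1) ∧ h (ch y) ≤ n (t - 1) ∧ g' y = g (y - ch y) + h (ch y)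
  complete : ∀ y y', y < stride n (t - 1) → y' < stride n (t - 1) → C y y' → Fit n t y y' →
    g y ≤ n (t - 1) → h y' ≤ n (t - 1) → g' (y + y') ≤ g y + h y'

/-- The tables for the first `K` perimeters. -/
structure Tables {m : ℕ} (P : Fin m → Perimeter) (t : ℕ) (n : ℕ → ℕ) (cap : ℕ → ℝ) (K : ℕ)
    (g h hi ch : ℕ → ℕ → ℕ) : Prop where
  zero : ∀ y < stride n (t - 1), g 0 y = if y = 0 then 0 else n (t - 1) + 1
  fills : ∀ k : Fin m, (k : ℕ) < K → ∀ y < stride n (t - 1),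
    Fills (P k) t n cap (P k).q y (h k y) (hi k y)
  conv : ∀ k < K, Conv t n (fun _ _ => True) (g k) (h k) (g (k + 1)) (ch (k + 1))

/-- Perimeter `k` is covered from segment `i k` with the robots of cell `c k`, and all robots are
used. -/
structure Plan {m : ℕ} (P : Fin m → Perimeter) (t : ℕ) (n : ℕ → ℕ) (cap : ℕ → ℝ) (i c : ℕ → ℕ) :
    Prop where
  start_lt : ∀ k : Fin m, i k < (P k).q
  cell_lt : ∀ k : Fin m, c k < stride n t
  covered : ∀ k : Fin m, segEnd (P k) (i k) ((P k).q - 1) ≤ tab (P k) (i k) t n cap (c k)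
  sum_eq : ∀ τ < t, ∑ k ∈ Finset.range m, digit n (c k) τ = n τ

section Multi
variable {m t : ℕ} {P : Fin m → Perimeter} {n : ℕ → ℕ} {cap : ℕ → ℝ}

theorem feas_iff_plan {n₀ : Fin t → ℕ} {cap₀ : Fin t → ℝ} {ρ : Equiv.Perm (Fin t)}
    (hn : ∀ τ : Fin t, n τ = n₀ (ρ τ)) (hcap : ∀ τ : Fin t, cap τ = cap₀ (ρ τ)) :
    Feas P n₀ cap₀ ↔ ∃ i c, Plan P t n cap i c := by
  have hcap' : (fun τ : Fin t => cap τ) = cap₀ ∘ ρ := funext hcap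
  constructor
  · rintro ⟨N, hN, hcov⟩
    choose i hi hD using hcov
    have hle : ∀ k (τ : Fin t), (N k ∘ ρ) τ ≤ n τ := fun k τ => by
      rw [hn, ← hN]
      exact Finset.single_le_sum (f := fun k => N k (ρ τ)) (fun _ _ => Nat.zero_le _)
        (Finset.mem_univ k)
    choose c hc hv using fun k => exists_vec n (hle k)
    refine ⟨pad i, pad c, fun k => by rw [pad_val]; exact hi k, fun k => by rw [pad_val]; exact hc k,
      fun k => ?_, fun τ hτ => ?_⟩
    · rw [pad_val, pad_val, tab, hv, hcap', dp_comp]; exact hD k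
    · rw [Finset.sum_range, hn ⟨τ, hτ⟩, ← hN]
      refine Finset.sum_congr rfl fun k _ => ?_
      rw [pad_val]
      exact congrFun (hv k) ⟨τ, hτ⟩
  · rintro ⟨i, c, h⟩
    refine ⟨fun k => vec n t (c k) ∘ ρ.symm, fun τ => ?_, fun k => ⟨i k, h.start_lt k, ?_⟩⟩
    · have := h.sum_eq (ρ.symm τ) (ρ.symm τ).2
      rw [hn, Equiv.apply_symm_apply, Finset.sum_range] at this
      exact this
    · have := h.covered k
      rw [tab, hcap', show vec n t (c k) = (vec n t (c k) ∘ ρ.symm) ∘ ρ by ext; simp, dp_comp] at this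
      exact this

variable {g h hi ch : ℕ → ℕ → ℕ}

theorem Tables.le_of_plan (ht : 1 ≤ t) (T : Tables P t n cap m g h hi ch) {i c : ℕ → ℕ}
    (hp : Plan P t n cap i c) : g m (stride n (t - 1) - 1) ≤ n (t - 1) := by
  set L := stride n (t - 1) with hL
  have hpart : ∀ K ≤ m, ∀ τ < t, ∑ k ∈ Finset.range K, digit n (c k) τ ≤ n τ := fun K hK τ hτ => by
    rw [← hp.sum_eq τ hτ]
    exact Finset.sum_le_sum_of_subset (Finset.range_mono hK)
  have key : ∀ K ≤ m, ∃ Y < L, (∀ τ < t - 1, digit n Y τ = ∑ k ∈ Finset.range K, digit n (c k) τ) ∧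
      g K Y ≤ ∑ k ∈ Finset.range K, digit n (c k) (t - 1) := by
    intro K
    induction K with
    | zero =>
      intro _
      refine ⟨0, stride_pos n _, by simp [digit_zero], ?_⟩
      rw [T.zero 0 (stride_pos n _)]; simp
    | succ K ih =>
      intro hK
      obtain ⟨Y, hY, h1, h2⟩ := ih (by omega)
      have hc := hp.cell_lt ⟨K, hK⟩
      set y := c K % L with hy
      have hyL : y < L := Nat.mod_lt _ (stride_pos n _)
      have hz : c K / L ≤ n (t - 1) := cell_div_le n ht hc
      have hcell : y + L * (c K / L) = c K := Nat.mod_add_div _ _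
      have hdl := digit_last n ht hc
      have hd : ∀ τ < t - 1, digit n y τ = digit n (c K) τ := fun τ hτ => by
        rw [← hcell, digit_cell n (show τ < t by omega) hyL hz, if_neg (by omega)]
      have hfit : Fit n t Y y := by
        intro τ hτ
        by_cases e : τ = t - 1
        · rw [e, digit_last_eq_zero n hY, digit_last_eq_zero n hyL]; exact Nat.zero_le _
        · rw [h1 τ (by omega), hd τ (by omega), ← Finset.sum_range_succ]
          exact hpart (K + 1) hK τ hτ
      obtain ⟨h3, h4⟩ := hfit.add ht hY hyL
      have hgn : g K Y ≤ n (t - 1) := h2.trans (hpart K (by omega) _ (by omega))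
      have hh : h K y ≤ c K / L := by
        refine (T.fills ⟨K, hK⟩ hK y hyL).complete _ (hp.start_lt ⟨K, hK⟩) _ hz ?_
        rw [hcell]
        exact hp.covered ⟨K, hK⟩
      refine ⟨Y + y, h3, fun τ hτ => ?_, ?_⟩
      · rw [h4 τ (by omega), h1 τ hτ, hd τ hτ, Finset.sum_range_succ]
      · rw [Finset.sum_range_succ]
        refine ((T.conv K hK).complete Y y hY hyL trivial hfit hgn (hh.trans hz)).trans ?_
        exact Nat.add_le_add h2 (hh.trans hdl.ge)
  obtain ⟨Y, hY, h1, h2⟩ := key m le_rfl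
  have e : Y = L - 1 := by
    refine eq_of_vec_eq n hY (by have := stride_pos n (t - 1); omega) ?_
    rw [vec_last]
    ext τ
    rw [vec, h1 τ τ.2, hp.sum_eq τ (by omega)]
  rw [← e]
  exact h2.trans (hp.sum_eq (t - 1) (by omega)).le

theorem Tables.plan (ht : 1 ≤ t) (hm : 1 ≤ m) (hcap : ∀ τ < t, 0 ≤ cap τ)
    (T : Tables P t n cap m g h hi ch) (hle : g m (stride n (t - 1) - 1) ≤ n (t - 1))
    {Y sel : ℕ → ℕ} (hY : Y m = stride n (t - 1) - 1) (hsel : ∀ k < m, sel k = ch (k + 1) (Y (k + 1)))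
    (hYs : ∀ k < m, Y k = Y (k + 1) - sel k) :
    (∀ k < m, h k (sel k) + (if k = 0 then n (t - 1) - g m (stride n (t - 1) - 1) else 0) ≤
      n (t - 1)) ∧ Plan P t n cap (fun k => hi k (sel k)) (fun k => sel k + stride n (t - 1) *
      (h k (sel k) + if k = 0 then n (t - 1) - g m (stride n (t - 1) - 1) else 0)) := by
  set L := stride n (t - 1) with hL
  have hLp : 0 < L := stride_pos n _
  have key : ∀ j ≤ m, ∀ k, k + j = m → Y k < L ∧ g k (Y k) ≤ n (t - 1) ∧
      (∀ τ < t, digit n (Y k) τ + ∑ k' ∈ Finset.Ico k m, digit n (sel k') τ = digit n (L - 1) τ) ∧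
      g k (Y k) + ∑ k' ∈ Finset.Ico k m, h k' (sel k') = g m (L - 1) ∧
      ∀ k', k ≤ k' → k' < m → sel k' < L ∧ h k' (sel k') ≤ n (t - 1) := by
    intro j
    induction j with
    | zero =>
      intro _ k hk
      obtain rfl : k = m := by omega
      rw [hY]
      simp only [add_zero, Finset.Ico_self, Finset.sum_empty]
      exact ⟨by omega, hle, fun _ _ => trivial, trivial, fun k' _ _ => by omega⟩
    | succ j ih =>
      intro hj k hk
      obtain ⟨h1, h2, h3, h4, h5⟩ := ih (by omega) (k + 1) (by omega)
      obtain ⟨s1, s2, s3, s4, s5⟩ := (T.conv k (by omega)).sound _ h1 h2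
      rw [← hsel k (by omega)] at s1 s2 s3 s4 s5
      rw [← hYs k (by omega)] at s2 s3 s5
      have hYk := hYs k (by omega)
      have hYL : Y k < L := by omega
      have hsL : sel k < L := by omega
      obtain ⟨-, hadd⟩ := s2.add ht hYL hsL
      rw [show Y k + sel k = Y (k + 1) by omega] at hadd
      refine ⟨hYL, s3, fun τ hτ => ?_, ?_, fun k' hk' hm' => ?_⟩
      · rw [Finset.sum_eq_sum_Ico_succ_bot (by omega), ← h3 τ hτ, hadd τ hτ]; omega
      · rw [Finset.sum_eq_sum_Ico_succ_bot (by omega), ← h4, s5]; omega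
      · by_cases e : k' = k
        · rw [e]; exact ⟨hsL, s4⟩
        · exact h5 k' (by omega) hm'
  obtain ⟨h1, h2, h3, h4, h5⟩ := key m le_rfl 0 (by omega)
  rw [T.zero _ h1] at h2 h4
  have hY0 : Y 0 = 0 := by
    by_contra e
    rw [if_neg e] at h2
    omega
  rw [hY0] at h3 h4
  simp only [digit_zero, zero_add, if_true, ← Finset.range_eq_Ico] at h3 h4
  have hz : ∀ k < m, h k (sel k) + (if k = 0 then n (t - 1) - g m (L - 1) else 0) ≤ n (t - 1) := by
    intro k hk
    have := Finset.single_le_sum (f := fun k => h k (sel k)) (fun _ _ => Nat.zero_le _)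
      (Finset.mem_range.2 hk)
    rw [h4] at this
    split_ifs <;> omega
  have hds : ∀ k < m, ∀ τ < t, digit n (sel k + L * (h k (sel k) +
      if k = 0 then n (t - 1) - g m (L - 1) else 0)) τ = if τ = t - 1 then h k (sel k) +
      (if k = 0 then n (t - 1) - g m (L - 1) else 0) else digit n (sel k) τ := fun k hk τ hτ =>
    digit_cell n hτ (h5 k (Nat.zero_le k) hk).1 (hz k hk)
  refine ⟨hz, fun k => ?_, fun k => ?_, fun k => ?_, fun τ hτ => ?_⟩
  · obtain ⟨s1, s2⟩ := h5 k (Nat.zero_le _) k.2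
    exact ((T.fills k k.2 _ s1).sound s2).1
  · exact OPG.cell_lt n ht (h5 k (Nat.zero_le _) k.2).1 (hz k k.2)
  · obtain ⟨s1, s2⟩ := h5 k (Nat.zero_le _) k.2
    refine ((T.fills k k.2 _ s1).sound s2).2.trans (tab_mono hcap fun τ hτ => ?_)
    rw [hds k k.2 τ hτ, digit_cell n hτ s1 s2]
    split_ifs <;> omega
  · rw [Finset.sum_congr rfl fun k hk => hds k (Finset.mem_range.1 hk) τ hτ]
    split_ifs with e
    · rw [Finset.sum_add_distrib, h4, Finset.sum_ite_eq' (Finset.range m) 0 fun _ =>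
        n (t - 1) - g m (L - 1), if_pos (Finset.mem_range.2 hm), e]
      omega
    · rw [h3 τ hτ]
      exact congrFun (vec_last n (t - 1)) ⟨τ, by omega⟩

theorem exists_trace (m : ℕ) (ch : ℕ → ℕ → ℕ) (y : ℕ) : ∃ Y sel : ℕ → ℕ, Y m = y ∧
    (∀ k < m, sel k = ch (k + 1) (Y (k + 1))) ∧ ∀ k < m, Y k = Y (k + 1) - sel k := by
  induction m generalizing y with
  | zero => exact ⟨fun _ => y, fun _ => 0, rfl, by simp, by simp⟩
  | succ m ih =>
    obtain ⟨Y, sel, h1, h2, h3⟩ := ih (y - ch (m + 1) y)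
    refine ⟨Function.update Y (m + 1) y, Function.update sel m (ch (m + 1) y), by simp, fun k hk => ?_,
      fun k hk => ?_⟩
    · by_cases e : k = m
      · subst e; simp
      · rw [Function.update_of_ne e, Function.update_of_ne (by omega)]; exact h2 k (by omega)
    · by_cases e : k = m
      · subst e; simp [h1]
      · rw [Function.update_of_ne e, Function.update_of_ne (by omega),
          Function.update_of_ne (by omega)]
        exact h3 k (by omega)

theorem Tables.le_iff_feas (ht : 1 ≤ t) (hm : 1 ≤ m) (hcap : ∀ τ < t, 0 ≤ cap τ)
    (T : Tables P t n cap m g h hi ch) {n₀ : Fin t → ℕ} {cap₀ : Fin t → ℝ} {ρ : Equiv.Perm (Fin t)}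
    (hn : ∀ τ : Fin t, n τ = n₀ (ρ τ)) (hcap₀ : ∀ τ : Fin t, cap τ = cap₀ (ρ τ)) :
    g m (stride n (t - 1) - 1) ≤ n (t - 1) ↔ Feas P n₀ cap₀ := by
  rw [feas_iff_plan hn hcap₀]
  constructor
  · intro hle
    obtain ⟨Y, sel, h1, h2, h3⟩ := exists_trace m ch (stride n (t - 1) - 1)
    exact ⟨_, _, (T.plan ht hm hcap hle h1 h2 h3).2⟩
  · rintro ⟨i, c, hp⟩
    exact T.le_of_plan ht hp

end Multi

/-! ### The test for several perimeters -/

/-- For each line, find the smallest number of robots of the last type that suffices with the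
starting segment at hand. -/
def fillProg : Prog :=
  (nset 27 0 ;; rset 23 (.get 13 (nv 24 - 1))) ;; .loop (natLt (nv 27) (nv 23)) (
    (nset 28 0 ;; nset 29 (nv 27) ;; nset 37 (.get 71 (nv 52 + nv 27))) ;;
    .loop (.and (natLt (nv 28) (nv 37)) (realLt (.get 11 (nv 29)) (rv 23)))
      (nset 28 (nv 28 + 1) ;; nset 29 (nv 29 + nv 23)) ;;
    (.cond (natLt (nv 28) (nv 37))
      (.setNat 71 (nv 52 + nv 27) (nv 28) ;; .setNat 72 (nv 52 + nv 27) (nv 26)) .skip ;;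
    nset 27 (nv 27 + 1)))

theorem fillProg_spec {O : ℕ → ℝ → Prop} {P : Perimeter} {t m : ℕ} {n a : ℕ → ℕ} {cap : ℕ → ℝ}
    {σ : State} {i b : ℕ} (ht : 1 ≤ t) (hr : Ready t m n a σ) (hs : Solved P i t n cap σ)
    (h24 : σ.nat 24 0 = P.q) (h26 : σ.nat 26 0 = i) (h52 : σ.nat 52 0 = b)
    (hF : ∀ y < stride n (t - 1), Fills P t n cap i y (σ.nat 71 (b + y)) (σ.nat 72 (b + y))) :
    Ex O fillProg σ (300 * stride n t + 50) 0 (fun σ' =>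
      (∀ y < stride n (t - 1), Fills P t n cap (i + 1) y (σ'.nat 71 (b + y)) (σ'.nat 72 (b + y))) ∧
      ∀ x < b, σ'.nat 71 x = σ.nat 71 x ∧ σ'.nat 72 x = σ.nat 72 x) := by
  set L := stride n (t - 1) with hL
  have hq := P.q_pos
  refine Ex.time (Ex.flat_seq 30 fun σ₁ e₁ a₁ => (Ex.for₀ L
    (40 + ((n (t - 1) + 1) * (30 + 20) + 20 + 80)) (fun y σ' => σ'.nat 27 0 = y ∧
      (∀ y' < y, Fills P t n cap (i + 1) y' (σ'.nat 71 (b + y')) (σ'.nat 72 (b + y'))) ∧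
      ∀ x, x < b ∨ b + y ≤ x → σ'.nat 71 x = σ.nat 71 x ∧ σ'.nat 72 x = σ.nat 72 x)
      ?_ ?_ ?_).mono le_rfl le_rfl ?_) ?_
  · refine ⟨by simp [e₁, Prog.sem], by simp, fun x _ => ?_⟩
    rw [a₁.nat 71 rfl, a₁.nat 72 rfl]; exact ⟨rfl, rfl⟩
  · rintro y hy σ' a' ⟨i1, i2, i3⟩
    have hr' := (hr.agree a₁).agree a'
    have g52 : σ'.nat 52 0 = b := by rw [a'.nat 52 rfl, a₁.nat 52 rfl, h52]
    have g26 : σ'.nat 26 0 = i := by rw [a'.nat 26 rfl, a₁.nat 26 rfl, h26]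
    have g11 : σ'.real 11 = σ.real 11 := by rw [a'.real 11 rfl, a₁.real 11 rfl]
    have g23 : σ'.real 23 0 = segEnd P i (P.q - 1) := by
      rw [a'.real 23 rfl, e₁]; simp [Prog.sem, h24, hs.en_eq _ (show P.q - 1 < P.q by omega)]
    obtain ⟨o1, o2⟩ := i3 (b + y) (Or.inr le_rfl)
    have hFy := hF y hy
    rw [← o1, ← o2] at hFy
    set h := σ'.nat 71 (b + y) with hh
    refine ⟨by simp [i1, hr'.lines_eq, ← hL, hy], ?_⟩
    refine Ex.time (Ex.flat_seq 40 fun σ₂ e₂ a₂ => Ex.seq₀ (Ex.while h (T := 30)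
      (K := 0) (fun k σ' => σ'.nat 28 0 + k = h ∧ σ'.nat 29 0 = y + L * σ'.nat 28 0 ∧
        ∀ z < σ'.nat 28 0, tab P i t n cap (y + L * z) < segEnd P i (P.q - 1)) ?_ ?_)
      fun σ₃ a₃ h₃ => Ex.flat (T := 80) ?_) ?_
    · simp [e₂, Prog.sem, i1]
    · rintro k σ₃ a₃ ⟨j1, j2, j3⟩ hb
      have w37 : σ₃.nat 37 0 = h := by
        rw [a₃.nat 37 rfl, e₂]; simp [Prog.sem, g52, i1, hh]
      have w23 : σ₃.real 23 0 = segEnd P i (P.q - 1) := by rw [a₃.real 23 rfl, a₂.real 23 rfl, g23]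
      have w11 : σ₃.real 11 = σ.real 11 := by rw [a₃.real 11 rfl, a₂.real 11 rfl, g11]
      have wL : σ₃.nat 23 0 = L := by rw [a₃.nat 23 rfl, a₂.nat 23 rfl, hr'.lines_eq]
      simp [w37, w23, w11, j2] at hb
      have hz : σ₃.nat 28 0 ≤ n (t - 1) := by have := hFy.le; omega
      rw [hs.tab_eq _ (cell_lt n ht hy hz)] at hb
      refine ⟨k - 1, by omega, Ex.flat ?_⟩
      simp [Prog.wp, j2, wL]
      refine ⟨by omega, by ring, fun z hz => ?_⟩
      rcases Nat.lt_succ_iff_lt_or_eq.1 (Nat.lt_succ_of_le hz) with h' | h'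
      · exact j3 z h'
      · rw [h']; exact hb.2
    · obtain ⟨hn, k, j1, j2, j3⟩ := h₃
      have w37 : σ₃.nat 37 0 = h := by
        rw [a₃.nat 37 rfl, e₂]; simp [Prog.sem, g52, i1, hh]
      have w23 : σ₃.real 23 0 = segEnd P i (P.q - 1) := by rw [a₃.real 23 rfl, a₂.real 23 rfl, g23]
      have w11 : σ₃.real 11 = σ.real 11 := by rw [a₃.real 11 rfl, a₂.real 11 rfl, g11]
      have w52 : σ₃.nat 52 0 = b := by rw [a₃.nat 52 rfl, a₂.nat 52 rfl, g52]
      have w27 : σ₃.nat 27 0 = y := by rw [a₃.nat 27 rfl, a₂.nat 27 rfl, i1]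
      have w26 : σ₃.nat 26 0 = i := by rw [a₃.nat 26 rfl, a₂.nat 26 rfl, g26]
      have w71 : σ₃.nat 71 = σ'.nat 71 := by rw [a₃.nat 71 rfl, a₂.nat 71 rfl]
      have w72 : σ₃.nat 72 = σ'.nat 72 := by rw [a₃.nat 72 rfl, a₂.nat 72 rfl]
      simp only [Test.holds_and, Test.holds_not, Test.holds_natLe, Test.holds_realLe,
        NatExp.eval_get, NatExp.eval_lit, RealExp.eval_get, w37, w23, w11, j2] at hn
      refine ⟨fun hlt => ?_, fun hlt => ?_⟩
      · simp [w37] at hlt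
        have hz : σ₃.nat 28 0 ≤ n (t - 1) := by have := hFy.le; omega
        have hD : segEnd P i (P.q - 1) ≤ tab P i t n cap (y + L * σ₃.nat 28 0) := by
          rw [← hs.tab_eq _ (cell_lt n ht hy hz)]
          by_contra hcon
          exact hn ⟨not_le.2 hlt, hcon⟩
        simp only [Prog.wp, State.setNat_nat, NatExp.eval_add, NatExp.eval_get, NatExp.eval_lit,
          NatExp.eval_one, w52, w27, w26, w71, w72, if_true, Function.update_self, if_false,
          Nat.reduceEqDiff]
        refine ⟨trivial, fun y' hy' => ?_, fun x hx => ?_⟩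
        · by_cases e : y' = y
          · subst e
            rw [Function.update_self, Function.update_self]
            refine ⟨by omega, fun _ => ⟨by omega, hD⟩, fun j hj z hz' hD' => ?_⟩
            rcases Nat.lt_succ_iff_lt_or_eq.1 hj with h' | h'
            · have := hFy.complete j h' z hz' hD'; omega
            · subst h'
              by_contra hcon
              exact absurd hD' (not_le.2 (j3 z (by omega)))
          · rw [Function.update_of_ne (by omega), Function.update_of_ne (by omega)]
            exact i2 y' (by omega)
        · rw [Function.update_of_ne (by omega), Function.update_of_ne (by omega)]
          exact i3 x (by omega)
      · simp [w37] at hlt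
        have hzh : σ₃.nat 28 0 = h := by omega
        simp only [Prog.wp, State.setNat_nat, NatExp.eval_add, NatExp.eval_get, NatExp.eval_lit,
          NatExp.eval_one, w27, w71, w72, if_true, Function.update_self, if_false,
          Nat.reduceEqDiff]
        refine ⟨trivial, fun y' hy' => ?_, fun x hx => i3 x (by omega)⟩
        by_cases e : y' = y
        · subst e
          refine ⟨hFy.le, fun hle => ⟨(hFy.sound hle).1.trans (Nat.lt_succ_self _), (hFy.sound hle).2⟩,
            fun j hj z hz' hD' => ?_⟩
          rcases Nat.lt_succ_iff_lt_or_eq.1 hj with h' | h'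
          · exact hFy.complete j h' z hz' hD'
          · subst h'
            by_contra hcon
            exact absurd hD' (not_le.2 (j3 z (by omega)))
        · exact i2 y' (by omega)
    · have := hFy.le
      have := Nat.mul_le_mul_right (30 + 20) this
      omega
  · rintro σ' a' ⟨i1, -⟩
    have hr' := (hr.agree a₁).agree a'
    simp [i1, hr'.lines_eq, ← hL]
  · rintro σ' - ⟨-, i2, i3⟩
    exact ⟨i2, fun x hx => i3 x (Or.inl hx)⟩
  · have h1 : stride n t = L * (n (t - 1) + 1) := stride_pred n ht
    have h2 : L * (40 + ((n (t - 1) + 1) * (30 + 20) + 20 + 80) + 20) =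
      50 * (L * (n (t - 1) + 1)) + 160 * L := by ring
    have h3 : L ≤ L * (n (t - 1) + 1) := Nat.le_mul_of_pos_right _ (Nat.succ_pos _)
    rw [h1, h2]; omega

/-- Combine the lines `nv 27` and `nv 53`. -/
def pairProg : Prog :=
  .cond (natLt (.get 71 (nv 52 + nv 53)) (nv 39)) (
    (nset 54 1 ;; nset 30 0 ;; nset 37 (.get 70 (nv 52 + nv 27) + .get 71 (nv 52 + nv 53))) ;;
    .loop (natLt (nv 30) (nv 20)) (
      .cond (natLt (.get 10 (nv 30)) (.get 15 (nv 31 + nv 30) + .get 15 (nv 32 + nv 30)))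
        (nset 54 0) .skip ;; nset 30 (nv 30 + 1)) ;;
    .cond (.and (.natLe 1 (nv 54)) (natLt (nv 37) (.get 70 (nv 38 + nv 27 + nv 53))))
      (.setNat 75 (nv 38 + nv 27 + nv 53) (nv 53) ;; .setNat 70 (nv 38 + nv 27 + nv 53) (nv 37))
      .skip)
    .skip

/-- The entries of array `A` from cell `b` on. -/
def row (σ : State) (A b : ℕ) : ℕ → ℕ := fun y => σ.nat A (b + y)

/-- The state of the combination of the lines. -/
structure Combining (t : ℕ) (n : ℕ → ℕ) (C : ℕ → ℕ → Prop) (b : ℕ) (σ₀ σ : State) : Prop where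
  below : ∀ x < b + stride n (t - 1), σ.nat 70 x = σ₀.nat 70 x ∧ σ.nat 75 x = σ₀.nat 75 x
  conv : Conv t n C (row σ₀ 70 b) (row σ₀ 71 b) (row σ 70 (b + stride n (t - 1)))
    (row σ 75 (b + stride n (t - 1)))

section Conv
variable {O : ℕ → ℝ → Prop} {t m b : ℕ} {n a : ℕ → ℕ} {C : ℕ → ℕ → Prop} {σ₀ σ : State}

theorem Combining.mono {C' : ℕ → ℕ → Prop} {σ' : State} (h : Combining t n C b σ₀ σ)
    (h70 : σ'.nat 70 = σ.nat 70) (h75 : σ'.nat 75 = σ.nat 75)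
    (hC : ∀ y y', y < stride n (t - 1) → y' < stride n (t - 1) → C' y y' → Fit n t y y' →
      row σ₀ 70 b y ≤ n (t - 1) → row σ₀ 71 b y' ≤ n (t - 1) → C y y') :
    Combining t n C' b σ₀ σ' := by
  have e70 : row σ' 70 (b + stride n (t - 1)) = row σ 70 (b + stride n (t - 1)) := by
    unfold row; rw [h70]
  have e75 : row σ' 75 (b + stride n (t - 1)) = row σ 75 (b + stride n (t - 1)) := by
    unfold row; rw [h75]
  refine ⟨by rw [h70, h75]; exact h.below, ?_⟩
  rw [e70, e75]
  exact ⟨h.conv.sound, fun y y' hy hy' hc hf h1 h2 =>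
    h.conv.complete y y' hy hy' (hC y y' hy hy' hc hf h1 h2) hf h1 h2⟩

theorem pairProg_spec (ht : 1 ≤ t) (hr : Ready t m n a σ) (h : Combining t n C b σ₀ σ)
    (h71 : σ.nat 71 = σ₀.nat 71) (h39 : σ.nat 39 0 = n (t - 1) + 1) (h52 : σ.nat 52 0 = b)
    (h38 : σ.nat 38 0 = b + stride n (t - 1)) {y y' : ℕ} (hy : y < stride n (t - 1))
    (hy' : y' < stride n (t - 1)) (h27 : σ.nat 27 0 = y) (h53 : σ.nat 53 0 = y')
    (h31 : σ.nat 31 0 = y * t) (h32 : σ.nat 32 0 = y' * t) (hfin : row σ₀ 70 b y ≤ n (t - 1)) :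
    Ex O pairProg σ (90 * t + 250) 0 (Combining t n (fun x x' => C x x' ∨ x = y ∧ x' = y') b σ₀) := by
  set L := stride n (t - 1) with hL
  have hLt : L ≤ stride n t := Nat.le_of_dvd (stride_pos n t) (stride_dvd n (Nat.sub_le t 1))
  have e71 : σ.nat 71 (b + y') = row σ₀ 71 b y' := by rw [h71]; rfl
  have e70 : σ.nat 70 (b + y) = row σ₀ 70 b y := (h.below _ (by omega)).1
  refine Ex.time (Ex.cond (T := 90 * t + 230) (fun hc => ?_) fun hc => ?_) (by omega)
  · simp [h52, h53, h39, e71] at hc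
    refine Ex.time (Ex.flat_seq 40 fun σ₁ e₁ a₁ => Ex.seq₀ (Ex.for₀ t 70
      (fun k σ' => σ'.nat 30 0 = k ∧ ((σ'.nat 54 0 = 1 ∧ ∀ τ < k, digit n y τ + digit n y' τ ≤ n τ) ∨
        (σ'.nat 54 0 = 0 ∧ ¬ ∀ τ < k, digit n y τ + digit n y' τ ≤ n τ))) ?_ ?_ ?_)
        fun σ₂ a₂ h₂ => Ex.flat (T := 80) ?_) (by omega)
    · simp [e₁, Prog.sem]
    · rintro k hk σ' a' ⟨i1, i2⟩
      have hr' := (hr.agree a₁).agree a'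
      have g31 : σ'.nat 31 0 = y * t := by rw [a'.nat 31 rfl, a₁.nat 31 rfl, h31]
      have g32 : σ'.nat 32 0 = y' * t := by rw [a'.nat 32 rfl, a₁.nat 32 rfl, h32]
      have d1 := hr'.digit_eq y (by omega) k hk
      have d2 := hr'.digit_eq y' (by omega) k hk
      refine ⟨by simp [i1, hr'.t_eq, hk], Ex.flat ⟨fun hb => ?_, fun hb => ?_⟩⟩
      · simp [i1, g31, g32, d1, d2, hr'.n_eq] at hb
        refine ⟨by simp [i1], Or.inr ⟨by simp, fun hall => ?_⟩⟩
        have := hall k (Nat.lt_succ_self k)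
        omega
      · simp [i1, g31, g32, d1, d2, hr'.n_eq] at hb
        refine ⟨by simp [i1], ?_⟩
        rcases i2 with ⟨i2, i3⟩ | ⟨i2, i3⟩
        · refine Or.inl ⟨by simpa using i2, fun τ hτ => ?_⟩
          rcases Nat.lt_succ_iff_lt_or_eq.1 hτ with h' | h'
          · exact i3 τ h'
          · rw [h']; exact hb
        · exact Or.inr ⟨by simpa using i2, fun hall => i3 fun τ hτ => hall τ (by omega)⟩
    · rintro σ' a' ⟨i1, -⟩
      have hr' := (hr.agree a₁).agree a'
      simp [i1, hr'.t_eq]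
    · obtain ⟨-, h54⟩ := h₂
      change (σ₂.nat 54 0 = 1 ∧ Fit n t y y') ∨ (σ₂.nat 54 0 = 0 ∧ ¬ Fit n t y y') at h54
      have w37 : σ₂.nat 37 0 = row σ₀ 70 b y + row σ₀ 71 b y' := by
        rw [a₂.nat 37 rfl, e₁]; simp [Prog.sem, h52, h27, h53, e70, e71]
      have w38 : σ₂.nat 38 0 = b + L := by rw [a₂.nat 38 rfl, a₁.nat 38 rfl, h38]
      have w27 : σ₂.nat 27 0 = y := by rw [a₂.nat 27 rfl, a₁.nat 27 rfl, h27]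
      have w53 : σ₂.nat 53 0 = y' := by rw [a₂.nat 53 rfl, a₁.nat 53 rfl, h53]
      have w70 : σ₂.nat 70 = σ.nat 70 := by rw [a₂.nat 70 rfl, a₁.nat 70 rfl]
      have w75 : σ₂.nat 75 = σ.nat 75 := by rw [a₂.nat 75 rfl, a₁.nat 75 rfl]
      refine ⟨fun hb => ?_, fun hb => ?_⟩
      · simp [w37, w38, w27, w53, w70] at hb
        have hfit : Fit n t y y' := by
          rcases h54 with h' | h'
          · exact h'.2
          · omega
        obtain ⟨hsum, -⟩ := hfit.add ht hy hy'
        refine ⟨fun x hx => ?_, fun x hx hle => ?_, fun x x' hx hx' hxc hf h1 h2 => ?_⟩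
        · simp [w38, w27, w53, w70, w75]
          rw [Function.update_of_ne (by omega), Function.update_of_ne (by omega)]
          exact h.below x hx
        · simp only [row, State.setNat_nat, NatExp.eval_add, NatExp.eval_get, NatExp.eval_lit,
            w37, w38, w27, w53, w70, w75, if_true, if_false, Nat.reduceEqDiff] at hle ⊢
          by_cases e : x = y + y'
          · subst e
            rw [show b + L + (y + y') = b + L + y + y' by ring, Function.update_self] at hle ⊢
            rw [Function.update_self, Nat.add_sub_cancel]
            exact ⟨by omega, hfit, hfin, by simp only [row] at hc; omega, rfl⟩
          · rw [Function.update_of_ne (by omega)] at hle ⊢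
            rw [Function.update_of_ne (by omega)]
            exact h.conv.sound x hx hle
        · simp only [row, State.setNat_nat, NatExp.eval_add, NatExp.eval_get, NatExp.eval_lit,
            w37, w38, w27, w53, w70, w75, if_true, if_false, Nat.reduceEqDiff]
          have hold : σ.nat 70 (b + L + (y + y')) > σ₀.nat 70 (b + y) + σ₀.nat 71 (b + y') := by
            have := hb.2
            simp only [row] at this
            rwa [← add_assoc]
          by_cases e : x + x' = y + y'
          · rw [e, show b + L + (y + y') = b + L + y + y' by ring, Function.update_self]
            rcases hxc with hxc | ⟨rfl, rfl⟩
            · have := h.conv.complete x x' hx hx' hxc hf h1 h2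
              simp only [row, e, ← hL] at this
              omega
            · exact le_rfl
          · rw [Function.update_of_ne (by omega)]
            refine h.conv.complete x x' hx hx' (hxc.resolve_right ?_) hf h1 h2
            rintro ⟨rfl, rfl⟩
            exact e rfl
      · simp [w37, w38, w27, w53, w70] at hb
        refine h.mono w70 w75 |> fun H => ⟨(H fun x x' _ _ hc _ _ _ => hc).below,
          (H fun x x' _ _ hc _ _ _ => hc).conv.sound, fun x x' hx hx' hxc hf h1 h2 => ?_⟩
        have e : row σ₂ 70 (b + L) = row σ 70 (b + L) := by unfold row; rw [w70]
        rw [e]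
        rcases hxc with hxc | ⟨rfl, rfl⟩
        · exact h.conv.complete x x' hx hx' hxc hf h1 h2
        · have := hb (by
            rcases h54 with h' | h'
            · have := h'.1; omega
            · exact absurd hf h'.2)
          simp only [row] at this ⊢
          rwa [← add_assoc]
  · simp [h52, h53, h39, e71] at hc
    refine Ex.flat (hT := le_trans (by decide : _ ≤ 230) (by omega))
      (h.mono rfl rfl fun x x' hx hx' hc' hf h1 h2 => ?_)
    rcases hc' with hc' | ⟨rfl, rfl⟩
    · exact hc'
    · omega

end Conv

/-- Combine line `nv 27` with all lines. -/
def rowProg : Prog :=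
  (nset 53 0 ;; nset 32 0) ;; .loop (natLt (nv 53) (nv 23))
    (pairProg ;; (nset 53 (nv 53 + 1) ;; nset 32 (nv 32 + nv 20)))

/-- Compute the next row of the table. -/
def convProg : Prog :=
  (nset 38 (nv 52 + nv 23) ;; nset 27 0) ;;
  .loop (natLt (nv 27) (nv 23)) (.setNat 70 (nv 38 + nv 27) (nv 39) ;; nset 27 (nv 27 + 1)) ;;
  (nset 27 0 ;; nset 31 0) ;; .loop (natLt (nv 27) (nv 23))
    (.cond (natLt (.get 70 (nv 52 + nv 27)) (nv 39)) rowProg .skip ;;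
      (nset 27 (nv 27 + 1) ;; nset 31 (nv 31 + nv 20)))

section Conv
variable {O : ℕ → ℝ → Prop} {t m b : ℕ} {n a : ℕ → ℕ} {C : ℕ → ℕ → Prop} {σ₀ σ : State}

theorem rowProg_spec (ht : 1 ≤ t) (hr : Ready t m n a σ) (h : Combining t n C b σ₀ σ)
    (h71 : σ.nat 71 = σ₀.nat 71) (h39 : σ.nat 39 0 = n (t - 1) + 1) (h52 : σ.nat 52 0 = b)
    (h38 : σ.nat 38 0 = b + stride n (t - 1)) {y : ℕ} (hy : y < stride n (t - 1))
    (h27 : σ.nat 27 0 = y) (h31 : σ.nat 31 0 = y * t) (hfin : row σ₀ 70 b y ≤ n (t - 1)) :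
    Ex O rowProg σ (stride n (t - 1) * (90 * t + 300) + 40) 0
      (Combining t n (fun x x' => C x x' ∨ x = y) b σ₀) := by
  refine Ex.time (Ex.flat_seq 20 fun σ₁ e₁ a₁ => (Ex.for₀ (stride n (t - 1))
    (90 * t + 250 + 30) (fun k σ' => σ'.nat 53 0 = k ∧ σ'.nat 32 0 = k * t ∧
      Combining t n (fun x x' => C x x' ∨ x = y ∧ x' < k) b σ₀ σ') ?_ ?_ ?_).mono
      le_rfl le_rfl ?_) (le_of_eq (by ring))
  · refine ⟨by simp [e₁, Prog.sem], by simp [e₁, Prog.sem], h.mono (a₁.nat 70 rfl) (a₁.nat 75 rfl) ?_⟩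
    intro x x' _ _ hc _ _ _
    exact hc.resolve_right fun h => absurd h.2 (Nat.not_lt_zero _)
  · rintro k hk σ' a' ⟨i1, i2, i3⟩
    have hr' := (hr.agree a₁).agree a'
    refine ⟨by simp [i1, hr'.lines_eq, hk], Ex.seq₀ (pairProg_spec ht hr' i3 ?_ ?_ ?_ ?_ hy hk ?_ i1 ?_
      i2 hfin) fun σ₂ a₂ h₂ => Ex.flat (T := 30) ?_⟩
    · rw [a'.nat 71 rfl, a₁.nat 71 rfl, h71]
    · rw [a'.nat 39 rfl, a₁.nat 39 rfl, h39]
    · rw [a'.nat 52 rfl, a₁.nat 52 rfl, h52]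
    · rw [a'.nat 38 rfl, a₁.nat 38 rfl, h38]
    · rw [a'.nat 27 rfl, a₁.nat 27 rfl, h27]
    · rw [a'.nat 31 rfl, a₁.nat 31 rfl, h31]
    · have w53 : σ₂.nat 53 0 = k := by rw [a₂.nat 53 rfl, i1]
      have w32 : σ₂.nat 32 0 = k * t := by rw [a₂.nat 32 rfl, i2]
      have w20 : σ₂.nat 20 0 = t := by rw [a₂.nat 20 rfl, hr'.t_eq]
      refine ⟨by simp [w53], by simp [w32, w20]; ring, h₂.mono rfl rfl ?_⟩
      intro x x' _ _ hc _ _ _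
      rcases hc with hc | ⟨hc, hc'⟩
      · exact Or.inl (Or.inl hc)
      · rcases Nat.lt_succ_iff_lt_or_eq.1 hc' with h' | h'
        · exact Or.inl (Or.inr ⟨hc, h'⟩)
        · exact Or.inr ⟨hc, h'⟩
  · rintro σ' a' ⟨i1, -⟩
    have hr' := (hr.agree a₁).agree a'
    simp [i1, hr'.lines_eq]
  · rintro σ' - ⟨-, -, i3⟩
    exact i3.mono rfl rfl fun x x' _ hx' hc _ _ _ => hc.imp_right fun h => ⟨h, hx'⟩

theorem convProg_spec (ht : 1 ≤ t) (hr : Ready t m n a σ) (h39 : σ.nat 39 0 = n (t - 1) + 1)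
    (h52 : σ.nat 52 0 = b) {R : ℕ}
    (hR : ((Finset.range (stride n (t - 1))).filter fun y => row σ 70 b y ≤ n (t - 1)).card ≤ R) :
    Ex O convProg σ (R * (stride n (t - 1) * (90 * t + 300) + 40) + 200 * stride n (t - 1) + 100) 0
      (fun σ' => Combining t n (fun _ _ => True) b σ σ' ∧
        σ'.nat 38 0 = b + stride n (t - 1)) := by
  set L := stride n (t - 1) with hL
  set X := L * (90 * t + 300) + 40 with hX
  refine Ex.time (Ex.flat_seq 20 fun σ₁ e₁ a₁ => Ex.seq₀ (Ex.for₀ L 30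
    (fun k σ' => σ'.nat 27 0 = k ∧ (∀ x < b + L, σ'.nat 70 x = σ.nat 70 x) ∧
      ∀ y < k, σ'.nat 70 (b + L + y) = n (t - 1) + 1) ?_ ?_ ?_) fun σ₂ a₂ h₂ =>
    Ex.flat_seq 20 fun σ₃ e₃ a₃ => (Ex.forT L
      (fun y => 20 + (if row σ 70 b y ≤ n (t - 1) then X else 10) + 30)
      (fun k σ' => σ'.nat 27 0 = k ∧ σ'.nat 31 0 = k * t ∧
        Combining t n (fun x x' => x < k) b σ σ') ?_ ?_ ?_).mono le_rfl le_rfl ?_) ?_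
  · refine ⟨by simp [e₁, Prog.sem], fun x _ => by rw [a₁.nat 70 rfl], by simp⟩
  · rintro k hk σ' a' ⟨i1, i2, i3⟩
    have hr' := (hr.agree a₁).agree a'
    have g38 : σ'.nat 38 0 = b + L := by
      rw [a'.nat 38 rfl, e₁]; simp [Prog.sem, h52, hr.lines_eq, hL]
    have g39 : σ'.nat 39 0 = n (t - 1) + 1 := by rw [a'.nat 39 rfl, a₁.nat 39 rfl, h39]
    refine ⟨by simp [i1, hr'.lines_eq, ← hL, hk], Ex.flat ?_⟩
    simp only [Prog.wp, State.setNat_nat, NatExp.eval_add, NatExp.eval_get, NatExp.eval_lit,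
      NatExp.eval_one, i1, g38, g39, if_true, Function.update_self, if_false, Nat.reduceEqDiff]
    refine ⟨trivial, fun x hx => ?_, fun y hy => ?_⟩
    · rw [Function.update_of_ne (by omega)]; exact i2 x hx
    · by_cases e : y = k
      · rw [e, Function.update_self]
      · rw [Function.update_of_ne (by omega)]; exact i3 y (by omega)
  · rintro σ' a' ⟨i1, -⟩
    have hr' := (hr.agree a₁).agree a'
    simp [i1, hr'.lines_eq, ← hL]
  · have f70 : σ₃.nat 70 = σ₂.nat 70 := a₃.nat 70 rfl
    have f75 : σ₃.nat 75 = σ.nat 75 := by rw [a₃.nat 75 rfl, a₂.nat 75 rfl, a₁.nat 75 rfl]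
    refine ⟨by simp [e₃, Prog.sem], by simp [e₃, Prog.sem], ⟨fun x hx => ?_, fun y hy hle => ?_,
      fun x x' _ _ hx => absurd hx (Nat.not_lt_zero _)⟩⟩
    · rw [f70, f75]; exact ⟨h₂.2.1 x hx, rfl⟩
    · have := h₂.2.2 y hy
      rw [row, f70, this] at hle
      omega
  · rintro y hy σ' a' ⟨i1, i2, i3⟩
    have hr' := (((hr.agree a₁).agree a₂).agree a₃).agree a'
    have g38 : σ'.nat 38 0 = b + L := by
      rw [a'.nat 38 rfl, a₃.nat 38 rfl, a₂.nat 38 rfl, e₁]; simp [Prog.sem, h52, hr.lines_eq, hL]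
    have g39 : σ'.nat 39 0 = n (t - 1) + 1 := by
      rw [a'.nat 39 rfl, a₃.nat 39 rfl, a₂.nat 39 rfl, a₁.nat 39 rfl, h39]
    have g52 : σ'.nat 52 0 = b := by
      rw [a'.nat 52 rfl, a₃.nat 52 rfl, a₂.nat 52 rfl, a₁.nat 52 rfl, h52]
    have g71 : σ'.nat 71 = σ.nat 71 := by
      rw [a'.nat 71 rfl, a₃.nat 71 rfl, a₂.nat 71 rfl, a₁.nat 71 rfl]
    have g70 : σ'.nat 70 (b + y) = row σ 70 b y := (i3.below _ (by omega)).1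
    refine ⟨by simp [i1, hr'.lines_eq, ← hL, hy], Ex.seq₀ (R := fun σ'' =>
      Combining t n (fun x x' => x < y + 1) b σ σ'') (Ex.cond (fun hc => ?_) fun hc => ?_)
      fun σ₄ a₄ h₄ => Ex.flat (T := 30) ?_⟩
    · simp [g52, i1, g39, g70] at hc
      rw [if_pos (by omega)]
      refine (rowProg_spec ht hr' i3 g71 g39 g52 g38 hy i1 i2 (by omega)).mono le_rfl le_rfl
        fun σ'' _ h'' => h''.mono rfl rfl fun x x' _ _ hx _ _ _ => ?_
      rcases Nat.lt_succ_iff_lt_or_eq.1 hx with h' | h'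
      · exact Or.inl h'
      · exact Or.inr h'
    · simp [g52, i1, g39, g70] at hc
      rw [if_neg (by omega)]
      refine Ex.flat (i3.mono rfl rfl fun x x' _ _ hx _ hfin _ => ?_)
      rcases Nat.lt_succ_iff_lt_or_eq.1 hx with h' | h'
      · exact h'
      · rw [h'] at hfin; omega
    · have w27 : σ₄.nat 27 0 = y := by rw [a₄.nat 27 rfl, i1]
      have w31 : σ₄.nat 31 0 = y * t := by rw [a₄.nat 31 rfl, i2]
      have w20 : σ₄.nat 20 0 = t := by rw [a₄.nat 20 rfl, hr'.t_eq]
      exact ⟨by simp [w27], by simp [w31, w20]; ring, h₄.mono rfl rfl fun _ _ _ _ h _ _ _ => h⟩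
  · rintro σ' a' ⟨i1, -⟩
    have hr' := (((hr.agree a₁).agree a₂).agree a₃).agree a'
    simp [i1, hr'.lines_eq, ← hL]
  · rintro σ' a' ⟨-, -, i3⟩
    refine ⟨i3.mono rfl rfl fun x x' hx _ _ _ _ _ => hx, ?_⟩
    rw [a'.nat 38 rfl, a₃.nat 38 rfl, a₂.nat 38 rfl, e₁]; simp [Prog.sem, h52, hr.lines_eq, hL]
  · have h1 : ∑ y ∈ Finset.range L, (if row σ 70 b y ≤ n (t - 1) then X else 10) ≤ R * X + 10 * L := by
      rw [Finset.sum_ite, Finset.sum_const, Finset.sum_const, smul_eq_mul, smul_eq_mul]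
      refine Nat.add_le_add (Nat.mul_le_mul_right _ hR) ?_
      have := Finset.card_filter_le (Finset.range L) fun y => ¬ row σ 70 b y ≤ n (t - 1)
      rw [Finset.card_range] at this
      omega
    have h2 : ∑ y ∈ Finset.range L, (20 + (if row σ 70 b y ≤ n (t - 1) then X else 10) + 30 + 20) =
        ∑ y ∈ Finset.range L, (if row σ 70 b y ≤ n (t - 1) then X else 10) + 70 * L := by
      simp only [Finset.sum_add_distrib, Finset.sum_const, Finset.card_range, smul_eq_mul]
      ring
    rw [h2]
    omega

end Conv

/-- Rows of length `L` in array `A`. -/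
def rows (σ : State) (A L k y : ℕ) : ℕ := σ.nat A (k * L + y)

/-- The tables in memory. -/
abbrev HasTables {m : ℕ} (P : Fin m → Perimeter) (t : ℕ) (n : ℕ → ℕ) (cap : ℕ → ℝ) (K : ℕ)
    (σ : State) : Prop :=
  Tables P t n cap K (rows σ 70 (stride n (t - 1))) (rows σ 71 (stride n (t - 1)))
    (rows σ 72 (stride n (t - 1))) (rows σ 75 (stride n (t - 1)))

/-- The tables for one more perimeter. -/
def perimProg : Prog :=
  (nset 24 (.get 1 (nv 51)) ;; nset 26 0 ;; nset 27 0) ;;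
  .loop (natLt (nv 27) (nv 23)) (.setNat 71 (nv 52 + nv 27) (nv 39) ;; nset 27 (nv 27 + 1)) ;;
  .loop (natLt (nv 26) (nv 24)) (dpRun ;; fillProg ;; nset 26 (nv 26 + 1)) ;;
  convProg ;;
  (nset 25 (nv 25 + nv 24) ;; nset 52 (nv 38) ;; nset 51 (nv 51 + 1))

/-- The running time for one more perimeter. -/
def perimTime (q t : ℕ) (n : ℕ → ℕ) (R : ℕ) : ℕ :=
  q * (dpTime q t n + 300 * stride n t + 110) + R * (stride n (t - 1) * (90 * t + 300) + 40) +
    300 * stride n (t - 1) + 300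

section Test
variable {O : ℕ → ℝ → Prop} {t m : ℕ} {P : Fin m → Perimeter} {n a : ℕ → ℕ} {cap : ℕ → ℝ} {σ : State}

theorem perimProg_spec (ht : 1 ≤ t) (hcap : ∀ τ < t, 0 ≤ cap τ) (hr : Ready t m n a σ)
    (hin : HasInput P σ) (hcap' : ∀ τ < t, σ.real 10 τ = cap τ) (h39 : σ.nat 39 0 = n (t - 1) + 1)
    {k : Fin m} (h51 : σ.nat 51 0 = k) (h25 : σ.nat 25 0 = offset P k)
    (h52 : σ.nat 52 0 = k * stride n (t - 1)) (hT : HasTables P t n cap k σ) :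
    Ex O perimProg σ (perimTime (P k).q t n (if (k : ℕ) = 0 then 1 else stride n (t - 1))) 0
      (fun σ' => σ'.nat 51 0 = k + 1 ∧ σ'.nat 25 0 = offset P (k + 1) ∧
        σ'.nat 52 0 = (k + 1) * stride n (t - 1) ∧ HasTables P t n cap (k + 1) σ') := by
  set L := stride n (t - 1) with hL
  set R := if (k : ℕ) = 0 then 1 else L with hR
  have hsucc : (k + 1 : ℕ) * L = k * L + L := Nat.succ_mul _ _
  have hrow : ∀ k' : ℕ, k' < k → k' * L + L ≤ k * L := fun k' hk' => by
    rw [← Nat.succ_mul]; exact Nat.mul_le_mul_right _ hk'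
  have hfin : ((Finset.range L).filter fun y => row σ 70 (k * L) y ≤ n (t - 1)).card ≤ R := by
    rw [hR]
    split_ifs with e
    · rw [Finset.card_le_one]
      have : ∀ y ∈ (Finset.range L).filter fun y => row σ 70 (k * L) y ≤ n (t - 1), y = 0 := by
        intro y hy
        rw [Finset.mem_filter, Finset.mem_range] at hy
        have h0 := hT.zero y hy.1
        have h1 := hy.2
        rw [e] at h1
        change rows σ 70 L 0 y ≤ _ at h1
        rw [h0] at h1
        by_contra hne
        rw [if_neg hne] at h1
        omega
      intro y hy y' hy'
      rw [this y hy, this y' hy']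
    · exact (Finset.card_filter_le _ _).trans (Finset.card_range _).le
  refine Ex.time (Ex.flat_seq 30 fun σ₁ e₁ a₁ => Ex.seq₀ (Ex.for₀ L 30
    (fun y σ' => σ'.nat 27 0 = y ∧ (∀ x < k * L, σ'.nat 71 x = σ.nat 71 x) ∧
      ∀ y' < y, σ'.nat 71 (k * L + y') = n (t - 1) + 1) ?_ ?_ ?_) fun σ₂ a₂ h₂ =>
    Ex.seq₀ (Ex.for₀ (P k).q (dpTime (P k).q t n + (300 * stride n t + 50 + 20)) (fun i σ' =>
      σ'.nat 26 0 = i ∧ (∀ x < k * L, σ'.nat 71 x = σ.nat 71 x ∧ σ'.nat 72 x = σ.nat 72 x) ∧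
      ∀ y < L, Fills (P k) t n cap i y (σ'.nat 71 (k * L + y)) (σ'.nat 72 (k * L + y)))
      ?_ ?_ ?_) fun σ₃ a₃ h₃ => Ex.seq₀ (convProg_spec (b := k * L) (R := R) ht
      (((hr.agree a₁).agree a₂).agree a₃) ?_ ?_ ?_)
      fun σ₄ a₄ h₄ => Ex.flat (T := 30) ?_) ?_
  · exact ⟨by simp [e₁, Prog.sem], fun x _ => by rw [a₁.nat 71 rfl], by simp⟩
  · rintro y hy σ' a' ⟨i1, i2, i3⟩
    have hr' := (hr.agree a₁).agree a'
    have g52 : σ'.nat 52 0 = k * L := by rw [a'.nat 52 rfl, a₁.nat 52 rfl, h52]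
    have g39 : σ'.nat 39 0 = n (t - 1) + 1 := by rw [a'.nat 39 rfl, a₁.nat 39 rfl, h39]
    refine ⟨by simp [i1, hr'.lines_eq, ← hL, hy], Ex.flat ?_⟩
    simp only [Prog.wp, State.setNat_nat, NatExp.eval_add, NatExp.eval_get, NatExp.eval_lit,
      NatExp.eval_one, i1, g52, g39, if_true, Function.update_self, if_false, Nat.reduceEqDiff]
    refine ⟨trivial, fun x hx => ?_, fun y' hy' => ?_⟩
    · rw [Function.update_of_ne (by omega)]; exact i2 x hx
    · by_cases e : y' = y
      · rw [e, Function.update_self]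
      · rw [Function.update_of_ne (by omega)]; exact i3 y' (by omega)
  · rintro σ' a' ⟨i1, -⟩
    have hr' := (hr.agree a₁).agree a'
    simp [i1, hr'.lines_eq, ← hL]
  · refine ⟨?_, fun x hx => ⟨h₂.2.1 x hx, ?_⟩, fun y hy => ?_⟩
    · rw [a₂.nat 26 rfl, e₁]; simp [Prog.sem]
    · rw [a₂.nat 72 rfl, a₁.nat 72 rfl]
    · rw [h₂.2.2 y hy]
      exact ⟨le_rfl, fun h => absurd h (by omega), fun j hj => absurd hj (Nat.not_lt_zero _)⟩
  · rintro i hi σ' a' ⟨i1, i2, i3⟩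
    have hr' := ((hr.agree a₁).agree a₂).agree a'
    have g24 : σ'.nat 24 0 = (P k).q := by
      rw [a'.nat 24 rfl, a₂.nat 24 rfl, e₁]; simp [Prog.sem, h51, hin.q_eq]
    have g25 : σ'.nat 25 0 = offset P k := by rw [a'.nat 25 rfl, a₂.nat 25 rfl, a₁.nat 25 rfl, h25]
    have g52 : σ'.nat 52 0 = k * L := by rw [a'.nat 52 rfl, a₂.nat 52 rfl, a₁.nat 52 rfl, h52]
    have hin' : HasInput P σ' := ((hin.agree a₁).agree a₂).agree a'
    refine ⟨by simp [i1, g24, hi], Ex.seq₀ (dpRun_spec ht hcap hr' (hin'.atPerim k g24 g25 i1) hi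
      (by rwa [a'.real 10 rfl, a₂.real 10 rfl, a₁.real 10 rfl])) fun σ₃ a₃ h₃ => Ex.seq₀
      (fillProg_spec (i := i) (b := k * L) ht (hr'.agree a₃) h₃ (by rw [a₃.nat 24 rfl, g24])
      (by rw [a₃.nat 26 rfl, i1]) (by rw [a₃.nat 52 rfl, g52])
      (by rw [a₃.nat 71 rfl, a₃.nat 72 rfl]; exact i3)) fun σ₄ a₄ h₄ =>
      Ex.flat (T := 20) ?_⟩
    have w26 : σ₄.nat 26 0 = i := by rw [a₄.nat 26 rfl, a₃.nat 26 rfl, i1]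
    obtain ⟨u1, u2⟩ := h₄
    rw [a₃.nat 71 rfl, a₃.nat 72 rfl] at u2
    refine ⟨by simp [w26], fun x hx => ?_, u1⟩
    exact ⟨(u2 x hx).1.trans (i2 x hx).1, (u2 x hx).2.trans (i2 x hx).2⟩
  · rintro σ' a' ⟨i1, -⟩
    have g24 : σ'.nat 24 0 = (P k).q := by
      rw [a'.nat 24 rfl, a₂.nat 24 rfl, e₁]; simp [Prog.sem, h51, hin.q_eq]
    simp [i1, g24]
  · rw [a₃.nat 39 rfl, a₂.nat 39 rfl, a₁.nat 39 rfl, h39]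
  · rw [a₃.nat 52 rfl, a₂.nat 52 rfl, a₁.nat 52 rfl, h52]
  · have e : row σ₃ 70 (k * L) = row σ 70 (k * L) := by
      unfold row; rw [a₃.nat 70 rfl, a₂.nat 70 rfl, a₁.nat 70 rfl]
    rw [e]; exact hfin
  · have g24 : σ₄.nat 24 0 = (P k).q := by
      rw [a₄.nat 24 rfl, a₃.nat 24 rfl, a₂.nat 24 rfl, e₁]; simp [Prog.sem, h51, hin.q_eq]
    have g25 : σ₄.nat 25 0 = offset P k := by
      rw [a₄.nat 25 rfl, a₃.nat 25 rfl, a₂.nat 25 rfl, a₁.nat 25 rfl, h25]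
    have g51 : σ₄.nat 51 0 = k := by
      rw [a₄.nat 51 rfl, a₃.nat 51 rfl, a₂.nat 51 rfl, a₁.nat 51 rfl, h51]
    have g71 : σ₄.nat 71 = σ₃.nat 71 := a₄.nat 71 rfl
    have g72 : σ₄.nat 72 = σ₃.nat 72 := a₄.nat 72 rfl
    have f70 : σ₃.nat 70 = σ.nat 70 := by rw [a₃.nat 70 rfl, a₂.nat 70 rfl, a₁.nat 70 rfl]
    have f75 : σ₃.nat 75 = σ.nat 75 := by rw [a₃.nat 75 rfl, a₂.nat 75 rfl, a₁.nat 75 rfl]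
    obtain ⟨u1, u2⟩ := h₄
    have ub := u1.below
    rw [f70, f75] at ub
    refine ⟨by simp [g51], by simp [g24, g25, offset_succ], by simp [u2, hsucc, ← hL], ?_⟩
    simp only [HasTables, ← hL] at hT ⊢
    have r70 : ∀ k' ≤ (k : ℕ), ∀ y < L, σ₄.nat 70 (k' * L + y) = σ.nat 70 (k' * L + y) := by
      intro k' hk' y hy
      have : k' * L ≤ k * L := Nat.mul_le_mul_right _ hk'
      exact (ub _ (by omega)).1
    constructor
    · intro y hy
      have := hT.zero y hy
      simp only [rows] at this
      simp [rows]
      rw [← this, ← r70 0 (Nat.zero_le _) y hy, zero_mul, zero_add]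
    · intro k' hk' y hy
      rcases Nat.lt_succ_iff_lt_or_eq.1 hk' with h' | h'
      · have := hT.fills k' h' y hy
        have hb := hrow k' h'
        simp only [rows] at this
        simp [rows, g71, g72]
        rwa [(h₃.2.1 _ (by omega)).1, (h₃.2.1 _ (by omega)).2]
      · obtain rfl : k' = k := Fin.ext h'
        simp [rows, g71, g72]
        exact h₃.2.2 y hy
    · intro k' hk'
      rcases Nat.lt_succ_iff_lt_or_eq.1 hk' with h' | h'
      · have hc := hT.conv k' h'
        have hb := hrow k' h'
        have hsum : ∀ y < L, (k' + 1) * L + y < k * L + L := by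
          intro y hy
          have : (k' + 1) * L ≤ k * L := Nat.mul_le_mul_right _ h'
          omega
        refine ⟨fun y hy hle => ?_, fun y y' hy hy' _ hf h1 h2 => ?_⟩
        · simp [rows, g71] at hle ⊢
          rw [(ub _ (hsum y hy)).1] at hle ⊢
          rw [(ub _ (hsum y hy)).2]
          obtain ⟨s1, s2, s3, s4, s5⟩ := hc.sound y hy hle
          simp only [rows] at s1 s2 s3 s4 s5
          have hch : σ.nat 75 ((k' + 1) * L + y) < L := by omega
          rw [(h₃.2.1 _ (by omega)).1, r70 k' h'.le _ (by omega)]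
          exact ⟨s1, s2, s3, s4, s5⟩
        · obtain ⟨hlt, -⟩ := hf.add ht hy hy'
          simp [rows, g71] at h1 h2 ⊢
          rw [r70 k' h'.le _ hy] at h1 ⊢
          rw [(h₃.2.1 _ (by omega)).1] at h2 ⊢
          rw [(ub _ (hsum _ hlt)).1]
          exact hc.complete y y' hy hy' trivial hf h1 h2
      · subst h'
        have hc := u1.conv
        have e1 : ∀ y < L, row σ₃ 70 (k * L) y = σ₄.nat 70 (k * L + y) := fun y hy => by
          rw [r70 k le_rfl y hy, row, f70]
        refine ⟨fun y hy hle => ?_, fun y y' hy hy' _ hf h1 h2 => ?_⟩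
        · simp [rows, hsucc] at hle ⊢
          obtain ⟨s1, s2, s3, s4, s5⟩ := hc.sound y hy hle
          rw [e1 _ (by omega)] at s3 s5
          simp only [row, ← g71] at s1 s2 s3 s4 s5
          exact ⟨s1, s2, s3, s4, s5⟩
        · simp [rows, hsucc] at h1 h2 ⊢
          rw [← e1 y hy] at h1 ⊢
          rw [g71] at h2 ⊢
          exact hc.complete y y' hy hy' trivial hf h1 h2
  · unfold perimTime
    have : (P k).q * (dpTime (P k).q t n + (300 * stride n t + 50 + 20) + 20) ≤
        (P k).q * (dpTime (P k).q t n + 300 * stride n t + 110) := Nat.mul_le_mul_left _ (by omega)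
    omega

end Test

/-! ### The test for several perimeters -/

/-- Fill the tables for all perimeters. -/
def tablesProg : Prog :=
  caps ;; (nset 39 (.get 10 (nv 20 - 1) + 1) ;; (nset 51 0 ;; nset 52 0) ;; nset 25 0 ;; nset 27 0) ;;
  .loop (natLt (nv 27) (nv 23)) (.setNat 70 (nv 27) (nv 39) ;; nset 27 (nv 27 + 1)) ;;
  .setNat 70 0 0 ;; .loop (natLt (nv 51) (nv 21)) perimProg

/-- Can the perimeters be covered with ratio at most the number in real variable `22`? -/
def multiTest : Prog :=
  tablesProg ;; .cond (natLt (.get 70 (nv 52 + nv 23 - 1)) (nv 39)) (nset 5 1) (nset 5 0)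

/-- The number of lines of the table that belong to a distribution of robots over `k` perimeters. -/
def width (t : ℕ) (n : ℕ → ℕ) (k : ℕ) : ℕ := if k = 0 then 1 else stride n (t - 1)

/-- Running time of the test for several perimeters. -/
def multiTime {m : ℕ} (P : Fin m → Perimeter) (t : ℕ) (n : ℕ → ℕ) : ℕ :=
  70 * t + 60 * stride n (t - 1) + (∑ k : Fin m, (perimTime (P k).q t n (width t n k) + 20)) + 200

section Test
variable {O : ℕ → ℝ → Prop} {t m : ℕ} {P : Fin m → Perimeter} {n a : ℕ → ℕ} {σ : State}

theorem tablesProg_spec (ht : 1 ≤ t) (hr : Ready t m n a σ) (hin : HasInput P σ)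
    (hx : 0 ≤ σ.real 22 0) : Ex O tablesProg σ (multiTime P t n - 50) 0 (fun σ' =>
      HasTables P t n (fun τ => a τ * σ.real 22 0) m σ' ∧ σ'.nat 39 0 = n (t - 1) + 1 ∧
      σ'.nat 51 0 = m ∧ σ'.nat 25 0 = offset P m ∧ σ'.nat 52 0 = m * stride n (t - 1) ∧
      ∀ τ < t, σ'.real 10 τ = a τ * σ.real 22 0) := by
  set cap : ℕ → ℝ := fun τ => a τ * σ.real 22 0 with hcapd
  have hcap : ∀ τ < t, 0 ≤ cap τ := fun τ _ => mul_nonneg (Nat.cast_nonneg _) hx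
  set L := stride n (t - 1) with hL
  refine Ex.time (Ex.seq₀ (caps_spec hr) fun σ₁ a₁ h₁ => Ex.flat_seq 30
    fun σ₂ e₂ a₂ => Ex.seq₀ (Ex.for₀ L 30 (fun y σ' => σ'.nat 27 0 = y ∧
      ∀ y' < y, σ'.nat 70 y' = n (t - 1) + 1) ?_ ?_ ?_) fun σ₃ a₃ h₃ =>
    Ex.flat_seq 10 fun σ₄ e₄ a₄ => (Ex.forT m
      (fun k => if h : k < m then perimTime (P ⟨k, h⟩).q t n (width t n k) else 0)
      (fun k σ' => HasTables P t n cap k σ' ∧ σ'.nat 51 0 = k ∧ σ'.nat 25 0 = offset P k ∧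
        σ'.nat 52 0 = k * L) ?_ ?_ ?_).mono le_rfl le_rfl ?_) ?_
  · exact ⟨by simp [e₂, Prog.sem], by simp⟩
  · rintro y hy σ' a' ⟨i1, i2⟩
    have hr' := ((hr.agree a₁).agree a₂).agree a'
    have g39 : σ'.nat 39 0 = n (t - 1) + 1 := by
      rw [a'.nat 39 rfl, e₂]
      simp [Prog.sem, (hr.agree a₁).t_eq, (hr.agree a₁).n_eq]
    refine ⟨by simp [i1, hr'.lines_eq, ← hL, hy], Ex.flat ?_⟩
    simp only [Prog.wp, State.setNat_nat, NatExp.eval_add, NatExp.eval_get, NatExp.eval_lit,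
      NatExp.eval_one, i1, g39, if_true, Function.update_self, if_false, Nat.reduceEqDiff]
    refine ⟨trivial, fun y' hy' => ?_⟩
    by_cases e : y' = y
    · rw [e, Function.update_self]
    · rw [Function.update_of_ne (by omega)]; exact i2 y' (by omega)
  · rintro σ' a' ⟨i1, -⟩
    have hr' := ((hr.agree a₁).agree a₂).agree a'
    simp [i1, hr'.lines_eq, ← hL]
  · have f51 : σ₄.nat 51 0 = 0 := by rw [a₄.nat 51 rfl, a₃.nat 51 rfl, e₂]; simp [Prog.sem]
    have f52 : σ₄.nat 52 0 = 0 := by rw [a₄.nat 52 rfl, a₃.nat 52 rfl, e₂]; simp [Prog.sem]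
    have f25 : σ₄.nat 25 0 = 0 := by rw [a₄.nat 25 rfl, a₃.nat 25 rfl, e₂]; simp [Prog.sem]
    refine ⟨⟨fun y hy => ?_, fun k hk => absurd hk (Nat.not_lt_zero _), fun k hk =>
      absurd hk (Nat.not_lt_zero _)⟩, f51, by rw [f25, offset_zero], by rw [f52, zero_mul]⟩
    have := h₃.2 y hy
    by_cases e : y = 0
    · simp [rows, e, e₄, Prog.sem]
    · simp [rows, e, e₄, Prog.sem, this]
  · rintro k hk σ' a' ⟨i1, i2, i3, i4⟩
    have hr' := ((((hr.agree a₁).agree a₂).agree a₃).agree a₄).agree a'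
    have hin' : HasInput P σ' := ((((hin.agree a₁).agree a₂).agree a₃).agree a₄).agree a'
    have g39 : σ'.nat 39 0 = n (t - 1) + 1 := by
      rw [a'.nat 39 rfl, a₄.nat 39 rfl, a₃.nat 39 rfl, e₂]
      simp [Prog.sem, (hr.agree a₁).t_eq, (hr.agree a₁).n_eq]
    have g10 : ∀ τ < t, σ'.real 10 τ = cap τ := by
      rw [a'.real 10 rfl, a₄.real 10 rfl, a₃.real 10 rfl, a₂.real 10 rfl]; exact h₁
    refine ⟨by simp [i2, hr'.m_eq, hk], ?_⟩
    rw [dif_pos hk]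
    exact (perimProg_spec (k := ⟨k, hk⟩) ht hcap hr' hin' g10 g39 i2 i3 i4 i1).mono le_rfl le_rfl
      fun _ _ h => ⟨h.2.2.2, h.1, h.2.1, h.2.2.1⟩
  · rintro σ' a' ⟨-, i2, -⟩
    have hr' := ((((hr.agree a₁).agree a₂).agree a₃).agree a₄).agree a'
    simp [i2, hr'.m_eq]
  · rintro σ' a' ⟨i1, i2, i3, i4⟩
    refine ⟨i1, ?_, i2, i3, i4, ?_⟩
    · rw [a'.nat 39 rfl, a₄.nat 39 rfl, a₃.nat 39 rfl, e₂]
      simp [Prog.sem, (hr.agree a₁).t_eq, (hr.agree a₁).n_eq]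
    · rw [a'.real 10 rfl, a₄.real 10 rfl, a₃.real 10 rfl, a₂.real 10 rfl]; exact h₁
  · rw [Finset.sum_range]
    simp only [Fin.is_lt, dif_pos, Fin.eta]
    unfold multiTime
    rw [← hL]
    have : L * (30 + 20) = 50 * L := by ring
    omega

/-- The test answers whether the tables allow to distribute the robots. -/
theorem multiTest_spec (ht : 1 ≤ t) (hr : Ready t m n a σ) (hin : HasInput P σ)
    (hx : 0 ≤ σ.real 22 0) : Ex O multiTest σ (multiTime P t n) 0 (fun σ' =>
      HasTables P t n (fun τ => a τ * σ.real 22 0) m σ' ∧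
      ((σ'.nat 5 0 = 1 ∧ rows σ' 70 (stride n (t - 1)) m (stride n (t - 1) - 1) ≤ n (t - 1)) ∨
        (σ'.nat 5 0 = 0 ∧
          ¬ rows σ' 70 (stride n (t - 1)) m (stride n (t - 1) - 1) ≤ n (t - 1)))) := by
  refine Ex.time (Ex.seq₀ (tablesProg_spec ht hr hin hx) fun σ₁ a₁ h₁ =>
    Ex.flat (T := 50) ?_) (by unfold multiTime; omega)
  obtain ⟨h1, h39, -, -, h52, -⟩ := h₁
  have hr' := hr.agree a₁
  have hL := stride_pos n (t - 1)
  have e : m * stride n (t - 1) + stride n (t - 1) - 1 =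
    m * stride n (t - 1) + (stride n (t - 1) - 1) := by omega
  refine ⟨fun h => ⟨h1, Or.inl ?_⟩, fun h => ⟨h1, Or.inr ?_⟩⟩
  · simp [h52, hr'.lines_eq, h39, e] at h
    refine ⟨by simp, ?_⟩
    simp [rows]; omega
  · simp [h52, hr'.lines_eq, h39, e] at h
    refine ⟨by simp, ?_⟩
    simp [rows]; omega

theorem multiTest_decides (ht : 1 ≤ t) (hm : 1 ≤ m) {n₀ a₀ : Fin t → ℕ}
    {ρ : Equiv.Perm (Fin t)} (hn : ∀ τ : Fin t, n τ = n₀ (ρ τ)) (ha : ∀ τ : Fin t, a τ = a₀ (ρ τ))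
    {ℓ : ℝ} (hℓ : ∀ x : ℝ, 0 ≤ x → (Feas P n₀ (fun τ => (a₀ τ : ℝ) * x) ↔ ℓ ≤ x)) :
    Decides O multiTest (fun σ => Ready t m n a σ ∧ HasInput P σ) ℓ (multiTime P t n) 0 := by
  refine ⟨fun σ hσ hx => (multiTest_spec ht hσ.1 hσ.2 hx).mono le_rfl le_rfl ?_,
    fun σ σ' hσ hnat hreal => ⟨?_, ?_⟩, by decide, by decide⟩
  · rintro σ' - ⟨h1, h2⟩
    rwa [h1.le_iff_feas ht hm (fun τ _ => mul_nonneg (Nat.cast_nonneg _) hx) hn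
      (cap₀ := fun τ => (a₀ τ : ℝ) * σ.real 22 0) (fun τ => by rw [ha]), hℓ _ hx] at h2
  · have e : ∀ A ∈ [10, 11, 13, 14, 15, 16, 20, 21, 22, 23], σ'.nat A = σ.nat A := fun A hA =>
      hnat A (by revert A; decide) (by revert A; decide)
    simp only [List.mem_cons, List.not_mem_nil, or_false, forall_eq_or_imp, forall_eq] at e
    obtain ⟨e1, e2, e3, e4, e5, e6, e7, e8, e9, e10⟩ := e
    obtain ⟨⟨h1, h2, h3, h4, h5, h6, h7, h8, h9, h10⟩, -⟩ := hσ
    constructor <;> simp only [*] <;> assumption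
  · exact hσ.2.of_eq (hnat 1 (by norm_num) rfl) (hreal 1 (by norm_num) (by norm_num) rfl)
      (hreal 2 (by norm_num) (by norm_num) rfl)

end Test

/-! ### The optimum for several perimeters -/

/-- Compute the optimum, after `setup`, to real variable `42`. -/
def valueProg : Prog :=
  nset 61 (nv 23) ;; listAll ;; sumProg ;;
    (nset 59 (.get 10 (nv 20 - 1) + 1) ;; nset 60 (.get 11 (nv 20 - 1))) ;; searchProg multiTest

/-- Running time of `valueProg`. -/
def valueTime {m : ℕ} (P : Fin m → Perimeter) (t : ℕ) (n : ℕ → ℕ) : ℕ :=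
  700 * ((∑ k, (P k).q ^ 2) * stride n (t - 1)) + 60 * offset P m +
    (Nat.clog 2 (n (t - 1) + 1) + 1) *
      (stageTime ((∑ k, (P k).q ^ 2) * stride n (t - 1)) (multiTime P t n) + 100) + 400

theorem valueProg_spec {O : ℕ → ℝ → Prop} {t m : ℕ} {P : Fin m → Perimeter} {n a : ℕ → ℕ}
    {σ : State} (ht : 1 ≤ t) (hm : 1 ≤ m) (ha₀ : ∀ τ < t, 0 < a τ) (hr : Ready t m n a σ)
    (hin : HasInput P σ) (h56 : ∀ j, σ.nat 56 j = 0) {n₀ a₀ : Fin t → ℕ}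
    {ρ : Equiv.Perm (Fin t)} (hn : ∀ τ : Fin t, n τ = n₀ (ρ τ)) (ha : ∀ τ : Fin t, a τ = a₀ (ρ τ))
    {ℓ : ℝ} (hℓ : ∀ x : ℝ, 0 ≤ x → (Feas P n₀ (fun τ => (a₀ τ : ℝ) * x) ↔ ℓ ≤ x))
    (hc : ℓ ∈ candidates P n₀ a₀) :
    Ex O valueProg σ (valueTime P t n) 0 (fun σ' => σ'.real 42 0 = ℓ) := by
  set L := stride n (t - 1) with hL
  have hLt : L ≤ stride n t := by
    rw [stride_pred n ht]; exact Nat.le_mul_of_pos_right _ (Nat.succ_pos _)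
  have hLp : 0 < L := stride_pos n _
  refine Ex.time (Ex.flat_seq 20 fun σ₁ e₁ a₁ => Ex.seq₀ (listAll_spec
    (P := P) (Y := L) ?_ ?_ ?_ ?_ ?_) fun σ₂ a₂ h₂ => Ex.seq₀ (sumProg_spec (P := P) ?_ h₂.1)
    fun σ₃ a₃ h₃ => Ex.flat_seq 30 fun σ₄ e₄ a₄ => ?_) (T := 20 +
    ((700 * ((∑ k, (P k).q ^ 2) * L) + 100) + ((60 * offset P m + 50) + (30 +
    ((Nat.clog 2 (n (t - 1) + 1) + 1) *
      (stageTime ((∑ k, (P k).q ^ 2) * L) (multiTime P t n) + 100) + 100))))) ?_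
  · exact hin.agree a₁
  · exact (hr.agree a₁).m_eq
  · simp [e₁, Prog.sem, hr.lines_eq, hL]
  · exact hLp
  · exact fun y hy => (hr.agree a₁).weight_pos ht ha₀ (lt_of_lt_of_le hy hLt)
  · exact (hin.agree a₁).agree a₂
  · obtain ⟨-, -, hlist⟩ := h₂
    have hr₁ := hr.agree a₁
    have hr₃ := (hr₁.agree a₂).agree a₃
    have hr₄ := hr₃.agree a₄
    have hin₄ : HasInput P σ₄ := (((hin.agree a₁).agree a₂).agree a₃).agree a₄
    have q40 : σ₄.nat 40 0 = (∑ k, (P k).q ^ 2) * L := by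
      rw [a₄.nat 40 rfl, a₃.nat 40 rfl, hlist.N_eq]
    have q42 : σ₄.real 42 0 = ∑ k, (P k).total := by rw [a₄.real 42 rfl, h₃]
    have q43 : σ₄.real 43 = σ₂.real 43 := (a₄.real 43 rfl).trans (a₃.real 43 rfl)
    have q55 : σ₄.nat 55 = σ₂.nat 55 := (a₄.nat 55 rfl).trans (a₃.nat 55 rfl)
    have q56 : ∀ j, σ₄.nat 56 j = 0 := by
      rw [a₄.nat 56 rfl, a₃.nat 56 rfl, a₂.nat 56 rfl, a₁.nat 56 rfl]; exact h56
    have q59 : σ₄.nat 59 0 = n (t - 1) + 1 := by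
      simp [e₄, Prog.sem, hr₃.t_eq, hr₃.n_eq]
    have q60 : σ₄.nat 60 0 = a (t - 1) := by
      simp [e₄, Prog.sem, hr₃.t_eq, hr₃.a_eq]
    have q16 : σ₂.nat 16 = σ₁.nat 16 := a₂.nat 16 rfl
    have ha_last : 0 < a (t - 1) := ha₀ _ (by omega)
    obtain ⟨k, i, d, x, hi, hd, hx, hpos, e⟩ := mem_candidates_iff.1 hc
    obtain ⟨c, hcl, hw⟩ := exists_cell hn ha hx
    set y := c % L with hy
    set z := c / L with hz
    have hyL : y < L := Nat.mod_lt _ hLp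
    have hzn : z ≤ n (t - 1) := cell_div_le n ht hcl
    have hcell : y + L * z = c := Nat.mod_add_div _ _
    have hwt : weight n a t c = weight n a t y + a (t - 1) * z := by
      obtain ⟨s, rfl⟩ : ∃ s, t = s + 1 := ⟨t - 1, by omega⟩
      simp only [Nat.add_sub_cancel] at *
      unfold weight
      rw [Finset.sum_range_succ, Finset.sum_range_succ, ← hcell,
        digit_cell n (Nat.lt_succ_self s) hyL hzn, if_pos (by omega),
        show digit n y s = 0 from digit_last_eq_zero (t := s + 1) n hyL,
        mul_zero, add_zero]
      congr 1
      refine Finset.sum_congr rfl fun τ hτ => ?_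
      have := Finset.mem_range.1 hτ
      rw [digit_cell n (by omega) hyL hzn, if_neg (by omega)]
    obtain ⟨j, hj, e1, e2⟩ := hlist.all k i d y ⟨hi, hd, hyL⟩
    rw [q16, hr₁.weight_eq y (lt_of_lt_of_le hyL hLt)] at e2
    rw [hwt] at hw
    obtain ⟨p, hp1, hp2, hent⟩ : ∃ p, 1 ≤ p ∧ p ≤ n (t - 1) + 1 ∧ entry σ₄ j p = ℓ := by
      by_cases h0 : y = 0
      · rw [if_pos h0] at e2
        rw [h0, weight_zero, zero_add] at hw
        have hz1 : 1 ≤ z := by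
          by_contra hz0
          have : z = 0 := Nat.lt_one_iff.1 (not_le.1 hz0)
          rw [this, mul_zero] at hw; omega
        refine ⟨z, hz1, Nat.le_succ_of_le hzn, ?_⟩
        unfold entry
        rw [e, q43, q55, q60, e1, e2, ← hw]
        congr 1
        push_cast [Nat.cast_sub hz1]
        ring
      · rw [if_neg h0] at e2
        refine ⟨z + 1, Nat.succ_pos z, Nat.succ_le_succ hzn, ?_⟩
        unfold entry
        rw [e, q43, q55, q60, e1, e2, ← hw]
        push_cast
        simp
    have := searchProg_spec (O := O) (multiTest_decides ht hm hn ha hℓ) (σ := σ₄) ⟨hr₄, hin₄⟩ q40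
      (by rw [q43]; exact fun j hj => (hlist.pos j hj).1)
      (by rw [q55]; exact fun j hj => (hlist.pos j hj).2) q56 q59 (by rw [q60]; exact ha_last)
      (by rw [q42]; exact le_sum_total hc) hj hp1 hp2 hent
    exact this.mono le_rfl (by simp) fun _ _ h => h
  · unfold valueTime; rw [← hL]; omega

/-! ### Reconstruction of an optimal cover -/

theorem startDist_eq (P : Perimeter) {i : ℕ} (hi : i ≤ P.q) (s : ℝ) : startDist P i s =
    if 0 ≤ s - segStart P i (P.q - i) then s - segStart P i (P.q - i)
    else s - segStart P i (P.q - i) + segStart P i P.q := by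
  have h : segStart P i (P.q - i) + segStart P 0 i = P.total := by
    rw [P.segStart_eq, P.segStart_eq, ← P.segStart_q 0, P.segStart_eq, Nat.add_sub_cancel' hi, zero_add,
      zero_add]
    ring
  unfold startDist
  rw [P.segStart_q]
  have e : P.total ≤ segStart P 0 i + s ↔ 0 ≤ s - segStart P i (P.q - i) := by
    constructor <;> intro _ <;> linarith
  simp only [e]
  split_ifs <;> linarith

theorem Plan.congr {m t : ℕ} {P : Fin m → Perimeter} {n : ℕ → ℕ} {cap : ℕ → ℝ} {i c i' c' : ℕ → ℕ}
    (h : Plan P t n cap i c) (hi : ∀ k < m, i' k = i k) (hc : ∀ k < m, c' k = c k) :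
    Plan P t n cap i' c' := by
  refine ⟨fun k => ?_, fun k => ?_, fun k => ?_, fun τ hτ => ?_⟩
  · rw [hi k k.2]; exact h.start_lt k
  · rw [hc k k.2]; exact h.cell_lt k
  · rw [hi k k.2, hc k k.2]; exact h.covered k
  · rw [← h.sum_eq τ hτ]
    exact Finset.sum_congr rfl fun k hk => by rw [hc k (Finset.mem_range.1 hk)]

/-- Find out which robots go to which perimeter. -/
def traceProg : Prog :=
  (nset 81 (nv 23 - 1) ;; nset 84 (nv 39 - 1 - .get 70 (nv 52 + (nv 23 - 1)))) ;;
  .loop (.natLe 1 (nv 51)) (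
    (nset 51 (nv 51 - 1) ;; nset 83 (.get 75 (nv 52 + nv 81)) ;; nset 52 (nv 52 - nv 23) ;;
      nset 81 (nv 81 - nv 83) ;; .setNat 76 (nv 51) (.get 72 (nv 52 + nv 83)) ;; nset 80 (nv 83) ;;
      nset 82 (.get 71 (nv 52 + nv 83)) ;;
      .cond (.natLe (nv 51) 0) (nset 82 (nv 82 + nv 84)) .skip) ;;
    .loop (.natLe 1 (nv 82)) (nset 80 (nv 80 + nv 23) ;; nset 82 (nv 82 - 1)) ;;
    .setNat 77 (nv 51) (nv 80))

section Trace
variable {O : ℕ → ℝ → Prop} {t m : ℕ} {P : Fin m → Perimeter} {n a : ℕ → ℕ} {cap : ℕ → ℝ} {σ : State}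

theorem traceProg_spec (ht : 1 ≤ t) (hm : 1 ≤ m) (hcap : ∀ τ < t, 0 ≤ cap τ) (hr : Ready t m n a σ)
    (hT : HasTables P t n cap m σ) (h39 : σ.nat 39 0 = n (t - 1) + 1) (h51 : σ.nat 51 0 = m)
    (h52 : σ.nat 52 0 = m * stride n (t - 1))
    (hle : rows σ 70 (stride n (t - 1)) m (stride n (t - 1) - 1) ≤ n (t - 1)) :
    Ex O traceProg σ (m * (40 * n (t - 1) + 200) + 60) 0
      (fun σ' => Plan P t n cap (σ'.nat 76) (σ'.nat 77)) := by
  set L := stride n (t - 1) with hL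
  obtain ⟨Y, sel, h1, h2, h3⟩ := exists_trace m (rows σ 75 L) (L - 1)
  obtain ⟨hz, hp⟩ := Tables.plan ht hm hcap hT hle h1 h2 h3
  simp only [← hL] at hz hp
  set z : ℕ → ℕ := fun k => rows σ 71 L k (sel k) +
    if k = 0 then n (t - 1) - rows σ 70 L m (L - 1) else 0 with hzd
  refine Ex.time (Ex.flat_seq 40 fun σ₁ e₁ a₁ => (Ex.for₀ m (40 * n (t - 1) + 180)
    (fun j σ' => σ'.nat 51 0 = m - j ∧ σ'.nat 52 0 = (m - j) * L ∧ σ'.nat 81 0 = Y (m - j) ∧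
      ∀ k < m, m - j ≤ k → σ'.nat 76 k = rows σ 72 L k (sel k) ∧ σ'.nat 77 k = sel k + L * z k)
    ?_ ?_ ?_).mono le_rfl le_rfl fun σ' _ h => hp.congr (fun k hk => ?_) fun k hk => ?_) ?_
  · refine ⟨?_, ?_, ?_, fun k hk hk' => by omega⟩
    · rw [a₁.nat 51 rfl, h51, Nat.sub_zero]
    · rw [a₁.nat 52 rfl, h52, Nat.sub_zero]
    · rw [Nat.sub_zero, h1]; simp [e₁, Prog.sem, hr.lines_eq, hL]
  · rintro j hj σ' a' ⟨i1, i2, i3, i4⟩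
    obtain ⟨k, hk⟩ : ∃ k, m - j = k + 1 := ⟨m - j - 1, by omega⟩
    have hkm : k < m := by omega
    have hr' := (hr.agree a₁).agree a'
    rw [hk] at i1 i2 i3
    have g70 : σ'.nat 84 0 = n (t - 1) - rows σ 70 L m (L - 1) := by
      rw [a'.nat 84 rfl, e₁]; simp [Prog.sem, hr.lines_eq, h52, h39, rows, hL]
    have g71 : σ'.nat 71 = σ.nat 71 := (a'.nat 71 rfl).trans (a₁.nat 71 rfl)
    have g72 : σ'.nat 72 = σ.nat 72 := (a'.nat 72 rfl).trans (a₁.nat 72 rfl)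
    have g75 : σ'.nat 75 = σ.nat 75 := (a'.nat 75 rfl).trans (a₁.nat 75 rfl)
    have g23 : σ'.nat 23 0 = L := hr'.lines_eq
    have hsel := h2 k hkm
    have hY := h3 k hkm
    have hmul : (k + 1) * L - L = k * L := by rw [Nat.succ_mul, Nat.add_sub_cancel]
    have hsel' : σ.nat 75 ((k + 1) * L + Y (k + 1)) = sel k := hsel.symm
    refine ⟨by simp [i1], Ex.time (Ex.seq₀ (Ex.flat (T := 100) (Q := fun σ₂ => σ₂.nat 51 0 = k ∧
      σ₂.nat 52 0 = k * L ∧ σ₂.nat 81 0 = Y k ∧ σ₂.nat 80 0 = sel k ∧ σ₂.nat 82 0 = z k ∧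
      σ₂.nat 76 = Function.update (σ'.nat 76) k (rows σ 72 L k (sel k))) ?_)
      fun σ₂ a₂ q => Ex.seq₀ (Ex.for₀ (z k) 20 (fun x s => s.nat 82 0 = z k - x ∧
        s.nat 80 0 = sel k + L * x) ?_ ?_ ?_) fun σ₃ a₃ q₃ =>
      Ex.flat (T := 20) ?_) ?_⟩
    · simp only [Prog.wp, State.setNat_nat, NatExp.eval_add, NatExp.eval_sub, NatExp.eval_get,
        NatExp.eval_lit, NatExp.eval_one, NatExp.eval_zero, Test.holds, i1, i2, i3, g70, g71, g72, g75,
        g23, if_true, if_false, Function.update_self, Nat.reduceEqDiff, Nat.add_sub_cancel, hmul, hsel',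
        ← hY, true_and]
      refine ⟨fun hb => ⟨?_, rfl⟩, fun hb => ⟨?_, rfl⟩⟩
      · simp [hzd, rows, show k = 0 by omega]
      · simp [hzd, rows, show k ≠ 0 by omega]
    · exact ⟨by rw [q.2.2.2.2.1, Nat.sub_zero], by rw [q.2.2.2.1, mul_zero, add_zero]⟩
    · rintro x hx s as ⟨s1, s2⟩
      have : s.nat 23 0 = L := by rw [as.nat 23 rfl, a₂.nat 23 rfl, g23]
      refine ⟨by simp [s1]; omega, Ex.flat ?_⟩
      simp [Prog.wp, s1, s2, this]
      exact ⟨by omega, by ring⟩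
    · rintro s - ⟨s1, -⟩
      simp [s1]
    · have w51 : σ₃.nat 51 0 = k := (congrFun (a₃.nat 51 rfl) 0).trans q.1
      have w52 : σ₃.nat 52 0 = k * L := (congrFun (a₃.nat 52 rfl) 0).trans q.2.1
      have w81 : σ₃.nat 81 0 = Y k := (congrFun (a₃.nat 81 rfl) 0).trans q.2.2.1
      have w76 : σ₃.nat 76 = _ := (a₃.nat 76 rfl).trans q.2.2.2.2.2
      have w77 : σ₃.nat 77 = σ'.nat 77 := (a₃.nat 77 rfl).trans (a₂.nat 77 rfl)
      rw [show m - (j + 1) = k by omega]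
      simp only [Prog.wp, State.setNat_nat, NatExp.eval_get, NatExp.eval_lit, w51, w52, w81, w76, w77,
        q₃.2, if_true, if_false, Nat.reduceEqDiff, true_and]
      intro k' hk' hkk
      by_cases e : k' = k
      · subst e; simp
      · rw [Function.update_of_ne e, Function.update_of_ne e]
        exact i4 k' hk' (by omega)
    · have := hz k hkm
      change z k ≤ n (t - 1) at this
      have : z k * (20 + 20) ≤ n (t - 1) * (20 + 20) := Nat.mul_le_mul_right _ this
      omega
  · rintro σ' - ⟨i1, -⟩
    simp [i1]
  · exact (h.2.2.2 k hk (by omega)).1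
  · exact (h.2.2.2 k hk (by omega)).2
  · have : m * (40 * n (t - 1) + 180 + 20) = m * (40 * n (t - 1) + 200) := by ring
    omega

end Trace

/-- The robots with `A` guard intervals; what they leave in perimeter `k` is dealt with by `F k`. -/
structure Assigned {m : ℕ} {ι : Type*} (P : Fin m → Perimeter) (i : Fin m → ℕ) (w : ι → ℝ)
    (F : Fin m → ℝ) (A : ι → Prop) (pl : ι → ℕ) (lo hi : ι → ℝ) : Prop where
  bound : ∀ j, A j → ∃ k : Fin m, pl j = k ∧ 0 ≤ lo j ∧ lo j ≤ hi j ∧ hi j - lo j ≤ w j ∧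
    hi j ≤ segEnd (P k) (i k) ((P k).q - 1) ∧
    min (F k) (segEnd (P k) (i k) ((P k).q - 1)) ≤ lo j
  nonoverlap : ∀ j j', A j → A j' → j ≠ j' → pl j = pl j' → hi j ≤ lo j' ∨ hi j' ≤ lo j
  cover : ∀ k, ∀ r < (P k).q, ∀ s, segStart (P k) (i k) r ≤ s → s ≤ segEnd (P k) (i k) r →
    Below (P k) (i k) r (F k) s ∨ ∃ j, A j ∧ pl j = k ∧ lo j ≤ s ∧ s ≤ hi j

theorem Assigned.insert {m : ℕ} {ι : Type*} {P : Fin m → Perimeter} {i : Fin m → ℕ} {w : ι → ℝ}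
    {F F' : Fin m → ℝ} {A A' : ι → Prop} {pl pl' : ι → ℕ} {lo hi lo' hi' : ι → ℝ}
    (h : Assigned P i w F A pl lo hi) {j₀ : ι} {k : Fin m} (hj : ¬ A j₀)
    (hF : F k = inc (P k) (i k) (F' k) (w j₀)) (hF' : ∀ k' ≠ k, F' k' = F k') (hL : 0 ≤ F' k)
    (hw : 0 ≤ w j₀) (hA : ∀ j, A' j ↔ A j ∨ j = j₀) (hpl : pl' j₀ = k)
    (hlo : lo' j₀ = min (F' k) (segEnd (P k) (i k) ((P k).q - 1)))
    (hhi : hi' j₀ = min (F' k + w j₀) (segEnd (P k) (i k) ((P k).q - 1)))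
    (hne : ∀ j ≠ j₀, pl' j = pl j ∧ lo' j = lo j ∧ hi' j = hi j) :
    Assigned P i w F' A' pl' lo' hi' := by
  have hAne : ∀ j, A j → j ≠ j₀ := fun j hA e => hj (e ▸ hA)
  have hinc : F' k + w j₀ ≤ F k := hF ▸ add_le_inc (P k) (i k) _ _
  have hD := (P k).segEnd_pos (i k) ((P k).q - 1)
  have hnew : ∀ j, A j → pl j = k → hi' j₀ ≤ lo j := by
    intro j hAj hp
    obtain ⟨k', e, -, -, -, -, h6⟩ := h.bound j hAj
    obtain rfl : k' = k := Fin.ext (e.symm.trans hp)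
    rw [hhi]
    exact (min_le_min_right _ hinc).trans h6
  refine ⟨fun j hj' => ?_, fun j j' h1 h2 hjj hp => ?_, fun k' r hr s hs hs' => ?_⟩
  · rcases (hA j).1 hj' with h1 | rfl
    · obtain ⟨k', e, b1, b2, b3, b4, b5⟩ := h.bound j h1
      obtain ⟨e1, e2, e3⟩ := hne j (hAne j h1)
      rw [e1, e2, e3]
      refine ⟨k', e, b1, b2, b3, b4, ?_⟩
      by_cases ek : k' = k
      · subst ek
        exact (min_le_min_right _ (by linarith)).trans b5
      · rwa [hF' k' ek]
    · refine ⟨k, hpl, ?_, ?_, ?_, ?_, ?_⟩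
      · rw [hlo]; exact le_min hL hD.le
      · rw [hlo, hhi]; exact min_le_min_right _ (by linarith)
      · rw [hlo, hhi]
        rcases le_total (F' k) (segEnd (P k) (i k) ((P k).q - 1)) with c | c
        · rw [min_eq_left c]; linarith [min_le_left (F' k + w j) (segEnd (P k) (i k) ((P k).q - 1))]
        · rw [min_eq_right c]; linarith [min_le_right (F' k + w j) (segEnd (P k) (i k) ((P k).q - 1))]
      · rw [hhi]; exact min_le_right _ _
      · rw [hlo]
  · rcases (hA j).1 h1 with a1 | rfl <;> rcases (hA j').1 h2 with a2 | rfl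
    · obtain ⟨e1, e2, e3⟩ := hne j (hAne j a1)
      obtain ⟨e1', e2', e3'⟩ := hne j' (hAne j' a2)
      rw [e2, e3, e2', e3']
      exact h.nonoverlap j j' a1 a2 hjj (by rw [← e1, ← e1', hp])
    · obtain ⟨e1, e2, e3⟩ := hne j (hAne j a1)
      rw [e2]
      exact Or.inr (hnew j a1 (by rw [← e1, hp, hpl]))
    · obtain ⟨e1, e2, e3⟩ := hne j' (hAne j' a2)
      rw [e2]
      exact Or.inl (hnew j' a2 (by rw [← e1, ← hp, hpl]))
    · exact absurd rfl hjj
  · rcases h.cover k' r hr s hs hs' with hb | ⟨j, b1, b2, b3⟩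
    · by_cases ek : k' = k
      · subst ek
        rw [hF] at hb
        rcases below_inc (P k') (i k') hs hs' hb with hb | hb
        · exact Or.inl hb
        · have hsD : s ≤ segEnd (P k') (i k') ((P k').q - 1) :=
            hs'.trans ((P k').segEnd_mono (i k') (by omega))
          refine Or.inr ⟨j₀, (hA j₀).2 (Or.inr rfl), hpl, ?_, ?_⟩
          · rw [hlo]; exact (min_le_left _ _).trans hb.1
          · rw [hhi]; exact le_min hb.2 hsD
      · left; rwa [hF' k' ek]
    · obtain ⟨e1, e2, e3⟩ := hne j (hAne j b1)
      exact Or.inr ⟨j, (hA j).2 (Or.inl b1), by rw [e1, b2], by rwa [e2, e3]⟩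

/-- The number of robots of smaller types. -/
def base {t : ℕ} (n : Fin t → ℕ) (τ : ℕ) : ℕ := ∑ τ' ∈ Finset.range τ, pad n τ'

/-- The number of the robot `j`. -/
def slot {t : ℕ} {n : Fin t → ℕ} (j : Robot n) : ℕ := finSigmaFinEquiv j

theorem slot_eq {t : ℕ} {n : Fin t → ℕ} (j : Robot n) : slot j = base n j.1 + j.2 :=
  finSigmaFinEquiv_val n j.1 j.2

theorem slot_inj {t : ℕ} {n : Fin t → ℕ} {j j' : Robot n} : slot j = slot j' ↔ j = j' :=
  ⟨fun h => finSigmaFinEquiv.injective (Fin.ext h), fun h => h ▸ rfl⟩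

/-- The memory while the robots are assigned; `rem k` is the cell of the robots that are still to be
assigned to perimeter `k`. -/
structure Walk {m t : ℕ} (P : Fin m → Perimeter) (n₀ : Fin t → ℕ) (cap₀ : Fin t → ℝ)
    (ρ : Equiv.Perm (Fin t)) (n : ℕ → ℕ) (cap : ℕ → ℝ) (i : Fin m → ℕ) (rem : Fin m → ℕ)
    (σ : State) : Prop where
  rem_lt : ∀ k, rem k < stride n t
  base_le : ∀ τ : Fin t, base n₀ τ ≤ σ.nat 74 τ
  count : ∀ τ : Fin t, σ.nat 74 (ρ τ) + ∑ k, digit n (rem k) τ = base n₀ (ρ τ) + n₀ (ρ τ)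
  assigned : Assigned P i (fun j : Robot n₀ => cap₀ j.1)
    (fun k => tab (P k) (i k) t n cap (rem k)) (fun j => slot j < σ.nat 74 j.1)
    (fun j => σ.nat 4 (slot j)) (fun j => σ.real 50 (slot j)) (fun j => σ.real 51 (slot j))
  out : ∀ j : Robot n₀, slot j < σ.nat 74 j.1 →
    σ.real 4 (slot j) = σ.real 51 (slot j) - σ.real 50 (slot j) ∧
    ∀ k : Fin m, σ.nat 4 (slot j) = k →
      σ.real 3 (slot j) = startDist (P k) (i k) (σ.real 50 (slot j))

section Walk
variable {m t : ℕ} {P : Fin m → Perimeter} {n₀ : Fin t → ℕ} {cap₀ : Fin t → ℝ}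
  {ρ : Equiv.Perm (Fin t)} {n : ℕ → ℕ} {cap : ℕ → ℝ} {i : Fin m → ℕ} {rem : Fin m → ℕ} {σ σ' : State}

theorem Walk.of_eq (h : Walk P n₀ cap₀ ρ n cap i rem σ) (h74 : σ'.nat 74 = σ.nat 74)
    (h4 : σ'.nat 4 = σ.nat 4) (r3 : σ'.real 3 = σ.real 3) (r4 : σ'.real 4 = σ.real 4)
    (r50 : σ'.real 50 = σ.real 50) (r51 : σ'.real 51 = σ.real 51) :
    Walk P n₀ cap₀ ρ n cap i rem σ' := by
  refine ⟨h.rem_lt, by rw [h74]; exact h.base_le, by rw [h74]; exact h.count, ?_, ?_⟩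
  · rw [h74, h4, r50, r51]; exact h.assigned
  · rw [h74, h4, r3, r4, r50, r51]; exact h.out

/-- One more robot is assigned. -/
theorem Walk.step (hcap₀ : ∀ τ, 0 ≤ cap₀ τ) (hcap : ∀ τ : Fin t, cap τ = cap₀ (ρ τ))
    (h : Walk P n₀ cap₀ ρ n cap i rem σ) {k : Fin m} {τ : Fin t}
    (hτ : IsChoice (P k) (i k) t n cap (rem k) τ) {x : ℕ} (hx : σ.nat 74 (ρ τ) = x) {lo hi : ℝ}
    (hlo : lo = min (tab (P k) (i k) t n cap (rem k - stride n τ))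
      (segEnd (P k) (i k) ((P k).q - 1)))
    (hhi : hi = min (tab (P k) (i k) t n cap (rem k - stride n τ) + cap τ)
      (segEnd (P k) (i k) ((P k).q - 1)))
    (h74 : σ'.nat 74 = Function.update (σ.nat 74) (ρ τ) (x + 1))
    (h4 : σ'.nat 4 = Function.update (σ.nat 4) x k)
    (r3 : σ'.real 3 = Function.update (σ.real 3) x (startDist (P k) (i k) lo))
    (r4 : σ'.real 4 = Function.update (σ.real 4) x (hi - lo))
    (r50 : σ'.real 50 = Function.update (σ.real 50) x lo)
    (r51 : σ'.real 51 = Function.update (σ.real 51) x hi) :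
    Walk P n₀ cap₀ ρ n cap i (Function.update rem k (rem k - stride n τ)) σ' := by
  obtain ⟨-, hd, hinc⟩ := hτ
  have hsum : ∀ τ' : Fin t, ∑ k', digit n (Function.update rem k (rem k - stride n τ) k') τ' +
      (if τ' = τ then 1 else 0) = ∑ k', digit n (rem k') τ' := by
    intro τ'
    rw [← Finset.add_sum_erase _ _ (Finset.mem_univ k), ← Finset.add_sum_erase Finset.univ
      (fun k' => digit n (rem k') τ') (Finset.mem_univ k), Function.update_self, digit_sub n hd]
    have : ∑ k' ∈ Finset.univ.erase k, digit n (Function.update rem k (rem k - stride n τ) k') τ' =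
        ∑ k' ∈ Finset.univ.erase k, digit n (rem k') τ' := Finset.sum_congr rfl fun k' hk' => by
      rw [Function.update_of_ne (Finset.ne_of_mem_erase hk')]
    rw [this]
    by_cases e : τ' = τ
    · subst e; simp only [if_true]; omega
    · have e' : (τ' : ℕ) ≠ τ := fun c => e (Fin.ext c)
      simp [e, e']
  have hne : ∀ τ' : Fin t, (τ' : ℕ) ≠ ρ τ ↔ τ' ≠ ρ τ := fun τ' => not_congr Fin.ext_iff.symm
  have hb := h.base_le (ρ τ)
  have hc := h.count τ
  rw [hx] at hb hc
  have hpos : 1 ≤ ∑ k', digit n (rem k') τ := by rw [← hsum, if_pos rfl]; omega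
  set j₀ : Robot n₀ := ⟨ρ τ, ⟨x - base n₀ (ρ τ), by omega⟩⟩ with hj₀
  have hslot : slot j₀ = x := (slot_eq j₀).trans (Nat.add_sub_cancel' hb)
  have hA : ∀ j : Robot n₀, slot j < σ'.nat 74 j.1 ↔ slot j < σ.nat 74 j.1 ∨ j = j₀ := by
    intro j
    rw [h74]
    by_cases e : j.1 = ρ τ
    · rw [e, Function.update_self, hx, ← slot_inj, hslot]
      exact Nat.lt_succ_iff_lt_or_eq
    · rw [Function.update_of_ne ((hne _).2 e)]
      exact ⟨Or.inl, fun c => c.resolve_right fun c' => e (by rw [c'])⟩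
  have hup : ∀ j ≠ j₀, slot j ≠ x := fun j hj c => hj (slot_inj.1 (c.trans hslot.symm))
  refine ⟨fun k' => ?_, fun τ' => ?_, fun τ' => ?_, ?_, fun j hj => ?_⟩
  · by_cases e : k' = k
    · rw [e, Function.update_self]; exact lt_of_le_of_lt (Nat.sub_le _ _) (h.rem_lt k)
    · rw [Function.update_of_ne e]; exact h.rem_lt k'
  · rw [h74]
    by_cases e : τ' = ρ τ
    · rw [e, Function.update_self]; omega
    · rw [Function.update_of_ne ((hne _).2 e)]; exact h.base_le τ'
  · rw [h74]
    have h1 := hsum τ'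
    have h2 := h.count τ'
    by_cases e : τ' = τ
    · subst e; rw [if_pos rfl] at h1; rw [Function.update_self]; omega
    · rw [if_neg e] at h1
      rw [Function.update_of_ne ((hne _).2 fun c => e (ρ.injective c))]; omega
  · have hcτ : cap τ = cap₀ j₀.1 := hcap τ
    rw [hcτ] at hhi hinc
    refine h.assigned.insert (j₀ := j₀) (k := k) ?_ ?_ ?_ (tab_nonneg _) (hcap₀ _) hA ?_ ?_ ?_ ?_
    · rw [hslot, hx]; exact lt_irrefl _
    · simp only [Function.update_self]; exact hinc
    · intro k' hk'; simp only [Function.update_of_ne hk']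
    · rw [hslot, h4, Function.update_self]
    · rw [hslot, r50, Function.update_self, Function.update_self, hlo]
    · rw [hslot, r51, Function.update_self, Function.update_self, hhi]
    · intro j hj
      rw [h4, r50, r51, Function.update_of_ne (hup j hj), Function.update_of_ne (hup j hj),
        Function.update_of_ne (hup j hj)]
      exact ⟨rfl, rfl, rfl⟩
  · rw [r4, r50, r51, h4, r3]
    by_cases e : j = j₀
    · rw [e, hslot]
      simp only [Function.update_self]
      exact ⟨trivial, fun k' hk' => by rw [Fin.ext hk']⟩
    · have := hup j e
      simp only [Function.update_of_ne this]
      exact h.out j (((hA j).1 hj).resolve_right e)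

/-- The start, when no robot is assigned. -/
theorem Plan.walk (hn : ∀ τ : Fin t, n τ = n₀ (ρ τ)) {i' c' : ℕ → ℕ} (hp : Plan P t n cap i' c')
    (h74 : ∀ τ : Fin t, σ.nat 74 τ = base n₀ τ) :
    Walk P n₀ cap₀ ρ n cap (fun k => i' k) (fun k => c' k) σ := by
  have hno : ∀ j : Robot n₀, ¬ slot j < σ.nat 74 j.1 := fun j => by rw [h74, slot_eq]; omega
  refine ⟨hp.cell_lt, fun τ => (h74 τ).ge, fun τ => ?_, ⟨fun j hj => absurd hj (hno j),
    fun j _ hj => absurd hj (hno j), fun k r hr s hs hs' => Or.inl ?_⟩, fun j hj => absurd hj (hno j)⟩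
  · rw [h74, ← hn, ← hp.sum_eq τ τ.2, Finset.sum_range]
  · have h1 := hp.covered k
    have h2 := (P k).segEnd_mono (i' k) (show r ≤ (P k).q - 1 by omega)
    have h3 := (P k).segStart_lt_segEnd (i' k) r
    refine ⟨by linarith, ?_⟩
    rcases eq_or_lt_of_le hs with e | e
    · left; linarith
    · exact Or.inr e

/-- The end, when all robots are assigned. -/
theorem Walk.exists_cover (hdisj : Pairwise fun k k' => Disjoint (P k).carrier (P k').carrier)
    (hi : ∀ k, i k < (P k).q) (h : Walk P n₀ cap₀ ρ n cap i (fun _ => 0) σ) :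
    ∃ c : Cover P n₀, Describes σ c ∧ ∀ j, len (c.part j) ≤ cap₀ j.1 := by
  have hA : ∀ j : Robot n₀, slot j < σ.nat 74 j.1 := fun j => by
    have := h.count (ρ.symm j.1)
    simp only [digit_zero, Finset.sum_const_zero, add_zero, Equiv.apply_symm_apply] at this
    rw [this, slot_eq]
    exact Nat.add_lt_add_left j.2.2 _
  obtain ⟨hb, hno, hcov⟩ := h.assigned
  choose place hpl h0 hle hcap hD _ using fun j => hb j (hA j)
  have hpe : ∀ j j', place j = place j' → σ.nat 4 (slot j) = σ.nat 4 (slot j') := fun j j' e => by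
    rw [hpl, hpl, e]
  obtain ⟨c, hc, hc'⟩ := OPG.exists_cover P n₀ hdisj place i hi _ _ h0 hle hD
    (fun j j' hne e => hno j j' (hA j) (hA j') hne (hpe j j' e))
    (fun k r hr s hs hs' => by
      rcases hcov k r hr s hs hs' with ⟨b1, b2⟩ | ⟨j, -, b1, b2⟩
      · simp only [tab_zero] at b1 b2
        have := (P k).segStart_mono (i k) (Nat.zero_le r)
        rw [(P k).segStart_zero] at this
        rcases b2 with b2 | b2 <;> linarith
      · exact ⟨j, Fin.ext ((hpl j).symm.trans b1), b2⟩)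
  subst hc
  refine ⟨c, fun j => ?_, fun j => by rw [(hc' j).1]; exact hcap j⟩
  obtain ⟨h1, h2, h3, h4⟩ := hc' j
  obtain ⟨o1, o2⟩ := h.out j (hA j)
  exact ⟨hpl j, h2, h3, (o2 _ (hpl j)).trans h4.symm, o1.trans h1.symm⟩

end Walk

/-- The number of the first robot of each type. -/
def baseProg : Prog :=
  (nset 30 0 ;; nset 31 0) ;; .loop (natLt (nv 30) (nv 20))
    (.setNat 74 (nv 30) (nv 31) ;; nset 31 (nv 31 + .get 2 (nv 30)) ;; nset 30 (nv 30 + 1))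

/-- Assign a robot to an interval that ends where the robots assigned before begin. -/
def assignProg : Prog :=
  (nset 30 (.get 18 (nv 80)) ;; nset 80 (nv 80 - .get 13 (nv 30)) ;; nset 31 (.get 12 (nv 30)) ;;
    nset 32 (.get 74 (nv 31))) ;;
  (rset 44 (.get 11 (nv 80)) ;; rset 45 (rv 44 + .get 10 (nv 30)) ;;
    .cond (.realLe (rv 23) (rv 44)) (rset 44 (rv 23)) .skip ;;
    .cond (.realLe (rv 23) (rv 45)) (rset 45 (rv 23)) .skip ;; rset 46 (rv 44 - rv 47) ;;
    .cond (.realLe 0 (rv 46)) .skip (rset 46 (rv 46 + rv 48))) ;;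
  (.setReal 50 (nv 32) (rv 44) ;; .setReal 51 (nv 32) (rv 45) ;; .setReal 3 (nv 32) (rv 46) ;;
    .setReal 4 (nv 32) (rv 45 - rv 44) ;; .setNat 4 (nv 32) (nv 51) ;; .setNat 74 (nv 31) (nv 32 + 1))

/-- Assign the robots of perimeter `nv 51`. -/
def walkProg : Prog :=
  (nset 24 (.get 1 (nv 51)) ;; nset 26 (.get 76 (nv 51))) ;; dpRun ;;
  (rset 23 (.get 13 (nv 24 - 1)) ;; rset 47 (.get 12 (nv 24 - nv 26)) ;; rset 48 (.get 12 (nv 24)) ;;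
    nset 80 (.get 77 (nv 51))) ;;
  .loop (.natLe 1 (nv 80)) assignProg ;; (nset 25 (nv 25 + nv 24) ;; nset 51 (nv 51 + 1))

/-- Compute a cover for the ratio in real variable `42`. -/
def coverProg : Prog :=
  rset 22 (rv 42) ;; tablesProg ;; traceProg ;; baseProg ;; (nset 51 0 ;; nset 25 0) ;;
    .loop (natLt (nv 51) (nv 21)) walkProg ;; rset 0 (rv 42)

section Walk
variable {O : ℕ → ℝ → Prop} {m t : ℕ} {P : Fin m → Perimeter} {n₀ : Fin t → ℕ} {cap₀ : Fin t → ℝ}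
  {ρ : Equiv.Perm (Fin t)} {n a : ℕ → ℕ} {cap : ℕ → ℝ} {σ : State}

theorem baseProg_spec (ht : σ.nat 20 0 = t) (h2 : ∀ τ : Fin t, σ.nat 2 τ = n₀ τ) :
    Ex O baseProg σ (60 * t + 50) 0 (fun σ' => ∀ τ : Fin t, σ'.nat 74 τ = base n₀ τ) := by
  refine Ex.time (Ex.flat_seq 20 fun σ₁ e₁ a₁ => (Ex.for₀ t 40
    (fun τ σ' => σ'.nat 30 0 = τ ∧ σ'.nat 31 0 = base n₀ τ ∧ ∀ τ' < τ, σ'.nat 74 τ' = base n₀ τ')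
    ?_ ?_ ?_).mono le_rfl le_rfl fun σ' _ h τ => h.2.2 τ τ.2) (by omega)
  · simp [e₁, Prog.sem, base]
  · rintro τ hτ σ' a' ⟨i1, i2, i3⟩
    have g20 : σ'.nat 20 0 = t := by rw [a'.nat 20 rfl, a₁.nat 20 rfl, ht]
    have g2 : σ'.nat 2 τ = n₀ ⟨τ, hτ⟩ := by rw [a'.nat 2 rfl, a₁.nat 2 rfl]; exact h2 ⟨τ, hτ⟩
    refine ⟨by simp [i1, g20, hτ], Ex.flat ?_⟩
    simp [Prog.wp, i1, i2, g2, Function.update_apply]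
    refine ⟨?_, fun τ' hτ' => ?_⟩
    · rw [base, base, Finset.sum_range_succ]; simp [pad, hτ]
    · split_ifs with e
      · rw [e]
      · exact i3 τ' (by omega)
  · rintro σ' a' ⟨i1, -⟩
    have g20 : σ'.nat 20 0 = t := by rw [a'.nat 20 rfl, a₁.nat 20 rfl, ht]
    simp [i1, g20]

theorem assignProg_spec (hcap₀ : ∀ τ, 0 ≤ cap₀ τ) (hcap : ∀ τ : Fin t, cap τ = cap₀ (ρ τ))
    (hr : Ready t m n a σ) (h12 : ∀ τ : Fin t, σ.nat 12 τ = ρ τ) (h10 : ∀ τ < t, σ.real 10 τ = cap τ)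
    {i : Fin m → ℕ} (hi : ∀ k, i k < (P k).q) {rem : Fin m → ℕ} {k : Fin m}
    (hs : Solved (P k) (i k) t n cap σ) (h51 : σ.nat 51 0 = k)
    (h23 : σ.real 23 0 = segEnd (P k) (i k) ((P k).q - 1))
    (h47 : σ.real 47 0 = segStart (P k) (i k) ((P k).q - i k))
    (h48 : σ.real 48 0 = segStart (P k) (i k) (P k).q) (h80 : σ.nat 80 0 = rem k) (h0 : rem k ≠ 0)
    (h : Walk P n₀ cap₀ ρ n cap i rem σ) :
    Ex O assignProg σ 180 0 (fun σ' => ∃ c < rem k, σ'.nat 80 0 = c ∧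
      Walk P n₀ cap₀ ρ n cap i (Function.update rem k c) σ') := by
  have hc := h.rem_lt k
  have hch := hs.choice (rem k) hc h0
  obtain ⟨hτ, hd, hinc⟩ := hch
  set τ : Fin t := ⟨σ.nat 18 (rem k), hτ⟩ with hτd
  have hch : IsChoice (P k) (i k) t n cap (rem k) τ := ⟨hτ, hd, hinc⟩
  have hle := stride_le_of_digit n hd
  have hsp := stride_pos n τ
  set c := rem k - stride n τ with hcd
  refine Ex.time (Ex.flat_seq 40 fun σ₁ e₁ a₁ => Ex.seq₀ (Ex.flat (T := 80)
    (Q := fun s => s.real 44 0 = min (tab (P k) (i k) t n cap c) (segEnd (P k) (i k) ((P k).q - 1)) ∧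
      s.real 45 0 = min (tab (P k) (i k) t n cap c + cap τ) (segEnd (P k) (i k) ((P k).q - 1)) ∧
      s.real 46 0 = startDist (P k) (i k) (s.real 44 0)) ?_) fun σ₂ a₂ q =>
    Ex.flat (T := 60) ?_) (by norm_num)
  · have g80 : σ₁.nat 80 0 = c := by
      simp [e₁, Prog.sem, h80, hr.stride_eq _ hτ.le, hcd, hτd]
    have g30 : σ₁.nat 30 0 = τ := by simp [e₁, Prog.sem, h80, hτd]
    have g11 : σ₁.real 11 c = tab (P k) (i k) t n cap c := by
      rw [a₁.real 11 rfl, hs.tab_eq _ (by omega)]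
    have g10 : σ₁.real 10 τ = cap τ := by rw [a₁.real 10 rfl, h10 _ τ.2]
    have g23 : σ₁.real 23 0 = _ := (congrFun (a₁.real 23 rfl) 0).trans h23
    have g47 : σ₁.real 47 0 = _ := (congrFun (a₁.real 47 rfl) 0).trans h47
    have g48 : σ₁.real 48 0 = _ := (congrFun (a₁.real 48 rfl) 0).trans h48
    simp [Prog.wp, g80, g30, g11, g10, g23, g47, g48, startDist_eq (P k) (hi k).le]
    constructor <;> intro b1 <;> constructor <;> intro b2 <;> constructor <;> intro b3 <;>
      simp [b1, b2, b3, not_le.2, le_of_lt]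
  · have w80 : σ₂.nat 80 0 = c := by
      rw [a₂.nat 80 rfl]; simp [e₁, Prog.sem, h80, hr.stride_eq _ hτ.le, hcd, hτd]
    have w31 : σ₂.nat 31 0 = ρ τ := by
      rw [a₂.nat 31 rfl, ← h12]; simp [e₁, Prog.sem, h80, hτd]
    have w32 : σ₂.nat 32 0 = σ.nat 74 (ρ τ) := by
      rw [a₂.nat 32 rfl, ← h12]; simp [e₁, Prog.sem, h80, hτd]
    have w51 : σ₂.nat 51 0 = k := by rw [a₂.nat 51 rfl, a₁.nat 51 rfl, h51]
    have f4 : σ₂.nat 4 = σ.nat 4 := (a₂.nat 4 rfl).trans (a₁.nat 4 rfl)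
    have f74 : σ₂.nat 74 = σ.nat 74 := (a₂.nat 74 rfl).trans (a₁.nat 74 rfl)
    have fr : ∀ A ∈ [3, 4, 50, 51], σ₂.real A = σ.real A := fun A hA =>
      (a₂.real A (by revert A; decide)).trans (a₁.real A (by revert A; decide))
    simp only [List.mem_cons, List.not_mem_nil, or_false, forall_eq_or_imp, forall_eq] at fr
    obtain ⟨f3, f4', f50, f51⟩ := fr
    refine ⟨c, by omega, by simp [w80], h.step hcap₀ hcap hch rfl q.1 q.2.1 ?_ ?_ ?_ ?_ ?_ ?_⟩ <;>
      simp [w31, w32, w51, f4, f74, f3, f4', f50, f51, q.2.2]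

theorem walkProg_spec (ht : 1 ≤ t) (hcap₀ : ∀ τ, 0 ≤ cap₀ τ) (hcap : ∀ τ : Fin t, cap τ = cap₀ (ρ τ))
    (hr : Ready t m n a σ) (hin : HasInput P σ) (h12 : ∀ τ : Fin t, σ.nat 12 τ = ρ τ)
    (h10 : ∀ τ < t, σ.real 10 τ = cap τ) {i : Fin m → ℕ} (hi : ∀ k, i k < (P k).q)
    {rem : Fin m → ℕ} {k : Fin m} (h51 : σ.nat 51 0 = k) (h25 : σ.nat 25 0 = offset P k)
    (h76 : σ.nat 76 k = i k) (h77 : σ.nat 77 k = rem k) (h : Walk P n₀ cap₀ ρ n cap i rem σ) :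
    Ex O walkProg σ (dpTime (P k).q t n + 200 * stride n t + 150) 0 (fun σ' =>
      Walk P n₀ cap₀ ρ n cap i (Function.update rem k 0) σ' ∧ σ'.nat 51 0 = k + 1 ∧
      σ'.nat 25 0 = offset P (k + 1)) := by
  have hq := (P k).q_pos
  have hcap' : ∀ τ < t, 0 ≤ cap τ := fun τ hτ => by rw [hcap ⟨τ, hτ⟩]; exact hcap₀ _
  refine Ex.time (Ex.flat_seq 20 fun σ₁ e₁ a₁ => Ex.seq₀ (dpRun_spec
    (off := offset P k) ht hcap' (hr.agree a₁) (i := i k) ?_ (hi k) ?_) fun σ₂ a₂ hs =>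
    Ex.flat_seq 60 fun σ₃ e₃ a₃ => Ex.seq₀ (Ex.while (T := 180) (K := 0) (rem k)
      (fun N s => ∃ c ≤ N, s.nat 80 0 = c ∧ Walk P n₀ cap₀ ρ n cap i (Function.update rem k c) s)
      ?_ ?_) fun σ₄ a₄ h₄ => Ex.flat (T := 20) ?_) ?_
  · exact (hin.agree a₁).atPerim k
      (by simp [e₁, Prog.sem, h51, hin.q_eq]) (by rw [a₁.nat 25 rfl, h25])
      (by simp [e₁, Prog.sem, h51, h76])
  · rw [a₁.real 10 rfl]; exact h10
  · refine ⟨rem k, le_rfl, ?_, ?_⟩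
    · simp [e₃, Prog.sem, a₂.nat 77 rfl, a₂.nat 51 rfl, a₁.nat 77 rfl, a₁.nat 51 rfl, h51, h77]
    · rw [Function.update_eq_self]
      exact h.of_eq (by rw [a₃.nat 74 rfl, a₂.nat 74 rfl, a₁.nat 74 rfl])
        (by rw [a₃.nat 4 rfl, a₂.nat 4 rfl, a₁.nat 4 rfl])
        (by rw [a₃.real 3 rfl, a₂.real 3 rfl, a₁.real 3 rfl])
        (by rw [a₃.real 4 rfl, a₂.real 4 rfl, a₁.real 4 rfl])
        (by rw [a₃.real 50 rfl, a₂.real 50 rfl, a₁.real 50 rfl])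
        (by rw [a₃.real 51 rfl, a₂.real 51 rfl, a₁.real 51 rfl])
  · rintro N σ' a' ⟨c, hc, g80, hw⟩ hb
    simp [g80] at hb
    have g24 : σ₂.nat 24 0 = (P k).q := by rw [a₂.nat 24 rfl]; simp [e₁, Prog.sem, h51, hin.q_eq]
    have g26 : σ₂.nat 26 0 = i k := by rw [a₂.nat 26 rfl]; simp [e₁, Prog.sem, h51, h76]
    have hs' : Solved (P k) (i k) t n cap σ' := by
      have e12 : σ'.real 12 = σ₂.real 12 := (a'.real 12 rfl).trans (a₃.real 12 rfl)
      have e13 : σ'.real 13 = σ₂.real 13 := (a'.real 13 rfl).trans (a₃.real 13 rfl)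
      have e11 : σ'.real 11 = σ₂.real 11 := (a'.real 11 rfl).trans (a₃.real 11 rfl)
      have e18 : σ'.nat 18 = σ₂.nat 18 := (a'.nat 18 rfl).trans (a₃.nat 18 rfl)
      exact ⟨by rw [e12]; exact hs.st_eq, by rw [e13]; exact hs.en_eq, by rw [e11]; exact hs.tab_eq,
        by rw [e18]; exact hs.choice⟩
    refine ⟨N - 1, by omega, (assignProg_spec (rem := Function.update rem k c) (k := k) hcap₀ hcap
      ((((hr.agree a₁).agree a₂).agree a₃).agree a')
      ?_ ?_ hi hs' ?_ ?_ ?_ ?_ (by rw [Function.update_self, g80])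
      (by rw [Function.update_self]; omega) hw).mono le_rfl le_rfl ?_⟩
    · rw [a'.nat 12 rfl, a₃.nat 12 rfl, a₂.nat 12 rfl, a₁.nat 12 rfl]; exact h12
    · rw [a'.real 10 rfl, a₃.real 10 rfl, a₂.real 10 rfl, a₁.real 10 rfl]; exact h10
    · rw [a'.nat 51 rfl, a₃.nat 51 rfl, a₂.nat 51 rfl, a₁.nat 51 rfl, h51]
    · rw [a'.real 23 rfl]; simp [e₃, Prog.sem, g24, hs.en_eq ((P k).q - 1) (by omega)]
    · rw [a'.real 47 rfl]; simp [e₃, Prog.sem, g24, g26, hs.st_eq ((P k).q - i k) (by omega)]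
    · rw [a'.real 48 rfl]; simp [e₃, Prog.sem, g24, hs.st_eq (P k).q le_rfl]
    · rintro s - ⟨c', hc', s1, s2⟩
      rw [Function.update_self] at hc'
      rw [Function.update_idem] at s2
      exact ⟨c', by omega, s1, s2⟩
  · obtain ⟨hb, N, c, -, g80, hw⟩ := h₄
    simp [g80] at hb
    subst hb
    refine ⟨hw.of_eq (by simp) (by simp) (by simp) (by simp) (by simp) (by simp), ?_, ?_⟩
    · have : σ₄.nat 51 0 = k := by
        rw [a₄.nat 51 rfl, a₃.nat 51 rfl, a₂.nat 51 rfl, a₁.nat 51 rfl, h51]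
      simp [this]
    · have f25 : σ₄.nat 25 0 = offset P k := by
        rw [a₄.nat 25 rfl, a₃.nat 25 rfl, a₂.nat 25 rfl, a₁.nat 25 rfl, h25]
      have f24 : σ₄.nat 24 0 = (P k).q := by
        rw [a₄.nat 24 rfl, a₃.nat 24 rfl, a₂.nat 24 rfl]; simp [e₁, Prog.sem, h51, hin.q_eq]
      simp [f24, f25, offset_succ]
  · have := h.rem_lt k
    have : rem k * (180 + 20) ≤ stride n t * (180 + 20) := Nat.mul_le_mul_right _ this.le
    omega

/-- Running time of `coverProg`. -/
def coverTime {m : ℕ} (P : Fin m → Perimeter) (t : ℕ) (n : ℕ → ℕ) : ℕ :=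
  multiTime P t n + m * (40 * n (t - 1) + 200) + 60 * t +
    (∑ k : Fin m, (dpTime (P k).q t n + 200 * stride n t + 170)) + 300

theorem coverProg_spec {a₀ : Fin t → ℕ} (ht : 1 ≤ t) (hm : 1 ≤ m)
    (hdisj : Pairwise fun k k' => Disjoint (P k).carrier (P k').carrier) (hr : Ready t m n a σ)
    (hin : HasInput P σ) (h12 : ∀ τ : Fin t, σ.nat 12 τ = ρ τ) (h2 : ∀ τ : Fin t, σ.nat 2 τ = n₀ τ)
    (hn : ∀ τ : Fin t, n τ = n₀ (ρ τ)) (ha : ∀ τ : Fin t, a τ = a₀ (ρ τ)) {ℓ : ℝ} (hℓ : 0 ≤ ℓ)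
    (h42 : σ.real 42 0 = ℓ) (hfeas : Feas P n₀ fun τ => (a₀ τ : ℝ) * ℓ) :
    Ex O coverProg σ (coverTime P t n) 0 (fun σ' => σ'.real 0 0 = ℓ ∧ ∃ c : Cover P n₀,
      Describes σ' c ∧ ∀ j, len (c.part j) ≤ a₀ j.1 * ℓ) := by
  set cap : ℕ → ℝ := fun τ => a τ * ℓ with hcapd
  set cap₀ : Fin t → ℝ := fun τ => a₀ τ * ℓ with hcapd₀
  have hcap' : ∀ τ < t, 0 ≤ cap τ := fun τ _ => mul_nonneg (Nat.cast_nonneg _) hℓ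
  have hcap₀ : ∀ τ, 0 ≤ cap₀ τ := fun τ => mul_nonneg (Nat.cast_nonneg _) hℓ
  have hcap : ∀ τ : Fin t, cap τ = cap₀ (ρ τ) := fun τ => by simp only [hcapd, hcapd₀, ha]
  refine Ex.time (Ex.flat_seq 10 fun σ₁ e₁ a₁ => ?_) (T := 10 + (multiTime P t n +
    ((m * (40 * n (t - 1) + 200) + 60) + ((60 * t + 50) + (20 + ((∑ k ∈ Finset.range m,
      ((if h : k < m then dpTime (P ⟨k, h⟩).q t n + 200 * stride n t + 150 else 0) + 20) + 20) +
        20)))))) ?_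
  · have g22 : σ₁.real 22 0 = ℓ := by simp [e₁, Prog.sem, h42]
    have hr₁ := hr.agree a₁
    have hin₁ : HasInput P σ₁ := hin.agree a₁
    have htab := tablesProg_spec (O := O) ht hr₁ hin₁ (by rw [g22]; exact hℓ)
    rw [g22] at htab
    refine Ex.seq₀ (htab.time (Nat.sub_le _ _)) fun σ₂ a₂ ⟨t1, t2, t3, t4, t5, t6⟩ => ?_
    have hr₂ := hr₁.agree a₂
    refine Ex.seq₀ (traceProg_spec ht hm hcap' hr₂ t1 t2 t3 t5
      ((t1.le_iff_feas ht hm hcap' hn hcap).2 hfeas)) fun σ₃ a₃ hp => ?_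
    have hr₃ := hr₂.agree a₃
    refine Ex.seq₀ (baseProg_spec (n₀ := n₀) hr₃.t_eq ?_) fun σ₄ a₄ h₄ => ?_
    · rw [a₃.nat 2 rfl, a₂.nat 2 rfl, a₁.nat 2 rfl]; exact h2
    have hr₄ := hr₃.agree a₄
    have hw := hp.walk (cap₀ := cap₀) hn (σ := σ₄) h₄
    refine Ex.flat_seq 20 fun σ₅ e₅ a₅ => Ex.seq₀ (Ex.forT m _ (fun k s =>
      s.nat 51 0 = k ∧ s.nat 25 0 = offset P k ∧ Walk P n₀ cap₀ ρ n cap (fun k => σ₃.nat 76 k)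
        (fun k' => if (k' : ℕ) < k then 0 else σ₃.nat 77 k') s) ?_ ?_ ?_)
      fun σ₆ a₆ h₆ => Ex.flat ?_
    · refine ⟨by simp [e₅, Prog.sem], by simp [e₅, Prog.sem, offset_zero], ?_⟩
      simp only [Nat.not_lt_zero, if_false]
      exact hw.of_eq (a₅.nat 74 rfl) (a₅.nat 4 rfl) (a₅.real 3 rfl) (a₅.real 4 rfl) (a₅.real 50 rfl)
        (a₅.real 51 rfl)
    · rintro k hk σ' a' ⟨i1, i2, i3⟩
      have hr' := (hr₄.agree a₅).agree a'
      refine ⟨by simp [i1, hr'.m_eq, hk], ?_⟩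
      rw [dif_pos hk]
      refine (walkProg_spec (k := ⟨k, hk⟩) ht hcap₀ hcap hr'
        (((((hin₁.agree a₂).agree a₃).agree a₄).agree a₅).agree a') ?_ ?_
        (fun k => hp.start_lt k) i1 i2 ?_ ?_ i3).mono le_rfl le_rfl fun s _ hs => ⟨hs.2.1, hs.2.2, ?_⟩
      · rw [a'.nat 12 rfl, a₅.nat 12 rfl, a₄.nat 12 rfl, a₃.nat 12 rfl, a₂.nat 12 rfl, a₁.nat 12 rfl]
        exact h12
      · rw [a'.real 10 rfl, a₅.real 10 rfl, a₄.real 10 rfl, a₃.real 10 rfl]; exact t6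
      · rw [a'.nat 76 rfl, a₅.nat 76 rfl, a₄.nat 76 rfl]
      · rw [a'.nat 77 rfl, a₅.nat 77 rfl, a₄.nat 77 rfl]; simp
      · convert hs.1 using 1
        ext k'
        by_cases e : k' = ⟨k, hk⟩
        · subst e; simp
        · have e' : (k' : ℕ) ≠ k := fun c => e (Fin.ext c)
          rw [Function.update_of_ne e]
          simp only [show (k' : ℕ) < k + 1 ↔ (k' : ℕ) < k by omega]
    · rintro σ' a' ⟨i1, -⟩
      have hr' := (hr₄.agree a₅).agree a'
      simp [i1, hr'.m_eq]
    · obtain ⟨-, -, h₆⟩ := h₆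
      simp only [Fin.is_lt, if_true] at h₆
      have f42 : σ₆.real 42 0 = ℓ := by
        rw [a₆.real 42 rfl, a₅.real 42 rfl, a₄.real 42 rfl, a₃.real 42 rfl, a₂.real 42 rfl,
          a₁.real 42 rfl, h42]
      refine ⟨by simp [f42], ?_⟩
      exact Walk.exists_cover hdisj (fun k => hp.start_lt k)
        (h₆.of_eq (by simp) (by simp) (by simp) (by simp) (by simp) (by simp))
  · rw [Finset.sum_range]
    simp only [Fin.is_lt, dif_pos, Fin.eta]
    unfold coverTime
    simp only [Finset.sum_add_distrib, Finset.sum_const, Finset.card_univ, Fintype.card_fin,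
      smul_eq_mul]
    omega

end Walk

/-- Compute the optimum and an optimal cover. -/
def optProg : Prog := setup ;; valueProg ;; coverProg

section Bounds
variable {m t : ℕ} (P : Fin m → Perimeter) {n : ℕ → ℕ}

/-- The part of the running time that is spent in the dynamic programs. -/
def mainCost (t : ℕ) (n : ℕ → ℕ) : ℕ :=
  t * stride n t * ∑ k, (P k).q + (∑ k, (P k).q ^ 2) * ∑ τ ∈ Finset.range t, face n t τ

theorem mainCost_bounds (ht : 1 ≤ t) (hm : 1 ≤ m) :
    stride n t * ∑ k, (P k).q ≤ t * stride n t * ∑ k, (P k).q ∧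
    m * stride n (t - 1) ≤ t * stride n t * ∑ k, (P k).q ∧
    t * stride n (t - 1) ≤ t * stride n t * ∑ k, (P k).q ∧
    m * stride n t ≤ t * stride n t * ∑ k, (P k).q ∧
    t * stride n t ≤ t * stride n t * ∑ k, (P k).q ∧
    (∑ k, (P k).q ^ 2) * stride n (t - 1) ≤
      (∑ k, (P k).q ^ 2) * ∑ τ ∈ Finset.range t, face n t τ := by
  have hmq : m ≤ ∑ k, (P k).q := by
    calc m = ∑ _k : Fin m, 1 := by simp
      _ ≤ _ := Finset.sum_le_sum fun k _ => (P k).q_pos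
  have hL : stride n (t - 1) ≤ stride n t := Nat.le_of_dvd (stride_pos n t) (stride_dvd n (Nat.sub_le t 1))
  have h1 : stride n t ≤ t * stride n t := Nat.le_mul_of_pos_left _ ht
  have h2 : t * stride n t ≤ t * stride n t * ∑ k, (P k).q := Nat.le_mul_of_pos_right _ (by omega)
  have h4 : m * stride n t ≤ t * stride n t * ∑ k, (P k).q := by
    rw [mul_comm]; exact Nat.mul_le_mul h1 hmq
  refine ⟨Nat.mul_le_mul_right _ h1, (Nat.mul_le_mul_left m hL).trans h4,
    (Nat.mul_le_mul_left t hL).trans h2, h4, h2, Nat.mul_le_mul_left _ ?_⟩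
  have := face_mul n (show t - 1 < t by omega)
  have e : stride n (t - 1) = face n t (t - 1) := by
    refine Nat.eq_of_mul_eq_mul_left (Nat.succ_pos (n (t - 1))) ?_
    rw [this, stride_pred n ht, mul_comm]
  rw [e]
  exact Finset.single_le_sum (f := fun τ => face n t τ) (fun _ _ => Nat.zero_le _)
    (Finset.mem_range.2 (by omega))

theorem one_le_mainCost (ht : 1 ≤ t) (hm : 1 ≤ m) : 1 ≤ mainCost P t n := by
  have := mainCost_bounds P (n := n) ht hm
  have := Nat.mul_pos hm (stride_pos n t)
  unfold mainCost
  omega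

theorem sum_dpTime (c : ℕ) : ∑ k, (dpTime (P k).q t n + c) =
    500 * (t * stride n t) * m + 160 * ((∑ k, (P k).q) * ∑ τ ∈ Finset.range t, face n t τ) +
      (100 + c) * m := by
  simp only [dpTime, Finset.sum_add_distrib, Finset.sum_const, Finset.card_univ, Fintype.card_fin,
    smul_eq_mul, ← Finset.mul_sum, ← Finset.sum_mul]
  ring

theorem multiTime_le (ht : 1 ≤ t) (hm : 1 ≤ m) : multiTime P t n ≤
    3000 * mainCost P t n + 430 * (t * ((m - 1) * stride n (t - 1) ^ 2)) := by
  obtain ⟨b1, b2, b3, b4, b5, b6⟩ := mainCost_bounds P (n := n) ht hm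
  have hc := stride_pos n t
  have hLp := stride_pos n (t - 1)
  set c := stride n t
  set L := stride n (t - 1) with hL
  set F := ∑ τ ∈ Finset.range t, face n t τ with hF
  have hw : ∑ k : Fin m, width t n k = 1 + (m - 1) * L := by
    obtain ⟨r, rfl⟩ : ∃ r, m = r + 1 := ⟨m - 1, by omega⟩
    rw [Fin.sum_univ_succ]
    simp [width, ← hL]
  have hsum : ∑ k : Fin m, (perimTime (P k).q t n (width t n k) + 20) =
      500 * (t * c * ∑ k, (P k).q) + 160 * ((∑ k, (P k).q ^ 2) * F) + 210 * (∑ k, (P k).q) +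
      300 * (c * ∑ k, (P k).q) + (1 + (m - 1) * L) * (L * (90 * t + 300) + 40) + 300 * (m * L) +
      320 * m := by
    have hk : ∀ k : Fin m, perimTime (P k).q t n (width t n k) + 20 = 500 * (t * c * (P k).q) +
        160 * ((P k).q ^ 2 * F) + 210 * (P k).q + 300 * (c * (P k).q) +
        width t n k * (L * (90 * t + 300) + 40) + (300 * L + 320) := fun k => by
      rw [perimTime, dpTime, ← hL, ← hF]
      change (P k).q * (500 * (t * c) + 160 * ((P k).q * F) + 100 + 300 * c + 110) + _ + _ + _ + _ = _
      ring
    rw [← hw, Finset.sum_congr rfl fun k _ => hk k]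
    simp only [Finset.sum_add_distrib, ← Finset.mul_sum, ← Finset.sum_mul, Finset.sum_const,
      Finset.card_univ, Fintype.card_fin, smul_eq_mul]
    ring
  have h1 : L * (90 * t + 300) + 40 ≤ 430 * (t * L) := by
    have h1 : 1 ≤ t * L := Nat.mul_pos ht hLp
    have h2 : L ≤ t * L := Nat.le_mul_of_pos_left _ ht
    have : L * (90 * t + 300) = 90 * (t * L) + 300 * L := by ring
    omega
  have h2 : (1 + (m - 1) * L) * (L * (90 * t + 300) + 40) ≤ 430 * (t * L) +
      430 * (t * ((m - 1) * L ^ 2)) :=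
    (Nat.mul_le_mul_left _ h1).trans (le_of_eq (by ring))
  have h3 : ∑ k, (P k).q ≤ c * ∑ k, (P k).q := Nat.le_mul_of_pos_left _ hc
  have h4 : m ≤ m * L := Nat.le_mul_of_pos_right _ hLp
  have h5 : t ≤ t * L := Nat.le_mul_of_pos_right _ hLp
  have h6 : L ≤ m * L := Nat.le_mul_of_pos_left _ hm
  have h7 : 1 ≤ m * L := Nat.mul_pos hm hLp
  unfold multiTime mainCost
  rw [hsum, ← hL]
  change 70 * t + 60 * L + _ + 200 ≤ 3000 * (t * c * ∑ k, (P k).q + (∑ k, (P k).q ^ 2) * F) + _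
  generalize (1 + (m - 1) * L) * (L * (90 * t + 300) + 40) = A at *
  generalize t * ((m - 1) * L ^ 2) = B at *
  omega

end Bounds

section Bounds
variable {m t : ℕ} (P : Fin m → Perimeter) {n : ℕ → ℕ}

theorem coverTime_le (ht : 1 ≤ t) (hm : 1 ≤ m) :
    coverTime P t n ≤ multiTime P t n + 2500 * mainCost P t n := by
  obtain ⟨b1, b2, b3, b4, b5, b6⟩ := mainCost_bounds P (n := n) ht hm
  have h1 := one_le_mainCost P (n := n) ht hm
  have h2 : m * n (t - 1) ≤ m * stride n t := by
    refine Nat.mul_le_mul_left _ ?_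
    rw [stride_pred n ht]
    exact (Nat.le_succ _).trans (Nat.le_mul_of_pos_left _ (stride_pos n _))
  have h3 : m ≤ m * stride n t := Nat.le_mul_of_pos_right _ (stride_pos n t)
  have h4 : t ≤ t * stride n t := Nat.le_mul_of_pos_right _ (stride_pos n t)
  have h5 : (∑ k, (P k).q) * ∑ τ ∈ Finset.range t, face n t τ ≤
      (∑ k, (P k).q ^ 2) * ∑ τ ∈ Finset.range t, face n t τ :=
    Nat.mul_le_mul_right _ (Finset.sum_le_sum fun k _ => Nat.le_self_pow (by norm_num) _)
  have h6 : m * (40 * n (t - 1) + 200) = 40 * (m * n (t - 1)) + 200 * m := by ring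
  have h7 : t * stride n t * m ≤ t * stride n t * ∑ k, (P k).q := Nat.mul_le_mul_left _ (by
    calc m = ∑ _k : Fin m, 1 := by simp
      _ ≤ _ := Finset.sum_le_sum fun k _ => (P k).q_pos)
  have h8 : ∑ k : Fin m, (dpTime (P k).q t n + 200 * stride n t + 170) =
      500 * (t * stride n t * m) + 160 * ((∑ k, (P k).q) * ∑ τ ∈ Finset.range t, face n t τ) +
        200 * (m * stride n t) + 270 * m := by
    simp only [add_assoc]
    rw [sum_dpTime]
    ring
  unfold coverTime
  rw [h6, h8]
  unfold mainCost at h1 ⊢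
  omega

theorem valueTime_le (ht : 1 ≤ t) (hm : 1 ≤ m) {u : ℝ} (hu : 1 ≤ u)
    (h1 : (Nat.clog 2 ((∑ k, (P k).q ^ 2) * stride n (t - 1)) : ℝ) ≤ u)
    (h2 : (Nat.log 2 ((∑ k, (P k).q ^ 2) * stride n (t - 1)) : ℝ) + 1 ≤ u)
    (h3 : (Nat.clog 2 (n (t - 1) + 1) : ℝ) + 1 ≤ u) :
    (valueTime P t n : ℝ) ≤ u ^ 2 * (3000 * mainCost P t n + multiTime P t n) := by
  obtain ⟨b1, b2, b3, b4, b5, b6⟩ := mainCost_bounds P (n := n) ht hm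
  have hZ1 := one_le_mainCost P (n := n) ht hm
  have ho : offset P m ≤ mainCost P t n := by
    have e : offset P m = ∑ k, (P k).q := by
      rw [offset, Finset.sum_range]; simp only [pad_val]
    rw [e]
    have : ∑ k, (P k).q ≤ stride n t * ∑ k, (P k).q := Nat.le_mul_of_pos_left _ (stride_pos n t)
    unfold mainCost
    omega
  have hN : (∑ k, (P k).q ^ 2) * stride n (t - 1) ≤ mainCost P t n :=
    b6.trans (Nat.le_add_left _ _)
  unfold valueTime stageTime
  generalize (∑ k, (P k).q ^ 2) * stride n (t - 1) = N at *
  generalize mainCost P t n = Z at *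
  generalize multiTime P t n = T at *
  generalize offset P m = o at *
  have r1 : (1 : ℝ) ≤ Z := by exact_mod_cast hZ1
  have r2 : (N : ℝ) ≤ Z := by exact_mod_cast hN
  have r3 : (o : ℝ) ≤ Z := by exact_mod_cast ho
  have r4 : (0 : ℝ) ≤ T := Nat.cast_nonneg _
  push_cast
  have s1 : (Nat.clog 2 N : ℝ) * (400 * N + 140) ≤ u * (540 * Z) :=
    mul_le_mul h1 (by linarith) (by positivity) (by linarith)
  have s2 : ((Nat.log 2 N : ℝ) + 1) * (T + 100) ≤ u * (T + 100 * Z) :=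
    mul_le_mul h2 (by linarith) (by positivity) (by linarith)
  have s3 : (Z : ℝ) ≤ u * Z := le_mul_of_one_le_left (by linarith) hu
  have s4 : u * Z ≤ u ^ 2 * Z := mul_le_mul_of_nonneg_right (by nlinarith) (by linarith)
  have s5 : ((Nat.clog 2 (n (t - 1) + 1) : ℝ) + 1) * (200 * N + Nat.clog 2 N * (400 * N + 140) +
      (Nat.log 2 N + 1) * (T + 100) + 400 + 100) ≤ u * (u * (1340 * Z + T)) :=
    mul_le_mul h3 (by linarith) (by positivity) (by linarith)
  have s6 : u * (u * (1340 * Z + T)) = u ^ 2 * (1340 * Z + T) := by ring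
  have s7 : u ^ 2 * (3000 * (Z : ℝ) + T) = u ^ 2 * (1340 * Z + T) + 1660 * (u ^ 2 * Z) := by ring
  rw [s6] at s5
  rw [s7]
  linarith

/-- The lines of the table, if the last type has the most robots. -/
theorem lines_le {n₀ : Fin t → ℕ} {ρ : Equiv.Perm (Fin t)} (ht : 1 ≤ t) (hn : ∀ τ : Fin t, n τ = n₀ (ρ τ))
    (hmax : ∀ τ, n₀ τ ≤ n₀ (ρ ⟨t - 1, by omega⟩)) (hpos : ∀ τ, 0 < n₀ τ) :
    (stride n (t - 1) : ℝ) ≤ 2 ^ t * ((∏ τ, (n₀ τ : ℝ)) / (Finset.univ.sup n₀ : ℕ)) := by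
  have hsup : Finset.univ.sup n₀ = n (t - 1) := by
    rw [hn ⟨t - 1, by omega⟩]
    exact le_antisymm (Finset.sup_le fun τ _ => hmax τ) (Finset.le_sup (Finset.mem_univ _))
  have hlast : 0 < n (t - 1) := by rw [hn ⟨t - 1, by omega⟩]; exact hpos _
  have hprod : ∏ τ, n₀ τ = (∏ τ ∈ Finset.range (t - 1), n τ) * n (t - 1) := by
    rw [← Finset.prod_range_succ, Nat.sub_add_cancel ht, Finset.prod_range, ← Equiv.prod_comp ρ]
    exact Finset.prod_congr rfl fun τ _ => (hn τ).symm
  have hle : stride n (t - 1) ≤ 2 ^ t * ∏ τ ∈ Finset.range (t - 1), n τ := by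
    calc stride n (t - 1) ≤ ∏ τ ∈ Finset.range (t - 1), 2 * n τ := Finset.prod_le_prod' fun τ hτ => by
          have h1 := Finset.mem_range.1 hτ
          have := hpos (ρ ⟨τ, by omega⟩)
          rw [← hn] at this
          simp only at this
          omega
      _ = 2 ^ (t - 1) * ∏ τ ∈ Finset.range (t - 1), n τ := by
          rw [Finset.prod_mul_distrib, Finset.prod_const, Finset.card_range]
      _ ≤ _ := Nat.mul_le_mul_right _ (Nat.pow_le_pow_right (by norm_num) (by omega))
  have h1 : (∏ τ, (n₀ τ : ℝ)) = ((∏ τ ∈ Finset.range (t - 1), n τ : ℕ) : ℝ) * n (t - 1) := by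
    exact_mod_cast hprod
  have h2 : (n (t - 1) : ℝ) ≠ 0 := by exact_mod_cast hlast.ne'
  rw [hsup, h1, mul_div_assoc, div_self h2, mul_one]
  exact_mod_cast hle

end Bounds

/-- An optimal cover is computed in pseudo-polynomial time. -/
theorem optimal_cover {t m : ℕ} (ht : 1 ≤ t) (P : Fin m → Perimeter) (n a : Fin t → ℕ) (hm : 1 ≤ m)
    (hmn : m ≤ ∑ τ, n τ) (hpos : m = 1 ∨ ∀ τ, 0 < n τ) (ha : ∀ τ, 0 < a τ)
    (hdisj : Pairwise fun k k' => Disjoint (P k).carrier (P k').carrier) :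
    ∃ (σ : State) (s : ℕ) (c : Cover P n), Run optProg (input P n a 0 0) σ s ∧
      Describes σ c ∧ IsOptimum P n a (c.ratio a) ∧ σ.real 0 0 = c.ratio a ∧
      (s : ℝ) ≤ (80000 * (t + 4) ^ 3 * 4 ^ t : ℕ) *
        Real.log ((∑ τ, n τ + ∑ k, (P k).q : ℕ) : ℝ) ^ 2 *
          (((m : ℝ) - 1) * ((∏ τ, (n τ : ℝ)) / (Finset.univ.sup n : ℕ)) ^ 2 +
            ∑ k, ((t : ℝ) * (P k).q * cells n + ((P k).q : ℝ) ^ 2 * faces n)) := by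
  obtain ⟨ℓ, hopt, hc⟩ := exists_optimum hdisj ha hm hmn
  have hfeas : ∀ x : ℝ, 0 ≤ x → (Feas P n (fun τ => (a τ : ℝ) * x) ↔ ℓ ≤ x) := fun x hx =>
    feas_iff_le hdisj ha hopt hx
  have hℓ : 0 ≤ ℓ := by
    obtain ⟨k, i, d, x, -, -, -, -, rfl⟩ := mem_candidates_iff.1 hc
    exact div_nonneg ((P k).segEnd_pos i d).le (Nat.cast_nonneg _)
  set S := ∑ τ, n τ + ∑ k, (P k).q with hS
  set Z : ℝ := ∑ k, ((t : ℝ) * (P k).q * cells n + ((P k).q : ℝ) ^ 2 * faces n) with hZ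
  set X : ℝ := (∏ τ, (n τ : ℝ)) / (Finset.univ.sup n : ℕ) with hX
  set u : ℝ := 2 * (t + 4) * Real.log S with hu
  have hmq : m ≤ ∑ k, (P k).q := by
    calc m = ∑ _k : Fin m, 1 := by simp
      _ ≤ _ := Finset.sum_le_sum fun k _ => (P k).q_pos
  have hS2 : 2 ≤ S := by omega
  have hl := one_le_two_mul_log hS2
  have hu1 : 1 ≤ u := by
    have : 0 ≤ (t : ℝ) * Real.log S := mul_nonneg (Nat.cast_nonneg _) (by linarith)
    rw [hu]; nlinarith
  have key : Ex (fun _ _ => False) optProg (input P n a 0 0)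
      ⌊u ^ 2 * (20000 * (Z + t * ((m - 1) * (2 ^ t * X) ^ 2)))⌋₊ 0 (fun σ' => σ'.real 0 0 = ℓ ∧
        ∃ c : Cover P n, Describes σ' c ∧ ∀ j, len (c.part j) ≤ a j.1 * ℓ) := by
    obtain ⟨σ₁, s₁, c₁, x₁, hs₁, hc₁, ρ, hmax, hr, hsw⟩ := setup_input (O := fun _ _ => False)
      (P := P) (n := n) (a := a) (i := 0) (ℓ := 0) ht
    have a₁ := x₁.agree
    set n' := σ₁.nat 10
    set a' := σ₁.nat 11
    have hn' : ∀ τ : Fin t, n' τ = n (ρ τ) := fun τ => (hsw τ).1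
    have ha' : ∀ τ : Fin t, a' τ = a (ρ τ) := fun τ => (hsw τ).2.1
    have hin : HasInput P σ₁ := (hasInput_input P n a 0 0).agree a₁
    obtain ⟨σ₂, s₂, c₂, x₂, hs₂, hc₂, hq⟩ : Ex (fun _ _ => False) (valueProg ;; coverProg) σ₁
        (valueTime P t n' + coverTime P t n') 0 (fun σ' => σ'.real 0 0 = ℓ ∧
          ∃ c : Cover P n, Describes σ' c ∧ ∀ j, len (c.part j) ≤ a j.1 * ℓ) := by
      refine Ex.seq₀ (valueProg_spec ht hm (fun τ hτ => by rw [ha' ⟨τ, hτ⟩]; exact ha _) hr hin ?_ hn'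
        ha' hfeas hc) fun σ₂ a₂ h₂ => coverProg_spec ht hm hdisj (hr.agree a₂)
        (hin.agree a₂) ?_ ?_ hn' ha' hℓ h₂
        ((hfeas ℓ hℓ).2 le_rfl)
      · intro j; rw [a₁.nat 56 rfl]; rfl
      · rw [a₂.nat 12 rfl]; exact fun τ => (hsw τ).2.2
      · rw [a₂.nat 2 rfl, a₁.nat 2 rfl]; exact input_n P n a 0 0
    refine ⟨σ₂, _, _, .seq x₁ x₂, Nat.le_floor ?_, by omega, hq⟩
    have hcells : stride n' t = cells n := by rw [cells_eq n' (n ∘ ρ) hn', cells_comp]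
    have hfaces : ∑ τ ∈ Finset.range t, face n' t τ = faces n := by
      rw [faces_eq n' (n ∘ ρ) hn', faces_comp]
    have hZ' : (mainCost P t n' : ℝ) = Z := by
      rw [mainCost, hcells, hfaces, hZ]
      push_cast
      rw [Finset.sum_add_distrib, Finset.mul_sum, Finset.sum_mul]
      congr 1
      exact Finset.sum_congr rfl fun k _ => by ring
    have hcS : cells n ≤ S ^ t := (cells_le_pow n).trans (Nat.pow_le_pow_left (by omega) _)
    have hlS : stride n' (t - 1) ≤ S ^ t := (Nat.le_of_dvd (stride_pos n' t)
      (stride_dvd n' (Nat.sub_le t 1))).trans (hcells ▸ hcS)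
    have hqS : ∑ k, (P k).q ^ 2 ≤ S ^ 2 := by
      calc ∑ k, (P k).q ^ 2 ≤ ∑ k, (P k).q * S := Finset.sum_le_sum fun k _ => by
            rw [pow_two]
            refine Nat.mul_le_mul_left _ (le_trans ?_ (Nat.le_add_left _ _))
            exact Finset.single_le_sum (f := fun k => (P k).q) (fun _ _ => Nat.zero_le _)
              (Finset.mem_univ k)
        _ = (∑ k, (P k).q) * S := (Finset.sum_mul _ _ _).symm
        _ ≤ S ^ 2 := by rw [pow_two]; exact Nat.mul_le_mul_right _ (Nat.le_add_left _ _)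
    have hlog1 := natLog_le (e := t + 2) hS2 (show (∑ k, (P k).q ^ 2) * stride n' (t - 1) ≤ S ^ (t + 2) by
      rw [pow_add, mul_comm]; exact Nat.mul_le_mul hlS hqS)
    have hlog2 := natLog_le (N := n' (t - 1) + 1) (e := 1) hS2 (by
      have h1 := hn' ⟨t - 1, by omega⟩
      have h2 : n (ρ ⟨t - 1, by omega⟩) ≤ ∑ τ, n τ :=
        Finset.single_le_sum (fun _ _ => Nat.zero_le _) (Finset.mem_univ _)
      simp only at h1
      rw [pow_one]; omega)
    have hc1 : (Nat.clog 2 ((∑ k, (P k).q ^ 2) * stride n' (t - 1)) : ℝ) ≤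
        Nat.log 2 ((∑ k, (P k).q ^ 2) * stride n' (t - 1)) + 1 := by
      exact_mod_cast clog_le_log_add_one _
    have hc2 : (Nat.clog 2 (n' (t - 1) + 1) : ℝ) ≤ Nat.log 2 (n' (t - 1) + 1) + 1 := by
      exact_mod_cast clog_le_log_add_one _
    push_cast at hlog1 hlog2
    have htl : 0 ≤ (t : ℝ) * Real.log S := mul_nonneg (Nat.cast_nonneg _) (by linarith)
    have hu' : u = 2 * ((t : ℝ) * Real.log S) + 8 * Real.log S := by rw [hu]; ring
    have hv := valueTime_le P (n := n') ht hm hu1 (by rw [hu']; linarith) (by rw [hu']; linarith)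
      (by rw [hu']; linarith)
    have hcov : (coverTime P t n' : ℝ) ≤ multiTime P t n' + 2500 * mainCost P t n' := by
      exact_mod_cast coverTime_le P (n := n') ht hm
    have hmul : (multiTime P t n' : ℝ) ≤
        3000 * mainCost P t n' + 430 * (t * ((m - 1) * stride n' (t - 1) ^ 2)) := by
      have := Nat.cast_le (α := ℝ).2 (multiTime_le P (n := n') ht hm)
      push_cast [Nat.cast_sub hm] at this
      exact this
    have hW : (((m : ℝ) - 1) * (stride n' (t - 1) : ℝ) ^ 2) ≤ (m - 1) * (2 ^ t * X) ^ 2 := by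
      rcases hpos with rfl | hpos
      · simp
      · refine mul_le_mul_of_nonneg_left (pow_le_pow_left₀ (Nat.cast_nonneg _)
          (lines_le ht hn' hmax hpos) 2) ?_
        have : (1 : ℝ) ≤ m := by exact_mod_cast hm
        linarith
    have htW := mul_le_mul_of_nonneg_left hW (Nat.cast_nonneg t : (0 : ℝ) ≤ t)
    have hset : (s₁ : ℝ) ≤ 1000 * mainCost P t n' := by
      have h1 := (mainCost_bounds P (n := n') ht hm).2.2.2.2.1
      have h2 := one_le_mainCost P (n := n') ht hm
      rw [hcells] at h1
      have : s₁ ≤ 1000 * mainCost P t n' := by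
        unfold mainCost at h2 ⊢
        rw [hcells] at h2 ⊢
        omega
      exact_mod_cast this
    have hs₂' : (s₂ : ℝ) ≤ valueTime P t n' + coverTime P t n' := by exact_mod_cast hs₂
    rw [hZ'] at hv hcov hmul hset
    have hZ0 : 0 ≤ Z := hZ' ▸ Nat.cast_nonneg _
    have hT0 : (0 : ℝ) ≤ multiTime P t n' := Nat.cast_nonneg _
    have hu2 : 1 ≤ u ^ 2 := one_le_pow₀ hu1
    push_cast
    calc (s₁ : ℝ) + s₂ ≤ 1000 * Z + u ^ 2 * (3000 * Z + multiTime P t n') +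
          (multiTime P t n' + 2500 * Z) := by linarith
      _ ≤ u ^ 2 * (6500 * Z + 2 * multiTime P t n') := by nlinarith
      _ ≤ _ := by
        have : (0 : ℝ) ≤ t * ((m - 1) * (stride n' (t - 1) : ℝ) ^ 2) := by
          have : (1 : ℝ) ≤ m := by exact_mod_cast hm
          exact mul_nonneg (Nat.cast_nonneg _) (mul_nonneg (by linarith) (sq_nonneg _))
        gcongr
        linarith
  obtain ⟨σ, s, hrun, ⟨h0, c, hd, hlen⟩, hs⟩ := key.run
  have hratio : c.ratio a = ℓ := le_antisymm (ratio_le ha hℓ hlen) (hopt.2 ⟨c, rfl⟩)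
  refine ⟨σ, s, c, hrun, hd, hratio ▸ hopt, h0.trans hratio.symm, ?_⟩
  have hlog : 0 ≤ Real.log S := by linarith
  have hmr : (0 : ℝ) ≤ m - 1 := by
    have : (1 : ℝ) ≤ m := by exact_mod_cast hm
    linarith
  have hZ0 : 0 ≤ Z := Finset.sum_nonneg fun k _ => by positivity
  have htr : (1 : ℝ) ≤ t := by exact_mod_cast ht
  have h4 : (1 : ℝ) ≤ 4 ^ t := one_le_pow₀ (by norm_num)
  have e4 : ((2 : ℝ) ^ t) ^ 2 = 4 ^ t := by rw [← pow_mul, mul_comm, pow_mul]; norm_num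
  have hW : 0 ≤ ((m : ℝ) - 1) * X ^ 2 := mul_nonneg hmr (sq_nonneg _)
  have hfin : Z + t * ((m - 1) * (2 ^ t * X) ^ 2) ≤ t * 4 ^ t * ((m - 1) * X ^ 2 + Z) := by
    rw [mul_pow, e4]
    have h5 : (1 : ℝ) ≤ t * 4 ^ t := one_le_mul_of_one_le_of_one_le htr h4
    nlinarith
  calc (s : ℝ) ≤ u ^ 2 * (20000 * (Z + t * ((m - 1) * (2 ^ t * X) ^ 2))) :=
        (Nat.cast_le.2 hs).trans (Nat.floor_le (by positivity))
    _ ≤ u ^ 2 * (20000 * (t * 4 ^ t * ((m - 1) * X ^ 2 + Z))) := by gcongr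
    _ = (80000 * (t * (t + 4) ^ 2) * 4 ^ t) * Real.log S ^ 2 * ((m - 1) * X ^ 2 + Z) := by
        rw [hu]; ring
    _ ≤ _ := by
        push_cast
        gcongr
        have : (0 : ℝ) ≤ (t + 4) ^ 2 := by positivity
        linarith [show ((t : ℝ) + 4) ^ 3 = t * (t + 4) ^ 2 + 4 * (t + 4) ^ 2 by ring]

end

end OPG

theorem mainTheorem4 :
    -- the feasibility test decides the decision problem for a candidate ratio
    (∀ (t : ℕ) (P : Perimeter) (n a : Fin t → ℕ), (∀ τ, 0 < a τ) → ∀ ℓ : ℝ, 0 ≤ ℓ →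
      (DOPG (fun _ : Fin 1 => P) n (fun τ => (a τ : ℝ) * ℓ) ↔
        ∃ i : Fin P.q, lrFeasible P n a i ℓ)) ∧
    -- running time of the feasibility test for one starting segment
    (∃ (F : Prog) (C : ℝ), ∀ (t : ℕ) (P : Perimeter) (n a : Fin t → ℕ), 1 ≤ t →
      (∀ τ, 0 < a τ) → ∀ (i : Fin P.q) (ℓ : ℝ), 0 ≤ ℓ →
      ∃ (σ : State) (s : ℕ), Run F (input (fun _ : Fin 1 => P) n a i ℓ) σ s ∧
        Answers σ (lrFeasible P n a i ℓ) ∧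
        (s : ℝ) ≤ C * (t * cells n + P.q * faces n)) ∧
    -- running time for the decision problem
    (∃ (D : Prog) (C : ℝ), ∀ (t : ℕ) (P : Perimeter) (n a : Fin t → ℕ), 1 ≤ t →
      (∀ τ, 0 < a τ) → ∀ ℓ : ℝ, 0 ≤ ℓ →
      ∃ (σ : State) (s : ℕ), Run D (input (fun _ : Fin 1 => P) n a 0 ℓ) σ s ∧
        Answers σ (DOPG (fun _ : Fin 1 => P) n (fun τ => (a τ : ℝ) * ℓ)) ∧
        (s : ℝ) ≤ C * (P.q * t * cells n + (P.q : ℝ) ^ 2 * faces n)) ∧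
    -- the optimum exists and is one of the candidates
    (∀ (t m : ℕ) (P : Fin m → Perimeter) (n a : Fin t → ℕ), 1 ≤ m → m ≤ ∑ τ, n τ →
      (∀ τ, 0 < a τ) → Pairwise (fun k k' => Disjoint (P k).carrier (P k').carrier) →
      ∃ ℓ : ℝ, IsOptimum P n a ℓ ∧ ℓ ∈ candidates P n a) ∧
    -- bisection: number of calls to the feasibility test. The program finds the optimum with the
    -- feasibility test as its subroutine; it does not use how that test works, and finds the
    -- threshold of any test whose threshold is a candidate
    (∃ B : Prog, ∀ t : ℕ, 1 ≤ t → ∃ (C : ℝ) (d : ℕ),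
      ∀ (P : Perimeter) (n a : Fin t → ℕ), 1 ≤ ∑ τ, n τ → (∀ τ, 0 < a τ) →
      ∀ (O : ℕ → ℝ → Prop) (ℓ : ℝ),
        ((O = lrFeasible P n a ∧ IsOptimum (fun _ : Fin 1 => P) n a ℓ) ∨
          (ℓ ∈ candidates (fun _ : Fin 1 => P) n a ∧
            ∀ x : ℝ, 0 ≤ x → ((∃ i : Fin P.q, O i x) ↔ ℓ ≤ x))) →
        ∃ (σ : State) (s c : ℕ), Exec O B (input (fun _ : Fin 1 => P) n a 0 0) σ s c ∧
          σ.real 0 0 = ℓ ∧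
          (c : ℝ) ≤ C * (P.q * Real.log ((∑ τ, n τ + P.q : ℕ) : ℝ)) ∧
          (s : ℝ) ≤ C * (P.q * cells n : ℝ) ^ d) ∧
    -- an optimal cover is computed in pseudo-polynomial time, for one or several perimeters
    (∃ A : Prog, ∀ t : ℕ, 1 ≤ t → ∃ (C : ℝ) (d : ℕ),
      ∀ (m : ℕ) (P : Fin m → Perimeter) (n a : Fin t → ℕ), 1 ≤ m → m ≤ ∑ τ, n τ →
      (m = 1 ∨ ∀ τ, 0 < n τ) → (∀ τ, 0 < a τ) →
      Pairwise (fun k k' => Disjoint (P k).carrier (P k').carrier) →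
      ∃ (σ : State) (s : ℕ) (c : Cover P n), Run A (input P n a 0 0) σ s ∧
        Describes σ c ∧ IsOptimum P n a (c.ratio a) ∧ σ.real 0 0 = c.ratio a ∧
        (s : ℝ) ≤ C * Real.log ((∑ τ, n τ + ∑ k, (P k).q : ℕ) : ℝ) ^ d *
          (((m : ℝ) - 1) * ((∏ τ, (n τ : ℝ)) / (Finset.univ.sup n : ℕ)) ^ 2 +
            ∑ k, ((t : ℝ) * (P k).q * cells n + ((P k).q : ℝ) ^ 2 * faces n))) := by
  refine ⟨fun t P n a _ ℓ hℓ => dopg_iff_lrFeasible P n a hℓ,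
    ⟨feasProg, (2000 : ℕ), fun t P n a ht _ i ℓ hℓ => ?_⟩,
    ⟨decideProg, (3000 : ℕ), fun t P n a ht _ ℓ hℓ => ?_⟩,
    fun t m P n a hm hmn ha hdisj => exists_optimum hdisj ha hm hmn,
    ⟨bisectProg, fun t ht => ⟨(700 * t + 5000 : ℕ), 4, fun P n a hn ha O ℓ h =>
      bisect ht P n a hn ha O ℓ h⟩⟩,
    ⟨optProg, fun t ht => ⟨(80000 * (t + 4) ^ 3 * 4 ^ t : ℕ), 2, fun m P n a hm hmn hpos ha hdisj =>
      optimal_cover ht P n a hm hmn hpos ha hdisj⟩⟩⟩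
  · obtain ⟨σ, s, h, hs, hT⟩ := (feasProg_spec P n a ht i.2 hℓ).run
    exact ⟨σ, s, h, hs, by exact_mod_cast hT⟩
  · obtain ⟨σ, s, h, hs, hT⟩ := (decideProg_spec P n a ht hℓ).run
    exact ⟨σ, s, h, hs, by exact_mod_cast hT⟩
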